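/- **Setting.** Let $\mathcal H$ be a complex Hilbert space (scalar product antilinear in the first argument), $h$ a self-adjoint operator on $\mathcal H$ and $k$ a bounded self-adjoint operator on $\mathcal H$. Put $h_0:=h+k^2$ and assume: * **(A1)** $h_0>0$, i.e. $h_0\ge 0$ and $\operatorname{Ker}h_0=\{0\}$. For $A>0$, $A^{-1/2}\mathcal H$ denotes the completion of $D(A^{1/2})$ for the norm $\|A^{1/2}u\|$. A bounded operator $T$ belongs to $\mathcal B(A^{-1/2}\mathcal H)$ if $T D(A^{1/2})\subset D(A^{1/2})$ and $\|A^{1/2}Tu\|\le C\|A^{1/2}u\|$ there; equivalently we write $A^{1/2}TA^{-1/2}\in\mathcal B(\mathcal H)$. * **(A2)** $k\in\mathcal B(h_0^{-1/2}\mathcal H)$; for $z\notin\mathbb R$, $(k-z)^{-1}\in\mathcal B(h_0^{-1/2}\mathcal H)$, and for some $n>0$ its norm there is $\lesssim|\mathrm{Im}\,z|^{-n}$ for $0<|\mathrm{Im}\,z|\le1$; for some $m>0$ its norm there is $\lesssim\big||z|-\|k\|\big|^{-1}$ if $|z|\ge m\|k\|$, $|z|\neq\|k\|$. A pair $(h',k')$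 satisfies **(A3)** if $h'\ge c\,k'^2$ for some $c>0$. Let $x$ be a self-adjoint operator on $\mathcal H$ with $\sigma(x)=\sigma_{ac}(x)=\mathbb R$ and $w$ a positive self-adjoint operator on $\mathcal H$ with bounded inverse. Let $\chi_\pm\in C^\infty(\mathbb R)$, $0\le\chi_\pm\le1$, $\chi_+^2+\chi_-^2=1$, $\operatorname{supp}\chi_-\subset(-\infty,1)$, $\chi_-=1$ on $(-\infty,-1]$, $\operatorname{supp}\chi_+\subset(-1,\infty)$, $\chi_+=1$ on $[1,\infty)$, and $\tilde\chi\in C_0^\infty((-2,2))$, $\tilde\chi=1$ on $[-1,1]$. For $\epsilon_0,R>0$ and $\ell\in\mathbb R$ let $i_\pm=\chi_\pm(\epsilon_0^{-1}x)$, $j_\pm=\chi_\pm(\epsilon_0^{-1}x\mp3)$, $\tilde i=\tilde\chi(R^{-1}x)$, and $$k_\pm=k\mp\ell j_\mp^2,\quad h_\pm=h_0-k_\pm^2,\quad \tilde h_-=h_0-(k_--\ell)^2 .$$ Commutators $[A,T]$ of a self-adjoint $A$ with a bounded self-adjoint $T$ are understood as forms on $D(A)$, and products containing them are called bounded if the corresponding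 forms are; in (TE3 b) the commutators are forms on $D(h_0^{1/2})$, which $\tilde i$ is required to leave invariant. For a triple $(h',k',w)$, with $h'\ge0$ self-adjoint and $k'$ bounded self-adjoint, consider * **(ME1)** $wk'w\in\mathcal B(\mathcal H)$; $[k',w]=0$; $h'^{-1/2}[h',w^{-\epsilon}]w^{\epsilon/2}\in\mathcal B(\mathcal H)$ for $0<\epsilon\le1$; for every $\epsilon>0$, $\|w^{-\epsilon}u\|\lesssim\|h'^{1/2}u\|$ for $u\in D(h'^{1/2})$; $w^{-1}(1+h'^2)^{-1/2}$ is compact. * **(ME2)** for every $\epsilon>0$ there is $\delta_\epsilon>0$ such that $w^{-\epsilon}(h'-z^2)^{-1}w^{-\epsilon}$ extends from $\mathrm{Im}\,z>0$ to $\mathrm{Im}\,z>-\delta_\epsilon$ as a finite meromorphic function (finitely many negative powers in each Laurent expansion, with finite rank coefficients) with values in the compact operators. Assume: * **(TE1)** $[x,k]=0$; $w=w(x)$ for some smooth function $w$ on $\mathbb R$; $h_0$ is local in $x$: if $\chi_1,\chi_2\in C^\infty(\mathbb R)$ are bounded with all derivatives and have disjoint supports, then $\chi_1(x)h_0\chi_2(x)=0$.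 * **(TE2)** $(h_+,k_+)$ and $(\tilde h_-,k_--\ell)$ satisfy (A3). * **(TE3)** a) $w\,i_+ki_+w$, $w\,i_-(k-\ell)i_-w\in\mathcal B(\mathcal H)$; b) $[h,i_\pm]=\tilde i[h,i_\pm]\tilde i$; c) $(h_+,k_+,w)$ and $(\tilde h_-,k_--\ell,w)$ satisfy (ME1), (ME2); d) $h_+^{1/2}i_+h_+^{-1/2}$, $\tilde h_-^{1/2}i_-\tilde h_-^{-1/2}$, $h_0^{1/2}i_\pm h_0^{-1/2}\in\mathcal B(\mathcal H)$; e) the operators $w[h,i_+]wh_+^{-1/2}$, $w[h,i_-]w\tilde h_-^{-1/2}$, $w[h,i_\pm]wh_0^{-1/2}$, $[h,i_+]h_+^{-1/2}$, $[h,i_-]\tilde h_-^{-1/2}$, $[h,i_\pm]h_0^{-1/2}$, $h_0^{-1/2}[w^{-1},h_0]w$ are bounded on $\mathcal H$; f) for every $\epsilon>0$, $\|w^{-\epsilon}u\|\lesssim\|h_0^{1/2}u\|$ for $u\in D(h_0^{1/2})$. Let $\dot{\mathcal E}$ be the completion of $D(h_0^{1/2})\oplus\mathcal H$ for the norm $\|(u_0,u_1)\|^2=\|u_1-ku_0\|^2+\|h_0^{1/2}u_0\|^2$,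 let $\dot H$ be the operator induced on $\dot{\mathcal E}$ by $\begin{pmatrix}0&1\\h&2k\end{pmatrix}$, with its maximal domain $\{u\in\dot{\mathcal E}:\ \begin{pmatrix}0&1\\h&2k\end{pmatrix}u\in\dot{\mathcal E}\}$, let $\dot R(z)=(\dot H-z)^{-1}$, and let $\sigma_{pp}^{\mathbb C}(\dot H)$ be the set of non-real eigenvalues of $\dot H$. An almost analytic extension of $f\in C_0^\infty(\mathbb R)$ is a function $\tilde f\in C_0^\infty(\mathbb C)$ with $\tilde f|_{\mathbb R}=f$ and, for each $N\in\mathbb N$, $|\partial\tilde f/\partial\bar z|\le C_N|\mathrm{Im}\,z|^N$. Call it admissible if $\operatorname{supp}\tilde f\cap\sigma_{pp}^{\mathbb C}(\dot H)=\emptyset$. **Proposition.** (i) Every $f\in C_0^\infty(\mathbb R)$ has an admissible almost analytic extension. For every admissible almost analytic extension $\tilde f$ of $f$ the integral $$f(\dot H):=\frac{i}{2\pi}\int_{\mathbb C}\frac{\partial\tilde f}{\partial\bar z}(z)\,\dot R(z)\,dz\wedge d\bar z=\frac1\pi\int_{\mathbb C}\frac{\partial\tilde f}{\partial\bar z}(z)\,\dot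 R(z)\,dx\,dy$$ is norm convergent in $\mathcal B(\dot{\mathcal E})$ (absolutely, as a Bochner integral), and it does not depend on the choice of $\tilde f$. (ii) The map $C_0^\infty(\mathbb R)\ni f\mapsto f(\dot H)\in\mathcal B(\dot{\mathcal E})$ is linear, multiplicative ($(fg)(\dot H)=f(\dot H)g(\dot H)$), and continuous for the canonical LF topology of $C_0^\infty(\mathbb R)$ and the norm topology of $\mathcal B(\dot{\mathcal E})$. -/

import Mathlib

open MeasureTheory Topology TopologicalSpace
open scoped ContDiff Distributions

noncomputable section

namespace KleinGordon

/-! ### Unbounded operators: resolvents and spectrum -/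

section Resolvent

variable {E : Type*} [NormedAddCommGroup E] [NormedSpace ℂ E]

/-- `T` is a bounded two-sided inverse of `A - z : D(A) → E`. -/
def IsResolventAt (A : E →ₗ.[ℂ] E) (z : ℂ) (T : E →L[ℂ] E) : Prop :=
  (∀ v : E, ∃ u : A.domain, (u : E) = T v ∧ A u - z • (u : E) = v) ∧
    ∀ u : A.domain, T (A u - z • (u : E)) = u

/-- The spectrum of an unbounded operator. -/
def opSpectrum (A : E →ₗ.[ℂ] E) : Set ℂ := {z | ¬ ∃ T, IsResolventAt A z T}

open Classical in
/-- The resolvent `(A - z)⁻¹` (the zero operator if `z` is in the spectrum). -/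
def res (A : E →ₗ.[ℂ] E) (z : ℂ) : E →L[ℂ] E :=
  if hz : ∃ T, IsResolventAt A z T then hz.choose else 0

/-- The set of non-real eigenvalues of `A`. -/
def complexEigenvalues (A : E →ₗ.[ℂ] E) : Set ℂ :=
  {z | z.im ≠ 0 ∧ ∃ u : A.domain, (u : E) ≠ 0 ∧ A u = z • (u : E)}

end Resolvent

variable {H : Type*} [NormedAddCommGroup H] [InnerProductSpace ℂ H] [CompleteSpace H]

/-! ### Continuous functional calculus of a self-adjoint operator -/

/-- Continuous functions on the line with compact support. -/
def IsCutoff (g : ℝ → ℝ) : Prop := Continuous g ∧ HasCompactSupport g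

/-- `g(A)` for `A` self-adjoint and `g` with compact support. With `B = (A + i)⁻¹`, a bounded
normal operator, `A = B⁻¹ - i`, and `g(A)` is the continuous functional calculus of `B` applied to
`ζ ↦ g(ζ⁻¹ - i) = g(Re ζ⁻¹)` on the spectrum of `B` (with value `0` at `ζ = 0`, i.e. at `λ = ∞`). -/
def cc (A : H →ₗ.[ℂ] H) (g : ℝ → ℝ) : H →L[ℂ] H :=
  cfc (fun ζ : ℂ => if ζ = 0 then 0 else ((g (ζ⁻¹).re : ℝ) : ℂ)) (res A (-Complex.I))

/-- The graph of `f(A)`, for `A` self-adjoint and `f` continuous on the spectrum of `A`, possibly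
unbounded: `v = f(A) u` if and only if `(f g)(A) u = g(A) v` for all compactly supported `g`. -/
def fcGraph (f : ℝ → ℝ) (A : H →ₗ.[ℂ] H) : Submodule ℂ (H × H) where
  carrier := {p | ∀ g, IsCutoff g → cc A (fun t => f t * g t) p.1 = cc A g p.2}
  add_mem' := by
    intro a b ha hb g hg
    simp only [Prod.fst_add, Prod.snd_add, map_add, ha g hg, hb g hg]
  zero_mem' := by
    intro g _
    simp only [Prod.fst_zero, Prod.snd_zero, map_zero]
  smul_mem' := by
    intro c a ha g hg
    simp only [Prod.smul_fst, Prod.smul_snd, map_smul, ha g hg]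

/-- `f(A)` as a possibly unbounded operator. -/
def fc (f : ℝ → ℝ) (A : H →ₗ.[ℂ] H) : H →ₗ.[ℂ] H := (fcGraph f A).toLinearPMap

open Classical in
/-- `f(A)` as a bounded operator on `H`, when `f` is bounded on the spectrum of `A`. -/
def bfc (f : ℝ → ℝ) (A : H →ₗ.[ℂ] H) : H →L[ℂ] H :=
  if hT : ∃ T : H →L[ℂ] H, ∀ u, (u, T u) ∈ fcGraph f A then hT.choose else 0

/-- `A^{1/2}` for a nonnegative self-adjoint operator `A`. -/
def sqrtOp (A : H →ₗ.[ℂ] H) : H →ₗ.[ℂ] H := fc Real.sqrt A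

/-- `A ≥ 0`. -/
def OpNonneg (A : H →ₗ.[ℂ] H) : Prop := ∀ u : A.domain, 0 ≤ (inner ℂ (u : H) (A u)).re

/-- `A > 0`, i.e. `A ≥ 0` and `Ker A = {0}`. -/
def OpPos (A : H →ₗ.[ℂ] H) : Prop :=
  OpNonneg A ∧ ∀ u : A.domain, A u = 0 → (u : H) = 0

/-- `[A, T] = 0` for `T` bounded: `T` maps `D(A)` into itself and `A T u = T A u` there. -/
def Commutes (A : H →ₗ.[ℂ] H) (T : H →L[ℂ] H) : Prop :=
  ∀ u : A.domain, ∃ v : A.domain, (v : H) = T u ∧ A v = T (A u)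

/-- The absolutely continuous subspace of `A`: the vectors `u` whose spectral measure `μ`,
characterised by `(u | g(A) u) = ∫ g dμ`, is absolutely continuous for Lebesgue measure. -/
def acSubspace (A : H →ₗ.[ℂ] H) : Set H :=
  {u | ∃ μ : Measure ℝ, IsFiniteMeasure μ ∧ μ ≪ volume ∧
    ∀ g, IsCutoff g → inner ℂ u (cc A g u) = ((∫ t, g t ∂μ : ℝ) : ℂ)}

/-- The absolutely continuous spectrum of `A`: the spectrum of the part of `A` in its
absolutely continuous subspace. -/
def acSpectrum (A : H →ₗ.[ℂ] H) : Set ℂ :=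
  {z | ¬ ∀ v ∈ acSubspace A, ∃! u : A.domain, (u : H) ∈ acSubspace A ∧ A u - z • (u : H) = v}

/-- `T ∈ B(A^{-1/2} H)` with norm at most `C`, for `A > 0` and `T` bounded on `H`: the operator
`T` leaves `D(A^{1/2})` invariant and `‖A^{1/2} T u‖ ≤ C ‖A^{1/2} u‖` there. Equivalently,
`A^{1/2} T A^{-1/2}` extends to a bounded operator on `H` of norm at most `C`. -/
def HomBoundedBy (A : H →ₗ.[ℂ] H) (T : H →L[ℂ] H) (C : ℝ) : Prop :=
  ∀ u : (sqrtOp A).domain, ∃ v : (sqrtOp A).domain,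
    (v : H) = T u ∧ ‖sqrtOp A v‖ ≤ C * ‖sqrtOp A u‖

/-- `w T w ∈ B(H)` for `w` self-adjoint, `T` bounded: `T w u ∈ D(w)` and `‖w T w u‖ ≤ C ‖u‖` for
`u ∈ D(w)`. -/
def SandwichBounded (w : H →ₗ.[ℂ] H) (T : H →L[ℂ] H) : Prop :=
  ∃ C : ℝ, ∀ u : w.domain, ∃ y : w.domain, (y : H) = T (w u) ∧ ‖w y‖ ≤ C * ‖(u : H)‖

/-- The commutator `[A, T]` of a self-adjoint operator `A` with a bounded self-adjoint operator
`T`, as the sesquilinear form `(φ | [A, T] ψ) = (A φ | T ψ) - (T φ | A ψ)` on `D(A)`. -/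
def commForm (A : H →ₗ.[ℂ] H) (T : H →L[ℂ] H) (φ ψ : A.domain) : ℂ :=
  inner ℂ (A φ) (T ψ) - inner ℂ (T φ) (A ψ)

/-- `[A, T] B^{-1/2} ∈ B(H)`. -/
def CommBounded (A : H →ₗ.[ℂ] H) (T : H →L[ℂ] H) (B : H →ₗ.[ℂ] H) : Prop :=
  ∃ C : ℝ, ∀ (φ ψ : A.domain) (s : (sqrtOp B).domain), (s : H) = ψ →
    ‖commForm A T φ ψ‖ ≤ C * ‖(φ : H)‖ * ‖sqrtOp B s‖

/-- `w [A, T] w B^{-1/2} ∈ B(H)`. -/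
def WeightedCommBounded (w A : H →ₗ.[ℂ] H) (T : H →L[ℂ] H) (B : H →ₗ.[ℂ] H) : Prop :=
  ∃ C : ℝ, ∀ (φ ψ : w.domain) (φ' ψ' : A.domain) (s : (sqrtOp B).domain),
    (φ' : H) = w φ → (ψ' : H) = w ψ → (s : H) = ψ →
    ‖commForm A T φ' ψ'‖ ≤ C * ‖(φ : H)‖ * ‖sqrtOp B s‖

/-- `A^{-1/2} [A, T] S⁻¹ ∈ B(H)` for a bounded injective self-adjoint operator `S`. -/
def LeftCommBounded (A : H →ₗ.[ℂ] H) (T S : H →L[ℂ] H) : Prop :=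
  ∃ C : ℝ, ∀ (φ ψ : A.domain) (s : (sqrtOp A).domain), (s : H) = φ →
    ‖commForm A T φ ψ‖ ≤ C * ‖sqrtOp A s‖ * ‖S ψ‖

/-- Finite meromorphic operator valued functions: the singular part of the Laurent expansion
at `z₀` is a finite sum with coefficients of finite rank. -/
def FiniteMeromorphicAt (F : ℂ → H →L[ℂ] H) (z₀ : ℂ) : Prop :=
  ∃ (m : ℕ) (a : Fin m → H →L[ℂ] H) (G : ℂ → H →L[ℂ] H),
    (∀ j, FiniteDimensional ℂ (LinearMap.range (a j : H →ₗ[ℂ] H))) ∧ AnalyticAt ℂ G z₀ ∧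
    ∀ᶠ z in 𝓝[≠] z₀, F z = ∑ j : Fin m, ((z - z₀) ^ ((j : ℕ) + 1))⁻¹ • a j + G z

/-! ### Klein-Gordon operators -/

/-- The operator `A + T`, with domain `D(A)`, for `T` bounded. -/
def addBounded (A : H →ₗ.[ℂ] H) (T : H →L[ℂ] H) : H →ₗ.[ℂ] H := (T : H →ₗ[ℂ] H) +ᵥ A

/-- `h₀ = h + k²`. -/
def hZero (h : H →ₗ.[ℂ] H) (k : H →L[ℂ] H) : H →ₗ.[ℂ] H := addBounded h (k * k)

/-- `(k - z)⁻¹` for `k` bounded. -/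
def kRes (k : H →L[ℂ] H) (z : ℂ) : H →L[ℂ] H := Ring.inverse (k - z • (1 : H →L[ℂ] H))

/-- Condition (A2): `k` and `(k - z)⁻¹`, `z ∉ ℝ`, act boundedly on `h₀^{-1/2} H`, with
`‖(k - z)⁻¹‖ ≲ |Im z|^{-n}` for some `n > 0`, and for some `m > 0` one has
`‖(k - z)⁻¹‖ ≲ ||z| - ‖k‖|⁻¹` if `|z| ≥ m ‖k‖`. The first bound is only asked for `|Im z| ≤ 1`,
the behaviour for large `z` being the subject of the second one. (For `|z| = ‖k‖` the second
bound is `+∞`, so that nothing is asked.) -/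
structure CondA2 (h : H →ₗ.[ℂ] H) (k : H →L[ℂ] H) : Prop where
  bounded : ∃ C : ℝ, HomBoundedBy (hZero h k) k C
  nonreal : ∀ z : ℂ, z.im ≠ 0 → ∃ C : ℝ, HomBoundedBy (hZero h k) (kRes k z) C
  near_real : ∃ C n : ℝ, 0 < n ∧ ∀ z : ℂ, z.im ≠ 0 → |z.im| ≤ 1 →
    HomBoundedBy (hZero h k) (kRes k z) (C * |z.im| ^ (-n))
  large : ∃ m C : ℝ, 0 < m ∧ ∀ z : ℂ, m * ‖k‖ ≤ ‖z‖ → ‖z‖ ≠ ‖k‖ →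
    HomBoundedBy (hZero h k) (kRes k z) (C * |‖z‖ - ‖k‖|⁻¹)

/-- Condition (A3): `h ≥ c k²` for some `c > 0`. -/
def CondA3 (h : H →ₗ.[ℂ] H) (k : H →L[ℂ] H) : Prop :=
  ∃ c : ℝ, 0 < c ∧ ∀ u : h.domain, c * ‖k (u : H)‖ ^ 2 ≤ (inner ℂ (u : H) (h u)).re

/-- The inhomogeneous energy space, as a vector space: pairs `(u₀, u₁)` with `u₀ ∈ D(h₀^{1/2})`
and `u₁ ∈ H`. It is equipped below with the norm of the homogeneous energy space. -/
def EnergySpace (h : H →ₗ.[ℂ] H) (k : H →L[ℂ] H) : Type _ := (sqrtOp (hZero h k)).domain × H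

instance (h : H →ₗ.[ℂ] H) (k : H →L[ℂ] H) : AddCommGroup (EnergySpace h k) :=
  inferInstanceAs (AddCommGroup ((sqrtOp (hZero h k)).domain × H))

instance (h : H →ₗ.[ℂ] H) (k : H →L[ℂ] H) : Module ℂ (EnergySpace h k) :=
  inferInstanceAs (Module ℂ ((sqrtOp (hZero h k)).domain × H))

/-- The map `(u₀, u₁) ↦ (h₀^{1/2} u₀, u₁ - k u₀)` into the Hilbert sum `H ⊕ H`. -/
def energyMap (h : H →ₗ.[ℂ] H) (k : H →L[ℂ] H) :
    EnergySpace h k →ₗ[ℂ] WithLp 2 (H × H) where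
  toFun u := WithLp.toLp 2 (sqrtOp (hZero h k) u.1, u.2 - k (u.1 : H))
  map_add' u v := by
    change WithLp.toLp 2 (sqrtOp (hZero h k) (u.1 + v.1),
      (u.2 + v.2) - k ((u.1 + v.1 : (sqrtOp (hZero h k)).domain) : H)) = _
    rw [← WithLp.toLp_add, Prod.mk_add_mk, LinearPMap.map_add, Submodule.coe_add, map_add]
    congr 2
    abel
  map_smul' c u := by
    change WithLp.toLp 2 (sqrtOp (hZero h k) (c • u.1),
      c • u.2 - k ((c • u.1 : (sqrtOp (hZero h k)).domain) : H)) = _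
    rw [RingHom.id_apply, ← WithLp.toLp_smul, Prod.smul_mk, LinearPMap.map_smul,
      Submodule.coe_smul, map_smul, smul_sub]

/-- The homogeneous energy norm `‖u‖² = ‖u₁ - k u₀‖² + ‖h₀^{1/2} u₀‖²`. -/
instance (h : H →ₗ.[ℂ] H) (k : H →L[ℂ] H) : SeminormedAddCommGroup (EnergySpace h k) :=
  SeminormedAddCommGroup.induced _ _ (energyMap h k)

instance (h : H →ₗ.[ℂ] H) (k : H →L[ℂ] H) : NormedSpace ℂ (EnergySpace h k) :=
  NormedSpace.induced ℂ _ _ (energyMap h k)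

lemma energySpace_norm_sq (h : H →ₗ.[ℂ] H) (k : H →L[ℂ] H) (u : EnergySpace h k) :
    ‖u‖ ^ 2 = ‖u.2 - k (u.1 : H)‖ ^ 2 + ‖sqrtOp (hZero h k) u.1‖ ^ 2 := by
  have h1 : ‖u‖ = ‖energyMap h k u‖ := rfl
  rw [h1, WithLp.prod_norm_sq_eq_of_L2, add_comm]
  rfl

/-- The homogeneous energy space: the completion of the energy space for the homogeneous norm. -/
abbrev HomEnergySpace (h : H →ₗ.[ℂ] H) (k : H →L[ℂ] H) : Type _ :=
  UniformSpace.Completion (EnergySpace h k)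

/-- The isometry `u ↦ (h₀^{1/2} u₀, u₁ - k u₀)` extended to the homogeneous energy space. Here
`h₀^{1/2}` stands for its extension to a unitary map from the homogeneous Sobolev space
`h₀^{-1/2} H` onto `H`. -/
def homCoord (h : H →ₗ.[ℂ] H) (k : H →L[ℂ] H) :
    HomEnergySpace h k →L[ℂ] WithLp 2 (H × H) :=
  ContinuousLinearMap.extend
    ((energyMap h k).mkContinuous 1 fun u => by rw [one_mul]; exact le_rfl)
    (UniformSpace.Completion.toComplL (𝕜 := ℂ) (E := EnergySpace h k))

/-- The operator induced by `k` on `h₀^{-1/2} H`, transported to `H` by `h₀^{1/2}`: the closure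
of the graph `{(h₀^{1/2} u, h₀^{1/2} k u) | u, k u ∈ D(h₀^{1/2})}`. -/
def kHomGraph (h : H →ₗ.[ℂ] H) (k : H →L[ℂ] H) : Submodule ℂ (H × H) :=
  (Submodule.span ℂ {p : H × H | ∃ u v : (sqrtOp (hZero h k)).domain, (v : H) = k u ∧
    p = (sqrtOp (hZero h k) u, sqrtOp (hZero h k) v)}).topologicalClosure

/-- The graph of the homogeneous Klein-Gordon operator, the operator induced on the homogeneous
energy space by the matrix `((0, 1), (h, 2k))`. The equation `f = ((0, 1), (h, 2k)) u` reads
`f₀ = u₁`, `f₁ = h u₀ + 2 k u₁`. In terms of `b = u₁ - k u₀ ∈ H` and `f₁ - k f₀ ∈ H` it becomes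
`f₀ - b = k u₀` in `h₀^{-1/2} H` (so that `b ∈ D(h₀^{1/2})`) and `f₁ - k f₀ = h₀ u₀ + k b` in `H`.
With `a = h₀^{1/2} u₀` and `a' = h₀^{1/2} f₀` these are the two equations below. -/
def homKGGraph (h : H →ₗ.[ℂ] H) (k : H →L[ℂ] H) :
    Submodule ℂ (HomEnergySpace h k × HomEnergySpace h k) where
  carrier := {p | ∃ a b : (sqrtOp (hZero h k)).domain,
    (a : H) = (homCoord h k p.1).fst ∧ (b : H) = (homCoord h k p.1).snd ∧
    ((a : H), (homCoord h k p.2).fst - sqrtOp (hZero h k) b) ∈ kHomGraph h k ∧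
    (homCoord h k p.2).snd = sqrtOp (hZero h k) a + k b}
  add_mem' := by
    rintro p q ⟨a, b, ha, hb, h1, h2⟩ ⟨a', b', ha', hb', h1', h2'⟩
    refine ⟨a + a', b + b', ?_, ?_, ?_, ?_⟩
    · simp [ha, ha']
    · simp [hb, hb']
    · convert add_mem h1 h1' using 1
      simp only [Submodule.coe_add, Prod.snd_add, map_add, WithLp.add_fst, LinearPMap.map_add,
        Prod.mk_add_mk, add_sub_add_comm]
    · simp only [Prod.snd_add, map_add, WithLp.add_snd, LinearPMap.map_add, Submodule.coe_add,
        h2, h2']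
      abel
  zero_mem' := by
    refine ⟨0, 0, by simp, by simp, ?_, by simp⟩
    convert zero_mem (kHomGraph h k) using 1
    simp
  smul_mem' := by
    rintro c p ⟨a, b, ha, hb, h1, h2⟩
    refine ⟨c • a, c • b, ?_, ?_, ?_, ?_⟩
    · simp [ha]
    · simp [hb]
    · convert Submodule.smul_mem _ c h1 using 1
      simp only [Submodule.coe_smul, Prod.smul_snd, map_smul, WithLp.smul_fst, LinearPMap.map_smul,
        Prod.smul_mk, smul_sub]
    · simp only [Prod.smul_snd, map_smul, WithLp.smul_snd, LinearPMap.map_smul, Submodule.coe_smul,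
        h2, smul_add]

/-- The homogeneous Klein-Gordon operator. -/
def homKG (h : H →ₗ.[ℂ] H) (k : H →L[ℂ] H) :
    HomEnergySpace h k →ₗ.[ℂ] HomEnergySpace h k := (homKGGraph h k).toLinearPMap

/-! ### Hypotheses on the weight and on the two ends -/

/-- `w^{-s}` for a positive self-adjoint operator `w` with bounded inverse. -/
def wPow (w : H →ₗ.[ℂ] H) (s : ℝ) : H →L[ℂ] H := bfc (fun t => t ^ (-s)) w

/-- Condition (ME1) for `(h, k, w)`. -/
structure CondME1 (h : H →ₗ.[ℂ] H) (k : H →L[ℂ] H) (w : H →ₗ.[ℂ] H) : Prop where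
  wkw : SandwichBounded w k
  comm : Commutes w k
  commutator : ∀ ε : ℝ, 0 < ε → ε ≤ 1 → LeftCommBounded h (wPow w ε) (wPow w (ε / 2))
  hardy : ∀ ε : ℝ, 0 < ε → ∃ C : ℝ, ∀ u : (sqrtOp h).domain,
    ‖wPow w ε (u : H)‖ ≤ C * ‖sqrtOp h u‖
  compact : IsCompactOperator (wPow w 1 * bfc (fun t => (1 + t ^ 2) ^ (-(1 / 2) : ℝ)) h)

/-- Condition (ME2) for `(h, w)`: for each `ε > 0` the function `w^{-ε} (h - z²)⁻¹ w^{-ε}` extends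
from `Im z > 0` to some half plane `Im z > -δ` as a finite meromorphic function with values in the
compact operators. -/
def CondME2 (h w : H →ₗ.[ℂ] H) : Prop :=
  ∀ ε : ℝ, 0 < ε → ∃ δ : ℝ, 0 < δ ∧ ∃ F : ℂ → H →L[ℂ] H,
    (∀ z : ℂ, 0 < z.im → F z = wPow w ε * res h (z ^ 2) * wPow w ε) ∧
    ∀ z₀ : ℂ, -δ < z₀.im →
      FiniteMeromorphicAt F z₀ ∧ ∀ᶠ z in 𝓝[≠] z₀, IsCompactOperator (F z)

/-- Smooth functions that are bounded together with all their derivatives. -/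
def IsBoundedSmooth (χ : ℝ → ℝ) : Prop :=
  ContDiff ℝ ∞ χ ∧ ∀ n : ℕ, ∃ C : ℝ, ∀ t, |iteratedDeriv n χ t| ≤ C

/-- `A` is local in `x`: `χ₁(x) A χ₂(x) = 0` if `χ₁`, `χ₂` have disjoint supports. -/
def IsLocalIn (A x : H →ₗ.[ℂ] H) : Prop :=
  ∀ χ₁ χ₂ : ℝ → ℝ, IsBoundedSmooth χ₁ → IsBoundedSmooth χ₂ →
    Disjoint (tsupport χ₁) (tsupport χ₂) →
    ∀ (u : H) (v : A.domain), (v : H) = bfc χ₂ x u → bfc χ₁ x (A v) = 0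

/-- The cutoff functions `χ₋`, `χ₊`, `χ̃` on the line. -/
structure IsCutoffTriple (χm χp χt : ℝ → ℝ) : Prop where
  smooth_m : ContDiff ℝ ∞ χm
  smooth_p : ContDiff ℝ ∞ χp
  smooth_t : ContDiff ℝ ∞ χt
  partition : ∀ t, χp t ^ 2 + χm t ^ 2 = 1
  range_m : ∀ t, 0 ≤ χm t ∧ χm t ≤ 1
  range_p : ∀ t, 0 ≤ χp t ∧ χp t ≤ 1
  supp_m : tsupport χm ⊆ Set.Iio 1
  supp_p : tsupport χp ⊆ Set.Ioi (-1)
  one_m : ∀ t ≤ -1, χm t = 1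
  one_p : ∀ t, 1 ≤ t → χp t = 1
  supp_t : tsupport χt ⊆ Set.Ioo (-2) 2
  one_t : ∀ t ∈ Set.Icc (-1 : ℝ) 1, χt t = 1

/-- The sesquilinear form of `h` on `D(h₀^{1/2})`: `(h₀^{1/2} φ | h₀^{1/2} ψ) - (k φ | k ψ)`. -/
def hForm (h : H →ₗ.[ℂ] H) (k : H →L[ℂ] H) (φ ψ : (sqrtOp (hZero h k)).domain) : ℂ :=
  inner ℂ (sqrtOp (hZero h k) φ) (sqrtOp (hZero h k) ψ) - inner ℂ (k (φ : H)) (k (ψ : H))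

/-- `T φ, T ψ ∈ D(h₀^{1/2})` and `(φ | [h, T] ψ) = c`, the commutator with the bounded
self-adjoint operator `T` being taken in the sense of forms on `D(h₀^{1/2})`. -/
def FormCommEq (h : H →ₗ.[ℂ] H) (k T : H →L[ℂ] H) (φ ψ : (sqrtOp (hZero h k)).domain)
    (c : ℂ) : Prop :=
  ∃ φ' ψ' : (sqrtOp (hZero h k)).domain, (φ' : H) = T φ ∧ (ψ' : H) = T ψ ∧
    c = hForm h k φ ψ' - hForm h k φ' ψ

/-- `[h, T] = S [h, T] S`, in the sense of forms on `D(h₀^{1/2})`; `S` leaves this space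
invariant. -/
def CommLocalized (h : H →ₗ.[ℂ] H) (k T S : H →L[ℂ] H) : Prop :=
  ∀ φ ψ : (sqrtOp (hZero h k)).domain, ∃ φ₁ ψ₁ : (sqrtOp (hZero h k)).domain,
    (φ₁ : H) = S φ ∧ (ψ₁ : H) = S ψ ∧ ∃ c : ℂ,
      FormCommEq h k T φ ψ c ∧ FormCommEq h k T φ₁ ψ₁ c

/-- `k₊ = k - ℓ j₋²` -/
def kPlus (k jm : H →L[ℂ] H) (ℓ : ℝ) : H →L[ℂ] H := k - (ℓ : ℂ) • (jm * jm)

/-- `k₋ = k + ℓ j₊²` -/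
def kMinus (k jp : H →L[ℂ] H) (ℓ : ℝ) : H →L[ℂ] H := k + (ℓ : ℂ) • (jp * jp)

/-- `h₊ = h₀ - k₊²` -/
def hPlus (h : H →ₗ.[ℂ] H) (k jm : H →L[ℂ] H) (ℓ : ℝ) : H →ₗ.[ℂ] H :=
  addBounded (hZero h k) (-(kPlus k jm ℓ * kPlus k jm ℓ))

/-- `k₋ - ℓ` -/
def kMinusShift (k jp : H →L[ℂ] H) (ℓ : ℝ) : H →L[ℂ] H := kMinus k jp ℓ - (ℓ : ℂ) • 1

/-- `h̃₋ = h₀ - (k₋ - ℓ)²` -/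
def hMinusTilde (h : H →ₗ.[ℂ] H) (k jp : H →L[ℂ] H) (ℓ : ℝ) : H →ₗ.[ℂ] H :=
  addBounded (hZero h k) (-(kMinusShift k jp ℓ * kMinusShift k jp ℓ))

/-- Conditions (TE1), (TE2), (TE3) for the operators `h`, `k`, `x`, `w` on `H` and the cutoff
operators `ip = i₊`, `im = i₋`, `jp = j₊`, `jm = j₋`, `it = ĩ`. -/
structure TwoEnds (h : H →ₗ.[ℂ] H) (k : H →L[ℂ] H) (x w : H →ₗ.[ℂ] H) (W : ℝ → ℝ) (ℓ : ℝ)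
    (ip im jp jm it : H →L[ℂ] H) : Prop where
  te1_comm : Commutes x k
  te1_smooth : ContDiff ℝ ∞ W
  te1_weight : w = fc W x
  te1_local : IsLocalIn (hZero h k) x
  te2_plus : CondA3 (hPlus h k jm ℓ) (kPlus k jm ℓ)
  te2_minus : CondA3 (hMinusTilde h k jp ℓ) (kMinusShift k jp ℓ)
  te3a_plus : SandwichBounded w (ip * k * ip)
  te3a_minus : SandwichBounded w (im * (k - (ℓ : ℂ) • 1) * im)
  te3b_plus : CommLocalized h k ip it
  te3b_minus : CommLocalized h k im it
  te3c_plus : CondME1 (hPlus h k jm ℓ) (kPlus k jm ℓ) w ∧ CondME2 (hPlus h k jm ℓ) w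
  te3c_minus : CondME1 (hMinusTilde h k jp ℓ) (kMinusShift k jp ℓ) w ∧
    CondME2 (hMinusTilde h k jp ℓ) w
  te3d_plus : ∃ C : ℝ, HomBoundedBy (hPlus h k jm ℓ) ip C
  te3d_minus : ∃ C : ℝ, HomBoundedBy (hMinusTilde h k jp ℓ) im C
  te3d_zero_plus : ∃ C : ℝ, HomBoundedBy (hZero h k) ip C
  te3d_zero_minus : ∃ C : ℝ, HomBoundedBy (hZero h k) im C
  te3e_w_plus : WeightedCommBounded w h ip (hPlus h k jm ℓ)
  te3e_w_minus : WeightedCommBounded w h im (hMinusTilde h k jp ℓ)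
  te3e_w_zero_plus : WeightedCommBounded w h ip (hZero h k)
  te3e_w_zero_minus : WeightedCommBounded w h im (hZero h k)
  te3e_plus : CommBounded h ip (hPlus h k jm ℓ)
  te3e_minus : CommBounded h im (hMinusTilde h k jp ℓ)
  te3e_zero_plus : CommBounded h ip (hZero h k)
  te3e_zero_minus : CommBounded h im (hZero h k)
  te3e_weight : LeftCommBounded (hZero h k) (wPow w 1) (wPow w 1)
  te3f : ∀ ε : ℝ, 0 < ε → ∃ C : ℝ, ∀ u : (sqrtOp (hZero h k)).domain,
    ‖wPow w ε (u : H)‖ ≤ C * ‖sqrtOp (hZero h k) u‖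

/-! ### Almost analytic extensions and the Helffer-Sjöstrand integral -/

/-- `∂F/∂z̄ = (∂ₓ F + i ∂_y F) / 2`. -/
def dbar (F : ℂ → ℂ) (z : ℂ) : ℂ :=
  (1 / 2 : ℂ) * (fderiv ℝ F z 1 + Complex.I * fderiv ℝ F z Complex.I)

/-- `F ∈ C₀^∞(ℂ)` is an almost analytic extension of `f`. -/
structure IsAlmostAnalyticExtension (f : ℝ → ℂ) (F : ℂ → ℂ) : Prop where
  smooth : ContDiff ℝ ∞ F
  compact : HasCompactSupport F
  extends_f : ∀ t : ℝ, F (t : ℂ) = f t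
  flat : ∀ N : ℕ, ∃ C : ℝ, ∀ z : ℂ, ‖dbar F z‖ ≤ C * |z.im| ^ N

section HelfferSjostrand

variable {E : Type*} [NormedAddCommGroup E] [NormedSpace ℂ E]

/-- An almost analytic extension whose support does not meet the non-real eigenvalues of `A`. -/
def IsAdmissible (A : E →ₗ.[ℂ] E) (f : ℝ → ℂ) (F : ℂ → ℂ) : Prop :=
  IsAlmostAnalyticExtension f F ∧ tsupport F ∩ complexEigenvalues A = ∅

/-- `z ↦ (∂F/∂z̄)(z) (A - z)⁻¹`. -/
def hsIntegrand (A : E →ₗ.[ℂ] E) (F : ℂ → ℂ) (z : ℂ) : E →L[ℂ] E := dbar F z • res A z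

/-- The Helffer-Sjöstrand integral `(i / 2π) ∫ (∂F/∂z̄)(z) (A - z)⁻¹ dz ∧ dz̄`. Since
`dz ∧ dz̄ = -2 i dx dy`, it equals `(1 / π) ∫ (∂F/∂z̄)(z) (A - z)⁻¹ dx dy`. -/
def hsIntegral (A : E →ₗ.[ℂ] E) (F : ℂ → ℂ) : E →L[ℂ] E :=
  ((Complex.I / (2 * Real.pi)) * (-2 * Complex.I)) • ∫ z : ℂ, hsIntegrand A F z

end HelfferSjostrand

end KleinGordon

end

open KleinGordon

open MeasureTheory Topology TopologicalSpace
open scoped ContDiff Distributions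

set_option linter.unusedSectionVars false

noncomputable section

namespace KleinGordon

/-! ### Resolvents of unbounded operators -/

section ResolventBasics

variable {E : Type*} [NormedAddCommGroup E] [NormedSpace ℂ E] {A : E →ₗ.[ℂ] E} {z z' : ℂ}
  {T T' : E →L[ℂ] E}

/-! The theorem rests on one property of the resolvent of `homKG h k`, recorded as `IsTempered`: a
non-real point is either in the resolvent set or an eigenvalue, and over each compact piece of the
real axis there is a strip whose non-real points are all resolvent points, with `‖R(z)‖ ≤ C |Im
z|^{-m}`. An admissible extension then meets no singularity off the axis, and the flatness of `∂̄F`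
on the axis absorbs the negative power of `|Im z|`.

Temperedness. In the coordinates `(h₀^{1/2} u₀, u₁ - k u₀)` the operator is the matrix `((K, S), (S,
k))` with `S = h₀^{1/2}` and `K = S k S⁻¹`. Eliminating one component leaves the pencil `h + 2 z k -
z² = h₀ - (k - z)²`, so the resolvent is built from the inverse of the pencil, from `(K - z)⁻¹`,
which (A2) controls, and from bounded operators (`exists_homKG_resolvent`). The pencil is inverted
by gluing. On the range of `i₊` it is `h₊ - z² + 2 z k₊`; on the range of `i₋` it is `h̃₋ - ζ² + 2 ζ
(k₋ - ℓ)` with `ζ = z - ℓ`. Hence `i (A - ζ²)⁻¹ i`, with `A` the nonnegative operator of that end,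
inverts it up to errors containing `[h, i]` or the potential, both of which carry powers of `w⁻¹`
(`exists_end_parametrix`). Sandwiched between these weights, `(A - ζ²)⁻¹` continues meromorphically
across the real axis by (ME2). The sum of the two errors becomes a finite meromorphic compact family
`K(z)` with `1 + K(z)` invertible high in the upper half plane, and the meromorphic Fredholm
alternative (`fredholm_alternative`) gives an inverse with poles of finite order up to and across
the axis. All other factors grow at most like powers of `|Im z|⁻¹`. Adjoints and the lower half
plane follow from the symmetry `(k, z) ↦ (-k, -z)` (`exists_pencil_inverse`).

The calculus. An extension of `f` is a plane cutoff times `∫ f(x - y t) φ(t) dt`, where the moments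
of `φ` are `(-i)^n`: formally this is the Taylor series of `f` at `x + i y`, and its `∂̄` is an
integral of the same kind with all moments zero, hence flat, with constants depending on two
derivatives of `f` only. Taking the cutoff inside the strip gives admissibility and the norm bound
behind continuity (`exists_isAdmissible_norm_le`). Two extensions differ by a function vanishing on
the axis with flat `∂̄`; such a function is itself flat (`isFlat_of_dbar`), and Stokes' formula
without boundary term gives independence (`IsFlat.integral_dbar_smul`). Multiplicativity is the
resolvent identity, Fubini and the Cauchy-Pompeiu formula (`hsIntegral_mul`). -/

lemma IsResolventAt.unique (h : IsResolventAt A z T) (h' : IsResolventAt A z T') : T = T' := by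
  ext v
  obtain ⟨u, hu, hv⟩ := h.1 v
  rw [← hu, ← h'.2 u, hv]

lemma isResolventAt_res (h : ∃ T, IsResolventAt A z T) : IsResolventAt A z (res A z) := by
  rw [res, dif_pos h]
  exact h.choose_spec

lemma IsResolventAt.res_eq (h : IsResolventAt A z T) : res A z = T :=
  (isResolventAt_res ⟨T, h⟩).unique h

lemma IsResolventAt.sub_eq (h : IsResolventAt A z T) (h' : IsResolventAt A z' T') :
    T - T' = (z - z') • (T * T') := by
  ext v
  obtain ⟨u, hu, hv⟩ := h'.1 v
  have h1 := h.2 u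
  have h2 : A u = v + z' • (u : E) := by rw [← hv]; abel
  rw [h2, map_sub, map_add, map_smul, map_smul] at h1
  simp only [sub_apply, smul_apply,
    mul_apply_eq_comp, ← hu]
  rw [← sub_eq_zero] at h1 ⊢
  rw [← h1, sub_smul]
  abel

lemma IsResolventAt.commute (h : IsResolventAt A z T) (h' : IsResolventAt A z' T') :
    T * T' = T' * T := by
  by_cases hz : z = z'
  · subst hz
    rw [h.unique h']
  · have h1 := h.sub_eq h'
    have h2 := h'.sub_eq h
    have h3 : (z - z') • (T * T') = (z - z') • (T' * T) := by
      rw [← h1, ← neg_sub, h2, ← neg_smul, neg_sub]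
    exact smul_right_injective _ (sub_ne_zero.2 hz) h3

/-- Neumann series: `A - z'` factors as `(1 - (z' - z) T)(A - z)` on the domain, and the first
factor is invertible when `(z' - z) T` is small. -/
lemma IsResolventAt.mul_inverse [CompleteSpace E] (h : IsResolventAt A z T)
    (hz : ‖(z' - z) • T‖ < 1) :
    IsResolventAt A z' (T * Ring.inverse (1 - (z' - z) • T)) := by
  have hu : IsUnit (1 - (z' - z) • T) := (Units.oneSub _ hz).isUnit
  set N := Ring.inverse (1 - (z' - z) • T)
  have h1 : (1 - (z' - z) • T) * N = 1 := Ring.mul_inverse_cancel _ hu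
  have h2 : N * (1 - (z' - z) • T) = 1 := Ring.inverse_mul_cancel _ hu
  have hc : T * N = N * T := by
    have h4 : N * (T * (1 - (z' - z) • T)) * N = N * ((1 - (z' - z) • T) * T) * N := by
      simp [mul_sub, sub_mul]
    have h5 : N * (T * (1 - (z' - z) • T)) * N = N * T := by
      rw [mul_assoc, mul_assoc, h1, mul_one]
    have h6 : N * ((1 - (z' - z) • T) * T) * N = T * N := by
      rw [← mul_assoc N, h2, one_mul]
    rw [← h6, ← h4, h5]
  constructor
  · intro v
    obtain ⟨u, hu, hv⟩ := h.1 (N v)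
    refine ⟨u, hu, ?_⟩
    have h3 := congrArg (fun S : E →L[ℂ] E => S v) h1
    simp only [mul_apply_eq_comp, sub_apply,
      one_apply_eq_self, smul_apply] at h3
    have h4 : A u = N v + z • (u : E) := by rw [← hv]; abel
    rw [← hu] at h3
    rw [h4, ← sub_eq_zero, ← sub_eq_zero.2 h3, sub_smul]
    abel
  · intro u
    rw [hc]
    have h3 := congrArg (fun S : E →L[ℂ] E => S u) h2
    simp only [mul_apply_eq_comp, sub_apply,
      one_apply_eq_self, smul_apply] at h3
    rw [mul_apply_eq_comp]
    have h4 : T (A u - z' • (u : E)) = u - (z' - z) • T u := by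
      have := h.2 u
      rw [map_sub, map_smul] at this ⊢
      nth_rewrite 2 [← this]
      rw [sub_smul]
      abel
    rw [h4, h3]

/-- The resolvent set of an unbounded operator. -/
def resolventPoints (A : E →ₗ.[ℂ] E) : Set ℂ := {z | ∃ T, IsResolventAt A z T}

lemma eventually_isResolventAt [CompleteSpace E] (h : IsResolventAt A z T) :
    ∀ᶠ z' in 𝓝 z, IsResolventAt A z' (T * Ring.inverse (1 - (z' - z) • T)) := by
  have h1 : Filter.Tendsto (fun z' : ℂ => ‖(z' - z) • T‖) (𝓝 z) (𝓝 ‖(z - z) • T‖) :=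
    (Continuous.norm (by fun_prop)).tendsto z
  rw [sub_self, zero_smul, norm_zero] at h1
  filter_upwards [h1.eventually_lt_const one_pos] with z' hz'
  exact h.mul_inverse hz'

lemma isOpen_resolventPoints [CompleteSpace E] (A : E →ₗ.[ℂ] E) : IsOpen (resolventPoints A) := by
  rw [isOpen_iff_mem_nhds]
  rintro z ⟨T, hT⟩
  filter_upwards [eventually_isResolventAt hT] with z' h
  exact ⟨_, h⟩

lemma continuousAt_res [CompleteSpace E] (h : z ∈ resolventPoints A) :
    ContinuousAt (res A) z := by
  have hT := isResolventAt_res h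
  set T := res A z
  have h1 : (fun z' => T * Ring.inverse (1 - (z' - z) • T)) =ᶠ[𝓝 z] res A := by
    filter_upwards [eventually_isResolventAt hT] with z' h using h.res_eq.symm
  refine ContinuousAt.congr ?_ h1
  have h2 : ContinuousAt Ring.inverse (1 - (z - z) • T) := by
    simpa using NormedRing.inverse_continuousAt (1 : (E →L[ℂ] E)ˣ)
  refine continuousAt_const.mul (ContinuousAt.comp (f := fun z' : ℂ => 1 - (z' - z) • T) h2 ?_)
  fun_prop

lemma hasDerivAt_res [CompleteSpace E] (h : z ∈ resolventPoints A) :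
    HasDerivAt (res A) (res A z * res A z) z := by
  rw [hasDerivAt_iff_tendsto_slope]
  have h1 : Filter.Tendsto (fun z' => res A z' * res A z) (𝓝[≠] z) (𝓝 (res A z * res A z)) :=
    (((continuousAt_res h).tendsto.mul_const _).mono_left nhdsWithin_le_nhds)
  refine h1.congr' ?_
  filter_upwards [self_mem_nhdsWithin,
    nhdsWithin_le_nhds ((isOpen_resolventPoints A).mem_nhds h)] with z' hz' hz
  rw [slope_def_module, (isResolventAt_res hz).sub_eq (isResolventAt_res h), smul_smul,
    inv_mul_cancel₀ (sub_ne_zero.2 hz'), one_smul]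

end ResolventBasics

variable {H : Type*} [NormedAddCommGroup H] [InnerProductSpace ℂ H] [CompleteSpace H]

/-! ### Self-adjoint operators -/

section SelfAdjoint

variable {A : H →ₗ.[ℂ] H}

lemma inner_self_ofReal (u : H) : inner ℂ u u = ((‖u‖ ^ 2 : ℝ) : ℂ) := by
  rw [inner_self_eq_norm_sq_to_K]
  push_cast
  rfl

lemma inner_symm (hA : IsSelfAdjoint A) (u v : A.domain) :
    inner ℂ (A u) (v : H) = inner ℂ (u : H) (A v) := by
  have h := LinearPMap.adjoint_isFormalAdjoint hA.dense_domain
  rw [LinearPMap.isSelfAdjoint_def.1 hA] at h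
  exact h u v

/-- Maximality of a self-adjoint operator: a weak solution of `A x = y` is a strong one. Membership
in domains is mostly obtained in this way. -/
lemma mem_domain_of_inner (hA : IsSelfAdjoint A) {x y : H}
    (h : ∀ a : A.domain, inner ℂ y (a : H) = inner ℂ x (A a)) :
    ∃ u : A.domain, (u : H) = x ∧ A u = y := by
  have h1 : x ∈ (LinearPMap.adjoint A).domain := LinearPMap.mem_adjoint_domain_of_exists x ⟨y, h⟩
  have h2 := LinearPMap.adjoint_apply_eq hA.dense_domain (⟨x, h1⟩ : (LinearPMap.adjoint A).domain) (x₀ := y) h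
  have h3 : ∀ B : H →ₗ.[ℂ] H, B = A → ∀ (h1 : x ∈ B.domain), B ⟨x, h1⟩ = y →
      ∃ u : A.domain, (u : H) = x ∧ A u = y := by
    rintro B rfl h1 h2
    exact ⟨⟨x, h1⟩, rfl, h2⟩
  exact h3 _ (LinearPMap.isSelfAdjoint_def.1 hA) h1 h2

lemma inner_self_im (hA : IsSelfAdjoint A) (u : A.domain) :
    (inner ℂ (u : H) (A u)).im = 0 := by
  have h := inner_symm hA u u
  rw [← inner_conj_symm] at h
  exact Complex.conj_eq_iff_im.1 h

/-- A symmetric operator whose domain is dense and contains that of its adjoint. -/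
lemma isSelfAdjoint_of_inner (hd : Dense (A.domain : Set H))
    (hs : ∀ u v : A.domain, inner ℂ (A u) (v : H) = inner ℂ (u : H) (A v))
    (hc : ∀ x y : H, (∀ a : A.domain, inner ℂ y (a : H) = inner ℂ x (A a)) → x ∈ A.domain) :
    IsSelfAdjoint A := by
  rw [LinearPMap.isSelfAdjoint_def]
  have h1 : A ≤ (LinearPMap.adjoint A) := LinearPMap.IsFormalAdjoint.le_adjoint hd hs
  refine le_antisymm (And.intro (fun x hx => ?_) (fun x y hxy => ?_)) h1
  · exact hc x ((LinearPMap.adjoint A) ⟨x, hx⟩) fun a => LinearPMap.adjoint_isFormalAdjoint hd ⟨x, hx⟩ a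
  · exact (h1.2 hxy.symm).symm

/-- `P` is a bounded two-sided inverse of `A + M : D(A) → H`. -/
def IsInverseOf (A : H →ₗ.[ℂ] H) (M P : H →L[ℂ] H) : Prop :=
  (∀ v : H, ∃ u : A.domain, (u : H) = P v ∧ A u + M u = v) ∧ ∀ u : A.domain, P (A u + M u) = u

lemma isResolventAt_iff_isInverseOf {z : ℂ} {T : H →L[ℂ] H} :
    IsResolventAt A z T ↔ IsInverseOf A (-(z • (1 : H →L[ℂ] H))) T := by
  simp [IsResolventAt, IsInverseOf, sub_eq_add_neg]

/-- The lower bound on the form gives injectivity and, `A` being closed, a closed range. A vector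
orthogonal to the range lies in the domain of the adjoint, hence of `A`, and the lower bound tested
on it shows that it vanishes. The same argument serves for non-real points, for points below a
nonnegative operator and for squares `ζ²`. -/
lemma exists_isInverseOf (hA : IsSelfAdjoint A) (M : H →L[ℂ] H) {c : ℝ} (hc : 0 < c)
    (h : ∀ u : A.domain, c * ‖(u : H)‖ ^ 2 ≤ ‖inner ℂ (u : H) (A u + M u)‖) :
    ∃ P, IsInverseOf A M P ∧ ∀ v, c * ‖P v‖ ≤ ‖v‖ := by
  let T : A.domain →ₗ[ℂ] H := A.toFun + (M : H →ₗ[ℂ] H) ∘ₗ A.domain.subtype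
  have hT : ∀ u : A.domain, T u = A u + M u := fun u => rfl
  have hlow : ∀ u : A.domain, c * ‖(u : H)‖ ≤ ‖T u‖ := by
    intro u
    by_cases hu : (u : H) = 0
    · simp [hu]
    have h1 : 0 < ‖(u : H)‖ := norm_pos_iff.2 hu
    have h2 := (h u).trans (norm_inner_le_norm _ _)
    rw [← hT, sq, ← mul_assoc, mul_comm ‖(u : H)‖ ‖T u‖] at h2
    exact le_of_mul_le_mul_right h2 h1
  have hinj : Function.Injective T := by
    rw [injective_iff_map_eq_zero]
    intro u hu
    have h1 := hlow u
    rw [hu, norm_zero] at h1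
    have h2 : ‖(u : H)‖ ≤ 0 := by nlinarith [norm_nonneg (u : H)]
    exact Subtype.ext (norm_le_zero_iff.1 h2)
  have hclosed : IsClosed (LinearMap.range T : Set H) := by
    refine IsSeqClosed.isClosed fun v y hv hy => ?_
    choose u hu using hv
    have hcau : CauchySeq fun n => (u n : H) := by
      have h1 := hy.cauchySeq
      rw [Metric.cauchySeq_iff'] at h1 ⊢
      intro ε hε
      obtain ⟨N, hN⟩ := h1 (c * ε) (by positivity)
      refine ⟨N, fun n hn => ?_⟩
      have h2 := hN n hn
      rw [dist_eq_norm] at h2 ⊢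
      have h3 := hlow (u n - u N)
      rw [map_sub, hu, hu, Submodule.coe_sub] at h3
      exact lt_of_mul_lt_mul_left (h3.trans_lt h2) hc.le
    obtain ⟨x, hx⟩ := cauchySeq_tendsto_of_complete hcau
    have hAu : Filter.Tendsto (fun n => A (u n)) Filter.atTop (𝓝 (y - M x)) := by
      have h1 : ∀ n, A (u n) = v n - M (u n) := fun n => by rw [← hu, hT]; abel
      simp_rw [h1]
      exact hy.sub ((M.continuous.tendsto x).comp hx)
    obtain ⟨a, ha, ha'⟩ := mem_domain_of_inner hA (x := x) (y := y - M x) (fun a => by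
      refine tendsto_nhds_unique (hAu.inner tendsto_const_nhds) ?_
      simp_rw [inner_symm hA]
      exact hx.inner tendsto_const_nhds)
    exact ⟨a, by rw [hT, ha', ha]; abel⟩
  have hsurj : LinearMap.range T = ⊤ := by
    have h1 : (LinearMap.range T)ᗮ = ⊥ := by
      rw [Submodule.eq_bot_iff]
      intro v hv
      rw [Submodule.mem_orthogonal'] at hv
      obtain ⟨a, ha, ha'⟩ := mem_domain_of_inner hA (x := v)
        (y := -(ContinuousLinearMap.adjoint M v)) (fun a => by
          have h2 := hv (T a) ⟨a, rfl⟩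
          rw [hT, inner_add_right] at h2
          rw [inner_neg_left, ContinuousLinearMap.adjoint_inner_left]
          linear_combination -h2)
      have h3 := hv (T a) ⟨a, rfl⟩
      rw [hT, ← ha] at h3
      have h4 := h a
      rw [h3, norm_zero] at h4
      have h5 : ‖(a : H)‖ ^ 2 ≤ 0 := by nlinarith [sq_nonneg ‖(a : H)‖]
      rw [← ha]
      exact norm_eq_zero.1 (pow_eq_zero_iff two_ne_zero |>.1 (le_antisymm h5 (sq_nonneg _)))
    rw [← Submodule.topologicalClosure_eq_top_iff] at h1
    rw [← h1, hclosed.submodule_topologicalClosure_eq]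
  let e := LinearEquiv.ofBijective T ⟨hinj, LinearMap.range_eq_top.1 hsurj⟩
  have he : ∀ v, T (e.symm v) = v := fun v => e.apply_symm_apply v
  have hb : ∀ v, ‖(A.domain.subtype ∘ₗ (e.symm : H →ₗ[ℂ] A.domain)) v‖ ≤ c⁻¹ * ‖v‖ := by
    intro v
    have h1 := hlow (e.symm v)
    rw [he] at h1
    rw [inv_mul_eq_div, le_div_iff₀' hc]
    exact h1
  refine ⟨LinearMap.mkContinuous _ c⁻¹ hb, ⟨fun v => ⟨e.symm v, rfl, he v⟩, fun u => ?_⟩,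
    fun v => ?_⟩
  · exact congrArg Subtype.val (e.symm_apply_apply u)
  · have h1 := hlow (e.symm v)
    rw [he] at h1
    exact h1

/-- Two right inverses of `A + M` and `A + M*` are adjoint to each other and two-sided. -/
lemma isInverseOf_of_right_inverse (hA : IsSelfAdjoint A) {M P P' : H →L[ℂ] H}
    (h : ∀ v : H, ∃ u : A.domain, (u : H) = P v ∧ A u + M u = v)
    (h' : ∀ v : H, ∃ u : A.domain, (u : H) = P' v ∧ A u + ContinuousLinearMap.adjoint M u = v) :
    IsInverseOf A M P := by
  refine ⟨h, fun u => ?_⟩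
  obtain ⟨a, ha, ha'⟩ := h (A u + M u)
  -- Every `v` is `A b + M* b`; moving `A + M*` across the inner product leaves `(A + M)(a - u) =
  -- 0`.
  have h1 : ∀ v, inner ℂ v ((a : H) - u) = 0 := by
    intro v
    obtain ⟨b, -, hb⟩ := h' v
    rw [← hb, inner_add_left, ContinuousLinearMap.adjoint_inner_left]
    have h2 : inner ℂ (A b) ((a : H) - u) = inner ℂ (b : H) (A (a - u)) :=
      inner_symm hA b (a - u)
    rw [h2, ← inner_add_right, LinearPMap.map_sub, map_sub]
    have h3 : A a - A u + (M a - M u) = (A a + M a) - (A u + M u) := by abel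
    rw [h3, ha', sub_self, inner_zero_right]
  have h2 := h1 ((a : H) - u)
  rw [inner_self_eq_zero, sub_eq_zero] at h2
  rw [← ha, h2]

lemma exists_isResolventAt (hA : IsSelfAdjoint A) {z : ℂ} (hz : z.im ≠ 0) :
    ∃ T, IsResolventAt A z T := by
  obtain ⟨P, hP, -⟩ := exists_isInverseOf hA (-(z • (1 : H →L[ℂ] H))) (abs_pos.2 hz)
    (fun u => by
      have h1 : (inner ℂ (u : H) (A u + (-(z • (1 : H →L[ℂ] H))) (u : H))).im
          = -(z.im * ‖(u : H)‖ ^ 2) := by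
        simp only [neg_apply, smul_apply,
          one_apply_eq_self, inner_add_right, inner_neg_right, inner_smul_right,
          inner_self_ofReal, Complex.add_im, Complex.neg_im, inner_self_im hA]
        rw [Complex.im_mul_ofReal, zero_add]
      refine le_trans (le_of_eq ?_) (Complex.abs_im_le_norm _)
      rw [h1, abs_neg, abs_mul, abs_of_nonneg (sq_nonneg ‖(u : H)‖)])
  exact ⟨P, isResolventAt_iff_isInverseOf.2 hP⟩

lemma addBounded_apply (T : H →L[ℂ] H) (u : A.domain) :
    addBounded A T u = T u + A u := rfl

lemma isSelfAdjoint_addBounded (hA : IsSelfAdjoint A) {T : H →L[ℂ] H} (hT : IsSelfAdjoint T) :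
    IsSelfAdjoint (addBounded A T) := by
  have hTs : ∀ u v : H, inner ℂ (T u) v = inner ℂ u (T v) := fun u v =>
    (ContinuousLinearMap.isSelfAdjoint_iff_isSymmetric.1 hT) u v
  refine isSelfAdjoint_of_inner hA.dense_domain (fun (u v : A.domain) => ?_) (fun x y h => ?_)
  · rw [addBounded_apply, addBounded_apply, inner_add_left, inner_add_right, inner_symm hA, hTs]
  · obtain ⟨a, ha, -⟩ := mem_domain_of_inner hA (x := x) (y := y - T x) (fun a => by
      have h1 := h a
      rw [addBounded_apply, inner_add_right, ← hTs] at h1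
      rw [inner_sub_left, h1]
      ring)
    rw [← ha]
    exact a.2

end SelfAdjoint

variable {H : Type*} [NormedAddCommGroup H] [InnerProductSpace ℂ H] [CompleteSpace H]

/-! ### The functional calculus of a self-adjoint operator -/

section FunctionalCalculus

variable {A : H →ₗ.[ℂ] H}

lemma isResolventAt_res_of_im (hA : IsSelfAdjoint A) {z : ℂ} (hz : z.im ≠ 0) :
    IsResolventAt A z (res A z) := isResolventAt_res (exists_isResolventAt hA hz)

lemma IsResolventAt.star (hA : IsSelfAdjoint A) {z : ℂ} {T T' : H →L[ℂ] H}
    (h : IsResolventAt A z T) (h' : IsResolventAt A (starRingEnd ℂ z) T') : star T = T' := by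
  rw [ContinuousLinearMap.star_eq_adjoint]
  symm
  rw [ContinuousLinearMap.eq_adjoint_iff]
  intro x y
  obtain ⟨a, ha, ha'⟩ := h'.1 x
  obtain ⟨b, hb, hb'⟩ := h.1 y
  rw [← ha, ← hb]
  conv_lhs => rw [← hb']
  conv_rhs => rw [← ha']
  rw [inner_sub_right, inner_sub_left, inner_symm hA, inner_smul_left, inner_smul_right,
    Complex.conj_conj]

lemma star_res (hA : IsSelfAdjoint A) {z : ℂ} (hz : z.im ≠ 0) :
    star (res A z) = res A (starRingEnd ℂ z) :=
  (isResolventAt_res_of_im hA hz).star hA (isResolventAt_res_of_im hA (by simpa using hz))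

lemma isStarNormal_res (hA : IsSelfAdjoint A) {z : ℂ} (hz : z.im ≠ 0) :
    IsStarNormal (res A z) := by
  refine ⟨?_⟩
  rw [star_res hA hz]
  exact (isResolventAt_res_of_im hA (z := starRingEnd ℂ z) (by simpa using hz)).commute
    (isResolventAt_res_of_im hA hz)

lemma negI_im : (-Complex.I).im ≠ 0 := by simp

lemma star_res_negI (hA : IsSelfAdjoint A) : star (res A (-Complex.I)) = res A Complex.I := by
  rw [star_res hA negI_im]; simp

/-- For `B = (A + i)⁻¹` the resolvent identity reads `B - B* = -2i B B*`. On the spectrum of the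
normal operator `B` it becomes `ζ - ζ̄ = -2i |ζ|²`, the circle made of `0` and of the points `(t +
i)⁻¹` with `t` real. -/
lemma im_inv_of_mem_spectrum (hA : IsSelfAdjoint A) {ζ : ℂ}
    (hζ : ζ ∈ spectrum ℂ (res A (-Complex.I))) (h0 : ζ ≠ 0) : (ζ⁻¹).im = 1 := by
  have hn := isStarNormal_res hA negI_im
  set B := res A (-Complex.I) with hB
  have h1 : B - star B = (-2 * Complex.I) • (B * star B) := by
    rw [star_res_negI hA, (isResolventAt_res_of_im hA negI_im).sub_eq
      (isResolventAt_res_of_im hA (z := Complex.I) (by simp))]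
    congr 1
    ring
  have h2 : cfc (fun ζ : ℂ => ζ - star ζ) B = cfc (fun ζ : ℂ => (-2 * Complex.I) • (ζ * star ζ)) B := by
    rw [cfc_sub (fun ζ : ℂ => ζ) (fun ζ => star ζ) B, cfc_smul (-2 * Complex.I) (fun ζ : ℂ => ζ * star ζ) B,
      cfc_mul (fun ζ : ℂ => ζ) (fun ζ => star ζ) B, cfc_star_id B, cfc_id' ℂ B, h1]
  have h3 := eqOn_of_cfc_eq_cfc (p := IsStarNormal) (R := ℂ) h2 (by fun_prop) (by fun_prop) hn hζ
  simp only [smul_eq_mul] at h3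
  have h4 := congrArg Complex.im h3
  have h5 : ζ * star ζ = ((Complex.normSq ζ : ℝ) : ℂ) := Complex.mul_conj ζ
  rw [h5] at h4
  simp at h4
  rw [Complex.inv_im]
  have h6 : Complex.normSq ζ ≠ 0 := by simpa using h0
  field_simp
  linarith

/-- The set of real `t` such that `(t + i)⁻¹` is in the spectrum of `(A + i)⁻¹`. -/
def realSpectrum (A : H →ₗ.[ℂ] H) : Set ℝ :=
  {t | ((t : ℂ) + Complex.I)⁻¹ ∈ spectrum ℂ (res A (-Complex.I))}

lemma re_inv_mem_realSpectrum (hA : IsSelfAdjoint A) {ζ : ℂ}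
    (hζ : ζ ∈ spectrum ℂ (res A (-Complex.I))) (h0 : ζ ≠ 0) : (ζ⁻¹).re ∈ realSpectrum A := by
  have h1 : (((ζ⁻¹).re : ℂ) + Complex.I) = ζ⁻¹ := by
    apply Complex.ext <;> simp
    have := im_inv_of_mem_spectrum hA hζ h0
    simpa using this.symm
  change (((ζ⁻¹).re : ℂ) + Complex.I)⁻¹ ∈ spectrum ℂ (res A (-Complex.I))
  rwa [h1, inv_inv]

/-- With `ζ = (t + i)⁻¹` and `T = (A - t)⁻¹`, the inverse of `ζ - B` is `(t + i)(1 + (t + i) T)`, by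
the resolvent identity. -/
lemma notMem_realSpectrum (hA : IsSelfAdjoint A) {t : ℝ} {T : H →L[ℂ] H}
    (hT : IsResolventAt A t T) : t ∉ realSpectrum A := by
  intro ht
  have hB := isResolventAt_res_of_im hA negI_im
  have hne : ((t : ℂ) + Complex.I) ≠ 0 := fun h => by simpa using congrArg Complex.im h
  refine ht ?_
  set B := res A (-Complex.I)
  set ζ := ((t : ℂ) + Complex.I)⁻¹
  have h0 : ζ * ((t : ℂ) + Complex.I) = 1 := inv_mul_cancel₀ hne
  have h1 : B - T = (-((t : ℂ) + Complex.I)) • (B * T) := by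
    rw [hB.sub_eq hT]; congr 1; ring
  have hc : B * T = T * B := hB.commute hT
  have h2 : (algebraMap ℂ (H →L[ℂ] H) ζ - B) * (((t : ℂ) + Complex.I) • (1 + ((t : ℂ) + Complex.I) • T)) = 1 := by
    rw [Algebra.algebraMap_eq_smul_one]
    have h3 : B - (T - ((t : ℂ) + Complex.I) • (B * T)) = 0 := by
      rw [← sub_add, h1, neg_smul, neg_add_cancel]
    have h4 : B * (1 + ((t : ℂ) + Complex.I) • T) = T := by
      rw [mul_add, mul_one, mul_smul_comm, ← sub_eq_zero, ← h3]
      abel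
    rw [mul_smul_comm, sub_mul, h4, smul_mul_assoc, one_mul, smul_add, smul_smul, h0, one_smul,
      add_sub_cancel_right, smul_smul, mul_comm, h0, one_smul]
  have h5 : (((t : ℂ) + Complex.I) • (1 + ((t : ℂ) + Complex.I) • T)) * (algebraMap ℂ (H →L[ℂ] H) ζ - B) = 1 := by
    refine Eq.trans ?_ h2
    have : Commute (((t : ℂ) + Complex.I) • (1 + ((t : ℂ) + Complex.I) • T)) (algebraMap ℂ (H →L[ℂ] H) ζ - B) := by
      refine Commute.smul_left ?_ _
      refine Commute.sub_right (Algebra.commutes' ζ _).symm ?_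
      exact (Commute.one_left B).add_left (Commute.smul_left hc.symm _)
    exact this
  exact ⟨⟨_, _, h2, h5⟩, rfl⟩

/-- Continuous functions on the line vanishing at infinity. -/
def VanishesAtInfty (f : ℝ → ℝ) : Prop :=
  Continuous f ∧ Filter.Tendsto f (Filter.cocompact ℝ) (𝓝 0)

lemma IsCutoff.vanishesAtInfty {g : ℝ → ℝ} (hg : IsCutoff g) : VanishesAtInfty g :=
  ⟨hg.1, hg.2.is_zero_at_infty⟩

lemma IsCutoff.mul_left {f g : ℝ → ℝ} (hg : IsCutoff g) (hf : Continuous f) :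
    IsCutoff (fun t => f t * g t) := ⟨hf.mul hg.1, hg.2.mul_left⟩

/-- The function on the spectrum of `(A + i)⁻¹` that corresponds to `f`. -/
def ccFun (f : ℝ → ℝ) (ζ : ℂ) : ℂ := if ζ = 0 then 0 else ((f (ζ⁻¹).re : ℝ) : ℂ)

lemma cc_eq (f : ℝ → ℝ) : cc A f = cfc (ccFun f) (res A (-Complex.I)) := rfl

/-- Since `ζ⁻¹` has imaginary part `1` on the spectrum, its real part tends to infinity as `ζ → 0`:
decay of `f` at infinity is continuity at the added point `0`. -/
lemma continuousOn_ccFun (hA : IsSelfAdjoint A) {f : ℝ → ℝ} (hf : VanishesAtInfty f) :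
    ContinuousOn (ccFun f) (spectrum ℂ (res A (-Complex.I))) := by
  intro ζ hζ
  by_cases h0 : ζ = 0
  · subst h0
    have h1 : Filter.Tendsto (fun ζ : ℂ => (ζ⁻¹).re)
        (𝓝[spectrum ℂ (res A (-Complex.I)) ∩ {0}ᶜ] 0) (Filter.cocompact ℝ) := by
      rw [← Metric.cobounded_eq_cocompact, ← tendsto_norm_atTop_iff_cobounded]
      have h2 : Filter.Tendsto (fun ζ : ℂ => ‖ζ⁻¹‖ - 1)
          (𝓝[spectrum ℂ (res A (-Complex.I)) ∩ {0}ᶜ] 0) Filter.atTop := by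
        refine Filter.tendsto_atTop_add_const_right _ (-1 : ℝ) ?_
        have := (tendsto_norm_inv_nhdsNE_zero_atTop (α := ℂ))
        exact this.mono_left (nhdsWithin_mono _ Set.inter_subset_right)
      refine Filter.tendsto_atTop_mono' _ ?_ h2
      filter_upwards [self_mem_nhdsWithin] with ζ hζ
      have h3 := im_inv_of_mem_spectrum hA hζ.1 hζ.2
      have h4 := Complex.norm_le_abs_re_add_abs_im ζ⁻¹
      rw [h3, abs_one] at h4
      rw [Real.norm_eq_abs]
      linarith
    have h5 := (Complex.continuous_ofReal.tendsto 0).comp (hf.2.comp h1)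
    have h6 : ContinuousWithinAt (ccFun f) (spectrum ℂ (res A (-Complex.I)) ∩ {0}ᶜ) 0 := by
      rw [ContinuousWithinAt, show ccFun f 0 = ((0 : ℝ) : ℂ) by simp [ccFun]]
      refine h5.congr' ?_
      filter_upwards [self_mem_nhdsWithin] with ζ hζ
      have : ζ ≠ 0 := hζ.2
      simp [ccFun, this]
    have h7 := continuousWithinAt_insert_self.2 h6
    refine h7.mono fun ζ hζ => ?_
    by_cases h : ζ = 0
    · exact Or.inl h
    · exact Or.inr ⟨hζ, h⟩
  · refine ContinuousAt.continuousWithinAt ?_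
    have h1 : (fun ζ : ℂ => ((f (ζ⁻¹).re : ℝ) : ℂ)) =ᶠ[𝓝 ζ] ccFun f := by
      filter_upwards [isOpen_compl_singleton.mem_nhds h0] with y hy
      have : y ≠ 0 := hy
      simp [ccFun, this]
    refine ContinuousAt.congr ?_ h1
    have h2 : ContinuousAt (fun ζ : ℂ => (ζ⁻¹).re) ζ :=
      Complex.continuous_re.continuousAt.comp (continuousAt_inv₀ h0)
    exact Complex.continuous_ofReal.continuousAt.comp (hf.1.continuousAt.comp h2)

lemma cc_congr (hA : IsSelfAdjoint A) {f g : ℝ → ℝ} (h : Set.EqOn f g (realSpectrum A)) :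
    cc A f = cc A g := by
  rw [cc_eq, cc_eq]
  refine cfc_congr fun ζ hζ => ?_
  by_cases h0 : ζ = 0
  · simp [ccFun, h0]
  · simp only [ccFun, if_neg h0, h (re_inv_mem_realSpectrum hA hζ h0)]

lemma cc_mul (hA : IsSelfAdjoint A) {f g : ℝ → ℝ} (hf : VanishesAtInfty f)
    (hg : VanishesAtInfty g) : cc A (fun t => f t * g t) = cc A f * cc A g := by
  rw [cc_eq, cc_eq, cc_eq, ← cfc_mul _ _ _ (continuousOn_ccFun hA hf) (continuousOn_ccFun hA hg)]
  congr 1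
  ext ζ
  by_cases h0 : ζ = 0 <;> simp [ccFun, h0]

lemma cc_commute (f g : ℝ → ℝ) : cc A f * cc A g = cc A g * cc A f :=
  cfc_commute_cfc _ _ _

lemma inner_cc (A : H →ₗ.[ℂ] H) (f : ℝ → ℝ) (u v : H) :
    inner ℂ (cc A f u) v = inner ℂ u (cc A f v) := by
  have h : star (cc A f) = cc A f := by
    rw [cc_eq, ← cfc_star]
    congr 1
    ext ζ
    by_cases h0 : ζ = 0 <;> simp [ccFun, h0]
  rw [ContinuousLinearMap.star_eq_adjoint] at h
  nth_rewrite 1 [← h]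
  exact ContinuousLinearMap.adjoint_inner_left _ _ _

lemma norm_cc_le (hA : IsSelfAdjoint A) {f : ℝ → ℝ} {c : ℝ} (hc : 0 ≤ c)
    (h : ∀ t ∈ realSpectrum A, |f t| ≤ c) : ‖cc A f‖ ≤ c := by
  rw [cc_eq]
  refine norm_cfc_le hc fun ζ hζ => ?_
  by_cases h0 : ζ = 0
  · simp [ccFun, h0, hc]
  · simpa [ccFun, h0] using h _ (re_inv_mem_realSpectrum hA hζ h0)

lemma commute_cc (hA : IsSelfAdjoint A) {T : H →L[ℂ] H} (h : Commute (res A (-Complex.I)) T)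
    (h' : Commute (res A Complex.I) T) (f : ℝ → ℝ) : Commute (cc A f) T := by
  rw [cc_eq]
  refine Commute.cfc h ?_ _
  rwa [star_res_negI hA]

lemma cc_mul_res (hA : IsSelfAdjoint A) {f : ℝ → ℝ} (hf : VanishesAtInfty f) :
    cc A f * res A (-Complex.I) = cfc (fun ζ => ccFun f ζ * ζ) (res A (-Complex.I)) := by
  have hn := isStarNormal_res hA negI_im
  rw [cc_eq, cfc_mul _ _ _ (continuousOn_ccFun hA hf), cfc_id' ℂ (res A (-Complex.I))]

/-- Piecewise linear cutoff functions increasing to `1`. -/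
def tent (n : ℕ) (t : ℝ) : ℝ := max 0 (min 1 (n + 1 - |t|))

lemma isCutoff_tent (n : ℕ) : IsCutoff (tent n) := by
  constructor
  · unfold tent; fun_prop
  · refine HasCompactSupport.intro (isCompact_Icc (a := -(n + 1 : ℝ)) (b := n + 1)) fun t ht => ?_
    rw [Set.mem_Icc, ← abs_le, not_le] at ht
    exact max_eq_left ((min_le_right _ _).trans (by linarith))

lemma tent_mem (n : ℕ) (t : ℝ) : 0 ≤ tent n t ∧ tent n t ≤ 1 :=
  ⟨le_max_left _ _, max_le zero_le_one (min_le_left _ _)⟩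

lemma tent_eq_one {n : ℕ} {t : ℝ} (h : |t| ≤ n) : tent n t = 1 := by
  unfold tent
  rw [min_eq_left (by linarith), max_eq_right zero_le_one]

lemma dense_range_res (hA : IsSelfAdjoint A) {z : ℂ} (hz : z.im ≠ 0) :
    DenseRange (res A z) := by
  refine hA.dense_domain.mono fun u hu => ?_
  exact ⟨_, (isResolventAt_res_of_im hA hz).2 ⟨u, hu⟩⟩

/-- The operators are contractions, so it is enough to look at the dense range of `(A + i)⁻¹`, where
convergence holds in norm. This limit is what allows identities between unbounded functions of `A`
to be tested against compactly supported functions only. -/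
lemma tendsto_cc_tent (hA : IsSelfAdjoint A) (u : H) :
    Filter.Tendsto (fun n => cc A (tent n) u) Filter.atTop (𝓝 u) := by
  have hn := isStarNormal_res hA negI_im
  have hle : ∀ n, ‖cc A (tent n)‖ ≤ 1 := fun n =>
    norm_cc_le hA zero_le_one fun t _ => by
      rw [abs_of_nonneg (tent_mem n t).1]; exact (tent_mem n t).2
  -- The summand `1 / (n + 1)` serves `n = 0`, where `1 / n` is `0` by convention; for `n > 0` the
  -- term `1 / n` suffices.
  have hres : ∀ n : ℕ, ‖cc A (tent n) * res A (-Complex.I) - res A (-Complex.I)‖ ≤ 1 / ((n : ℝ) + 1) + 1 / (n : ℝ) := by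
    intro n
    rw [cc_mul_res hA (isCutoff_tent n).vanishesAtInfty]
    have hid := cfc_id' ℂ (res A (-Complex.I))
    have hcong : ∀ C B B' : H →L[ℂ] H, B = B' → ‖C - B‖ = ‖C - B'‖ := by rintro C B _ rfl; rfl
    rw [hcong _ _ _ hid.symm]
    rw [← cfc_sub (fun ζ => ccFun (tent n) ζ * ζ) (fun ζ => ζ) _
      ((continuousOn_ccFun hA (isCutoff_tent n).vanishesAtInfty).mul continuousOn_id)]
    refine norm_cfc_le (by positivity) fun ζ hζ => ?_
    by_cases h0 : ζ = 0
    · simp [h0]; positivity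
    simp only [ccFun, if_neg h0]
    have h1 : ((tent n (ζ⁻¹).re : ℝ) : ℂ) * ζ - ζ = (((tent n (ζ⁻¹).re - 1 : ℝ)) : ℂ) * ζ := by
      push_cast; ring
    rw [h1, norm_mul, Complex.norm_real, Real.norm_eq_abs]
    by_cases h2 : |(ζ⁻¹).re| ≤ n
    · rw [tent_eq_one h2]; simp; positivity
    · push Not at h2
      have h3 : (n : ℝ) < ‖ζ‖⁻¹ := by
        rw [← norm_inv]; exact h2.trans_le (Complex.abs_re_le_norm _)
      have h4 : ‖ζ‖ ≤ 1 / (n : ℝ) ∨ n = 0 := by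
        rcases Nat.eq_zero_or_pos n with hn0 | hn0
        · exact Or.inr hn0
        left
        have : (0 : ℝ) < n := by exact_mod_cast hn0
        rw [le_div_iff₀ this]
        rw [lt_inv_comm₀ this (norm_pos_iff.2 h0), ← one_div, lt_div_iff₀ this] at h3
        exact h3.le
      have h5 : |tent n (ζ⁻¹).re - 1| ≤ 1 := by
        rw [abs_le]; constructor <;> linarith [(tent_mem n (ζ⁻¹).re).1, (tent_mem n (ζ⁻¹).re).2]
      have h7 : (0:ℝ) ≤ 1 / ((n : ℝ) + 1) := by positivity
      rcases h4 with h4 | h4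
      · calc _ ≤ 1 * ‖ζ‖ := by gcongr
          _ ≤ _ := by linarith
      · subst h4
        have h6 : ‖ζ‖ ≤ 1 := by
          have h8 : 1 ≤ ‖ζ⁻¹‖ := by
            rw [← im_inv_of_mem_spectrum hA hζ h0]
            exact (le_abs_self _).trans (Complex.abs_im_le_norm _)
          rw [norm_inv] at h8
          exact (one_le_inv₀ (norm_pos_iff.2 h0)).1 h8
        calc _ ≤ 1 * ‖ζ‖ := by gcongr
          _ ≤ _ := by simpa using h6
  have hlim : Filter.Tendsto (fun n : ℕ => 1 / ((n : ℝ) + 1) + 1 / (n : ℝ)) Filter.atTop (𝓝 0) := by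
    rw [← add_zero (0 : ℝ)]
    exact tendsto_one_div_add_atTop_nhds_zero_nat.add tendsto_one_div_atTop_nhds_zero_nat
  rw [Metric.tendsto_atTop]
  intro ε hε
  obtain ⟨v, hv⟩ := (dense_range_res hA negI_im).exists_dist_lt u (ε := ε / 3) (by positivity)
  have h2 : Filter.Tendsto (fun n : ℕ => (1 / ((n : ℝ) + 1) + 1 / (n : ℝ)) * ‖v‖) Filter.atTop (𝓝 0) := by
    simpa using hlim.mul_const ‖v‖
  obtain ⟨N, hN⟩ := Metric.tendsto_atTop.1 h2 (ε / 3) (by positivity)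
  refine ⟨N, fun n hn => ?_⟩
  have h3 := hN n hn
  rw [Real.dist_eq, sub_zero] at h3
  have h4 : ‖cc A (tent n) (res A (-Complex.I) v) - res A (-Complex.I) v‖ < ε / 3 := by
    refine lt_of_le_of_lt ?_ ((le_abs_self _).trans_lt h3)
    exact (ContinuousLinearMap.le_opNorm (cc A (tent n) * res A (-Complex.I) - res A (-Complex.I)) v).trans
      (by gcongr; exact hres n)
  set y := res A (-Complex.I) v
  rw [dist_eq_norm] at hv ⊢
  have h5 : cc A (tent n) u - u = cc A (tent n) (u - y) + (cc A (tent n) y - y) - (u - y) := by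
    rw [map_sub]; abel
  rw [h5]
  have h6 : ‖cc A (tent n) (u - y)‖ ≤ ‖u - y‖ :=
    ((cc A (tent n)).le_opNorm _).trans (by nlinarith [hle n, norm_nonneg (u - y)])
  calc _ ≤ ‖cc A (tent n) (u - y)‖ + ‖cc A (tent n) y - y‖ + ‖u - y‖ :=
        (norm_sub_le _ _).trans (by gcongr; exact norm_add_le _ _)
    _ < ε := by linarith

lemma eq_of_forall_cc (hA : IsSelfAdjoint A) {u v : H}
    (h : ∀ g, IsCutoff g → cc A g u = cc A g v) : u = v :=
  tendsto_nhds_unique (tendsto_cc_tent hA u)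
    ((tendsto_cc_tent hA v).congr fun n => (h _ (isCutoff_tent n)).symm)

end FunctionalCalculus

variable {H : Type*} [NormedAddCommGroup H] [InnerProductSpace ℂ H] [CompleteSpace H]

/-! ### Graphs of unbounded functions of a self-adjoint operator -/

section Graphs

variable {A : H →ₗ.[ℂ] H}

lemma fcGraph_congr (hA : IsSelfAdjoint A) {f f' : ℝ → ℝ} (h : Set.EqOn f f' (realSpectrum A)) :
    fcGraph f A = fcGraph f' A := by
  ext p
  have h1 : ∀ g : ℝ → ℝ, cc A (fun t => f t * g t) = cc A (fun t => f' t * g t) := fun g =>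
    cc_congr hA fun t ht => by simp only [h ht]
  change (∀ g, IsCutoff g → _) ↔ (∀ g, IsCutoff g → _)
  simp only [h1]

lemma fcGraph_unique (hA : IsSelfAdjoint A) {f : ℝ → ℝ} {u v v' : H}
    (h : (u, v) ∈ fcGraph f A) (h' : (u, v') ∈ fcGraph f A) : v = v' :=
  eq_of_forall_cc hA fun g hg => (h g hg).symm.trans (h' g hg)

lemma fc_graph (hA : IsSelfAdjoint A) (f : ℝ → ℝ) : (fc f A).graph = fcGraph f A := by
  refine Submodule.toLinearPMap_graph_eq _ fun p hp h0 => ?_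
  obtain ⟨u, v⟩ := p
  simp only at h0
  subst h0
  exact fcGraph_unique hA hp (zero_mem _)

lemma mem_fcGraph_of_mem (hA : IsSelfAdjoint A) {f : ℝ → ℝ} (a : (fc f A).domain) :
    ((a : H), fc f A a) ∈ fcGraph f A := by
  rw [← fc_graph hA]
  exact LinearPMap.mem_graph _ a

lemma exists_of_mem_fcGraph (hA : IsSelfAdjoint A) {f : ℝ → ℝ} {u v : H}
    (h : (u, v) ∈ fcGraph f A) : ∃ a : (fc f A).domain, (a : H) = u ∧ fc f A a = v := by
  rw [← fc_graph hA, LinearPMap.mem_graph_iff] at h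
  exact h

/-- Supplies the vectors on which `f(A)` is computed. Only decay of `m` and `f m` is needed, so that
`m` may be a function such as `1 / (1 + t²)`. -/
lemma fcGraph_cc (hA : IsSelfAdjoint A) {f m : ℝ → ℝ} (hf : Continuous f)
    (hm : VanishesAtInfty m) (hfm : VanishesAtInfty fun t => f t * m t) (c : H) :
    (cc A m c, cc A (fun t => f t * m t) c) ∈ fcGraph f A := by
  intro g hg
  change (cc A (fun t => f t * g t) * cc A m) c = (cc A g * cc A (fun t => f t * m t)) c
  rw [← cc_mul hA (hg.mul_left hf).vanishesAtInfty hm, ← cc_mul hA hg.vanishesAtInfty hfm]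
  congr 2
  ext t
  ring

lemma fcGraph_cc_of_isCutoff (hA : IsSelfAdjoint A) {f m : ℝ → ℝ} (hf : Continuous f)
    (hm : IsCutoff m) (c : H) : (cc A m c, cc A (fun t => f t * m t) c) ∈ fcGraph f A :=
  fcGraph_cc hA hf hm.vanishesAtInfty (hm.mul_left hf).vanishesAtInfty c

lemma fcGraph_symm (hA : IsSelfAdjoint A) {f : ℝ → ℝ} {u v u' v' : H}
    (h : (u, v) ∈ fcGraph f A) (h' : (u', v') ∈ fcGraph f A) : inner ℂ v u' = inner ℂ u v' := by
  refine tendsto_nhds_unique ((tendsto_cc_tent hA v).inner (tendsto_const_nhds (x := u')))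
    (((tendsto_const_nhds (x := u)).inner (tendsto_cc_tent hA v')).congr fun n => ?_)
  rw [← h _ (isCutoff_tent n), ← h' _ (isCutoff_tent n)]
  exact (inner_cc A _ _ _).symm

/-- The vectors `cc A g c` belong to the domain of `f(A)`, and pairing with them recovers the
defining identity of the graph. Thus the adjoint of `f(A)` is no larger than `f(A)`, which is the
substance of `isSelfAdjoint_fc`. -/
lemma fcGraph_of_inner (hA : IsSelfAdjoint A) {f : ℝ → ℝ} (hf : Continuous f) {u v : H}
    (h : ∀ p ∈ fcGraph f A, inner ℂ v p.1 = inner ℂ u p.2) : (u, v) ∈ fcGraph f A := by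
  intro g hg
  refine ext_inner_right ℂ fun c => ?_
  rw [inner_cc A, inner_cc A]
  exact (h _ (fcGraph_cc_of_isCutoff hA hf hg c)).symm

lemma fcGraph_comp {f f' : ℝ → ℝ} (hf' : Continuous f') {u v y : H}
    (h : (u, v) ∈ fcGraph f A) (h' : (v, y) ∈ fcGraph f' A) :
    (u, y) ∈ fcGraph (fun t => f t * f' t) A := by
  intro g hg
  have h1 := h _ (hg.mul_left hf')
  simp only [mul_assoc] at h1 ⊢
  rw [h1]
  exact h' g hg

lemma dense_domain_fc (hA : IsSelfAdjoint A) {f : ℝ → ℝ} (hf : Continuous f) :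
    Dense ((fc f A).domain : Set H) := by
  intro u
  refine mem_closure_of_tendsto (tendsto_cc_tent hA u) (.of_forall fun n => ?_)
  obtain ⟨a, ha, -⟩ := exists_of_mem_fcGraph hA (fcGraph_cc_of_isCutoff hA hf (isCutoff_tent n) u)
  rw [← ha]
  exact a.2

lemma isSelfAdjoint_fc (hA : IsSelfAdjoint A) {f : ℝ → ℝ} (hf : Continuous f) :
    IsSelfAdjoint (fc f A) := by
  refine isSelfAdjoint_of_inner (dense_domain_fc hA hf)
    (fun u v => fcGraph_symm hA (mem_fcGraph_of_mem hA u) (mem_fcGraph_of_mem hA v))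
    (fun x y h => ?_)
  obtain ⟨a, ha, -⟩ := exists_of_mem_fcGraph hA
    (fcGraph_of_inner hA hf (u := x) (v := y) (fun p hp => by
      obtain ⟨a, ha, ha'⟩ := exists_of_mem_fcGraph hA (u := p.1) (v := p.2) hp
      rw [← ha, ← ha', h a]))
  rw [← ha]
  exact a.2

lemma inv_add_I_mul (hA : IsSelfAdjoint A) {ζ : ℂ}
    (hζ : ζ ∈ spectrum ℂ (res A (-Complex.I))) (h0 : ζ ≠ 0) :
    (((ζ⁻¹).re : ℂ) + Complex.I) * ζ = 1 := by
  have h1 : (((ζ⁻¹).re : ℂ) + Complex.I) = ζ⁻¹ := by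
    apply Complex.ext <;> simp
    have := im_inv_of_mem_spectrum hA hζ h0
    simpa using this.symm
  rw [h1, inv_mul_cancel₀ h0]

/-- On the spectrum `(t + i) ζ = 1`; multiplied by `g` this is `(t g)(A) B + i g(A) B = g(A)`, which
is then applied to `(A + i) a`. -/
lemma mem_fcGraph_id (hA : IsSelfAdjoint A) (a : A.domain) : ((a : H), A a) ∈ fcGraph id A := by
  have hn := isStarNormal_res hA negI_im
  intro g hg
  have hg' : IsCutoff (fun t => id t * g t) := hg.mul_left continuous_id
  have h1 : cc A (fun t => id t * g t) * res A (-Complex.I) +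
      Complex.I • (cc A g * res A (-Complex.I)) = cc A g := by
    have c1 : ContinuousOn (fun ζ => ccFun (fun t => id t * g t) ζ * ζ) _ :=
      (continuousOn_ccFun hA hg'.vanishesAtInfty).mul continuousOn_id
    have c2 : ContinuousOn (fun ζ => ccFun g ζ * ζ) _ :=
      (continuousOn_ccFun hA hg.vanishesAtInfty).mul continuousOn_id
    rw [cc_mul_res hA hg'.vanishesAtInfty, cc_mul_res hA hg.vanishesAtInfty,
      ← cfc_smul _ (fun ζ => ccFun g ζ * ζ) _ c2,
      ← cfc_add _ _ (fun ζ => Complex.I • (ccFun g ζ * ζ)) c1 (c2.const_smul Complex.I), cc_eq]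
    refine cfc_congr fun ζ hζ => ?_
    by_cases h0 : ζ = 0
    · simp [ccFun, h0]
    · have h3 := inv_add_I_mul hA hζ h0
      simp only [ccFun, if_neg h0, smul_eq_mul, id, Complex.ofReal_mul]
      linear_combination (g (ζ⁻¹).re : ℂ) * h3
  have h2 := (isResolventAt_res_of_im hA negI_im).2 a
  have h3 := congrArg (fun T : H →L[ℂ] H => T (A a - (-Complex.I) • (a : H))) h1
  simp only [add_apply, smul_apply, mul_apply_eq_comp, h2] at h3
  rw [map_sub, map_smul, neg_smul, sub_neg_eq_add] at h3
  exact add_right_cancel h3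

lemma exists_of_mem_fcGraph_id (hA : IsSelfAdjoint A) {u v : H} (h : (u, v) ∈ fcGraph id A) :
    ∃ a : A.domain, (a : H) = u ∧ A a = v :=
  mem_domain_of_inner hA fun a => fcGraph_symm hA h (mem_fcGraph_id hA a)

lemma norm_le_of_mem_fcGraph (hA : IsSelfAdjoint A) {f : ℝ → ℝ} {C : ℝ}
    (hC : 0 ≤ C) (h : ∀ t ∈ realSpectrum A, |f t| ≤ C) {u v : H}
    (huv : (u, v) ∈ fcGraph f A) : ‖v‖ ≤ C * ‖u‖ := by
  refine le_of_tendsto (tendsto_cc_tent hA v).norm (.of_forall fun n => ?_)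
  rw [← huv _ (isCutoff_tent n)]
  refine (ContinuousLinearMap.le_opNorm _ _).trans ?_
  gcongr
  refine norm_cc_le hA hC fun t ht => ?_
  rw [abs_mul, abs_of_nonneg (tent_mem n t).1]
  have := h t ht
  have h1 := tent_mem n t
  nlinarith [abs_nonneg (f t)]

/-- `f(A)` is bounded on a dense domain and its graph, being cut out by bounded operators, is
closed; so every vector has an image. -/
lemma exists_bounded_fcGraph (hA : IsSelfAdjoint A) {f : ℝ → ℝ} (hf : Continuous f) {C : ℝ}
    (hC : 0 ≤ C) (h : ∀ t ∈ realSpectrum A, |f t| ≤ C) :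
    ∃ T : H →L[ℂ] H, ∀ u, (u, T u) ∈ fcGraph f A := by
  have hle : ∀ a : (fc f A).domain, ‖fc f A a‖ ≤ C * ‖(a : H)‖ := fun a =>
    norm_le_of_mem_fcGraph hA hC h (mem_fcGraph_of_mem hA a)
  have hall : ∀ u : H, ∃ v, (u, v) ∈ fcGraph f A := by
    intro u
    have hu := (dense_domain_fc hA hf) u
    obtain ⟨a, ha, hau⟩ := mem_closure_iff_seq_limit.1 hu
    have hcau : CauchySeq fun n => fc f A ⟨a n, ha n⟩ := by
      have h1 := hau.cauchySeq
      rw [Metric.cauchySeq_iff'] at h1 ⊢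
      intro ε hε
      obtain ⟨N, hN⟩ := h1 (ε / (C + 1)) (by positivity)
      refine ⟨N, fun n hn => ?_⟩
      have h2 := hN n hn
      rw [dist_eq_norm, lt_div_iff₀ (by positivity)] at h2
      rw [dist_eq_norm, ← LinearPMap.map_sub]
      refine (hle _).trans_lt ?_
      rw [Submodule.coe_sub]
      nlinarith [norm_nonneg (a n - a N)]
    obtain ⟨v, hv⟩ := cauchySeq_tendsto_of_complete hcau
    refine ⟨v, fun g hg => ?_⟩
    refine tendsto_nhds_unique (((cc A _).continuous.tendsto u).comp hau)
      ((((cc A g).continuous.tendsto v).comp hv).congr fun n => ?_)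
    exact (mem_fcGraph_of_mem hA (⟨a n, ha n⟩ : (fc f A).domain) g hg).symm
  choose T hT using hall
  refine ⟨LinearMap.mkContinuous ⟨⟨T, fun u v => ?_⟩, fun c u => ?_⟩ C fun u =>
    norm_le_of_mem_fcGraph hA hC h (hT u), hT⟩
  · exact fcGraph_unique hA (hT (u + v)) (add_mem (hT u) (hT v))
  · exact fcGraph_unique hA (hT (c • u)) (Submodule.smul_mem _ c (hT u))

lemma bfc_eq (hA : IsSelfAdjoint A) {f : ℝ → ℝ} {T : H →L[ℂ] H}
    (hT : ∀ u, (u, T u) ∈ fcGraph f A) : bfc f A = T := by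
  have h : ∃ T : H →L[ℂ] H, ∀ u, (u, T u) ∈ fcGraph f A := ⟨T, hT⟩
  rw [bfc, dif_pos h]
  ext u
  exact fcGraph_unique hA (h.choose_spec u) (hT u)

/-- The continuous `f'` stands in for an `f` that behaves well on the spectrum only, such as `t ^
(-s)`. -/
lemma mem_fcGraph_bfc (hA : IsSelfAdjoint A) {f f' : ℝ → ℝ} (hf : Continuous f') {C : ℝ}
    (hC : 0 ≤ C) (h : ∀ t ∈ realSpectrum A, |f' t| ≤ C) (hff : Set.EqOn f f' (realSpectrum A))
    (u : H) : (u, bfc f A u) ∈ fcGraph f' A := by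
  obtain ⟨T, hT⟩ := exists_bounded_fcGraph hA hf hC h
  rw [← fcGraph_congr hA hff] at hT
  rw [bfc_eq hA hT, ← fcGraph_congr hA hff]
  exact hT u

lemma isSelfAdjoint_of_fcGraph (hA : IsSelfAdjoint A) {f : ℝ → ℝ} {T : H →L[ℂ] H}
    (hT : ∀ u, (u, T u) ∈ fcGraph f A) : IsSelfAdjoint T := by
  rw [ContinuousLinearMap.isSelfAdjoint_iff_isSymmetric]
  exact fun u v => fcGraph_symm hA (hT u) (hT v)

lemma map_mem_fcGraph (hA : IsSelfAdjoint A) {T : H →L[ℂ] H}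
    (h : Commute (res A (-Complex.I)) T) (h' : Commute (res A Complex.I) T) {f : ℝ → ℝ} {u v : H}
    (huv : (u, v) ∈ fcGraph f A) : (T u, T v) ∈ fcGraph f A := by
  intro g hg
  have h1 := fun g => congrArg (fun S : H →L[ℂ] H => S u) (commute_cc hA h h' g).eq
  have h2 := congrArg (fun S : H →L[ℂ] H => S v) (commute_cc hA h h' g).eq
  simp only [mul_apply_eq_comp] at h1 h2
  simp only
  rw [h1, h2]
  exact congrArg T (huv g hg)

lemma commute_of_fcGraph (hA : IsSelfAdjoint A) {T S : H →L[ℂ] H}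
    (h : Commute (res A (-Complex.I)) T) (h' : Commute (res A Complex.I) T) {f : ℝ → ℝ}
    (hS : ∀ u, (u, S u) ∈ fcGraph f A) : Commute S T := by
  ext u
  exact fcGraph_unique hA (hS (T u)) (map_mem_fcGraph hA h h' (hS u))

lemma Commutes.commute_res {T : H →L[ℂ] H} (h : Commutes A T) (hA : IsSelfAdjoint A) {z : ℂ}
    (hz : z.im ≠ 0) : Commute (res A z) T := by
  have hR := isResolventAt_res_of_im hA hz
  ext v
  obtain ⟨a, ha, ha'⟩ := hR.1 v
  obtain ⟨b, hb, hb'⟩ := h a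
  simp only [mul_apply_eq_comp]
  rw [← ha, ← hb, ← hR.2 b, hb', hb, ← ha', map_sub, map_smul]

lemma res_negI_commute_of_fcGraph (hA : IsSelfAdjoint A) {S : H →L[ℂ] H} {f : ℝ → ℝ}
    (hS : ∀ u, (u, S u) ∈ fcGraph f A) :
    Commute (res A (-Complex.I)) S ∧ Commute (res A Complex.I) S := by
  have h1 := isResolventAt_res_of_im hA negI_im
  have h2 := isResolventAt_res_of_im hA (z := Complex.I) (by simp)
  exact ⟨(commute_of_fcGraph hA (Commute.refl _) (h2.commute h1) hS).symm,
    (commute_of_fcGraph hA (h1.commute h2) (Commute.refl _) hS).symm⟩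

/-! ### Square roots -/

lemma realSpectrum_nonneg (hA : IsSelfAdjoint A) (h : OpNonneg A) {t : ℝ}
    (ht : t ∈ realSpectrum A) : 0 ≤ t := by
  by_contra! hneg
  obtain ⟨P, hP, -⟩ := exists_isInverseOf hA (-((t : ℂ) • (1 : H →L[ℂ] H))) (neg_pos.2 hneg)
    (fun u => by
      refine le_trans ?_ (Complex.re_le_norm _)
      rw [inner_add_right]
      simp only [neg_apply, smul_apply, one_apply_eq_self, inner_neg_right, inner_smul_right,
        inner_self_ofReal, Complex.add_re, Complex.neg_re, Complex.re_ofReal_mul,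
        Complex.ofReal_re]
      have := h u
      linarith)
  exact notMem_realSpectrum hA (isResolventAt_iff_isInverseOf.2 hP) ht

/-- Fourth powers keep exponents integral: the slowest function to be treated is `√t · t / (1 +
t²)`, of size `|t|^{-1/2}`. -/
lemma vanishesAtInfty_of_pow_four {f : ℝ → ℝ} (hf : Continuous f)
    (h : ∀ t, f t ^ 4 ≤ (1 + t ^ 2)⁻¹) : VanishesAtInfty f := by
  refine ⟨hf, ?_⟩
  have h1 : Filter.Tendsto (fun t : ℝ => (1 + t ^ 2)⁻¹) (Filter.cocompact ℝ) (𝓝 0) := by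
    refine Filter.Tendsto.inv_tendsto_atTop ?_
    refine Filter.tendsto_atTop_add_const_left _ _ ?_
    have h2 := (Filter.tendsto_pow_atTop (α := ℝ) two_ne_zero).comp (tendsto_norm_cocompact_atTop (E := ℝ))
    refine h2.congr fun t => ?_
    simp
  have h2 : Filter.Tendsto (fun t => f t ^ 4) (Filter.cocompact ℝ) (𝓝 0) :=
    squeeze_zero (fun t => by positivity) h h1
  have h3 := (Real.continuous_sqrt.comp Real.continuous_sqrt).tendsto 0 |>.comp h2
  simp only [Function.comp_apply, Real.sqrt_zero] at h3
  rw [tendsto_zero_iff_abs_tendsto_zero]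
  refine h3.congr fun t => ?_
  simp only [Function.comp_apply]
  rw [show f t ^ 4 = (f t ^ 2) ^ 2 by ring, Real.sqrt_sq (sq_nonneg _), Real.sqrt_sq_eq_abs]

lemma one_add_sq_pos (t : ℝ) : 0 < 1 + t ^ 2 := by positivity

lemma vanishesAtInfty_mul_inv {f : ℝ → ℝ} (hf : Continuous f) (h : ∀ t, f t ^ 4 ≤ (1 + t ^ 2) ^ 3) :
    VanishesAtInfty fun t => f t * (1 + t ^ 2)⁻¹ := by
  refine vanishesAtInfty_of_pow_four
    (hf.mul (Continuous.inv₀ (by fun_prop) fun t => (one_add_sq_pos t).ne')) fun t => ?_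
  have h1 := one_add_sq_pos t
  rw [mul_pow, inv_pow, ← div_eq_mul_inv, ← one_div, div_le_div_iff₀ (by positivity) h1]
  calc f t ^ 4 * (1 + t ^ 2) ≤ (1 + t ^ 2) ^ 3 * (1 + t ^ 2) := by gcongr; exact h t
    _ = _ := by ring

lemma vanishesAtInfty_id_mul_inv : VanishesAtInfty fun t : ℝ => t * (1 + t ^ 2)⁻¹ :=
  vanishesAtInfty_mul_inv continuous_id' fun t => by
    have := sq_nonneg t
    nlinarith [mul_nonneg this this, mul_nonneg this (mul_nonneg this this)]

lemma vanishesAtInfty_inv : VanishesAtInfty fun t : ℝ => (1 + t ^ 2)⁻¹ := by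
  have h := vanishesAtInfty_mul_inv (f := fun _ => 1) continuous_const fun t => by
    rw [one_pow]; exact one_le_pow₀ (by nlinarith [sq_nonneg t])
  simpa only [one_mul] using h

/-- This is `1 / (t + i) = (t - i) / (1 + t²)`; it rewrites the resolvent with the real functions to
which `cc` applies. -/
lemma res_eq_cc (hA : IsSelfAdjoint A) : res A (-Complex.I) =
    cc A (fun t => t * (1 + t ^ 2)⁻¹) - Complex.I • cc A (fun t => (1 + t ^ 2)⁻¹) := by
  have hn := isStarNormal_res hA negI_im
  have v1 := vanishesAtInfty_id_mul_inv
  have v2 := vanishesAtInfty_inv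
  have hid := cfc_id' ℂ (res A (-Complex.I))
  refine hid.symm.trans ?_
  rw [cc_eq, cc_eq, ← cfc_smul _ _ _ (continuousOn_ccFun hA v2),
    ← cfc_sub _ (fun ζ => Complex.I • ccFun (fun t => (1 + t ^ 2)⁻¹) ζ) _
      (continuousOn_ccFun hA v1) ((continuousOn_ccFun hA v2).const_smul Complex.I)]
  refine cfc_congr fun ζ hζ => ?_
  by_cases h0 : ζ = 0
  · simp [ccFun, h0]
  · have h3 := inv_add_I_mul hA hζ h0
    simp only [ccFun, if_neg h0, smul_eq_mul]
    set t := (ζ⁻¹).re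
    have h4 : ((1 + t ^ 2 : ℝ) : ℂ) ≠ 0 := by exact_mod_cast (one_add_sq_pos t).ne'
    push_cast at h4 ⊢
    field_simp
    linear_combination (t - Complex.I) * h3 + ζ * Complex.I_sq

lemma isSelfAdjoint_sqrtOp (hA : IsSelfAdjoint A) : IsSelfAdjoint (sqrtOp A) :=
  isSelfAdjoint_fc hA Real.continuous_sqrt

/-- On `D(A)`, `A^{1/2} A^{1/2} = A`. -/
lemma exists_sqrtOp (hA : IsSelfAdjoint A) (h : OpNonneg A) (a : A.domain) :
    ∃ b c : (sqrtOp A).domain, (b : H) = a ∧ (c : H) = sqrtOp A b ∧ sqrtOp A c = A a := by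
  have hsq : ∀ t : ℝ, Real.sqrt t ^ 4 ≤ t ^ 2 := by
    intro t
    rcases le_total 0 t with ht | ht
    · rw [show Real.sqrt t ^ 4 = (Real.sqrt t ^ 2) ^ 2 by ring, Real.sq_sqrt ht]
    · rw [Real.sqrt_eq_zero_of_nonpos ht]; nlinarith [sq_nonneg t]
  have v1 := vanishesAtInfty_id_mul_inv
  have v2 := vanishesAtInfty_inv
  have v3 : VanishesAtInfty fun t : ℝ => Real.sqrt t * (t * (1 + t ^ 2)⁻¹) := by
    simp_rw [← mul_assoc]
    refine vanishesAtInfty_mul_inv (Real.continuous_sqrt.mul continuous_id') fun t => ?_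
    rw [mul_pow]
    calc _ ≤ t ^ 2 * t ^ 4 := by gcongr; exact hsq t
      _ = (t ^ 2) ^ 3 := by ring
      _ ≤ _ := by gcongr; linarith
  have v4 : VanishesAtInfty fun t : ℝ => Real.sqrt t * (1 + t ^ 2)⁻¹ := by
    refine vanishesAtInfty_mul_inv Real.continuous_sqrt fun t => (hsq t).trans ?_
    have := sq_nonneg t
    nlinarith [mul_nonneg this this, mul_nonneg this (mul_nonneg this this)]
  -- As `a = (A + i)⁻¹ c`, `res_eq_cc` makes it a combination of `cc` operators applied to `c`, and
  -- `√t / (t + i)` still vanishes at infinity; this puts `a` in the domain of `A^{1/2}`.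
  set c := A a - (-Complex.I) • (a : H)
  have hc : res A (-Complex.I) c = a := (isResolventAt_res_of_im hA negI_im).2 a
  rw [res_eq_cc hA] at hc
  simp only [sub_apply, smul_apply] at hc
  have hmem := sub_mem (fcGraph_cc hA Real.continuous_sqrt v1 v3 c)
    (Submodule.smul_mem _ Complex.I (fcGraph_cc hA Real.continuous_sqrt v2 v4 c))
  rw [Prod.smul_mk, Prod.mk_sub_mk, hc] at hmem
  obtain ⟨b, hb, hb'⟩ := exists_of_mem_fcGraph hA hmem
  have hmem2 : (fc Real.sqrt A b, A a) ∈ fcGraph Real.sqrt A := by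
    intro g hg
    have h1 := mem_fcGraph_of_mem hA b _ (hg.mul_left Real.continuous_sqrt)
    have h2 := mem_fcGraph_id hA a g hg
    simp only at h1 h2 ⊢
    rw [← h1, ← h2, hb]
    congr 1
    refine cc_congr hA fun t ht => ?_
    have := realSpectrum_nonneg hA h ht
    simp only [id]
    rw [← mul_assoc, Real.mul_self_sqrt this]
  obtain ⟨d, hd, hd'⟩ := exists_of_mem_fcGraph hA hmem2
  exact ⟨b, d, hb, hd, hd'⟩

end Graphs

variable {H : Type*} [NormedAddCommGroup H] [InnerProductSpace ℂ H] [CompleteSpace H]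

/-! ### Meromorphic Fredholm theory -/

section Fredholm

/-- The operator with matrix `c` for the orthonormal vectors `e`. -/
def matOp {n : ℕ} (e : Fin n → H) (c : Matrix (Fin n) (Fin n) ℂ) : H →L[ℂ] H :=
  ∑ i, ∑ j, c i j • InnerProductSpace.rankOne ℂ (e i) (e j)

lemma matOp_apply {n : ℕ} (e : Fin n → H) (c : Matrix (Fin n) (Fin n) ℂ) (v : H) :
    matOp e c v = ∑ i, ∑ j, (c i j * inner ℂ (e j) v) • e i := by
  simp [matOp, sum_apply, smul_smul]

/-- The matrix of an operator compressed to the span of `e`. -/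
def opMat {n : ℕ} (e : Fin n → H) (T : H →L[ℂ] H) : Matrix (Fin n) (Fin n) ℂ :=
  Matrix.of fun i j => inner ℂ (e i) (T (e j))

lemma opMat_mulVec {n : ℕ} (e : Fin n → H) (T : H →L[ℂ] H) (x : Fin n → ℂ) (i : Fin n) :
    (opMat e T).mulVec x i = inner ℂ (e i) (T (∑ j, x j • e j)) := by
  simp only [Matrix.mulVec, dotProduct, opMat, Matrix.of_apply, map_sum, map_smul, inner_sum,
    inner_smul_right, mul_comm]

lemma matOp_apply' {n : ℕ} (e : Fin n → H) (c : Matrix (Fin n) (Fin n) ℂ) (v : H) :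
    matOp e c v = ∑ i, c.mulVec (fun j => inner ℂ (e j) v) i • e i := by
  simp only [matOp_apply, ← Finset.sum_smul]
  rfl

lemma matOp_mul_mul {n : ℕ} (e : Fin n → H) (c c' : Matrix (Fin n) (Fin n) ℂ) (T : H →L[ℂ] H) :
    matOp e c * T * matOp e c' = matOp e (c * opMat e T * c') := by
  ext v
  have h : (fun i => inner ℂ (e i) (T (matOp e c' v))) =
      (opMat e T).mulVec (c'.mulVec fun j => inner ℂ (e j) v) := by
    ext i
    rw [opMat_mulVec, matOp_apply']
  rw [mul_apply_eq_comp, mul_apply_eq_comp, matOp_apply' e c, h, matOp_apply', Matrix.mulVec_mulVec,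
    Matrix.mulVec_mulVec]

lemma opMat_one {n : ℕ} {e : Fin n → H} (he : Orthonormal ℂ e) :
    opMat e (1 : H →L[ℂ] H) = 1 := by
  ext i j
  simp [opMat, Matrix.one_apply, orthonormal_iff_ite.1 he i j]

lemma matOp_sub {n : ℕ} (e : Fin n → H) (c c' : Matrix (Fin n) (Fin n) ℂ) :
    matOp e (c - c') = matOp e c - matOp e c' := by
  simp [matOp, sub_smul]

/-- `1 + S T` with `T` of finite rank is inverted through a matrix. -/
lemma isUnit_one_add_mul {n : ℕ} {e : Fin n → H} (he : Orthonormal ℂ e) {S T : H →L[ℂ] H}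
    (hT : matOp e 1 * T = T) (hdet : (1 + opMat e (T * S)).det ≠ 0) :
    IsUnit (1 + S * T) ∧
      Ring.inverse (1 + S * T) = 1 - S * matOp e (1 + opMat e (T * S))⁻¹ * T := by
  set m := 1 + opMat e (T * S) with hm
  have h1 : m * m⁻¹ = 1 := Matrix.mul_nonsing_inv _ (isUnit_iff_ne_zero.2 hdet)
  have h2 : m⁻¹ * m = 1 := Matrix.nonsing_inv_mul _ (isUnit_iff_ne_zero.2 hdet)
  have hB : opMat e (T * S) = m - 1 := by rw [hm]; abel
  have e1 : ∀ c, matOp e 1 * matOp e c = matOp e c := fun c => by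
    have := matOp_mul_mul e 1 c 1
    rwa [opMat_one he, mul_one, one_mul, one_mul] at this
  have e2 : ∀ c, matOp e c * matOp e 1 = matOp e c := fun c => by
    have := matOp_mul_mul e c 1 1
    rwa [opMat_one he, mul_one, mul_one, mul_one] at this
  -- Woodbury's formula: compressed to the span of `e`, `T S` is `m - 1`, so the product telescopes
  -- through `m m⁻¹ = 1`.
  have e3 : S * T * (S * matOp e m⁻¹ * T) = S * T - S * matOp e m⁻¹ * T := by
    have h := matOp_mul_mul e 1 m⁻¹ (T * S)
    rw [hB, one_mul, sub_mul, h1, one_mul, matOp_sub, ← mul_assoc, hT] at h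
    calc _ = S * (T * S * matOp e m⁻¹) * T := by simp only [mul_assoc]
      _ = _ := by rw [h, mul_sub, sub_mul, mul_assoc S (matOp e 1) T, hT]
  have e4 : S * matOp e m⁻¹ * T * (S * T) = S * T - S * matOp e m⁻¹ * T := by
    have h := matOp_mul_mul e m⁻¹ 1 (T * S)
    rw [hB, mul_one, mul_sub, h2, mul_one, matOp_sub] at h
    calc _ = S * (matOp e m⁻¹ * (T * S) * matOp e 1) * T := by
          nth_rewrite 2 [← hT]; simp only [mul_assoc]
      _ = _ := by rw [h, mul_sub, sub_mul, mul_assoc S (matOp e 1) T, hT]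
  have e5 : (1 + S * T) * (1 - S * matOp e m⁻¹ * T) = 1 := by
    rw [add_mul, one_mul, mul_sub, mul_one, e3]; abel
  have e6 : (1 - S * matOp e m⁻¹ * T) * (1 + S * T) = 1 := by
    rw [sub_mul, one_mul, mul_add, mul_one, e4]; abel
  exact ⟨⟨⟨_, _, e5, e6⟩, rfl⟩, Ring.inverse_unit ⟨_, _, e5, e6⟩⟩

/-- A null vector `c` of the matrix yields `y = ∑ cⱼ eⱼ ≠ 0` with `T S y = -y`; then `S y` is a
nonzero element of the kernel of `1 + S T`. -/
lemma not_isUnit_one_add_mul {n : ℕ} {e : Fin n → H} (he : Orthonormal ℂ e) {S T : H →L[ℂ] H}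
    (hT : matOp e 1 * T = T) (hdet : (1 + opMat e (T * S)).det = 0) : ¬ IsUnit (1 + S * T) := by
  rintro hu
  obtain ⟨c, hc, hmc⟩ := Matrix.exists_mulVec_eq_zero_iff.2 hdet
  have hTS : ∀ v, T v = ∑ i, inner ℂ (e i) (T v) • e i := by
    intro v
    nth_rewrite 1 [← hT]
    rw [mul_apply_eq_comp, matOp_apply]
    refine Finset.sum_congr rfl fun i _ => ?_
    rw [← Finset.sum_smul]
    simp [Matrix.one_apply]
  set y := ∑ j, c j • e j with hy
  have hinner : ∀ i, inner ℂ (e i) y = c i := fun i => by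
    rw [hy, he.inner_right_fintype]
  have h1 : T (S y) = -y := by
    rw [hTS, hy, ← Finset.sum_neg_distrib]
    refine Finset.sum_congr rfl fun i _ => ?_
    have h2 := congrFun hmc i
    rw [Matrix.add_mulVec, Matrix.one_mulVec, Pi.add_apply, Pi.zero_apply] at h2
    rw [← neg_smul]
    congr 1
    rw [eq_neg_iff_add_eq_zero, add_comm, ← h2]
    congr 1
    rw [opMat_mulVec]
    rfl
  have h2 : (1 + S * T) (S y) = 0 := by
    simp [h1]
  have h3 : S y = 0 := by
    have h4 := congrArg (fun P : H →L[ℂ] H => P (S y)) (Ring.inverse_mul_cancel _ hu)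
    simp only [mul_apply_eq_comp, one_apply_eq_self] at h4
    rw [← h4, h2, map_zero]
  have h4 : y = 0 := by
    rw [h3, map_zero] at h1
    exact neg_eq_zero.1 h1.symm
  exact hc (funext fun i => by rw [← hinner i, h4, inner_zero_right]; rfl)

/-- Near `z₀`, up to the value at `z₀`, the function `F` is the sum of a meromorphic function with
values in a fixed finite dimensional space and of an analytic one, compact at `z₀`. -/
def FredholmAt (F : ℂ → H →L[ℂ] H) (z₀ : ℂ) : Prop :=
  ∃ (N G : ℂ → H →L[ℂ] H) (Y : Submodule ℂ H), FiniteDimensional ℂ Y ∧ MeromorphicAt N z₀ ∧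
    (∀ z v, N z v ∈ Y) ∧ AnalyticAt ℂ G z₀ ∧ IsCompactOperator (G z₀) ∧
    ∀ᶠ z in 𝓝[≠] z₀, F z = N z + G z

/-- Project orthogonally onto the span of a finite net of the image of the unit ball; the projection
is at least as close as the nearest point of the net. -/
lemma _root_.IsCompactOperator.exists_finite_rank {T : H →L[ℂ] H} (hT : IsCompactOperator T)
    {ε : ℝ} (hε : 0 < ε) : ∃ (P : H →L[ℂ] H) (Y : Submodule ℂ H), FiniteDimensional ℂ Y ∧
      (∀ v, P v ∈ Y) ∧ ‖T - P‖ ≤ ε := by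
  obtain ⟨K, hK, hTK⟩ := IsCompactOperator.image_closedBall_subset_compact (f := (T : H →ₗ[ℂ] H)) hT 1
  obtain ⟨t, htf, ht⟩ := Metric.totallyBounded_iff.1 hK.totallyBounded ε hε
  set Y := Submodule.span ℂ t with hY
  have : FiniteDimensional ℂ Y := FiniteDimensional.span_of_finite ℂ htf
  refine ⟨Y.starProjection ∘L T, Y, this, fun v => ?_, ?_⟩
  · exact Submodule.starProjection_apply_mem _ _
  · refine ContinuousLinearMap.opNorm_le_of_unit_norm hε.le fun x hx => ?_
    have h1 := ht (hTK ⟨x, by simp [hx], rfl⟩)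
    simp only [Set.mem_iUnion, Metric.mem_ball] at h1
    obtain ⟨y, hyt, hy⟩ := h1
    have h2 : ‖T x - Y.starProjection (T x)‖ ≤ ‖T x - y‖ := by
      rw [Submodule.starProjection_minimal]
      exact ciInf_le ⟨0, by rintro _ ⟨z, rfl⟩; positivity⟩ (⟨y, Submodule.subset_span hyt⟩ : Y)
    rw [dist_eq_norm] at hy
    exact h2.trans hy.le

lemma matOp_one_apply {n : ℕ} (e : Fin n → H) (v : H) :
    matOp e 1 v = ∑ i, inner ℂ (e i) v • e i := by
  rw [matOp_apply]
  refine Finset.sum_congr rfl fun i _ => ?_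
  rw [← Finset.sum_smul]
  simp [Matrix.one_apply]

lemma exists_orthonormal (Y : Submodule ℂ H) [FiniteDimensional ℂ Y] :
    ∃ (n : ℕ) (e : Fin n → H), Orthonormal ℂ e ∧ ∀ y ∈ Y, matOp e 1 y = y := by
  let b := stdOrthonormalBasis ℂ Y
  refine ⟨_, fun i => (b i : H), b.orthonormal.comp_linearIsometry Y.subtypeₗᵢ, fun y hy => ?_⟩
  rw [matOp_one_apply]
  have := congrArg Subtype.val (b.sum_repr' ⟨y, hy⟩)
  simpa using this

/-- `F` is bounded near `z₀` by a negative power of the distance to `z₀`. -/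
def PoleBoundAt {E : Type*} [NormedAddCommGroup E] (F : ℂ → E) (z₀ : ℂ) : Prop :=
  ∃ (C : ℝ) (m : ℕ), ∀ᶠ z in 𝓝[≠] z₀, ‖F z‖ ≤ C * (‖z - z₀‖⁻¹) ^ m

lemma _root_.MeromorphicAt.poleBoundAt {E : Type*} [NormedAddCommGroup E] [NormedSpace ℂ E]
    {F : ℂ → E} {z₀ : ℂ} (h : MeromorphicAt F z₀) : PoleBoundAt F z₀ := by
  obtain ⟨m, hm⟩ := h
  have h1 := hm.continuousAt.norm.tendsto.eventually_lt_const (lt_add_one _)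
  refine ⟨‖(z₀ - z₀) ^ m • F z₀‖ + 1, m, ?_⟩
  filter_upwards [nhdsWithin_le_nhds h1, self_mem_nhdsWithin] with z hz hz0
  have h2 : z - z₀ ≠ 0 := sub_ne_zero.2 hz0
  rw [norm_smul, norm_pow] at hz
  rw [inv_pow, ← div_eq_mul_inv, le_div_iff₀ (by positivity), mul_comm]
  exact hz.le

lemma meromorphicAt_det {n : ℕ} {M : ℂ → Matrix (Fin n) (Fin n) ℂ} {z₀ : ℂ}
    (h : ∀ i j, MeromorphicAt (fun z => M z i j) z₀) : MeromorphicAt (fun z => (M z).det) z₀ := by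
  simp only [Matrix.det_apply]
  refine MeromorphicAt.fun_sum fun σ _ => ?_
  have h1 : MeromorphicAt (fun z => ∏ i, M z (σ i) i) z₀ :=
    MeromorphicAt.fun_prod fun i _ => h _ _
  refine (h1.fun_const_smul (((Equiv.Perm.sign σ : ℤ) : ℂ))).congr (.of_forall fun z => ?_)
  simp [Units.smul_def]

lemma meromorphicAt_inv_entry {n : ℕ} {M : ℂ → Matrix (Fin n) (Fin n) ℂ} {z₀ : ℂ}
    (h : ∀ i j, MeromorphicAt (fun z => M z i j) z₀) (i j : Fin n) :
    MeromorphicAt (fun z => (M z)⁻¹ i j) z₀ := by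
  simp only [Matrix.inv_def, Matrix.smul_apply, Matrix.adjugate_apply, Ring.inverse_eq_inv',
    smul_eq_mul]
  refine (meromorphicAt_det h).fun_inv.fun_mul (meromorphicAt_det fun a b => ?_)
  by_cases hab : a = j
  · subst hab
    simp
  · simpa [Matrix.updateRow_ne hab] using h a b

/-- **Meromorphic Fredholm alternative**, local version. -/
lemma FredholmAt.alternative {F : ℂ → H →L[ℂ] H} {z₀ : ℂ} (h : FredholmAt F z₀) :
    (∀ᶠ z in 𝓝[≠] z₀, ¬ IsUnit (1 + F z)) ∨
      ((∀ᶠ z in 𝓝[≠] z₀, IsUnit (1 + F z)) ∧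
        PoleBoundAt (fun z => Ring.inverse (1 + F z)) z₀) := by
  obtain ⟨N, G, Y, hY, hN, hNY, hG, hGc, hF⟩ := h
  -- With `P` within `1/2` of `G z₀`, the operator `1 + (G - P)` is invertible near `z₀`, with
  -- inverse `D`. What remains, `T = N + P`, maps into a fixed finite dimensional space, and `1 + F
  -- = (1 + (G - P))(1 + D T)`.
  obtain ⟨P, Y', hY', hPY', hP⟩ := hGc.exists_finite_rank (ε := 1 / 2) (by norm_num)
  have : FiniteDimensional ℂ (Y ⊔ Y' : Submodule ℂ H) := inferInstance
  obtain ⟨n, e, he, hYe⟩ := exists_orthonormal (Y ⊔ Y')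
  set T : ℂ → H →L[ℂ] H := fun z => N z + P with hTdef
  set D : ℂ → H →L[ℂ] H := fun z => Ring.inverse (1 + (G z - P)) with hDdef
  have hT : ∀ z, matOp e 1 * T z = T z := fun z => by
    ext v
    exact hYe _ (add_mem (Submodule.mem_sup_left (hNY z v)) (Submodule.mem_sup_right (hPY' v)))
  have hunit0 : IsUnit (1 + (G z₀ - P)) := by
    have : ‖-(G z₀ - P)‖ < 1 := by rw [norm_neg]; linarith
    simpa only [Units.val_oneSub, sub_neg_eq_add] using (Units.oneSub _ this).isUnit
  have hana : AnalyticAt ℂ (fun z => 1 + (G z - P)) z₀ := by fun_prop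
  have hD : AnalyticAt ℂ D z₀ := by
    have h1 : AnalyticAt ℂ (Ring.inverse : (H →L[ℂ] H) → (H →L[ℂ] H)) (1 + (G z₀ - P)) :=
      analyticAt_inverse hunit0.unit
    exact h1.fun_comp_of_eq hana rfl
  have hunit : ∀ᶠ z in 𝓝[≠] z₀, IsUnit (1 + (G z - P)) :=
    nhdsWithin_le_nhds (hana.continuousAt.eventually_mem (Units.isOpen.mem_nhds hunit0))
  have hfac : ∀ᶠ z in 𝓝[≠] z₀, 1 + F z = (1 + (G z - P)) * (1 + D z * T z) := by
    filter_upwards [hunit, hF] with z hz hFz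
    rw [mul_add, mul_one, ← mul_assoc, Ring.mul_inverse_cancel _ hz, one_mul, hFz, hTdef]
    simp only
    abel
  have hTm : MeromorphicAt T z₀ := hN.fun_add (MeromorphicAt.const P z₀)
  have hm : ∀ i j, MeromorphicAt (fun z => (1 + opMat e (T z * D z)) i j) z₀ := fun i j => by
    have h1 : MeromorphicAt (fun z => T z * D z) z₀ := hTm.fun_smul hD.meromorphicAt
    obtain ⟨k, hk⟩ := h1
    have h2 : MeromorphicAt (fun z => inner ℂ (e i) ((T z * D z) (e j))) z₀ := by
      refine ⟨k, ?_⟩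
      have h3 := ((innerSL ℂ (e i)).comp (ContinuousLinearMap.apply ℂ H (e j))).analyticAt
        ((fun z => (z - z₀) ^ k • (T z * D z)) z₀)
      refine (h3.fun_comp_of_eq hk rfl).congr (.of_forall fun z => ?_)
      simp
    simpa only [Matrix.add_apply, opMat, Matrix.of_apply] using (MeromorphicAt.const _ z₀).fun_add h2
  -- The dichotomy is that of a scalar meromorphic function, the determinant of the compression of
  -- `1 + T D`.
  rcases (meromorphicAt_det hm).eventually_eq_zero_or_eventually_ne_zero with h0 | h0
  · left
    filter_upwards [hfac, h0, hunit] with z h1 h2 h3 h4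
    refine not_isUnit_one_add_mul he (hT z) h2 ?_
    rw [h1] at h4
    exact (h3.unit.isUnit_units_mul (1 + D z * T z)).1 h4
  · right
    have hinv := fun z hz => isUnit_one_add_mul (S := D z) he (hT z) hz
    constructor
    · filter_upwards [hfac, h0, hunit] with z h1 h2 h3
      rw [h1]
      exact h3.mul (hinv z h2).1
    · have h5 : MeromorphicAt (fun z => (1 - D z * matOp e (1 + opMat e (T z * D z))⁻¹ * T z) * D z) z₀ := by
        have h6 : MeromorphicAt (fun z => matOp e (1 + opMat e (T z * D z))⁻¹) z₀ := by
          unfold matOp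
          exact MeromorphicAt.fun_sum fun i _ => MeromorphicAt.fun_sum fun j _ =>
            (meromorphicAt_inv_entry hm i j).fun_smul (MeromorphicAt.const _ z₀)
        exact ((MeromorphicAt.const _ z₀).fun_sub
          ((hD.meromorphicAt.fun_smul h6).fun_smul hTm)).fun_smul hD.meromorphicAt
      obtain ⟨C, m, hC⟩ := h5.poleBoundAt
      refine ⟨C, m, ?_⟩
      filter_upwards [hC, hfac, h0, hunit] with z h1 h2 h3 h4
      obtain ⟨i1, i2⟩ := hinv z h3
      have h5 : Ring.inverse ((1 + (G z - P)) * (1 + D z * T z)) =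
          Ring.inverse (1 + D z * T z) * Ring.inverse (1 + (G z - P)) := by
        obtain ⟨a, ha⟩ := h4
        obtain ⟨b, hb⟩ := i1
        rw [← ha, ← hb, ← Units.val_mul, Ring.inverse_unit, Ring.inverse_unit, Ring.inverse_unit,
          mul_inv_rev, Units.val_mul]
      rw [h2, h5, i2]
      exact h1

/-- **Meromorphic Fredholm alternative** on a connected set. -/
theorem fredholm_alternative {F : ℂ → H →L[ℂ] H} {Ω : Set ℂ} (hΩ : IsOpen Ω)
    (hc : IsPreconnected Ω) (hF : ∀ z ∈ Ω, FredholmAt F z) {z₁ : ℂ} (hz₁ : z₁ ∈ Ω)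
    (h₁ : ∀ᶠ z in 𝓝[≠] z₁, IsUnit (1 + F z)) {z₀ : ℂ} (hz₀ : z₀ ∈ Ω) :
    (∀ᶠ z in 𝓝[≠] z₀, IsUnit (1 + F z)) ∧ PoleBoundAt (fun z => Ring.inverse (1 + F z)) z₀ := by
  set u := {z ∈ Ω | ∀ᶠ y in 𝓝[≠] z, IsUnit (1 + F y)}
  set v := {z ∈ Ω | ∀ᶠ y in 𝓝[≠] z, ¬ IsUnit (1 + F y)}
  have key : ∀ p : ℂ → Prop, IsOpen {z ∈ Ω | ∀ᶠ y in 𝓝[≠] z, p y} := by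
    intro p
    rw [isOpen_iff_mem_nhds]
    rintro z ⟨hz, hp⟩
    have h1 := eventually_eventually_nhdsWithin.2 hp
    rw [eventually_nhdsWithin_iff] at h1
    filter_upwards [h1, hΩ.mem_nhds hz] with y hy hyΩ
    refine ⟨hyΩ, ?_⟩
    by_cases hyz : y = z
    · rwa [hyz]
    · have h2 := hy hyz
      have h4 : 𝓝[{z}ᶜ] y = 𝓝 y := isOpen_compl_singleton.nhdsWithin_eq hyz
      rw [h4] at h2
      exact nhdsWithin_le_nhds h2
  -- The points near which `1 + F` is invertible and those near which it is not form two disjoint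
  -- open sets covering `Ω`; connectedness and `z₁` leave only the first.
  have hsub : Ω ⊆ u := by
    refine hc.subset_left_of_subset_union (key _) (key fun z => ¬ IsUnit (1 + F z)) (v := v) ?_ ?_
      ⟨z₁, hz₁, hz₁, h₁⟩
    · rw [Set.disjoint_left]
      rintro z ⟨-, hz⟩ ⟨-, hz'⟩
      obtain ⟨y, hy, hy'⟩ := (hz.and hz').exists
      exact hy' hy
    · intro z hz
      rcases (hF z hz).alternative with h | h
      · exact Or.inr ⟨hz, h⟩
      · exact Or.inl ⟨hz, h.1⟩
  rcases (hF z₀ hz₀).alternative with h | h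
  · obtain ⟨y, hy, hy'⟩ := ((hsub hz₀).2.and h).exists
    exact absurd hy hy'
  · exact h

end Fredholm

variable {H : Type*} [NormedAddCommGroup H] [InnerProductSpace ℂ H] [CompleteSpace H]

/-! ### Stability of the Fredholm class, compactness criteria and factorization of operators -/

section Fredholm

lemma FredholmAt.add {F F' : ℂ → H →L[ℂ] H} {z₀ : ℂ} (h : FredholmAt F z₀)
    (h' : FredholmAt F' z₀) : FredholmAt (fun z => F z + F' z) z₀ := by
  obtain ⟨N, G, Y, hY, hN, hNY, hG, hGc, hF⟩ := h
  obtain ⟨N', G', Y', hY', hN', hNY', hG', hGc', hF'⟩ := h'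
  refine ⟨fun z => N z + N' z, fun z => G z + G' z, Y ⊔ Y', inferInstance, hN.fun_add hN',
    fun z v => add_mem (Submodule.mem_sup_left (hNY z v)) (Submodule.mem_sup_right (hNY' z v)),
    hG.fun_add hG', hGc.add hGc', ?_⟩
  filter_upwards [hF, hF'] with z h1 h2
  rw [h1, h2]
  abel

lemma FredholmAt.smul {F : ℂ → H →L[ℂ] H} {z₀ : ℂ} (h : FredholmAt F z₀) {c : ℂ → ℂ}
    (hc : AnalyticAt ℂ c z₀) : FredholmAt (fun z => c z • F z) z₀ := by
  obtain ⟨N, G, Y, hY, hN, hNY, hG, hGc, hF⟩ := h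
  refine ⟨fun z => c z • N z, fun z => c z • G z, Y, hY, hc.meromorphicAt.fun_smul hN,
    fun z v => Y.smul_mem _ (hNY z v), hc.fun_smul hG, hGc.smul (c z₀), ?_⟩
  filter_upwards [hF] with z h1
  rw [h1, smul_add]

lemma FredholmAt.mul_mul {F : ℂ → H →L[ℂ] H} {z₀ : ℂ} (h : FredholmAt F z₀) (A B : H →L[ℂ] H) :
    FredholmAt (fun z => A * F z * B) z₀ := by
  obtain ⟨N, G, Y, hY, hN, hNY, hG, hGc, hF⟩ := h
  refine ⟨fun z => A * N z * B, fun z => A * G z * B, Y.map (A : H →ₗ[ℂ] H), inferInstance,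
    ((MeromorphicAt.const A z₀).fun_smul hN).fun_smul (MeromorphicAt.const B z₀),
    fun z v => ⟨N z (B v), hNY _ _, rfl⟩, (analyticAt_const.mul hG).mul analyticAt_const,
    (hGc.comp_clm B).clm_comp A, ?_⟩
  filter_upwards [hF] with z h1
  rw [h1, mul_add, add_mul]

lemma fredholmAt_const {K : H →L[ℂ] H} (hK : IsCompactOperator K) (z₀ : ℂ) :
    FredholmAt (fun _ => K) z₀ :=
  ⟨fun _ => 0, fun _ => K, ⊥, inferInstance, MeromorphicAt.const 0 z₀, by simp, analyticAt_const, hK,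
    by simp⟩

/-- Finite meromorphic functions with compact values, precomposed with a translation. -/
lemma FiniteMeromorphicAt.fredholmAt {F : ℂ → H →L[ℂ] H} {z₀ ℓ : ℂ}
    (h : FiniteMeromorphicAt F (z₀ - ℓ)) (hc : ∀ᶠ z in 𝓝[≠] (z₀ - ℓ), IsCompactOperator (F z)) :
    FredholmAt (fun z => F (z - ℓ)) z₀ := by
  obtain ⟨m, a, G, ha, hG, hF⟩ := h
  set N : ℂ → H →L[ℂ] H := fun z => ∑ j : Fin m, ((z - (z₀ - ℓ)) ^ ((j : ℕ) + 1))⁻¹ • a j with hN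
  have hfin : ∀ j, IsCompactOperator (a j) := fun j => by
    have := ha j
    refine (isCompactOperator_iff_image_closedBall_subset_compact (a j : H →ₗ[ℂ] H) one_pos).2 ?_
    let Y : Submodule ℂ H := LinearMap.range (a j : H →ₗ[ℂ] H)
    have hpr : ProperSpace Y := FiniteDimensional.proper ℂ Y
    refine ⟨(↑) '' (Metric.closedBall (0 : Y) ‖a j‖), (isCompact_closedBall _ _).image
      continuous_subtype_val, ?_⟩
    rintro _ ⟨x, hx, rfl⟩
    refine ⟨⟨a j x, ⟨x, rfl⟩⟩, ?_, rfl⟩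
    rw [mem_closedBall_zero_iff] at hx ⊢
    exact ((a j).le_opNorm x).trans (by nlinarith [norm_nonneg (a j)])
  have hNc : ∀ z, IsCompactOperator (N z) := fun z => by
    have : ∀ s : Finset (Fin m), IsCompactOperator
        (∑ j ∈ s, ((z - (z₀ - ℓ)) ^ ((j : ℕ) + 1))⁻¹ • a j : H →L[ℂ] H) := by
      intro s
      induction s using Finset.induction_on with
      | empty => exact isCompactOperator_zero
      | insert j s hj ih =>
        rw [Finset.sum_insert hj]
        exact ((hfin j).smul _).add ih
    exact this _
  -- The regular part is compact at the centre, as the norm limit of the compact operators `F z - N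
  -- z`.
  have hGc : IsCompactOperator (G (z₀ - ℓ)) := by
    refine isCompactOperator_of_tendsto
      (hG.continuousAt.tendsto.mono_left nhdsWithin_le_nhds : Filter.Tendsto G (𝓝[≠] (z₀ - ℓ)) _) ?_
    filter_upwards [hF, hc] with z h1 h2
    have h3 : G z = F z - N z := by rw [h1, hN]; abel
    rw [h3]
    exact h2.sub (hNc z)
  have hsub : Filter.Tendsto (fun z => z - ℓ) (𝓝[≠] z₀) (𝓝[≠] (z₀ - ℓ)) := by
    refine tendsto_nhdsWithin_iff.2 ⟨((continuous_id.sub continuous_const).tendsto z₀).mono_left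
      nhdsWithin_le_nhds, ?_⟩
    filter_upwards [self_mem_nhdsWithin] with z hz h
    exact hz (sub_left_injective h)
  refine ⟨fun z => N (z - ℓ), fun z => G (z - ℓ), ⨆ j, LinearMap.range (a j : H →ₗ[ℂ] H),
    inferInstance, ?_, fun z v => ?_, ?_, hGc, hsub.eventually hF⟩
  · refine MeromorphicAt.fun_sum fun j _ => MeromorphicAt.fun_smul ?_ (MeromorphicAt.const _ _)
    refine MeromorphicAt.fun_inv (AnalyticAt.meromorphicAt ?_)
    fun_prop
  · simp only [hN, sum_apply, smul_apply]
    exact Submodule.sum_mem _ fun j _ => Submodule.smul_mem _ _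
      (Submodule.mem_iSup_of_mem j ⟨v, rfl⟩)
  · exact hG.fun_comp_of_eq (by fun_prop) rfl

/-- If `T* T` is compact, so is `T`. -/
lemma isCompactOperator_of_star_mul_self {T : H →L[ℂ] H}
    (h : IsCompactOperator (star T * T : H →L[ℂ] H)) : IsCompactOperator T := by
  obtain ⟨K, hK, hTK⟩ := IsCompactOperator.image_closedBall_subset_compact
    (f := ((star T * T : H →L[ℂ] H) : H →ₗ[ℂ] H)) h 1
  refine (isCompactOperator_iff_isCompact_closure_image_closedBall (T : H →ₗ[ℂ] H) one_pos).2 ?_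
  refine TotallyBounded.isCompact_of_isClosed (TotallyBounded.closure ?_) isClosed_closure
  refine Metric.totallyBounded_of_finite_discretization fun ε hε => ?_
  obtain ⟨t, htf, ht⟩ := Metric.totallyBounded_iff.1 hK.totallyBounded (ε ^ 2 / 8) (by positivity)
  have hb : ∀ x : (T : H →ₗ[ℂ] H) '' Metric.closedBall 0 1, ∃ b : H, ‖b‖ ≤ 1 ∧ T b = x ∧
      ∃ y : t, ‖(star T * T) b - y‖ < ε ^ 2 / 8 := by
    rintro ⟨_, b, hb, rfl⟩
    rw [mem_closedBall_zero_iff] at hb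
    have h1 := ht (hTK ⟨b, by simpa using hb, rfl⟩)
    simp only [Set.mem_iUnion, Metric.mem_ball, dist_eq_norm] at h1
    obtain ⟨y, hy, hy'⟩ := h1
    exact ⟨b, hb, rfl, ⟨y, hy⟩, hy'⟩
  choose b hb1 hb2 y hy using hb
  have : Fintype t := htf.fintype
  obtain ⟨n, ⟨e⟩⟩ := Finite.exists_equiv_fin t
  -- Points are sorted by the element of the net close to `T* T b`. Two points of one class differ
  -- by `T d` with `‖T d‖² ≤ ‖d‖ ‖T* T d‖ ≤ 2 · ε² / 4`.
  refine ⟨ULift (Fin n), inferInstance, fun x => ⟨e (y x)⟩, fun x x' hxx => ?_⟩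
  have hyy : y x = y x' := e.injective (ULift.up_injective hxx)
  rw [dist_eq_norm, ← hb2 x, ← hb2 x', ← map_sub]
  set d := b x - b x' with hd
  have h1 : ‖(star T * T) d‖ ≤ ε ^ 2 / 4 := by
    have h2 := hy x
    have h3 := hy x'
    rw [← hyy] at h3
    have h4 : (star T * T) d = ((star T * T) (b x) - y x) - ((star T * T) (b x') - y x) := by
      rw [hd, map_sub]; abel
    rw [h4]
    exact (norm_sub_le _ _).trans (by linarith)
  have h2 : ‖d‖ ≤ 2 := (norm_sub_le _ _).trans (by linarith [hb1 x, hb1 x'])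
  have h3 : ‖T d‖ ^ 2 ≤ ‖d‖ * ‖(star T * T) d‖ := by
    have h4 : inner ℂ d ((star T * T) d) = ((‖T d‖ ^ 2 : ℝ) : ℂ) := by
      rw [← inner_self_ofReal, ContinuousLinearMap.star_eq_adjoint, mul_apply_eq_comp,
        ContinuousLinearMap.adjoint_inner_right]
    have h5 := norm_inner_le_norm (𝕜 := ℂ) d ((star T * T) d)
    rw [h4, Complex.norm_real, Real.norm_of_nonneg (sq_nonneg _)] at h5
    exact h5
  have h4 : ‖T d‖ ^ 2 < ε ^ 2 := by
    nlinarith [norm_nonneg d, norm_nonneg ((star T * T) d)]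
  exact lt_of_pow_lt_pow_left₀ 2 hε.le h4

/-- If `‖X u‖ ≤ C ‖Y u‖` then `X = B Y` for a bounded operator `B`. -/
lemma exists_clm_comp_eq {E : Type*} [AddCommGroup E] [Module ℂ E] (X Y : E →ₗ[ℂ] H) {C : ℝ}
    (h : ∀ u, ‖X u‖ ≤ C * ‖Y u‖) : ∃ B : H →L[ℂ] H, ∀ u, B (Y u) = X u := by
  set K := (LinearMap.range Y).topologicalClosure with hK
  have : CompleteSpace K := (Submodule.isClosed_topologicalClosure _).completeSpace_coe
  let e : E →ₗ[ℂ] K := Y.codRestrict K fun u =>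
    (LinearMap.range Y).le_topologicalClosure ⟨u, rfl⟩
  have hd : DenseRange e := by
    intro x
    rw [closure_subtype, ← Set.range_comp]
    exact x.2
  have hn : ∃ C, ∀ x, ‖X x‖ ≤ C * ‖e x‖ := ⟨C, h⟩
  -- `B` is the extension of `Y u ↦ X u` to the closure of the range of `Y`, and zero on the
  -- orthogonal complement.
  refine ⟨X.extendOfNorm e ∘L K.orthogonalProjectionOnto, fun u => ?_⟩
  have h1 : K.orthogonalProjectionOnto (Y u) = e u :=
    Submodule.orthogonalProjectionOnto_mem_subspace_eq_self (e u)
  rw [ContinuousLinearMap.comp_apply, h1, LinearMap.extendOfNorm_eq hd hn]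

/-- If `|(φ | X u)| ≤ C ‖S φ‖ ‖Y u‖` for `φ` in a dense set then `X = S B Y` for a bounded
operator `B`. -/
lemma exists_clm_factor {E : Type*} [AddCommGroup E] [Module ℂ E] (X Y : E →ₗ[ℂ] H)
    {S : H →L[ℂ] H} (hS : IsSelfAdjoint S) (hSr : DenseRange S) {D : Set H}
    (hD : Dense D) {C : ℝ} (h : ∀ φ ∈ D, ∀ u, ‖inner ℂ φ (X u)‖ ≤ C * ‖S φ‖ * ‖Y u‖) :
    ∃ B : H →L[ℂ] H, ∀ u, X u = S (B (Y u)) := by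
  have hsym : ∀ u v : H, inner ℂ (S u) v = inner ℂ u (S v) := fun u v =>
    (ContinuousLinearMap.isSelfAdjoint_iff_isSymmetric.1 hS) u v
  have hinj : ∀ v, S v = 0 → v = 0 := fun v hv => by
    refine hSr.eq_zero_of_inner_left ℂ fun u => ?_
    rw [← hsym, hv, inner_zero_left]
  have h' : ∀ φ u, ‖inner ℂ φ (X u)‖ ≤ C * ‖S φ‖ * ‖Y u‖ := fun φ u =>
    hD.induction (P := fun φ => ‖inner ℂ φ (X u)‖ ≤ C * ‖S φ‖ * ‖Y u‖) (fun φ hφ => h φ hφ u)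
      (isClosed_le (by fun_prop) (by fun_prop)) φ
  -- For fixed `u` the functional `S φ ↦ (X u | φ)` is bounded on the dense range of `S`, hence
  -- represented by a vector `y`, by Riesz; since `S` is injective, `y` depends linearly on `u`.
  have hex : ∀ u, ∃ y : H, S y = X u ∧ ‖y‖ ≤ |C| * ‖Y u‖ := by
    intro u
    set f : H →ₗ[ℂ] ℂ := (innerSL ℂ (X u) : H →ₗ[ℂ] ℂ)
    have hf : ∀ φ, ‖f φ‖ ≤ (|C| * ‖Y u‖) * ‖(S : H →ₗ[ℂ] H) φ‖ := fun φ => by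
      have h1 := h' φ u
      rw [norm_inner_symm] at h1
      refine (show ‖f φ‖ ≤ _ from h1).trans ?_
      calc _ ≤ |C| * ‖S φ‖ * ‖Y u‖ := by gcongr; exact le_abs_self C
        _ = _ := by rw [mul_right_comm]; rfl
    have hSr' : DenseRange (S : H →ₗ[ℂ] H) := hSr
    set g := f.extendOfNorm (S : H →ₗ[ℂ] H)
    have hg : ∀ φ, g (S φ) = inner ℂ (X u) φ := fun φ =>
      LinearMap.extendOfNorm_eq hSr' ⟨_, hf⟩ φ
    refine ⟨(InnerProductSpace.toDual ℂ H).symm g, ?_, ?_⟩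
    · refine ext_inner_right ℂ fun φ => ?_
      rw [hsym, InnerProductSpace.toDual_symm_apply, hg]
    · rw [LinearIsometryEquiv.norm_map]
      exact LinearMap.opNorm_extendOfNorm_le hSr' (by positivity) hf
  choose y hy hyn using hex
  let Z : E →ₗ[ℂ] H :=
    { toFun := y
      map_add' := fun u v => by
        rw [← sub_eq_zero]
        refine hinj _ ?_
        rw [map_sub, map_add, hy, hy, hy, map_add, sub_self]
      map_smul' := fun c u => by
        rw [← sub_eq_zero]
        refine hinj _ ?_
        rw [map_sub, map_smul, hy, hy, map_smul, RingHom.id_apply, sub_self] }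
  obtain ⟨B, hB⟩ := exists_clm_comp_eq Z Y hyn
  exact ⟨B, fun u => by rw [hB u]; exact (hy u).symm⟩

end Fredholm

variable {H : Type*} [NormedAddCommGroup H] [InnerProductSpace ℂ H] [CompleteSpace H]
variable {A w : H →ₗ.[ℂ] H}

/-! ### Negative powers of the weight -/

section Weights

lemma mem_domain_of_bound (hA : IsSelfAdjoint A) {x : H} {C : ℝ}
    (h : ∀ a : A.domain, ‖inner ℂ x (A a)‖ ≤ C * ‖(a : H)‖) : x ∈ A.domain := by
  have h1 : x ∈ (LinearPMap.adjoint A).domain := by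
    rw [LinearPMap.mem_adjoint_domain_iff]
    exact AddMonoidHomClass.continuous_of_bound _ C h
  have h2 : LinearPMap.adjoint A = A := hA
  rwa [h2] at h1

/-- The bounded inverse frees a disk around `0` from spectrum, and positivity excludes the negative
axis. -/
lemma exists_le_realSpectrum (hw : IsSelfAdjoint w) (hpos : OpPos w)
    (hinv : (0 : ℂ) ∉ opSpectrum w) : ∃ c : ℝ, 0 < c ∧ ∀ t ∈ realSpectrum w, c ≤ t := by
  have h0 : (0 : ℂ) ∈ resolventPoints w := not_not.1 hinv
  obtain ⟨c, hc, hball⟩ := Metric.isOpen_iff.1 (isOpen_resolventPoints w) 0 h0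
  refine ⟨c, hc, fun t ht => ?_⟩
  by_contra! hlt
  have ht0 := realSpectrum_nonneg hw hpos.1 ht
  have : (t : ℂ) ∈ resolventPoints w := hball (by
    rw [mem_ball_zero_iff, Complex.norm_real, Real.norm_of_nonneg ht0]
    exact hlt)
  obtain ⟨T, hT⟩ := this
  exact notMem_realSpectrum hw hT ht

/-- On the spectrum `t ^ (-s)` agrees with `max t c ^ (-s)`, which is continuous and bounded on the
whole line. -/
lemma mem_fcGraph_wPow (hw : IsSelfAdjoint w) {c : ℝ} (hc : 0 < c)
    (h : ∀ t ∈ realSpectrum w, c ≤ t) {s : ℝ} (hs : 0 < s) (u : H) :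
    (u, wPow w s u) ∈ fcGraph (fun t => max t c ^ (-s)) w := by
  have hmax : ∀ t : ℝ, 0 < max t c := fun t => lt_max_of_lt_right hc
  refine mem_fcGraph_bfc hw ?_ (Real.rpow_nonneg hc.le (-s)) (fun t _ => ?_) (fun t ht => ?_) u
  · exact (continuous_id.max continuous_const).rpow_const fun t => Or.inl (hmax t).ne'
  · rw [abs_of_nonneg (Real.rpow_nonneg (hmax t).le _)]
    exact Real.rpow_le_rpow_of_nonpos hc (le_max_right _ _) (by linarith)
  · simp only [max_eq_left (h t ht)]

/-- The properties of `w^{-1}` and `w^{-1/2}`. -/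
structure IsWeight (w : H →ₗ.[ℂ] H) : Prop where
  selfAdjoint : IsSelfAdjoint w
  selfAdjoint_one : IsSelfAdjoint (wPow w 1)
  selfAdjoint_half : IsSelfAdjoint (wPow w (1 / 2))
  half_mul_half : wPow w (1 / 2) * wPow w (1 / 2) = wPow w 1
  exists_eq : ∀ u : H, ∃ a : w.domain, (a : H) = wPow w 1 u ∧ w a = u
  one_apply : ∀ a : w.domain, wPow w 1 (w a) = a
  commute : ∀ T : H →L[ℂ] H, Commutes w T → Commute (wPow w 1) T ∧ Commute (wPow w (1 / 2)) T
  denseRange_one : DenseRange (wPow w 1)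

lemma isWeight (hw : IsSelfAdjoint w) (hpos : OpPos w) (hinv : (0 : ℂ) ∉ opSpectrum w) :
    IsWeight w := by
  obtain ⟨c, hc, hcw⟩ := exists_le_realSpectrum hw hpos hinv
  have hmax : ∀ t : ℝ, 0 < max t c := fun t => lt_max_of_lt_right hc
  have h1 := mem_fcGraph_wPow hw hc hcw one_pos
  have h2 := mem_fcGraph_wPow hw hc hcw one_half_pos
  have hcont : ∀ s : ℝ, Continuous fun t : ℝ => max t c ^ (-s) := fun s =>
    (continuous_id.max continuous_const).rpow_const fun t => Or.inl (hmax t).ne'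
  have hex : ∀ u : H, ∃ a : w.domain, (a : H) = wPow w 1 u ∧ w a = u := fun u => by
    refine exists_of_mem_fcGraph_id hw fun g hg => ?_
    have h3 := h1 u (fun t => id t * g t) (hg.mul_left continuous_id)
    refine Eq.trans h3.symm ?_
    refine congrArg (fun T : H →L[ℂ] H => T u) (cc_congr hw fun t ht => ?_)
    have : max t c = t := max_eq_left (hcw t ht)
    simp only [this, id, Real.rpow_neg_one]
    rw [inv_mul_cancel_left₀ (hc.trans_le (hcw t ht)).ne']
  have hone : ∀ a : w.domain, wPow w 1 (w a) = a := fun a => by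
    have h3 := fcGraph_comp (hcont 1) (mem_fcGraph_id hw a) (h1 _)
    have h4 : ((a : H), (a : H)) ∈ fcGraph (fun t => id t * max t c ^ (-1 : ℝ)) w := by
      intro g hg
      refine congrArg (fun T : H →L[ℂ] H => T (a : H)) (cc_congr hw fun t ht => ?_)
      have : max t c = t := max_eq_left (hcw t ht)
      simp only [this, id, Real.rpow_neg_one]
      rw [mul_inv_cancel₀ (hc.trans_le (hcw t ht)).ne', one_mul]
    exact fcGraph_unique hw h3 h4
  refine ⟨hw, isSelfAdjoint_of_fcGraph hw h1, isSelfAdjoint_of_fcGraph hw h2, ?_, hex, hone,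
    fun T hT => ?_, ?_⟩
  · ext u
    have h3 := fcGraph_comp (hcont _) (h2 u) (h2 _)
    have h4 : (fun t : ℝ => max t c ^ (-(1 / 2 : ℝ)) * max t c ^ (-(1 / 2 : ℝ))) =
        fun t => max t c ^ (-1 : ℝ) := by
      funext t
      rw [← Real.rpow_add (hmax t)]
      norm_num
    rw [h4] at h3
    exact fcGraph_unique hw h3 (h1 u)
  · have h3 := hT.commute_res hw negI_im
    have h4 := hT.commute_res hw (z := Complex.I) (by simp)
    exact ⟨commute_of_fcGraph hw h3 h4 h1, commute_of_fcGraph hw h3 h4 h2⟩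
  · refine Dense.mono ?_ hw.dense_domain
    exact fun a ha => ⟨w ⟨a, ha⟩, hone ⟨a, ha⟩⟩

/-- The hypothesis says `|(φ | T v)| ≤ C ‖w⁻¹ φ‖ ‖w⁻¹ v‖`; through `exists_clm_factor` the decay of
`T` is turned into explicit factors `w⁻¹` on both sides, as the parametrix requires. -/
lemma IsWeight.exists_sandwich (hw : IsWeight w) {T : H →L[ℂ] H} (hT : SandwichBounded w T) :
    ∃ B : H →L[ℂ] H, T = wPow w 1 * B * wPow w 1 := by
  obtain ⟨C, hC⟩ := hT
  obtain ⟨B, hB⟩ := exists_clm_factor (T : H →ₗ[ℂ] H) (wPow w 1 : H →ₗ[ℂ] H) hw.selfAdjoint_one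
    hw.denseRange_one dense_univ (C := |C|) (fun φ _ v => by
      obtain ⟨a, ha, hav⟩ := hw.exists_eq v
      obtain ⟨y, hy, hyn⟩ := hC a
      have hs := (ContinuousLinearMap.isSelfAdjoint_iff_isSymmetric.1 hw.selfAdjoint_one) φ (w y)
      have h1 : (T : H →ₗ[ℂ] H) v = wPow w 1 (w y) := by
        rw [hw.one_apply, hy, hav]; rfl
      have h2 : inner ℂ φ (wPow w 1 (w y)) = inner ℂ (wPow w 1 φ) (w y) := hs.symm
      rw [h1, h2]
      refine (norm_inner_le_norm _ _).trans ?_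
      rw [ha] at hyn
      calc ‖wPow w 1 φ‖ * ‖w y‖ ≤ ‖wPow w 1 φ‖ * (|C| * ‖wPow w 1 v‖) := by
            gcongr
            exact hyn.trans (by gcongr; exact le_abs_self C)
        _ = _ := by rw [mul_left_comm, mul_assoc]; rfl)
  exact ⟨B, ContinuousLinearMap.ext fun u => hB u⟩

end Weights

/-! ### Bounded functions of the position operator -/

section FunctionsOfX

variable {x : H →ₗ.[ℂ] H}

/-- Bounded functions of `x`. -/
lemma mem_fcGraph_bfc_of_bounded (hx : IsSelfAdjoint x) {f : ℝ → ℝ} (hf : Continuous f)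
    (hb : ∀ t, 0 ≤ f t ∧ f t ≤ 1) (u : H) : (u, bfc f x u) ∈ fcGraph f x :=
  mem_fcGraph_bfc hx hf zero_le_one (fun t _ => by rw [abs_of_nonneg (hb t).1]; exact (hb t).2)
    (fun _ _ => rfl) u

lemma commute_bfc_of_commutes (hx : IsSelfAdjoint x) {f : ℝ → ℝ} (hf : Continuous f)
    (hb : ∀ t, 0 ≤ f t ∧ f t ≤ 1) {T : H →L[ℂ] H} (hT : Commutes x T) : Commute (bfc f x) T :=
  commute_of_fcGraph hx (hT.commute_res hx negI_im) (hT.commute_res hx (by simp))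
    (mem_fcGraph_bfc_of_bounded hx hf hb)

lemma commute_bfc (hx : IsSelfAdjoint x) {f g : ℝ → ℝ} (hf : Continuous f)
    (hb : ∀ t, 0 ≤ f t ∧ f t ≤ 1) (hg : Continuous g) (hb' : ∀ t, 0 ≤ g t ∧ g t ≤ 1) :
    Commute (bfc f x) (bfc g x) := by
  have h := res_negI_commute_of_fcGraph hx (mem_fcGraph_bfc_of_bounded hx hg hb')
  exact commute_of_fcGraph hx h.1 h.2 (mem_fcGraph_bfc_of_bounded hx hf hb)

lemma commutes_fc_bfc (hx : IsSelfAdjoint x) {f : ℝ → ℝ} (hf : Continuous f)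
    (hb : ∀ t, 0 ≤ f t ∧ f t ≤ 1) (W : ℝ → ℝ) : Commutes (fc W x) (bfc f x) := fun u => by
  have h := res_negI_commute_of_fcGraph hx (mem_fcGraph_bfc_of_bounded hx hf hb)
  exact exists_of_mem_fcGraph hx (map_mem_fcGraph hx h.1 h.2 (mem_fcGraph_of_mem hx u))

lemma bfc_mul_bfc (hx : IsSelfAdjoint x) {f g : ℝ → ℝ} (hf : Continuous f)
    (hb : ∀ t, 0 ≤ f t ∧ f t ≤ 1) (hg : Continuous g) (hb' : ∀ t, 0 ≤ g t ∧ g t ≤ 1) (u : H) :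
    (u, bfc g x (bfc f x u)) ∈ fcGraph (fun t => f t * g t) x :=
  fcGraph_comp hg (mem_fcGraph_bfc_of_bounded hx hf hb u) (mem_fcGraph_bfc_of_bounded hx hg hb' _)

lemma bfc_mul_bfc_eq_zero (hx : IsSelfAdjoint x) {f g : ℝ → ℝ} (hf : Continuous f)
    (hb : ∀ t, 0 ≤ f t ∧ f t ≤ 1) (hg : Continuous g) (hb' : ∀ t, 0 ≤ g t ∧ g t ≤ 1)
    (h : ∀ t, f t * g t = 0) : bfc g x * bfc f x = 0 := by
  ext u
  have h1 := bfc_mul_bfc hx hf hb hg hb' u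
  have h2 : (fun t => f t * g t) = fun _ => 0 := funext h
  rw [h2] at h1
  refine fcGraph_unique hx h1 fun g hg => ?_
  have h5 : cc x (fun t => (0 : ℝ) * g t) = 0 := by
    have h6 := norm_cc_le hx (f := fun t => (0 : ℝ) * g t) le_rfl (fun t _ => by simp)
    exact norm_le_zero_iff.1 h6
  rw [h5, zero_apply]
  exact (map_zero _).symm

/-- The constant `1` has no compact support, so the partition of unity is multiplied by a cutoff
`m`, for which `cc` is additive, and then freed of it by `eq_of_forall_cc`. -/
lemma bfc_sq_add_bfc_sq (hx : IsSelfAdjoint x) {f g : ℝ → ℝ} (hf : Continuous f)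
    (hb : ∀ t, 0 ≤ f t ∧ f t ≤ 1) (hg : Continuous g) (hb' : ∀ t, 0 ≤ g t ∧ g t ≤ 1)
    (h : ∀ t, f t ^ 2 + g t ^ 2 = 1) : bfc f x * bfc f x + bfc g x * bfc g x = 1 := by
  ext u
  refine eq_of_forall_cc hx fun m hm => ?_
  have h1 := bfc_mul_bfc hx hf hb hf hb u m hm
  have h2 := bfc_mul_bfc hx hg hb' hg hb' u m hm
  have e1 : IsCutoff fun t => f t * f t * m t := hm.mul_left (hf.mul hf)
  have e2 : (fun t => g t * g t * m t) = fun t => m t - f t * f t * m t := by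
    funext t
    have := h t
    linear_combination m t * this
  have e3 : cc x (fun t => m t - f t * f t * m t) = cc x m - cc x (fun t => f t * f t * m t) := by
    simp only [cc_eq]
    have e4 : ccFun (fun t => m t - f t * f t * m t) =
        fun ζ => ccFun m ζ - ccFun (fun t => f t * f t * m t) ζ := by
      funext ζ
      simp only [ccFun]
      split_ifs <;> simp
    have : IsStarNormal (res x (-Complex.I)) := isStarNormal_res hx negI_im
    rw [e4]
    exact cfc_sub _ _ _ (continuousOn_ccFun hx hm.vanishesAtInfty)
      (continuousOn_ccFun hx e1.vanishesAtInfty)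
  simp only at h1 h2
  rw [e2, e3] at h2
  rw [add_apply, one_apply_eq_self, mul_apply_eq_comp, mul_apply_eq_comp, map_add, ← h1, ← h2,
    sub_apply, add_sub_cancel]

end FunctionsOfX

/-! ### The square root of a nonnegative operator through bounded operators -/

section SquareRoot

/-- `(A + 1)⁻¹` and `A^{1/2} (A + 1)⁻¹` for `A ≥ 0`. -/
structure IsSqrtPair (A : H →ₗ.[ℂ] H) (G N : H →L[ℂ] H) : Prop where
  inverse : IsInverseOf A 1 G
  exists_sqrt : ∀ v, ∃ b : (sqrtOp A).domain, (b : H) = G v ∧ sqrtOp A b = N v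
  exists_sqrt' : ∀ v, ∃ b : (sqrtOp A).domain, (b : H) = N v ∧ sqrtOp A b = v - G v
  apply_sqrt : ∀ s : (sqrtOp A).domain, G (sqrtOp A s) = N s
  selfAdjoint_G : IsSelfAdjoint G
  selfAdjoint_N : IsSelfAdjoint N
  commute : Commute N G
  mul_self : N * N = G - G * G

lemma norm_sqrtOp_sq (hA : IsSelfAdjoint A) (h : OpNonneg A) (a : A.domain)
    (b : (sqrtOp A).domain) (hb : (b : H) = a) :
    inner ℂ (a : H) (A a) = ((‖sqrtOp A b‖ ^ 2 : ℝ) : ℂ) := by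
  obtain ⟨b', c, hb', hc, hcA⟩ := exists_sqrtOp hA h a
  obtain rfl : b' = b := Subtype.ext (hb'.trans hb.symm)
  rw [← hcA, ← hb', ← inner_symm (isSelfAdjoint_sqrtOp hA), hc, inner_self_ofReal]

/-- `N = A^{1/2} G` is bounded because `‖A^{1/2} G v‖² = (G v | v - G v)`. Its symmetry comes from
moving `G`, which commutes with the resolvents of `A`, across `A^{1/2}`. -/
lemma exists_isSqrtPair (hA : IsSelfAdjoint A) (h : OpNonneg A) :
    ∃ G N : H →L[ℂ] H, IsSqrtPair A G N := by
  have hS := isSelfAdjoint_sqrtOp hA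
  obtain ⟨G, hG, hGn⟩ := exists_isInverseOf hA 1 one_pos (fun u => by
    have h1 : inner ℂ (u : H) (A u + (1 : H →L[ℂ] H) u) =
        ((inner ℂ (u : H) (A u)).re + ‖(u : H)‖ ^ 2 : ℝ) := by
      rw [inner_add_right, one_apply_eq_self, inner_self_ofReal, Complex.ofReal_add]
      congr 1
      exact Complex.ext rfl (by simp [inner_self_im hA u])
    rw [h1, Complex.norm_real, one_mul]
    exact le_trans (by linarith [h u]) (le_abs_self _))
  have hGres : IsResolventAt A (-1) G := by
    rw [isResolventAt_iff_isInverseOf]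
    simpa using hG
  have hGB : ∀ z : ℂ, z.im ≠ 0 → Commute (res A z) G := fun z hz =>
    (isResolventAt_res_of_im hA hz).commute hGres
  have key : ∀ v, ∃ b c : (sqrtOp A).domain, (b : H) = G v ∧ (c : H) = sqrtOp A b ∧
      sqrtOp A c = v - G v := fun v => by
    obtain ⟨a, ha, hav⟩ := hG.1 v
    obtain ⟨b, c, hb, hc, hcA⟩ := exists_sqrtOp hA h a
    refine ⟨b, c, hb.trans ha, hc, ?_⟩
    rw [hcA, eq_sub_iff_add_eq, ← ha]
    exact hav
  choose b c hb hc hcA using key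
  have hbadd : ∀ u v, b (u + v) = b u + b v := fun u v => Subtype.ext (by
    rw [Submodule.coe_add, hb, hb, hb, map_add])
  have hbsmul : ∀ (t : ℂ) v, b (t • v) = t • b v := fun t v => Subtype.ext (by
    rw [Submodule.coe_smul, hb, hb, map_smul])
  have hbn : ∀ v, ‖sqrtOp A (b v)‖ ≤ 2 * ‖v‖ := fun v => by
    have h1 : inner ℂ (G v) (v - G v) = ((‖sqrtOp A (b v)‖ ^ 2 : ℝ) : ℂ) := by
      rw [← hcA, ← hb, ← inner_symm hS, ← hc, inner_self_ofReal]
    have h2 := norm_inner_le_norm (𝕜 := ℂ) (G v) (v - G v)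
    rw [h1, Complex.norm_real, Real.norm_of_nonneg (sq_nonneg _)] at h2
    have h3 := hGn v
    have h4 := norm_sub_le v (G v)
    nlinarith [norm_nonneg v, norm_nonneg (G v), norm_nonneg (sqrtOp A (b v)), norm_nonneg (v - G v)]
  let N : H →L[ℂ] H := LinearMap.mkContinuous
    { toFun := fun v => sqrtOp A (b v)
      map_add' := fun u v => by rw [hbadd, LinearPMap.map_add]
      map_smul' := fun t v => by rw [hbsmul, LinearPMap.map_smul, RingHom.id_apply] } 2 hbn
  have hN : ∀ v, N v = sqrtOp A (b v) := fun v => rfl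
  have hGsa : IsSelfAdjoint G := hGres.star hA (by simpa using hGres)
  have hGsym : ∀ u v, inner ℂ (G u) v = inner ℂ u (G v) := fun u v =>
    (ContinuousLinearMap.isSelfAdjoint_iff_isSymmetric.1 hGsa) u v
  have hGS : ∀ s : (sqrtOp A).domain, G (sqrtOp A s) = N s := fun s => by
    have h1 := map_mem_fcGraph hA (hGB _ negI_im) (hGB Complex.I (by simp))
      (mem_fcGraph_of_mem hA s)
    have h2 := mem_fcGraph_of_mem hA (b (s : H))
    rw [hb] at h2
    exact fcGraph_unique hA h1 h2
  have hNsym : ∀ u v, inner ℂ (N u) v = inner ℂ u (N v) := by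
    intro u v
    have hd : Dense ((sqrtOp A).domain : Set H) := hS.dense_domain
    refine hd.induction (P := fun v => inner ℂ (N u) v = inner ℂ u (N v)) (fun v hv => ?_)
      (isClosed_eq (by fun_prop) (by fun_prop)) v
    have h1 := hGS ⟨v, hv⟩
    have h2 := inner_symm hS (b u) ⟨v, hv⟩
    rw [hb, hGsym, h1] at h2
    exact h2
  have hNG : N * G = G * N := by
    ext v
    rw [mul_apply_eq_comp, mul_apply_eq_comp, ← hb v, ← hGS, hN]
  refine ⟨G, N, hG, fun v => ⟨b v, hb v, rfl⟩, fun v => ⟨c v, hc v, hcA v⟩, hGS, hGsa,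
    ContinuousLinearMap.isSelfAdjoint_iff_isSymmetric.2 hNsym, hNG, ?_⟩
  ext v
  have h1 := hGS (c v)
  rw [hcA, hc] at h1
  rw [mul_apply_eq_comp, sub_apply, mul_apply_eq_comp, ← map_sub, h1, hN v]

/-- If `S (1 + A²)^{-1/2}` is compact, so is `A^{1/2} (A + 1)⁻¹ S`. -/
lemma isCompactOperator_sqrt_mul (hA : IsSelfAdjoint A) {G N S : H →L[ℂ] H}
    (hp : IsSqrtPair A G N) (hS : IsSelfAdjoint S)
    (hc : IsCompactOperator (S * bfc (fun t => (1 + t ^ 2) ^ (-(1 / 2) : ℝ)) A : H →L[ℂ] H)) :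
    IsCompactOperator (N * S : H →L[ℂ] H) := by
  set Y := bfc (fun t : ℝ => (1 + t ^ 2) ^ (-(1 / 2) : ℝ)) A with hY
  set B := res A (-Complex.I) with hB
  have hpos := one_add_sq_pos
  have hcont : Continuous fun t : ℝ => (1 + t ^ 2) ^ (-(1 / 2) : ℝ) :=
    (by fun_prop : Continuous fun t : ℝ => 1 + t ^ 2).rpow_const fun t => Or.inl (hpos t).ne'
  have hYg : ∀ u, (u, Y u) ∈ fcGraph (fun t : ℝ => (1 + t ^ 2) ^ (-(1 / 2) : ℝ)) A :=
    mem_fcGraph_bfc hA hcont zero_le_one (fun t _ => by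
      rw [abs_of_nonneg (Real.rpow_nonneg (hpos t).le _)]
      exact Real.rpow_le_one_of_one_le_of_nonpos (by nlinarith [sq_nonneg t]) (by norm_num))
      (fun _ _ => rfl)
  have hstar : star B = res A Complex.I := star_res_negI hA
  have hccsa : ∀ f, star (cc A f) = cc A f := fun f =>
    ContinuousLinearMap.isSelfAdjoint_iff_isSymmetric.2 (inner_cc A f)
  -- Two expressions of `B - B*` are compared: `-2i B B*` from the resolvent identity and `-2i (1 +
  -- A²)⁻¹` from `res_eq_cc`.
  have hBB : B * star B = cc A (fun t => (1 + t ^ 2)⁻¹) := by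
    have h1 := (isResolventAt_res_of_im hA negI_im).sub_eq
      (isResolventAt_res_of_im hA (z := Complex.I) (by simp))
    rw [← hstar] at h1
    have h2 := res_eq_cc hA
    rw [← hB] at h1 h2
    have h3 : star B = cc A (fun t => t * (1 + t ^ 2)⁻¹) +
        Complex.I • cc A (fun t => (1 + t ^ 2)⁻¹) := by
      rw [h2, star_sub, star_smul, hccsa, hccsa]
      simp
    have h4 : B - star B = (-Complex.I - Complex.I) • cc A (fun t => (1 + t ^ 2)⁻¹) := by
      rw [h3, h2, sub_smul, neg_smul]
      abel
    rw [h4] at h1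
    have h5 : (-Complex.I - Complex.I) ≠ 0 := by
      intro h
      have := congrArg Complex.im h
      norm_num at this
    exact (smul_right_injective _ h5 h1).symm
  have hYY : Y * Y = B * star B := by
    rw [hBB]
    ext u
    have h1 := fcGraph_comp hcont (hYg u) (hYg (Y u))
    have h2 : (fun t : ℝ => (1 + t ^ 2) ^ (-(1 / 2) : ℝ) * (1 + t ^ 2) ^ (-(1 / 2) : ℝ)) =
        fun t => (1 + t ^ 2)⁻¹ := by
      funext t
      rw [← Real.rpow_add (hpos t), ← Real.rpow_neg_one]
      norm_num
    rw [h2] at h1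
    refine fcGraph_unique hA h1 fun g hg => ?_
    rw [cc_mul hA vanishesAtInfty_inv hg.vanishesAtInfty, cc_commute, mul_apply_eq_comp]
  -- `(B* S)* (B* S) = S B B* S = (S Y)(Y S)`, and `S Y` is compact by hypothesis.
  have hBS : IsCompactOperator (star B * S : H →L[ℂ] H) := by
    refine isCompactOperator_of_star_mul_self ?_
    have h1 : star (star B * S) * (star B * S) = (S * Y) * (Y * S) := by
      rw [star_mul, star_star, hS.star_eq]
      calc S * B * (star B * S) = S * (B * star B) * S := by simp only [mul_assoc]
        _ = _ := by rw [← hYY]; simp only [mul_assoc]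
    rw [h1]
    exact hc.comp_clm (Y * S)
  have hGres : IsResolventAt A (-1) G := by
    rw [isResolventAt_iff_isInverseOf]
    simpa using hp.inverse
  have hGS : IsCompactOperator (G * S : H →L[ℂ] H) := by
    have h1 := hGres.sub_eq (isResolventAt_res_of_im hA (z := Complex.I) (by simp))
    rw [← hstar] at h1
    have h2 : G * S = (1 + ((-1 - Complex.I) • G : H →L[ℂ] H)) * (star B * S) := by
      rw [add_mul, one_mul, smul_mul_assoc, ← mul_assoc, ← smul_mul_assoc, ← h1, ← add_mul,
        add_sub_cancel]
    rw [h2]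
    exact hBS.clm_comp (1 + (-1 - Complex.I) • G)
  refine isCompactOperator_of_star_mul_self ?_
  -- `N² = (1 - G) G` reduces the compactness of `N S` to that of `G S`, which the resolvent
  -- identity deduces from that of `B* S`.
  have h1 : star (N * S) * (N * S) = (S * (1 - G)) * (G * S) := by
    rw [star_mul, hS.star_eq, hp.selfAdjoint_N.star_eq]
    calc S * N * (N * S) = S * (N * N) * S := by simp only [mul_assoc]
      _ = _ := by rw [hp.mul_self]; simp only [mul_assoc, mul_sub, sub_mul, one_mul]
  rw [h1]
  exact hGS.clm_comp (S * (1 - G))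

end SquareRoot

variable {H : Type*} [NormedAddCommGroup H] [InnerProductSpace ℂ H] [CompleteSpace H]
variable {A h w : H →ₗ.[ℂ] H}

/-! ### The parametrix at one end -/

section End

/-- Dividing by `ζ` before taking imaginary parts, `Im (a/ζ - ζ n) = -Im ζ (a/|ζ|² + n)`. With `a =
(u | A u)` and `n = ‖u‖²` this bounds the form of `A - ζ²` from below in the whole upper half plane,
whereas `Im ζ²` vanishes on the imaginary axis. The term in `a` yields the bound on `A^{1/2}` times
the resolvent, by the arithmetic-geometric inequality. -/
lemma exists_resolvent_sq (hA : IsSelfAdjoint A) (h0 : OpNonneg A) {ζ : ℂ} (hζ : 0 < ζ.im) :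
    IsResolventAt A (ζ ^ 2) (res A (ζ ^ 2)) ∧ ‖res A (ζ ^ 2)‖ ≤ (‖ζ‖ * ζ.im)⁻¹ ∧
      ∀ (v : H) (s : (sqrtOp A).domain), (s : H) = res A (ζ ^ 2) v →
        ‖sqrtOp A s‖ ≤ ζ.im⁻¹ * ‖v‖ := by
  have hζ0 : ζ ≠ 0 := fun h => by simp [h] at hζ
  have hn : 0 < ‖ζ‖ := norm_pos_iff.2 hζ0
  have key : ∀ a n : ℝ, 0 ≤ a → 0 ≤ n →
      ‖ζ‖ * ζ.im * (a / ‖ζ‖ ^ 2 + n) ≤ ‖(a : ℂ) - ζ ^ 2 * n‖ := fun a n ha hn0 => by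
    have h1 : (a : ℂ) - ζ ^ 2 * n = ζ * (a * ζ⁻¹ - ζ * n) := by field_simp
    rw [h1, norm_mul, mul_assoc]
    refine mul_le_mul_of_nonneg_left ?_ (norm_nonneg _)
    refine le_trans (le_of_eq ?_) (Complex.abs_im_le_norm _)
    have h2 : ((a : ℂ) * ζ⁻¹ - ζ * n).im = -(ζ.im * (a / ‖ζ‖ ^ 2 + n)) := by
      rw [Complex.sub_im, Complex.im_ofReal_mul, Complex.inv_im, Complex.normSq_eq_norm_sq,
        Complex.im_mul_ofReal]
      ring
    rw [h2, abs_neg, abs_of_nonneg]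
    positivity
  have hq : ∀ u : A.domain, inner ℂ (u : H) (A u + (-(ζ ^ 2 • (1 : H →L[ℂ] H))) u) =
      (((inner ℂ (u : H) (A u)).re : ℝ) : ℂ) - ζ ^ 2 * ((‖(u : H)‖ ^ 2 : ℝ) : ℂ) := fun u => by
    rw [neg_apply, smul_apply, one_apply_eq_self, ← sub_eq_add_neg, inner_sub_right,
      inner_smul_right, inner_self_ofReal]
    congr 1
    exact Complex.ext rfl (by simp [inner_self_im hA u])
  obtain ⟨P, hP, hPn⟩ := exists_isInverseOf hA (-(ζ ^ 2 • (1 : H →L[ℂ] H)))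
    (mul_pos hn hζ) (fun u => by
      rw [hq]
      refine le_trans ?_ (key _ _ (h0 u) (sq_nonneg _))
      have : 0 ≤ (inner ℂ (u : H) (A u)).re / ‖ζ‖ ^ 2 := div_nonneg (h0 u) (sq_nonneg _)
      exact mul_le_mul_of_nonneg_left (by linarith) (by positivity))
  have hR : IsResolventAt A (ζ ^ 2) P := isResolventAt_iff_isInverseOf.2 hP
  rw [hR.res_eq]
  refine ⟨hR, ContinuousLinearMap.opNorm_le_bound _ (by positivity) fun v => ?_, fun v s hs => ?_⟩
  · rw [inv_mul_eq_div, le_div_iff₀ (by positivity), mul_comm]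
    exact hPn v
  · obtain ⟨u, hu, huv⟩ := hP.1 v
    have h1 := norm_sqrtOp_sq hA h0 u s (hs.trans hu.symm)
    have h2 := key _ _ (h0 u) (sq_nonneg ‖(u : H)‖)
    rw [← hq, huv, h1, Complex.ofReal_re] at h2
    have h3 := h2.trans (norm_inner_le_norm _ _)
    set a := ‖sqrtOp A s‖
    set n := ‖(u : H)‖
    have ha : 0 ≤ a := norm_nonneg _
    have hn0 : 0 ≤ n := norm_nonneg _
    have h4 : 2 * (a * n) ≤ ‖ζ‖ * (a ^ 2 / ‖ζ‖ ^ 2 + n ^ 2) := by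
      have : ‖ζ‖ * (a ^ 2 / ‖ζ‖ ^ 2 + n ^ 2) - 2 * (a * n) = (a - ‖ζ‖ * n) ^ 2 / ‖ζ‖ := by
        field_simp
        ring
      have h5 : 0 ≤ (a - ‖ζ‖ * n) ^ 2 / ‖ζ‖ := by positivity
      linarith
    have h5 : ζ.im * (2 * (a * n)) ≤ n * ‖v‖ := by
      refine le_trans (mul_le_mul_of_nonneg_left h4 hζ.le) (le_trans (le_of_eq (by ring)) h3)
    rw [inv_mul_eq_div, le_div_iff₀ hζ]
    rcases hn0.eq_or_lt with h6 | h6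
    · have h7 : (u : H) = 0 := norm_eq_zero.1 h6.symm
      have h8 : s = 0 := Subtype.ext ((hs.trans hu.symm).trans h7)
      have : a = 0 := by simp [a, h8, LinearPMap.map_zero]
      rw [this, zero_mul]
      exact norm_nonneg _
    · have h7 : n * (ζ.im * (2 * a)) ≤ n * ‖v‖ := le_trans (le_of_eq (by ring)) h5
      have h8 := le_of_mul_le_mul_left h7 h6
      nlinarith

/-- The commutator of `h` with a bounded operator, as an operator on `D(h)`. -/
lemma exists_commutator (hh : IsSelfAdjoint h) {i : H →L[ℂ] H} (hi : IsSelfAdjoint i)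
    (hdom : ∀ u : h.domain, ∃ s : (sqrtOp A).domain, (s : H) = u) (hcb : CommBounded h i A) :
    ∃ (X : h.domain →ₗ[ℂ] H) (c : ℝ), 0 ≤ c ∧
      (∀ u : h.domain, ∃ v : h.domain, (v : H) = i u ∧ h v = i (h u) + X u) ∧
      (∀ φ u : h.domain, commForm h i φ u = inner ℂ (φ : H) (X u)) ∧
      ∀ (u : h.domain) (s : (sqrtOp A).domain), (s : H) = u → ‖X u‖ ≤ c * ‖sqrtOp A s‖ := by
  obtain ⟨C, hC⟩ := hcb
  have hisym : ∀ u v, inner ℂ (i u) v = inner ℂ u (i v) := fun u v =>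
    (ContinuousLinearMap.isSelfAdjoint_iff_isSymmetric.1 hi) u v
  -- `(h a | i u)` differs from `(a | i (h u))` by the commutator form, which is bounded in `a`; so
  -- `i` preserves the domain of `h` and the commutator is an operator there.
  have hmem : ∀ u : h.domain, i u ∈ h.domain := fun u => by
    obtain ⟨s, hs⟩ := hdom u
    refine mem_domain_of_bound hh (C := C * ‖sqrtOp A s‖ + ‖i (h u)‖) fun a => ?_
    have h1 := hC a u s hs
    rw [commForm, hisym] at h1
    have h2 := norm_inner_le_norm (𝕜 := ℂ) (a : H) (i (h u))
    rw [norm_inner_symm]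
    calc ‖inner ℂ (h a) (i u)‖ = ‖(inner ℂ (h a) (i u) - inner ℂ (a : H) (i (h u))) +
          inner ℂ (a : H) (i (h u))‖ := by rw [sub_add_cancel]
      _ ≤ _ := norm_add_le _ _
      _ ≤ _ := by linarith
  let X : h.domain →ₗ[ℂ] H :=
    { toFun := fun u => h ⟨i u, hmem u⟩ - i (h u)
      map_add' := fun u v => by
        have : (⟨i (u + v : h.domain), hmem (u + v)⟩ : h.domain) = ⟨i u, hmem u⟩ + ⟨i v, hmem v⟩ :=
          Subtype.ext (by simp)
        rw [this, LinearPMap.map_add, LinearPMap.map_add, map_add]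
        abel
      map_smul' := fun t u => by
        have : (⟨i (t • u : h.domain), hmem (t • u)⟩ : h.domain) = t • ⟨i u, hmem u⟩ :=
          Subtype.ext (by simp)
        rw [this, LinearPMap.map_smul, LinearPMap.map_smul, map_smul, ← smul_sub,
          RingHom.id_apply] }
  have hX : ∀ φ u : h.domain, commForm h i φ u = inner ℂ (φ : H) (X u) := fun φ u => by
    have h1 := inner_symm hh φ ⟨i u, hmem u⟩
    change _ - _ = inner ℂ (φ : H) (h ⟨i u, hmem u⟩ - i (h u))
    rw [inner_sub_right, ← h1, hisym]
  refine ⟨X, |C|, abs_nonneg _, fun u => ⟨⟨i u, hmem u⟩, rfl, ?_⟩, hX, fun u s hs => ?_⟩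
  · change _ = i (h u) + (h ⟨i u, hmem u⟩ - i (h u))
    rw [add_sub_cancel]
  · have h1 : ∀ φ : H, ‖inner ℂ φ (X u)‖ ≤ |C| * ‖φ‖ * ‖sqrtOp A s‖ := fun φ => by
      refine hh.dense_domain.induction
        (P := fun φ => ‖inner ℂ φ (X u)‖ ≤ |C| * ‖φ‖ * ‖sqrtOp A s‖) (fun φ hφ => ?_)
        (isClosed_le (by fun_prop) (by fun_prop)) φ
      rw [← hX ⟨φ, hφ⟩ u]
      refine (hC _ _ s hs).trans ?_
      gcongr
      exact le_abs_self C
    have h2 := h1 (X u)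
    rw [inner_self_ofReal, Complex.norm_real, Real.norm_of_nonneg (sq_nonneg _)] at h2
    rcases (norm_nonneg (X u)).eq_or_lt with h3 | h3
    · rw [← h3]; positivity
    · refine le_of_mul_le_mul_left ?_ h3
      linarith

/-- `A^{1/2} W u` for `u ∈ D(A)` when `A^{-1/2} [A, W] V⁻¹` is bounded. -/
lemma exists_sqrt_weight (hA : IsSelfAdjoint A) (h0 : OpNonneg A) {G N W V : H →L[ℂ] H}
    (hp : IsSqrtPair A G N) (hW : IsSelfAdjoint W) (hc : LeftCommBounded A W V) :
    ∃ B : H →L[ℂ] H, ∀ u : A.domain, ∃ s : (sqrtOp A).domain, (s : H) = W u ∧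
      sqrtOp A s = N (W (A u + u)) + B (V u) := by
  obtain ⟨C, hC⟩ := hc
  have hS := isSelfAdjoint_sqrtOp hA
  have hWsym : ∀ u v, inner ℂ (W u) v = inner ℂ u (W v) := fun u v =>
    (ContinuousLinearMap.isSelfAdjoint_iff_isSymmetric.1 hW) u v
  have hNsym : ∀ u v, inner ℂ (N u) v = inner ℂ u (N v) := fun u v =>
    (ContinuousLinearMap.isSelfAdjoint_iff_isSymmetric.1 hp.selfAdjoint_N) u v
  -- The test vector is `φ = (A + 1)⁻¹ A^{1/2} η`, for which `‖A^{1/2} φ‖ ≤ ‖η‖`. The commutator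
  -- form at `φ` and `u` is precisely the difference between `A^{1/2} W u` and `N W (A + 1) u`,
  -- paired with `η`.
  have key : ∀ (u : A.domain) (η : (sqrtOp A).domain),
      ‖inner ℂ (sqrtOp A η) (W u) - inner ℂ (η : H) (N (W (A u + u)))‖ ≤
        |C| * ‖V u‖ * ‖(η : H)‖ := fun u η => by
    obtain ⟨φ, hφ, hφη⟩ := hp.inverse.1 (sqrtOp A η)
    obtain ⟨s, c, hs, hc', hcA⟩ := exists_sqrtOp hA h0 φ
    have hn : ‖sqrtOp A s‖ ≤ ‖(η : H)‖ := by
      have h1 := norm_sqrtOp_sq hA h0 φ s hs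
      have h2 : inner ℂ (φ : H) (sqrtOp A η) = inner ℂ (sqrtOp A s) (η : H) := by
        rw [← hs]
        exact (inner_symm hS s η).symm
      rw [← hφη, inner_add_right, one_apply_eq_self, h1, inner_self_ofReal] at h2
      have h3 := norm_inner_le_norm (𝕜 := ℂ) (sqrtOp A s) (η : H)
      rw [← h2, ← Complex.ofReal_add, Complex.norm_real, Real.norm_of_nonneg (by positivity)] at h3
      rcases (norm_nonneg (sqrtOp A s)).eq_or_lt with h4 | h4
      · rw [← h4]; positivity
      · refine le_of_mul_le_mul_left ?_ h4
        nlinarith [sq_nonneg ‖(φ : H)‖]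
    have h1 : inner ℂ (sqrtOp A η) (W u) - inner ℂ (η : H) (N (W (A u + u))) =
        commForm A W φ u := by
      have h2 : (φ : H) = N η := by rw [hφ, hp.apply_sqrt]
      rw [← hNsym, ← h2, ← hφη, commForm, inner_add_left, map_add, inner_add_right, hWsym,
        one_apply_eq_self]
      ring
    rw [h1]
    refine (hC φ u s hs).trans ?_
    calc C * ‖sqrtOp A s‖ * ‖V u‖ ≤ |C| * ‖(η : H)‖ * ‖V u‖ := by
          gcongr
          exact le_abs_self C
      _ = _ := by ring
  have hmem : ∀ u : A.domain, W u ∈ (sqrtOp A).domain := fun u => by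
    refine mem_domain_of_bound hS (C := ‖N (W (A u + u))‖ + |C| * ‖V u‖) fun η => ?_
    rw [norm_inner_symm]
    calc ‖inner ℂ (sqrtOp A η) (W u)‖ = ‖inner ℂ (η : H) (N (W (A u + u))) +
          (inner ℂ (sqrtOp A η) (W u) - inner ℂ (η : H) (N (W (A u + u))))‖ := by
            rw [add_sub_cancel]
      _ ≤ _ := norm_add_le _ _
      _ ≤ ‖(η : H)‖ * ‖N (W (A u + u))‖ + |C| * ‖V u‖ * ‖(η : H)‖ :=
          add_le_add (norm_inner_le_norm _ _) (key u η)
      _ = _ := by ring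
  let X : A.domain →ₗ[ℂ] H :=
    { toFun := fun u => sqrtOp A ⟨W u, hmem u⟩ - N (W (A u + u))
      map_add' := fun u v => by
        have : (⟨W (u + v : A.domain), hmem (u + v)⟩ : (sqrtOp A).domain) =
          ⟨W u, hmem u⟩ + ⟨W v, hmem v⟩ := Subtype.ext (by simp)
        rw [this, LinearPMap.map_add, LinearPMap.map_add, Submodule.coe_add]
        simp only [map_add]
        abel
      map_smul' := fun t u => by
        have : (⟨W (t • u : A.domain), hmem (t • u)⟩ : (sqrtOp A).domain) = t • ⟨W u, hmem u⟩ :=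
          Subtype.ext (by simp)
        rw [this, LinearPMap.map_smul, LinearPMap.map_smul, Submodule.coe_smul, ← smul_add,
          map_smul, map_smul, ← smul_sub, RingHom.id_apply] }
  have hX : ∀ u, ‖X u‖ ≤ |C| * ‖((V : H →ₗ[ℂ] H) ∘ₗ A.domain.subtype) u‖ := fun u => by
    have h1 : ∀ η : H, ‖inner ℂ η (X u)‖ ≤ |C| * ‖V u‖ * ‖η‖ := fun η => by
      refine hS.dense_domain.induction
        (P := fun η => ‖inner ℂ η (X u)‖ ≤ |C| * ‖V u‖ * ‖η‖) (fun η hη => ?_)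
        (isClosed_le (by fun_prop) (by fun_prop)) η
      have h2 := inner_symm hS ⟨η, hη⟩ ⟨W u, hmem u⟩
      change ‖inner ℂ η (sqrtOp A ⟨W u, hmem u⟩ - N (W (A u + u)))‖ ≤ _
      rw [inner_sub_right, ← h2]
      exact key u ⟨η, hη⟩
    have h2 := h1 (X u)
    rw [inner_self_ofReal, Complex.norm_real, Real.norm_of_nonneg (sq_nonneg _)] at h2
    change _ ≤ |C| * ‖V u‖
    rcases (norm_nonneg (X u)).eq_or_lt with h3 | h3
    · rw [← h3]; positivity
    · refine le_of_mul_le_mul_left ?_ h3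
      linarith
  obtain ⟨B, hB⟩ := exists_clm_comp_eq X _ hX
  refine ⟨B, fun u => ⟨⟨W u, hmem u⟩, rfl, ?_⟩⟩
  have h1 : B (V u) = sqrtOp A ⟨W u, hmem u⟩ - N (W (A u + u)) := hB u
  rw [h1, add_sub_cancel]

/-- An approximate right inverse of `h + 2 z k - z²`, localized by `i`, for `Im z > 0`. -/
def HasEndParametrix (h : H →ₗ.[ℂ] H) (k : H →L[ℂ] H) (w : H →ₗ.[ℂ] H) (i : H →L[ℂ] H) : Prop :=
  ∃ δ : ℝ, 0 < δ ∧ ∃ (Q L K : ℂ → H →L[ℂ] H) (C : ℝ), 0 ≤ C ∧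
    (∀ z : ℂ, 0 < z.im →
      (∀ f, ∃ u : h.domain, (u : H) = Q z f ∧
        h u + ((2 * z) • k - z ^ 2 • (1 : H →L[ℂ] H)) u = i (i f) + wPow w (1 / 2) (L z f)) ∧
      L z * wPow w (1 / 2) = K z ∧ ‖Q z‖ ≤ C * (1 + (z.im⁻¹) ^ 2) ∧
      ‖L z‖ ≤ C * ((1 + ‖z‖) ^ 2 * (1 + (z.im⁻¹) ^ 2)) ∧ ‖wPow w (1 / 2) * L z‖ ≤ C * z.im⁻¹) ∧
    ∀ z₀ : ℂ, -δ < z₀.im → FredholmAt K z₀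

/-- The growth of the error term, separated from its operator content. With `T = (1 + |ℓ|)(1 + ‖z‖)`
one has `|z - ℓ| ≤ T - 1`, so that `|(z - ℓ)² + 1| ≤ T²` and `|2 (z - ℓ)| ≤ 2 T²`. -/
lemma norm_add_affine_mul_le (L₀ M₁ M₂ M₃ V r i : H →L[ℂ] H) (z : ℂ) (ℓ : ℝ) {y : ℝ}
    (hr : ‖r‖ ≤ y ^ 2) :
    ‖L₀ + (((z - ℓ) ^ 2 + 1) • M₁ + M₂ + (2 * (z - ℓ)) • M₃) * V * r * i‖ ≤
      (‖L₀‖ + ((1 + |ℓ|) ^ 2 * (‖M₁‖ + ‖M₂‖ + 2 * ‖M₃‖)) * (‖V‖ * ‖i‖)) *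
        ((1 + ‖z‖) ^ 2 * (1 + y ^ 2)) := by
  have hζz : ‖z - ℓ‖ ≤ (1 + |ℓ|) * (1 + ‖z‖) - 1 := by
    have h1 : ‖z - ℓ‖ ≤ ‖z‖ + |ℓ| := by
      refine (norm_sub_le _ _).trans ?_
      rw [Complex.norm_real, Real.norm_eq_abs]
    nlinarith [mul_nonneg (abs_nonneg ℓ) (norm_nonneg z)]
  set ζ := z - ℓ
  set T := (1 + |ℓ|) * (1 + ‖z‖) with hT
  have hT1 : 1 ≤ T := by linarith [norm_nonneg ζ]
  have h3 : (1 : ℝ) ≤ T ^ 2 := one_le_pow₀ hT1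
  have h1 : ‖ζ ^ 2 + 1‖ ≤ T ^ 2 := by
    refine (norm_add_le _ _).trans ?_
    rw [norm_pow, norm_one]
    nlinarith [norm_nonneg ζ]
  have h2 : ‖2 * ζ‖ ≤ T ^ 2 * 2 := by
    rw [norm_mul, Complex.norm_ofNat]
    nlinarith [norm_nonneg ζ]
  set M := (ζ ^ 2 + 1) • M₁ + M₂ + (2 * ζ) • M₃ with hM'
  set m := ‖M₁‖ + ‖M₂‖ + 2 * ‖M₃‖ with hm
  have hm0 : 0 ≤ m := by positivity
  have hM : ‖M‖ ≤ T ^ 2 * m := by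
    calc ‖M‖ ≤ ‖(ζ ^ 2 + 1) • M₁‖ + ‖M₂‖ + ‖(2 * ζ) • M₃‖ := norm_add₃_le
      _ ≤ T ^ 2 * ‖M₁‖ + T ^ 2 * ‖M₂‖ + T ^ 2 * 2 * ‖M₃‖ := by
          rw [norm_smul, norm_smul]
          gcongr
          exact le_mul_of_one_le_left (norm_nonneg _) h3
      _ = _ := by rw [hm]; ring
  have h4 : ‖M * V * r * i‖ ≤ T ^ 2 * m * (‖V‖ * ‖i‖) * y ^ 2 := by
    calc ‖M * V * r * i‖ ≤ ‖M‖ * ‖V‖ * ‖r‖ * ‖i‖ :=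
          (norm_mul_le _ _).trans (by gcongr; exact norm_mul₃_le)
      _ ≤ (T ^ 2 * m) * ‖V‖ * y ^ 2 * ‖i‖ := by gcongr
      _ = _ := by ring
  have h5 : (1 : ℝ) ≤ (1 + ‖z‖) ^ 2 := one_le_pow₀ (by linarith [norm_nonneg z])
  have h6 : T ^ 2 = (1 + |ℓ|) ^ 2 * (1 + ‖z‖) ^ 2 := by rw [hT]; ring
  have hy2 : 0 ≤ y ^ 2 := by positivity
  calc ‖L₀ + M * V * r * i‖ ≤ ‖L₀‖ + T ^ 2 * m * (‖V‖ * ‖i‖) * y ^ 2 :=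
        (norm_add_le _ _).trans (by gcongr)
    _ ≤ ‖L₀‖ * ((1 + ‖z‖) ^ 2 * (1 + y ^ 2)) +
        ((1 + |ℓ|) ^ 2 * m) * (‖V‖ * ‖i‖) * ((1 + ‖z‖) ^ 2 * (1 + y ^ 2)) := by
        refine add_le_add (le_mul_of_one_le_right (norm_nonneg _) ?_) ?_
        · nlinarith
        · rw [h6]
          have : 0 ≤ ((1 + |ℓ|) ^ 2 * m) * (‖V‖ * ‖i‖) * (1 + ‖z‖) ^ 2 := by positivity
          nlinarith
    _ = _ := by ring

set_option maxHeartbeats 1000000 in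
/-- The approximate right inverse of `h + 2 z k - z²` at one end. -/
theorem exists_end_parametrix {k ke i : H →L[ℂ] H} {ℓ : ℝ} (hw : IsWeight w)
    (hh : IsSelfAdjoint h) (hA : IsSelfAdjoint (addBounded h (k * k - ke * ke)))
    (h0 : OpNonneg (addBounded h (k * k - ke * ke))) (hi : IsSelfAdjoint i)
    (hik : k * i = (ke + (ℓ : ℂ) • (1 : H →L[ℂ] H)) * i)
    (hki : Commute k i) (hkei : Commute ke i) (hwi : Commutes w i)
    (hwkw : SandwichBounded w ke)
    (hcomm : LeftCommBounded (addBounded h (k * k - ke * ke)) (wPow w 1) (wPow w (1 / 2)))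
    (hcomp : IsCompactOperator (wPow w 1 * bfc (fun t => (1 + t ^ 2) ^ (-(1 / 2) : ℝ))
      (addBounded h (k * k - ke * ke)) : H →L[ℂ] H))
    (hme2 : CondME2 (addBounded h (k * k - ke * ke)) w)
    (hwcb : WeightedCommBounded w h i (addBounded h (k * k - ke * ke)))
    (hcb : CommBounded h i (addBounded h (k * k - ke * ke))) :
    HasEndParametrix h k w i := by
  set D := k * k - ke * ke with hD
  set A := addBounded h D with hAdef
  set W := wPow w 1
  set V := wPow w (1 / 2)
  obtain ⟨G, N, hp⟩ := exists_isSqrtPair hA h0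
  obtain ⟨B₂, hB₂⟩ := exists_sqrt_weight hA h0 hp hw.selfAdjoint_one hcomm
  have hdom : ∀ u : h.domain, ∃ s : (sqrtOp A).domain, (s : H) = u := fun u => by
    obtain ⟨s, _, hs, _⟩ := exists_sqrtOp hA h0 u
    exact ⟨s, hs⟩
  obtain ⟨X, c, hc, hX, hXf, hXn⟩ := exists_commutator hh hi hdom hcb
  have hVV : V * V = W := hw.half_mul_half
  have hWi : Commute W i := (hw.commute i hwi).1
  have hVi : Commute V i := (hw.commute i hwi).2
  obtain ⟨kw, hkw⟩ := hw.exists_sandwich hwkw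
  -- the factorization of the commutator
  obtain ⟨B, hB⟩ : ∃ B : H →L[ℂ] H, ∀ u : h.domain,
      X u = W (B (N (W (A u + u)) + B₂ (V u))) := by
    obtain ⟨C, hC⟩ := hwcb
    let Y : h.domain →ₗ[ℂ] H := ((N * W : H →L[ℂ] H) : H →ₗ[ℂ] H) ∘ₗ (A.toFun + A.domain.subtype) +
      ((B₂ * V : H →L[ℂ] H) : H →ₗ[ℂ] H) ∘ₗ A.domain.subtype
    -- `Y u` is `A^{1/2} w⁻¹ u` in the form given by `exists_sqrt_weight`; the boundedness of `w [h,
    -- i] w A^{-1/2}` is then the estimate to be factorized.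
    refine exists_clm_factor X Y hw.selfAdjoint_one hw.denseRange_one hh.dense_domain (C := |C|)
      fun φ hφ u => ?_
    obtain ⟨φ', hφ', hφw⟩ := hw.exists_eq φ
    obtain ⟨u', hu', huw⟩ := hw.exists_eq u
    obtain ⟨s, hs, hsu⟩ := hB₂ u
    have h1 := hC φ' u' ⟨φ, hφ⟩ u s hφw.symm huw.symm (hs.trans hu'.symm)
    rw [hXf, hsu, hφ'] at h1
    refine h1.trans ?_
    change C * ‖W φ‖ * ‖_‖ ≤ |C| * ‖W φ‖ * ‖N (W (A u + u)) + B₂ (V u)‖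
    gcongr
    exact le_abs_self C
  obtain ⟨δ, hδ, F, hF, hFm⟩ := hme2 (1 / 2) one_half_pos
  -- For `u = (A - ζ²)⁻¹ i f` one has `A u = i f + ζ² u`. Inserted in the factorized commutator,
  -- together with `ke = w⁻¹ kw w⁻¹`, this splits the error `V L f` into `V L₀ f`, free of the
  -- resolvent, and `V M(ζ) V u`.
  let M : ℂ → H →L[ℂ] H := fun ζ =>
    (ζ ^ 2 + 1) • (V * B * N * V) + V * B * B₂ + (2 * ζ) • (V * i * kw * V)
  set L₀ := V * B * N * W * i with hL₀
  let r : ℂ → H →L[ℂ] H := fun z => res A ((z - ℓ) ^ 2)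
  refine ⟨δ, hδ, fun z => i * r z * i, fun z => L₀ + M (z - ℓ) * V * r z * i,
    fun z => L₀ * V + M (z - ℓ) * F (z - ℓ) * i, ‖i‖ * ‖i‖ + ‖L₀‖ + ((1 + |ℓ|) ^ 2 *
      (‖V * B * N * V‖ + ‖V * B * B₂‖ + 2 * ‖V * i * kw * V‖)) * (‖V‖ * ‖i‖) +
      (c + 2 * ‖ke * i‖) * ‖i‖, by positivity, fun z hz => ?_, fun z₀ hz₀ => ?_⟩
  · have hzl : 0 < (z - ℓ).im := by simpa using hz
    have him : (z - ℓ).im = z.im := by simp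
    obtain ⟨hr, hrn, hrs⟩ := exists_resolvent_sq hA h0 hzl
    rw [him] at hrn hrs
    set ζ := z - ℓ with hζ
    have hzζ : z = ζ + ℓ := by rw [hζ, sub_add_cancel]
    have hy : 0 < z.im⁻¹ := inv_pos.2 hz
    have hζim : z.im ≤ ‖ζ‖ := by
      rw [← him]; exact (le_abs_self _).trans (Complex.abs_im_le_norm _)
    have hζpos : 0 < ‖ζ‖ := hz.trans_le hζim
    have hrn' : ‖r z‖ ≤ z.im⁻¹ ^ 2 := by
      refine hrn.trans ?_
      rw [mul_inv, sq]
      gcongr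
    -- On the range of `i` one has `k = ke + ℓ`, so the pencil is `A - ζ² + 2 ζ ke` there. Applied
    -- to `i u` it gives `i i f`, the commutator `X u` and the potential term.
    have hap : ∀ f, ∃ u v : h.domain, (u : H) = r z (i f) ∧ (v : H) = i u ∧
        h v + ((2 * z) • k - z ^ 2 • (1 : H →L[ℂ] H)) v =
          i (i f) + (X u + (2 * ζ) • ke (i u)) ∧ A u = i f + ζ ^ 2 • (u : H) := fun f => by
      obtain ⟨u, hu, huf⟩ := hr.1 (i f)
      obtain ⟨v, hv, hvX⟩ := hX u
      refine ⟨u, v, hu, hv, ?_, by rw [← huf, sub_add_cancel]⟩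
      have h1 : A u = D u + h u := addBounded_apply (A := h) D u
      have h2 : h u = i f + ζ ^ 2 • (u : H) - D u := by
        rw [eq_sub_iff_add_eq, add_comm, ← h1, ← huf, sub_add_cancel]
      have h3 : ∀ y, k (i y) = ke (i y) + (ℓ : ℂ) • i y := fun y => by
        have := DFunLike.congr_fun hik y
        simpa [add_mul] using this
      have h4 : ∀ y, i (ke y) = ke (i y) := fun y => (DFunLike.congr_fun hkei y).symm
      have h5 : ∀ y, i (k y) = k (i y) := fun y => (DFunLike.congr_fun hki y).symm
      have h6 : i (D u) = (2 * (ℓ : ℂ)) • ke (i u) + ((ℓ : ℂ) ^ 2) • i u := by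
        have h7 : k (ke (i u)) = ke (ke (i u)) + (ℓ : ℂ) • ke (i u) := by
          rw [← h4, h3]
        rw [hD, sub_apply, mul_apply_eq_comp, mul_apply_eq_comp, map_sub, h5, h5, h4, h4, h3,
          map_add, map_smul, h3, h7]
        module
      rw [hvX, hv, h2, map_sub, map_add, h6, map_smul, sub_apply, smul_apply, smul_apply,
        one_apply_eq_self, h3, hzζ]
      module
    have hVL : ∀ f (u : h.domain), (u : H) = r z (i f) → A u = i f + ζ ^ 2 • (u : H) →
        V ((L₀ + M ζ * V * r z * i) f) = X u + (2 * ζ) • ke (i u) := fun f u hu hAu => by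
      have e1 : ∀ y, V (V y) = W y := fun y => DFunLike.congr_fun hVV y
      have e2 : ke (i u) = W (i (kw (W u))) := by
        have h4 : ke (i u) = i (ke u) := DFunLike.congr_fun hkei (u : H)
        have h5 : ke u = W (kw (W u)) := by rw [hkw]; rfl
        rw [h4, h5]
        exact (DFunLike.congr_fun hWi _).symm
      rw [hB, e2, hAu, hu, ← e1, ← e1]
      simp only [hL₀, M, add_apply, mul_apply_eq_comp, smul_apply, map_add, map_smul, e1]
      module
    refine ⟨fun f => ?_, ?_, ?_, ?_, ?_⟩
    · obtain ⟨u, v, hu, hv, hvp, hAu⟩ := hap f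
      refine ⟨v, by rw [hv, hu]; rfl, ?_⟩
      rw [hvp, hVL f u hu hAu]
    -- `V` commutes with `i` and can be moved next to the resolvent, producing `V r V`, the function
    -- that (ME2) continues.
    · have h1 : F ζ = V * r z * V := hF ζ hzl
      change (L₀ + M ζ * V * r z * i) * V = L₀ * V + M ζ * F ζ * i
      rw [h1, add_mul]
      simp only [mul_assoc]
      rw [← hVi.eq]
    · refine (norm_mul₃_le).trans ?_
      calc ‖i‖ * ‖r z‖ * ‖i‖ ≤ (‖i‖ * ‖i‖) * (1 + z.im⁻¹ ^ 2) := by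
            nlinarith [mul_nonneg (norm_nonneg i) (norm_nonneg i)]
        _ ≤ _ := by
            gcongr
            have : 0 ≤ ‖L₀‖ + ((1 + |ℓ|) ^ 2 *
              (‖V * B * N * V‖ + ‖V * B * B₂‖ + 2 * ‖V * i * kw * V‖)) * (‖V‖ * ‖i‖) +
              (c + 2 * ‖ke * i‖) * ‖i‖ := by positivity
            linarith
    · refine (norm_add_affine_mul_le L₀ (V * B * N * V) (V * B * B₂) (V * i * kw * V) V (r z) i z ℓ
        hrn').trans ?_
      refine mul_le_mul_of_nonneg_right ?_ (by positivity)
      have h7 : 0 ≤ ‖i‖ * ‖i‖ := by positivity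
      have h8 : 0 ≤ (c + 2 * ‖ke * i‖) * ‖i‖ := by positivity
      linarith
    -- `A^{1/2} r` is bounded by `1 / Im z`, which handles the commutator, and the bound `1 / (|ζ|
    -- Im z)` of `r` compensates the factor `2 ζ`. The resulting decay makes `1 + V L` invertible
    -- high in the half plane.
    · have h1 : ‖V * (L₀ + M ζ * V * r z * i)‖ ≤ ((c + 2 * ‖ke * i‖) * ‖i‖) * z.im⁻¹ := by
        refine ContinuousLinearMap.opNorm_le_bound _ (by positivity) fun f => ?_
        obtain ⟨u, v, hu, hv, hvp, hAu⟩ := hap f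
        obtain ⟨s, hs⟩ := hdom u
        rw [mul_apply_eq_comp, hVL f u hu hAu]
        have h2 := (hXn u s hs).trans (mul_le_mul_of_nonneg_left (hrs (i f) s (hs.trans hu)) hc)
        have h3 : ‖(u : H)‖ ≤ (‖ζ‖ * z.im)⁻¹ * ‖i f‖ := by
          rw [hu]; exact (r z).le_of_opNorm_le hrn _
        have h4 : ‖(2 * ζ) • ke (i u)‖ ≤ 2 * ‖ke * i‖ * z.im⁻¹ * ‖i f‖ := by
          rw [norm_smul, norm_mul, Complex.norm_ofNat]
          calc 2 * ‖ζ‖ * ‖ke (i u)‖ ≤ 2 * ‖ζ‖ * (‖ke * i‖ * ((‖ζ‖ * z.im)⁻¹ * ‖i f‖)) := by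
                gcongr
                exact ((ke * i).le_opNorm _).trans (by gcongr)
            _ = _ := by field_simp
        calc _ ≤ c * (z.im⁻¹ * ‖i f‖) + 2 * ‖ke * i‖ * z.im⁻¹ * ‖i f‖ :=
              (norm_add_le _ _).trans (add_le_add h2 h4)
          _ = (c + 2 * ‖ke * i‖) * z.im⁻¹ * ‖i f‖ := by ring
          _ ≤ (c + 2 * ‖ke * i‖) * z.im⁻¹ * (‖i‖ * ‖f‖) := by
              gcongr
              exact i.le_opNorm f
          _ = _ := by ring
      refine h1.trans ?_
      gcongr
      have : 0 ≤ ‖i‖ * ‖i‖ + ‖L₀‖ + ((1 + |ℓ|) ^ 2 *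
        (‖V * B * N * V‖ + ‖V * B * B₂‖ + 2 * ‖V * i * kw * V‖)) * (‖V‖ * ‖i‖) := by positivity
      linarith
  · have hF1 : FredholmAt (fun z => F (z - ℓ)) z₀ := by
      have h1 := hFm (z₀ - ℓ) (by simpa using hz₀)
      exact h1.1.fredholmAt h1.2
    -- The resolvent-free part contains `N W = A^{1/2} (A + 1)⁻¹ w⁻¹`, compact by the last condition
    -- of (ME1).
    have hL₀c : IsCompactOperator (L₀ * V : H →L[ℂ] H) := by
      have h1 : L₀ * V = (V * B) * ((N * W) * (i * V)) := by simp only [hL₀, mul_assoc]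
      have h2 := (isCompactOperator_sqrt_mul hA hp hw.selfAdjoint_one hcomp).comp_clm (i * V)
      rw [h1]
      exact h2.clm_comp (V * B)
    have h3 := (((hF1.mul_mul (V * B * N * V) i).smul
      (c := fun z => (z - ℓ) ^ 2 + 1) (by fun_prop)).add (hF1.mul_mul (V * B * B₂) i)).add
      ((hF1.mul_mul (V * i * kw * V) i).smul (c := fun z => 2 * (z - ℓ)) (by fun_prop))
    have h4 := (fredholmAt_const hL₀c z₀).add h3
    refine (congrArg (FredholmAt · z₀) (funext fun z => ?_)).mp h4
    simp only [M, add_mul, smul_mul_assoc]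

end End

variable {H : Type*} [NormedAddCommGroup H] [InnerProductSpace ℂ H] [CompleteSpace H]
variable {h w : H →ₗ.[ℂ] H}

/-! ### Invertibility of the quadratic pencil -/

section Pencil

/-- The bounded part of the quadratic pencil `h + 2 z k - z²`. -/
def pencil (k : H →L[ℂ] H) (z : ℂ) : H →L[ℂ] H := (2 * z) • k - z ^ 2 • (1 : H →L[ℂ] H)

/-- The gauge `1 + |z - z₀|⁻¹ + |Im z|⁻¹`. -/
def gauge (z₀ z : ℂ) : ℝ := 1 + ‖z - z₀‖⁻¹ + |z.im|⁻¹

lemma one_le_gauge (z₀ z : ℂ) : 1 ≤ gauge z₀ z := by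
  unfold gauge
  have : 0 ≤ ‖z - z₀‖⁻¹ := by positivity
  have : 0 ≤ |z.im|⁻¹ := by positivity
  linarith

lemma inv_norm_le_gauge (z₀ z : ℂ) : ‖z - z₀‖⁻¹ ≤ gauge z₀ z := by
  unfold gauge
  have : 0 ≤ |z.im|⁻¹ := by positivity
  linarith

lemma inv_im_le_gauge (z₀ z : ℂ) : |z.im|⁻¹ ≤ gauge z₀ z := by
  unfold gauge
  have : 0 ≤ ‖z - z₀‖⁻¹ := by positivity
  linarith

/-- `F` grows at most like a power of the gauge in the part `U` of a punctured neighbourhood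
of `z₀`. -/
def TemperedAt {E : Type*} [NormedAddCommGroup E] (U : Set ℂ) (F : ℂ → E) (z₀ : ℂ) : Prop :=
  ∃ (C : ℝ) (m : ℕ), 0 ≤ C ∧ ∀ᶠ z in 𝓝[≠] z₀, z ∈ U → ‖F z‖ ≤ C * gauge z₀ z ^ m

variable {U : Set ℂ} {z₀ : ℂ}

lemma TemperedAt.add {E : Type*} [NormedAddCommGroup E] {F F' : ℂ → E} (h : TemperedAt U F z₀)
    (h' : TemperedAt U F' z₀) : TemperedAt U (fun z => F z + F' z) z₀ := by
  obtain ⟨C, m, hC, h⟩ := h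
  obtain ⟨C', m', hC', h'⟩ := h'
  refine ⟨C + C', max m m', add_nonneg hC hC', ?_⟩
  filter_upwards [h, h'] with z h1 h2 hz
  have hg := one_le_gauge z₀ z
  calc ‖F z + F' z‖ ≤ C * gauge z₀ z ^ m + C' * gauge z₀ z ^ m' :=
        (norm_add_le _ _).trans (add_le_add (h1 hz) (h2 hz))
    _ ≤ C * gauge z₀ z ^ max m m' + C' * gauge z₀ z ^ max m m' := by
        gcongr
        exacts [le_max_left _ _, le_max_right _ _]
    _ = _ := by ring

lemma TemperedAt.mul {F F' : ℂ → H →L[ℂ] H} (h : TemperedAt U F z₀)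
    (h' : TemperedAt U F' z₀) : TemperedAt U (fun z => F z * F' z) z₀ := by
  obtain ⟨C, m, hC, h⟩ := h
  obtain ⟨C', m', hC', h'⟩ := h'
  refine ⟨C * C', m + m', mul_nonneg hC hC', ?_⟩
  filter_upwards [h, h'] with z h1 h2 hz
  have hg := one_le_gauge z₀ z
  calc ‖F z * F' z‖ ≤ (C * gauge z₀ z ^ m) * (C' * gauge z₀ z ^ m') :=
        (norm_mul_le _ _).trans (mul_le_mul (h1 hz) (h2 hz) (norm_nonneg _) (by positivity))
    _ = _ := by ring

lemma TemperedAt.neg {E : Type*} [NormedAddCommGroup E] {F : ℂ → E} (h : TemperedAt U F z₀) :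
    TemperedAt U (fun z => -F z) z₀ := by
  simpa only [TemperedAt, norm_neg] using h

lemma TemperedAt.sub {E : Type*} [NormedAddCommGroup E] {F F' : ℂ → E} (h : TemperedAt U F z₀)
    (h' : TemperedAt U F' z₀) : TemperedAt U (fun z => F z - F' z) z₀ := by
  simpa only [sub_eq_add_neg] using h.add h'.neg

lemma ContinuousAt.temperedAt {E : Type*} [NormedAddCommGroup E] {F : ℂ → E}
    (h : ContinuousAt F z₀) : TemperedAt U F z₀ := by
  refine ⟨‖F z₀‖ + 1, 0, by positivity, Filter.Eventually.filter_mono nhdsWithin_le_nhds ?_⟩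
  filter_upwards [h.norm.eventually_lt (continuousAt_const (y := ‖F z₀‖ + 1)) (by linarith)]
    with z hz _
  simpa using hz.le

lemma PoleBoundAt.temperedAt {E : Type*} [NormedAddCommGroup E] {F : ℂ → E}
    (h : PoleBoundAt F z₀) : TemperedAt U F z₀ := by
  obtain ⟨C, m, h⟩ := h
  refine ⟨|C|, m, abs_nonneg _, ?_⟩
  filter_upwards [h] with z hz _
  refine hz.trans ?_
  gcongr
  exacts [le_abs_self C, inv_norm_le_gauge z₀ z]

lemma TemperedAt.mono_norm {E E' : Type*} [NormedAddCommGroup E] [NormedAddCommGroup E']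
    {F : ℂ → E} {F' : ℂ → E'} (h : TemperedAt U F z₀)
    (h' : ∀ᶠ z in 𝓝[≠] z₀, z ∈ U → ‖F' z‖ ≤ ‖F z‖) : TemperedAt U F' z₀ := by
  obtain ⟨C, m, hC, h⟩ := h
  refine ⟨C, m, hC, ?_⟩
  filter_upwards [h, h'] with z h1 h2 hz
  exact (h2 hz).trans (h1 hz)

/-- The inverse is `1 - T (1 + S T)⁻¹ S`. Smallness is known for `V L`, while the Fredholm theory
concerns `L V`. -/
lemma isUnit_one_add_mul_swap {S T : H →L[ℂ] H} (h : IsUnit (1 + S * T)) :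
    IsUnit (1 + T * S) := by
  obtain ⟨B, hB, hB'⟩ := isUnit_iff_exists.1 h
  have e1 : S * T * B = 1 - B := by rw [eq_sub_iff_add_eq, add_comm, ← hB, add_mul, one_mul]
  have e2 : B * (S * T) = 1 - B := by rw [eq_sub_iff_add_eq, add_comm, ← hB', mul_add, mul_one]
  refine isUnit_iff_exists.2 ⟨1 - T * B * S, ?_, ?_⟩
  · calc (1 + T * S) * (1 - T * B * S) = 1 + T * S - T * B * S - T * (S * T * B) * S := by
          noncomm_ring
      _ = 1 := by rw [e1]; noncomm_ring
  · calc (1 - T * B * S) * (1 + T * S) = 1 + T * S - T * B * S - T * (B * (S * T)) * S := by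
          noncomm_ring
      _ = 1 := by rw [e2]; noncomm_ring

/-- The domain `Im z > 0`. -/
def upper : Set ℂ := {z | 0 < z.im}

/-- As `i² + i'² = 1`, the sum of the parametrices inverts the pencil up to `1 + V (L + L')`, whose
inverse is `1 - V (1 + K + K')⁻¹ (L + L')`. The middle factor is controlled by the Fredholm
alternative on a half plane containing the closed upper one, hence has poles of finite order; the
others grow at most like powers of `1 / Im z`. -/
lemma exists_right_inverse {k i i' : H →L[ℂ] H} (h1 : HasEndParametrix h k w i)
    (h2 : HasEndParametrix h k w i') (hi : i * i + i' * i' = 1) :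
    ∃ P : ℂ → H →L[ℂ] H, ∀ z₀ : ℂ, 0 ≤ z₀.im →
      (∀ᶠ z in 𝓝[≠] z₀, z ∈ upper →
        ∀ v, ∃ u : h.domain, (u : H) = P z v ∧ h u + pencil k z u = v) ∧
      TemperedAt upper P z₀ := by
  obtain ⟨δ, hδ, Q, L, K, C, hC, hz, hK⟩ := h1
  obtain ⟨δ', hδ', Q', L', K', C', hC', hz', hK'⟩ := h2
  set V := wPow w (1 / 2)
  have hΩ : IsOpen {z : ℂ | -(min δ δ') < z.im} := isOpen_lt continuous_const Complex.continuous_im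
  have hconv : Convex ℝ {z : ℂ | -(min δ δ') < z.im} := convex_halfSpace_im_gt _
  have hF : ∀ z ∈ {z : ℂ | -(min δ δ') < z.im}, FredholmAt (fun z => K z + K' z) z := fun z hz =>
    (hK z (lt_of_le_of_lt (neg_le_neg (min_le_left _ _)) hz)).add
      (hK' z (lt_of_le_of_lt (neg_le_neg (min_le_right _ _)) hz))
  -- A height near which `‖V (L + L')‖ ≤ (C + C') / Im z < 1`.
  set τ : ℝ := C + C' + 1
  have hτ : 0 < τ := by positivity
  have hunit : ∀ᶠ z in 𝓝[≠] ((τ : ℂ) * Complex.I), IsUnit (1 + (K z + K' z)) := by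
    have ho : IsOpen {z : ℂ | C + C' < z.im} := isOpen_lt continuous_const Complex.continuous_im
    filter_upwards [mem_nhdsWithin_of_mem_nhds (ho.mem_nhds (x := (τ : ℂ) * Complex.I)
      (by simp [τ]))] with z hzC
    have hzC' : C + C' < z.im := hzC
    have hpos : 0 < z.im := lt_of_le_of_lt (by positivity) hzC'
    obtain ⟨_, e1, _, _, e2⟩ := hz z hpos
    obtain ⟨_, e1', _, _, e2'⟩ := hz' z hpos
    rw [← e1, ← e1', ← add_mul]
    refine isUnit_one_add_mul_swap ?_
    have h3 : ‖-(V * (L z + L' z))‖ < 1 := by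
      rw [norm_neg, mul_add]
      refine (norm_add_le _ _).trans_lt ((add_le_add e2 e2').trans_lt ?_)
      rw [← add_mul, ← div_eq_mul_inv, div_lt_one hpos]
      exact hzC'
    simpa using isUnit_one_sub_of_norm_lt_one h3
  refine ⟨fun z => (Q z + Q' z) * (1 - V * Ring.inverse (1 + (K z + K' z)) * (L z + L' z)),
    fun z₀ hz₀ => ?_⟩
  obtain ⟨f1, f2⟩ := fredholm_alternative hΩ hconv.isPreconnected hF
    (z₁ := (τ : ℂ) * Complex.I) (by
      have : -(min δ δ') < 0 := neg_lt_zero.2 (lt_min hδ hδ')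
      simpa using this.trans hτ) hunit (z₀ := z₀)
    (lt_of_lt_of_le (neg_lt_zero.2 (lt_min hδ hδ')) hz₀)
  constructor
  · filter_upwards [f1] with z hu hzU v
    set J := Ring.inverse (1 + (K z + K' z)) with hJ
    obtain ⟨g1, e1, _⟩ := hz z hzU
    obtain ⟨g1', e1', _⟩ := hz' z hzU
    set f := (1 - V * J * (L z + L' z)) v with hf
    obtain ⟨u, hu1, hu2⟩ := g1 f
    obtain ⟨u', hu1', hu2'⟩ := g1' f
    refine ⟨u + u', ?_, ?_⟩
    · rw [Submodule.coe_add, hu1, hu1', mul_apply_eq_comp, add_apply]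
    · have h3 : h (u + u') + pencil k z (u + u' : h.domain) =
          (i (i f) + i' (i' f)) + V ((L z + L' z) f) := by
        rw [LinearPMap.map_add, Submodule.coe_add, map_add]
        unfold pencil
        rw [add_add_add_comm, hu2, hu2', add_apply, map_add]
        abel
      have h4 : i (i f) + i' (i' f) = f := DFunLike.congr_fun hi f
      have h5 : (K z + K' z) * J = 1 - J := by
        have h7 := Ring.mul_inverse_cancel _ hu
        rw [add_mul, one_mul, ← hJ] at h7
        exact eq_sub_of_add_eq' h7
      have h6 : (1 + V * (L z + L' z)) * (1 - V * J * (L z + L' z)) = 1 := by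
        have h7 : (L z + L' z) * V = K z + K' z := by rw [add_mul, e1, e1']
        calc _ = 1 + V * (L z + L' z) - V * J * (L z + L' z) -
              V * (((L z + L' z) * V) * J) * (L z + L' z) := by noncomm_ring
          _ = 1 := by rw [h7, h5]; noncomm_ring
      rw [h3, h4]
      have h8 := DFunLike.congr_fun h6 v
      simpa [hf] using h8
  · have hQ : ∀ {Q : ℂ → H →L[ℂ] H} {C : ℝ}, 0 ≤ C →
        (∀ z, 0 < z.im → ‖Q z‖ ≤ C * (1 + (z.im⁻¹) ^ 2)) → TemperedAt upper Q z₀ := by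
      intro Q C hC hQ
      refine ⟨C * 2, 2, by positivity, Filter.Eventually.of_forall fun z hz => (hQ z hz).trans ?_⟩
      rw [mul_assoc]
      refine mul_le_mul_of_nonneg_left ?_ hC
      have h3 := inv_im_le_gauge z₀ z
      rw [abs_of_pos (show 0 < z.im from hz)] at h3
      have h4 := one_le_gauge z₀ z
      have h5 : 0 < z.im⁻¹ := inv_pos.2 hz
      nlinarith
    have hL : ∀ {Q : ℂ → H →L[ℂ] H} {C : ℝ}, 0 ≤ C →
        (∀ z, 0 < z.im → ‖Q z‖ ≤ C * ((1 + ‖z‖) ^ 2 * (1 + (z.im⁻¹) ^ 2))) →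
        TemperedAt upper Q z₀ := by
      intro Q C hC hQ'
      have h3 : ContinuousAt (fun z : ℂ => (1 + ‖z‖) ^ 2) z₀ := by fun_prop
      refine ⟨C * ((1 + ‖z₀‖) ^ 2 + 1) * 2, 2, by positivity, ?_⟩
      filter_upwards [Filter.Eventually.filter_mono nhdsWithin_le_nhds (h3.eventually_lt
        (continuousAt_const (y := (1 + ‖z₀‖) ^ 2 + 1)) (by linarith))] with z hz hzU
      have h3 := inv_im_le_gauge z₀ z
      rw [abs_of_pos (show 0 < z.im from hzU)] at h3
      have h4 := one_le_gauge z₀ z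
      have h5 : 0 < z.im⁻¹ := inv_pos.2 hzU
      calc ‖Q z‖ ≤ C * ((1 + ‖z‖) ^ 2 * (1 + (z.im⁻¹) ^ 2)) := hQ' z hzU
        _ ≤ C * (((1 + ‖z₀‖) ^ 2 + 1) * (2 * gauge z₀ z ^ 2)) := by
            gcongr
            nlinarith
        _ = _ := by ring
    have t1 := hQ hC fun z hzU => (hz z hzU).2.2.1
    have t2 := hQ hC' fun z hzU => (hz' z hzU).2.2.1
    have t3 := hL hC fun z hzU => (hz z hzU).2.2.2.1
    have t4 := hL hC' fun z hzU => (hz' z hzU).2.2.2.1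
    have c1 : ∀ B : H →L[ℂ] H, TemperedAt upper (fun _ => B) z₀ := fun B =>
      ContinuousAt.temperedAt continuousAt_const
    exact (t1.add t2).mul ((c1 1).sub (((c1 V).mul f2.temperedAt).mul (t3.add t4)))

/-- With `pencil_neg_neg` this reduces adjoints and the lower half plane to right inverses in the
upper half plane, for `k` and for `-k`. -/
lemma adjoint_pencil {k : H →L[ℂ] H} (hk : IsSelfAdjoint k) (z : ℂ) :
    ContinuousLinearMap.adjoint (pencil k z) = pencil (-k) (-(starRingEnd ℂ z)) := by
  have h1 : ContinuousLinearMap.adjoint k = k := hk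
  rw [← ContinuousLinearMap.star_eq_adjoint, pencil, pencil, star_sub, star_smul, star_smul,
    hk.star_eq, star_one]
  simp

lemma pencil_neg_neg (k : H →L[ℂ] H) (z : ℂ) : pencil (-k) (-z) = pencil k z := by
  simp [pencil]

/-- The non-real points. -/
def nonreal : Set ℂ := {z | z.im ≠ 0}

lemma tendsto_neg_conj (z₀ : ℂ) : Filter.Tendsto (fun z => -(starRingEnd ℂ z)) (𝓝[≠] z₀)
    (𝓝[≠] (-(starRingEnd ℂ z₀))) := by
  refine tendsto_nhdsWithin_iff.2 ⟨Filter.Tendsto.mono_left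
    ((Complex.continuous_conj.neg).tendsto z₀) nhdsWithin_le_nhds, ?_⟩
  filter_upwards [self_mem_nhdsWithin] with z hz h
  exact hz ((starRingEnd ℂ).injective (neg_injective h))

lemma tendsto_neg_punctured (z₀ : ℂ) : Filter.Tendsto (fun z => -z) (𝓝[≠] z₀) (𝓝[≠] (-z₀)) := by
  refine tendsto_nhdsWithin_iff.2 ⟨Filter.Tendsto.mono_left
    (continuous_neg.tendsto z₀) nhdsWithin_le_nhds, ?_⟩
  filter_upwards [self_mem_nhdsWithin] with z hz h
  exact hz (by simpa using h)

lemma tendsto_conj_punctured (z₀ : ℂ) : Filter.Tendsto (fun z => starRingEnd ℂ z) (𝓝[≠] z₀)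
    (𝓝[≠] (starRingEnd ℂ z₀)) := by
  refine tendsto_nhdsWithin_iff.2 ⟨Filter.Tendsto.mono_left
    (Complex.continuous_conj.tendsto z₀) nhdsWithin_le_nhds, ?_⟩
  filter_upwards [self_mem_nhdsWithin] with z hz h
  exact hz ((starRingEnd ℂ).injective h)

/-- Invertibility of the quadratic pencil near every point, with a polynomial bound. -/
theorem exists_pencil_inverse {k i i' : H →L[ℂ] H} (hh : IsSelfAdjoint h) (hk : IsSelfAdjoint k)
    (h1 : HasEndParametrix h k w i ∧ HasEndParametrix h (-k) w i)
    (h2 : HasEndParametrix h k w i' ∧ HasEndParametrix h (-k) w i') (hi : i * i + i' * i' = 1) :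
    ∃ P : ℂ → H →L[ℂ] H, ∀ z₀ : ℂ,
      (∀ᶠ z in 𝓝[≠] z₀, z.im ≠ 0 → IsInverseOf h (pencil k z) (P z)) ∧
      TemperedAt nonreal P z₀ := by
  classical
  obtain ⟨P, hP⟩ := exists_right_inverse h1.1 h2.1 hi
  obtain ⟨P', hP'⟩ := exists_right_inverse h1.2 h2.2 hi
  have hup : ∀ z₀ : ℂ, 0 ≤ z₀.im → ∀ᶠ z in 𝓝[≠] z₀, 0 < z.im →
      IsInverseOf h (pencil k z) (P z) := fun z₀ hz₀ => by
    filter_upwards [(hP z₀ hz₀).1, (tendsto_neg_conj z₀).eventually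
      (hP' (-(starRingEnd ℂ z₀)) (by simpa using hz₀)).1] with z e1 e2 hz
    refine isInverseOf_of_right_inverse hh (P' := P' (-(starRingEnd ℂ z))) (e1 hz) ?_
    rw [adjoint_pencil hk]
    exact e2 (by simpa [upper] using hz)
  have hlow : ∀ z₀ : ℂ, z₀.im ≤ 0 → ∀ᶠ z in 𝓝[≠] z₀, z.im < 0 →
      IsInverseOf h (pencil k z) (P' (-z)) := fun z₀ hz₀ => by
    filter_upwards [(tendsto_neg_punctured z₀).eventually (hP' (-z₀) (by simpa using hz₀)).1,
      (tendsto_conj_punctured z₀).eventually (hP (starRingEnd ℂ z₀) (by simpa using hz₀)).1]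
      with z e1 e2 hz
    refine isInverseOf_of_right_inverse hh (P' := P (starRingEnd ℂ z)) ?_ ?_
    · rw [← pencil_neg_neg]
      exact e1 (by simpa [upper] using hz)
    · rw [adjoint_pencil hk, pencil_neg_neg]
      exact e2 (by simpa [upper] using hz)
  have hlt : ∀ z₀ : ℂ, 0 < z₀.im → ∀ᶠ z in 𝓝[≠] z₀, 0 < z.im := fun z₀ h =>
    mem_nhdsWithin_of_mem_nhds ((isOpen_lt continuous_const Complex.continuous_im).mem_nhds h)
  have hlt' : ∀ z₀ : ℂ, z₀.im < 0 → ∀ᶠ z in 𝓝[≠] z₀, z.im < 0 := fun z₀ h =>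
    mem_nhdsWithin_of_mem_nhds ((isOpen_lt Complex.continuous_im continuous_const).mem_nhds h)
  have hup' : ∀ z₀ : ℂ, ∃ (C : ℝ) (m : ℕ), 0 ≤ C ∧ ∀ᶠ z in 𝓝[≠] z₀, 0 < z.im →
      IsInverseOf h (pencil k z) (P z) ∧ ‖P z‖ ≤ C * gauge z₀ z ^ m := fun z₀ => by
    rcases le_or_gt 0 z₀.im with h0 | h0
    · obtain ⟨C, m, hC, hCm⟩ := (hP z₀ h0).2
      refine ⟨C, m, hC, ?_⟩
      filter_upwards [hup z₀ h0, hCm] with z e1 e2 hz using ⟨e1 hz, e2 hz⟩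
    · refine ⟨0, 0, le_rfl, ?_⟩
      filter_upwards [hlt' z₀ h0] with z e1 hz
      exact absurd hz e1.not_gt
  have hlow' : ∀ z₀ : ℂ, ∃ (C : ℝ) (m : ℕ), 0 ≤ C ∧ ∀ᶠ z in 𝓝[≠] z₀, z.im < 0 →
      IsInverseOf h (pencil k z) (P' (-z)) ∧ ‖P' (-z)‖ ≤ C * gauge z₀ z ^ m := fun z₀ => by
    rcases le_or_gt z₀.im 0 with h0 | h0
    · obtain ⟨C, m, hC, hCm⟩ := (hP' (-z₀) (by simpa using h0)).2
      refine ⟨C, m, hC, ?_⟩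
      filter_upwards [hlow z₀ h0, (tendsto_neg_punctured z₀).eventually hCm] with z e1 e2 hz
      have e3 : gauge (-z₀) (-z) = gauge z₀ z := by
        unfold gauge
        rw [neg_sub_neg, norm_sub_rev, Complex.neg_im, abs_neg]
      rw [e3] at e2
      exact ⟨e1 hz, e2 (by simpa [upper] using hz)⟩
    · refine ⟨0, 0, le_rfl, ?_⟩
      filter_upwards [hlt z₀ h0] with z e1 hz
      exact absurd hz e1.not_gt
  refine ⟨fun z => if 0 < z.im then P z else P' (-z), fun z₀ => ?_⟩
  obtain ⟨C, m, hC, e1⟩ := hup' z₀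
  obtain ⟨C', m', hC', e2⟩ := hlow' z₀
  constructor
  · filter_upwards [e1, e2] with z e1 e2 hz
    split_ifs with hpos
    · exact (e1 hpos).1
    · exact (e2 (lt_of_le_of_ne (not_lt.1 hpos) hz)).1
  · refine ⟨max C C', max m m', le_max_of_le_left hC, ?_⟩
    filter_upwards [e1, e2] with z e1 e2 hz
    have hg := one_le_gauge z₀ z
    split_ifs with hpos
    · refine (e1 hpos).2.trans ?_
      gcongr
      exacts [le_max_left _ _, le_max_left _ _]
    · refine (e2 (lt_of_le_of_ne (not_lt.1 hpos) hz)).2.trans ?_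
      gcongr
      exacts [le_max_right _ _, le_max_right _ _]

end Pencil

/-! ### Verification of the parametrix hypotheses at the two ends -/

section TwoEnds

/-- Both parametrices at one end, for `k` and for `-k`. -/
lemma hasEndParametrix_and_neg {k ke i : H →L[ℂ] H} {A : H →ₗ.[ℂ] H} {ℓ : ℝ} (hw : IsWeight w)
    (hh : IsSelfAdjoint h) (hk : IsSelfAdjoint k) (hke : IsSelfAdjoint ke)
    (hA : A = addBounded (hZero h k) (-(ke * ke))) (hA3 : CondA3 A ke) (hi : IsSelfAdjoint i)
    (hik : k * i = (ke + (ℓ : ℂ) • (1 : H →L[ℂ] H)) * i)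
    (hki : Commute k i) (hkei : Commute ke i) (hwi : Commutes w i)
    (hme1 : CondME1 A ke w) (hme2 : CondME2 A w) (hwcb : WeightedCommBounded w h i A)
    (hcb : CommBounded h i A) :
    HasEndParametrix h k w i ∧ HasEndParametrix h (-k) w i := by
  have hA' : A = addBounded h (k * k - ke * ke) := by
    rw [hA, hZero, addBounded, addBounded, addBounded, vadd_vadd]
    congr 1
    ext u
    simp [sub_eq_neg_add]
  subst hA'
  have hsa : IsSelfAdjoint (k * k - ke * ke) :=
    ((hk.commute_iff hk).1 (Commute.refl k)).sub ((hke.commute_iff hke).1 (Commute.refl ke))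
  have hAsa := isSelfAdjoint_addBounded hh hsa
  have h0 : OpNonneg (addBounded h (k * k - ke * ke)) := by
    obtain ⟨c, hc, hcu⟩ := hA3
    exact fun u => le_trans (by positivity) (hcu u)
  have hcomm := hme1.commutator 1 one_pos le_rfl
  refine ⟨exists_end_parametrix hw hh hAsa h0 hi hik hki hkei hwi hme1.wkw hcomm hme1.compact
    hme2 hwcb hcb, ?_⟩
  have e : (-k) * (-k) - (-ke) * (-ke) = k * k - ke * ke := by rw [neg_mul_neg, neg_mul_neg]
  refine exists_end_parametrix (ke := -ke) (ℓ := -ℓ) hw hh (by rwa [e]) (by rwa [e]) hi ?_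
    hki.neg_left hkei.neg_left hwi ?_ (by rwa [e]) (by rw [e]; exact hme1.compact) (by rwa [e])
    (by rwa [e]) (by rwa [e])
  · rw [neg_mul, hik, ← neg_mul, neg_add, Complex.ofReal_neg, neg_smul]
  · obtain ⟨C, hC⟩ := hme1.wkw
    refine ⟨C, fun u => ?_⟩
    obtain ⟨y, hy, hyn⟩ := hC u
    refine ⟨-y, by simp [hy], ?_⟩
    rwa [LinearPMap.map_neg, norm_neg]

/-- The quadratic pencil of a Klein-Gordon operator with two ends. -/
theorem exists_pencil_inverse_of_twoEnds {h : H →ₗ.[ℂ] H} {k : H →L[ℂ] H} {x w : H →ₗ.[ℂ] H}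
    {W χm χp χt : ℝ → ℝ} {ε R ℓ : ℝ} (hh : IsSelfAdjoint h) (hk : IsSelfAdjoint k)
    (hx : IsSelfAdjoint x) (hw : IsSelfAdjoint w) (hwpos : OpPos w)
    (hwinv : (0 : ℂ) ∉ opSpectrum w) (hχ : IsCutoffTriple χm χp χt)
    (hTE : TwoEnds h k x w W ℓ
      (bfc (fun t => χp (ε⁻¹ * t)) x) (bfc (fun t => χm (ε⁻¹ * t)) x)
      (bfc (fun t => χp (ε⁻¹ * t - 3)) x) (bfc (fun t => χm (ε⁻¹ * t + 3)) x)
      (bfc (fun t => χt (R⁻¹ * t)) x)) :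
    ∃ P : ℂ → H →L[ℂ] H, ∀ z₀ : ℂ,
      (∀ᶠ z in 𝓝[≠] z₀, z.im ≠ 0 → IsInverseOf h (pencil k z) (P z)) ∧
      TemperedAt nonreal P z₀ := by
  have hcm := hχ.smooth_m.continuous
  have hcp := hχ.smooth_p.continuous
  have cip : Continuous fun t => χp (ε⁻¹ * t) := by fun_prop
  have cim : Continuous fun t => χm (ε⁻¹ * t) := by fun_prop
  have cjp : Continuous fun t => χp (ε⁻¹ * t - 3) := by fun_prop
  have cjm : Continuous fun t => χm (ε⁻¹ * t + 3) := by fun_prop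
  have bip : ∀ t, 0 ≤ χp (ε⁻¹ * t) ∧ χp (ε⁻¹ * t) ≤ 1 := fun t => hχ.range_p _
  have bim : ∀ t, 0 ≤ χm (ε⁻¹ * t) ∧ χm (ε⁻¹ * t) ≤ 1 := fun t => hχ.range_m _
  have bjp : ∀ t, 0 ≤ χp (ε⁻¹ * t - 3) ∧ χp (ε⁻¹ * t - 3) ≤ 1 := fun t => hχ.range_p _
  have bjm : ∀ t, 0 ≤ χm (ε⁻¹ * t + 3) ∧ χm (ε⁻¹ * t + 3) ≤ 1 := fun t => hχ.range_m _
  have zm : ∀ t, 1 ≤ t → χm t = 0 := fun t ht => by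
    by_contra h0
    exact absurd (hχ.supp_m (subset_tsupport _ h0)) (not_lt.2 ht)
  have zp : ∀ t, t ≤ -1 → χp t = 0 := fun t ht => by
    by_contra h0
    exact absurd (hχ.supp_p (subset_tsupport _ h0)) (not_lt.2 ht)
  have hwt := isWeight hw hwpos hwinv
  have sa : ∀ {f : ℝ → ℝ}, Continuous f → (∀ t, 0 ≤ f t ∧ f t ≤ 1) → IsSelfAdjoint (bfc f x) :=
    fun hf hb => isSelfAdjoint_of_fcGraph hx (mem_fcGraph_bfc_of_bounded hx hf hb)
  have ck : ∀ {f : ℝ → ℝ}, Continuous f → (∀ t, 0 ≤ f t ∧ f t ≤ 1) → Commute k (bfc f x) :=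
    fun hf hb => (commute_bfc_of_commutes hx hf hb hTE.te1_comm).symm
  have cw : ∀ {f : ℝ → ℝ}, Continuous f → (∀ t, 0 ≤ f t ∧ f t ≤ 1) → Commutes w (bfc f x) :=
    fun hf hb => by
      have h1 := commutes_fc_bfc hx hf hb W
      rwa [← hTE.te1_weight] at h1
  -- The shift by `3` separates supports: `j₋` lives where `ε⁻¹ x < -2` and `i₊` where `ε⁻¹ x > -1`.
  -- Hence `k₊ = k` on the range of `i₊` and, by the next lines, `k₋ - ℓ = k - ℓ` on that of `i₋`,
  -- which accounts for the shifts `0` and `ℓ` below.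
  have hjmip := bfc_mul_bfc_eq_zero hx cip bip cjm bjm fun t => by
    rcases le_total (ε⁻¹ * t) (-1) with h1 | h1
    · rw [zp _ h1, zero_mul]
    · rw [zm (ε⁻¹ * t + 3) (by linarith), mul_zero]
  have hjpim := bfc_mul_bfc_eq_zero hx cim bim cjp bjp fun t => by
    rcases le_total 1 (ε⁻¹ * t) with h1 | h1
    · rw [zm _ h1, zero_mul]
    · rw [zp (ε⁻¹ * t - 3) (by linarith), mul_zero]
  have hpart := bfc_sq_add_bfc_sq hx cip bip cim bim fun t => hχ.partition _
  set ip := bfc (fun t => χp (ε⁻¹ * t)) x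
  set im := bfc (fun t => χm (ε⁻¹ * t)) x
  set jp := bfc (fun t => χp (ε⁻¹ * t - 3)) x
  set jm := bfc (fun t => χm (ε⁻¹ * t + 3)) x
  have hsq : ∀ {j : H →L[ℂ] H}, IsSelfAdjoint j → IsSelfAdjoint ((ℓ : ℂ) • (j * j)) := fun hj => by
    refine IsSelfAdjoint.smul (Complex.conj_ofReal ℓ) ?_
    exact (hj.commute_iff hj).1 (Commute.refl _)
  have hkp : IsSelfAdjoint (kPlus k jm ℓ) := hk.sub (hsq (sa cjm bjm))
  have hkm : IsSelfAdjoint (kMinusShift k jp ℓ) :=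
    (hk.add (hsq (sa cjp bjp))).sub (IsSelfAdjoint.smul (Complex.conj_ofReal ℓ) (.one _))
  refine exists_pencil_inverse hh hk
    (hasEndParametrix_and_neg (ℓ := 0) hwt hh hk hkp rfl hTE.te2_plus (sa cip bip) ?_ (ck cip bip)
      ?_ (cw cip bip) hTE.te3c_plus.1 hTE.te3c_plus.2 hTE.te3e_w_plus hTE.te3e_plus)
    (hasEndParametrix_and_neg (ℓ := ℓ) hwt hh hk hkm rfl hTE.te2_minus (sa cim bim) ?_ (ck cim bim)
      ?_ (cw cim bim) hTE.te3c_minus.1 hTE.te3c_minus.2 hTE.te3e_w_minus hTE.te3e_minus) hpart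
  · rw [kPlus, Complex.ofReal_zero, zero_smul, add_zero, sub_mul, smul_mul_assoc, mul_assoc, hjmip,
      mul_zero, smul_zero, sub_zero]
  · have h1 := commute_bfc hx cjm bjm cip bip
    exact (ck cip bip).sub_left ((h1.mul_left h1).smul_left _)
  · rw [kMinusShift, kMinus, sub_add_cancel, add_mul, smul_mul_assoc, mul_assoc, hjpim,
      mul_zero, smul_zero, add_zero]
  · have h1 := commute_bfc hx cjp bjp cim bim
    exact ((ck cim bim).add_left ((h1.mul_left h1).smul_left _)).sub_left
      ((Commute.one_left _).smul_left _)

end TwoEnds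

variable {H : Type*} [NormedAddCommGroup H] [InnerProductSpace ℂ H] [CompleteSpace H]
variable {A h : H →ₗ.[ℂ] H} {k : H →L[ℂ] H}

/-! ### The homogeneous space of `h₀` and the operator that `k` induces on it -/

section Homogeneous

lemma exists_of_sqrtOp_mem (hA : IsSelfAdjoint A) (h0 : OpNonneg A) {s t : (sqrtOp A).domain}
    (hst : (t : H) = sqrtOp A s) : ∃ a : A.domain, (a : H) = s ∧ A a = sqrtOp A t := by
  have h1 := mem_fcGraph_of_mem hA s
  have h2 := mem_fcGraph_of_mem hA t
  rw [hst] at h2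
  have h3 := fcGraph_comp Real.continuous_sqrt h1 h2
  rw [fcGraph_congr hA (f := fun t => √t * √t) (f' := id)
    fun t ht => Real.mul_self_sqrt (realSpectrum_nonneg hA h0 ht)] at h3
  exact exists_of_mem_fcGraph_id hA h3

lemma eq_zero_of_sqrtOp_eq_zero (hA : IsSelfAdjoint A) (hpos : OpPos A) (s : (sqrtOp A).domain)
    (hs : sqrtOp A s = 0) : s = 0 := by
  obtain ⟨a, ha, haA⟩ := exists_of_sqrtOp_mem hA hpos.1 (s := s) (t := 0) (by simp [hs])
  rw [LinearPMap.map_zero] at haA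
  exact Subtype.ext (ha.symm.trans (hpos.2 a haA))

/-- A vector orthogonal to the range is in the kernel of `A^{1/2}`, hence in that of `A`. -/
lemma denseRange_sqrtOp (hA : IsSelfAdjoint A) (hpos : OpPos A) :
    DenseRange (sqrtOp A).toFun := by
  have hd : Dense ((LinearMap.range (sqrtOp A).toFun : Submodule ℂ H) : Set H) := by
    rw [Submodule.dense_iff_topologicalClosure_eq_top,
      Submodule.topologicalClosure_eq_top_iff, Submodule.eq_bot_iff]
    intro y hy
    obtain ⟨s, hs, hs0⟩ := mem_domain_of_inner (isSelfAdjoint_sqrtOp hA) (x := y) (y := 0)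
      fun a => by
        rw [inner_zero_left]
        exact ((Submodule.mem_orthogonal' _ _).1 hy _ ⟨a, rfl⟩).symm
    rw [← hs, eq_zero_of_sqrtOp_eq_zero hA hpos s hs0, Submodule.coe_zero]
  exact hd

/-- The operator induced on `A^{-1/2} H`, transported to `H`. -/
lemma HomBoundedBy.exists_clm (hA : IsSelfAdjoint A) (hpos : OpPos A) {T : H →L[ℂ] H} {C : ℝ}
    (hC : 0 ≤ C) (hT : HomBoundedBy A T C) : ∃ B : H →L[ℂ] H, ‖B‖ ≤ C ∧
      ∀ u : (sqrtOp A).domain, ∃ v : (sqrtOp A).domain, (v : H) = T u ∧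
        sqrtOp A v = B (sqrtOp A u) := by
  choose v hv hvn using hT
  let X : (sqrtOp A).domain →ₗ[ℂ] H :=
    { toFun := fun u => sqrtOp A (v u)
      map_add' := fun a b => by
        have : v (a + b) = v a + v b := Subtype.ext (by simp [hv])
        rw [this, LinearPMap.map_add]
      map_smul' := fun c a => by
        have : v (c • a) = c • v a := Subtype.ext (by simp [hv])
        rw [this, LinearPMap.map_smul, RingHom.id_apply] }
  have hd := denseRange_sqrtOp hA hpos
  have hX : ∀ u, ‖X u‖ ≤ C * ‖(sqrtOp A).toFun u‖ := hvn
  exact ⟨X.extendOfNorm (sqrtOp A).toFun, LinearMap.opNorm_extendOfNorm_le hd hC hX,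
    fun u => ⟨v u, hv u, (LinearMap.extendOfNorm_eq (f := X) hd ⟨C, hX⟩ u).symm⟩⟩

lemma eq_of_forall_sqrtOp (hA : IsSelfAdjoint A) (hpos : OpPos A) {B B' : H →L[ℂ] H}
    (hB : ∀ u : (sqrtOp A).domain, B (sqrtOp A u) = B' (sqrtOp A u)) : B = B' := by
  have hd := denseRange_sqrtOp hA hpos
  refine ContinuousLinearMap.coeFn_injective (hd.equalizer B.continuous B'.continuous ?_)
  exact funext hB

lemma isSelfAdjoint_mul_self (hk : IsSelfAdjoint k) : IsSelfAdjoint (k * k) :=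
  (hk.commute_iff hk).1 (Commute.refl k)

lemma isSelfAdjoint_hZero (hh : IsSelfAdjoint h) (hk : IsSelfAdjoint k) :
    IsSelfAdjoint (hZero h k) :=
  isSelfAdjoint_addBounded hh (isSelfAdjoint_mul_self hk)

lemma isUnit_sub_smul (hk : IsSelfAdjoint k) {z : ℂ} (hz : z.im ≠ 0) :
    IsUnit (k - z • (1 : H →L[ℂ] H)) := by
  have h1 : z ∉ spectrum ℂ k := fun h => by
    rw [hk.mem_spectrum_eq_re h] at hz
    simp at hz
  rw [spectrum.notMem_iff] at h1
  rw [← neg_sub]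
  simpa [Algebra.algebraMap_eq_smul_one] using h1.neg

/-- The operator induced by `k` on the homogeneous space, with its resolvents. -/
lemma exists_kHat (hh : IsSelfAdjoint h) (hk : IsSelfAdjoint k) (hpos : OpPos (hZero h k))
    (hA2 : CondA2 h k) : ∃ K : H →L[ℂ] H,
      (∀ u : (sqrtOp (hZero h k)).domain, ∃ v : (sqrtOp (hZero h k)).domain,
        (v : H) = k u ∧ sqrtOp (hZero h k) v = K (sqrtOp (hZero h k) u)) ∧
      (∀ z : ℂ, z.im ≠ 0 → IsUnit (K - z • (1 : H →L[ℂ] H)) ∧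
        ∀ u : (sqrtOp (hZero h k)).domain, ∃ v : (sqrtOp (hZero h k)).domain,
          (v : H) = kRes k z u ∧ sqrtOp (hZero h k) v = kRes K z (sqrtOp (hZero h k) u)) ∧
      ∀ z₀ : ℂ, TemperedAt nonreal (kRes K) z₀ := by
  have hA := isSelfAdjoint_hZero hh hk
  set S := sqrtOp (hZero h k)
  obtain ⟨C, hC⟩ := hA2.bounded
  have hmono : ∀ {T : H →L[ℂ] H} {C : ℝ}, HomBoundedBy (hZero h k) T C →
      HomBoundedBy (hZero h k) T |C| := fun hT u => by
    obtain ⟨v, hv, hvn⟩ := hT u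
    exact ⟨v, hv, hvn.trans (by gcongr; exact le_abs_self _)⟩
  obtain ⟨K, -, hK⟩ := (hmono hC).exists_clm hA hpos (abs_nonneg _)
  have key : ∀ (z : ℂ) (C : ℝ), z.im ≠ 0 → HomBoundedBy (hZero h k) (kRes k z) C →
      IsUnit (K - z • (1 : H →L[ℂ] H)) ∧ ‖kRes K z‖ ≤ |C| ∧
        ∀ u : S.domain, ∃ v : S.domain, (v : H) = kRes k z u ∧ S v = kRes K z (S u) := by
    intro z C hz hT
    obtain ⟨B, hBn, hB⟩ := (hmono hT).exists_clm hA hpos (abs_nonneg _)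
    have hu := isUnit_sub_smul hk hz
    have e1 : ∀ u, k (kRes k z u) - z • kRes k z u = u := fun u => by
      have := DFunLike.congr_fun (Ring.mul_inverse_cancel _ hu) u
      simpa [kRes] using this
    have e2 : ∀ u, kRes k z (k u - z • u) = u := fun u => by
      have := DFunLike.congr_fun (Ring.inverse_mul_cancel _ hu) u
      simpa [kRes] using this
    -- `B`, induced by `(k - z)⁻¹`, inverts `K - z`: both products are computed on the dense range
    -- of `h₀^{1/2}`.
    have h1 : (K - z • (1 : H →L[ℂ] H)) * B = 1 := by
      refine eq_of_forall_sqrtOp hA hpos fun u => ?_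
      obtain ⟨v, hv, hvS⟩ := hB u
      obtain ⟨y, hy, hyS⟩ := hK v
      have : y - z • v = u := Subtype.ext (by
        rw [Submodule.coe_sub, Submodule.coe_smul, hy, hv, e1])
      rw [mul_apply_eq_comp, ← hvS, sub_apply, smul_apply, one_apply_eq_self, one_apply_eq_self,
        ← hyS, ← LinearPMap.map_smul, ← LinearPMap.map_sub, this]
    have h2 : B * (K - z • (1 : H →L[ℂ] H)) = 1 := by
      refine eq_of_forall_sqrtOp hA hpos fun u => ?_
      obtain ⟨y, hy, hyS⟩ := hK u
      obtain ⟨v, hv, hvS⟩ := hB (y - z • u)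
      have : v = u := Subtype.ext (by
        rw [hv, Submodule.coe_sub, Submodule.coe_smul, hy, e2])
      rw [mul_apply_eq_comp, sub_apply, smul_apply, one_apply_eq_self, ← hyS, ← LinearPMap.map_smul, ← LinearPMap.map_sub,
        ← hvS, this]
    have hunit : IsUnit (K - z • (1 : H →L[ℂ] H)) := isUnit_iff_exists.2 ⟨B, h1, h2⟩
    have h3 : kRes K z = B := by
      have h4 := Ring.inverse_mul_cancel _ hunit
      calc kRes K z = kRes K z * ((K - z • (1 : H →L[ℂ] H)) * B) := by rw [h1, mul_one]
        _ = B := by rw [← mul_assoc, kRes, h4, one_mul]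
    rw [h3]
    exact ⟨hunit, hBn, hB⟩
  refine ⟨K, hK, fun z hz => ?_, fun z₀ => ?_⟩
  · obtain ⟨C, hC⟩ := hA2.nonreal z hz
    exact ⟨(key z C hz hC).1, (key z C hz hC).2.2⟩
  · by_cases hz₀ : z₀.im = 0
    · obtain ⟨C, n, hn, hCn⟩ := hA2.near_real
      refine ⟨|C|, ⌈n⌉₊, abs_nonneg _, ?_⟩
      have hlt : ∀ᶠ z in 𝓝[≠] z₀, |z.im| < 1 := by
        refine mem_nhdsWithin_of_mem_nhds ((isOpen_lt (by fun_prop) continuous_const).mem_nhds ?_)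
        simp [hz₀]
      filter_upwards [hlt] with z hz hzn
      refine (key z _ hzn (hCn z hzn hz.le)).2.1.trans ?_
      have hpos' : 0 < |z.im| := abs_pos.2 hzn
      rw [abs_mul, abs_of_nonneg (Real.rpow_nonneg (abs_nonneg _) _), Real.rpow_neg (abs_nonneg _),
        ← Real.inv_rpow (abs_nonneg _)]
      refine mul_le_mul_of_nonneg_left ?_ (abs_nonneg _)
      calc |z.im|⁻¹ ^ n ≤ gauge z₀ z ^ n :=
            Real.rpow_le_rpow (by positivity) (inv_im_le_gauge _ _) hn.le
        _ ≤ gauge z₀ z ^ ((⌈n⌉₊ : ℕ) : ℝ) :=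
            Real.rpow_le_rpow_of_exponent_le (one_le_gauge _ _) (Nat.le_ceil n)
        _ = _ := Real.rpow_natCast _ _
    · obtain ⟨C, hC⟩ := hA2.nonreal z₀ hz₀
      have hu := (key z₀ C hz₀ hC).1
      refine ContinuousAt.temperedAt ?_
      have h1 : ContinuousAt Ring.inverse (K - z₀ • (1 : H →L[ℂ] H)) := by
        obtain ⟨a, ha⟩ := hu
        rw [← ha]
        exact NormedRing.inverse_continuousAt a
      exact ContinuousAt.comp (f := fun z : ℂ => K - z • (1 : H →L[ℂ] H)) h1 (by fun_prop)

/-- The graph of the bounded operator `K` is closed and contains the generators; the density of the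
range of `h₀^{1/2}` gives the converse inclusion. -/
lemma mem_kHomGraph_iff (hh : IsSelfAdjoint h) (hk : IsSelfAdjoint k) (hpos : OpPos (hZero h k))
    {K : H →L[ℂ] H}
    (hK : ∀ u : (sqrtOp (hZero h k)).domain, ∃ v : (sqrtOp (hZero h k)).domain,
        (v : H) = k u ∧ sqrtOp (hZero h k) v = K (sqrtOp (hZero h k) u)) (a b : H) :
    (a, b) ∈ kHomGraph h k ↔ b = K a := by
  have hA := isSelfAdjoint_hZero hh hk
  set S := sqrtOp (hZero h k)
  constructor
  · intro hab
    let g : Submodule ℂ (H × H) := LinearMap.ker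
      ((K ∘L ContinuousLinearMap.fst ℂ H H - ContinuousLinearMap.snd ℂ H H : H × H →L[ℂ] H) :
        H × H →ₗ[ℂ] H)
    have hg : kHomGraph h k ≤ g := by
      refine Submodule.topologicalClosure_minimal _ (Submodule.span_le.2 ?_)
        (ContinuousLinearMap.isClosed_ker _)
      rintro _ ⟨u, v, hv, rfl⟩
      obtain ⟨v', hv', hvS⟩ := hK u
      obtain rfl : v' = v := Subtype.ext (hv'.trans hv.symm)
      change K (S u) - S v' = 0
      rw [hvS, sub_self]
    have h1 : K a - b = 0 := hg hab
    exact (sub_eq_zero.1 h1).symm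
  · rintro rfl
    have hd := denseRange_sqrtOp hA hpos
    refine hd.induction_on (p := fun a => (a, K a) ∈ kHomGraph h k) a ?_ fun u => ?_
    · exact (Submodule.isClosed_topologicalClosure _).preimage (by fun_prop)
    · obtain ⟨v, hv, hvS⟩ := hK u
      refine Submodule.le_topologicalClosure _ (Submodule.subset_span ⟨u, v, hv, ?_⟩)
      exact Prod.ext rfl hvS.symm

end Homogeneous

/-! ### Unitary coordinates on the homogeneous energy space -/

section Coordinates

lemma homCoord_coe (u : EnergySpace h k) : homCoord h k (u : HomEnergySpace h k) =
    energyMap h k u :=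
  ContinuousLinearMap.extend_eq _ (UniformSpace.Completion.denseRange_coe)
    (UniformSpace.Completion.isUniformInducing_coe _) u

lemma norm_homCoord (p : HomEnergySpace h k) : ‖homCoord h k p‖ = ‖p‖ := by
  refine UniformSpace.Completion.induction_on p
    (isClosed_eq (by fun_prop) (by fun_prop)) fun u => ?_
  rw [homCoord_coe, UniformSpace.Completion.norm_coe]
  rfl

lemma denseRange_homCoord (hh : IsSelfAdjoint h) (hk : IsSelfAdjoint k)
    (hpos : OpPos (hZero h k)) : DenseRange (homCoord h k) := by
  have h2 : DenseRange (Prod.map (sqrtOp (hZero h k)).toFun (id : H → H)) :=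
    (denseRange_sqrtOp (isSelfAdjoint_hZero hh hk) hpos).prodMap denseRange_id
  have h3 := (WithLp.prodContinuousLinearEquiv 2 ℂ H H).symm.surjective.denseRange.comp h2
    (WithLp.prodContinuousLinearEquiv 2 ℂ H H).symm.continuous
  refine h3.mono ?_
  rintro _ ⟨⟨u, v⟩, rfl⟩
  let u' : EnergySpace h k := (u, v + k (u : H))
  refine ⟨(u' : HomEnergySpace h k), (homCoord_coe u').trans ?_⟩
  have h4 : v + k (u : H) - k (u : H) = v := add_sub_cancel_right _ _
  exact congrArg (fun y => WithLp.toLp 2 (sqrtOp (hZero h k) u, y)) h4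

lemma exists_homCoord_inverse (hh : IsSelfAdjoint h) (hk : IsSelfAdjoint k)
    (hpos : OpPos (hZero h k)) : ∃ J : WithLp 2 (H × H) →L[ℂ] HomEnergySpace h k,
      (∀ p, J (homCoord h k p) = p) ∧ ∀ q, homCoord h k (J q) = q := by
  let e : HomEnergySpace h k →ₗᵢ[ℂ] WithLp 2 (H × H) :=
    { toLinearMap := (homCoord h k).toLinearMap
      norm_map' := norm_homCoord }
  have hsurj : Function.Surjective e := by
    have h1 : IsClosed (Set.range e) := e.isometry.isClosedEmbedding.isClosed_range
    have h2 : closure (Set.range e) = Set.univ :=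
      (denseRange_homCoord hh hk hpos).closure_range
    rw [h1.closure_eq] at h2
    exact Set.range_eq_univ.1 h2
  let f := LinearIsometryEquiv.ofSurjective e hsurj
  exact ⟨(f.symm : WithLp 2 (H × H) →L[ℂ] HomEnergySpace h k), fun p => f.symm_apply_apply p,
    fun q => f.apply_symm_apply q⟩

/-- The homogeneous Klein-Gordon operator in coordinates. -/
lemma homKG_iff (hh : IsSelfAdjoint h) (hk : IsSelfAdjoint k) (hpos : OpPos (hZero h k))
    {K : H →L[ℂ] H}
    (hK : ∀ u : (sqrtOp (hZero h k)).domain, ∃ v : (sqrtOp (hZero h k)).domain,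
        (v : H) = k u ∧ sqrtOp (hZero h k) v = K (sqrtOp (hZero h k) u))
    (p q : HomEnergySpace h k) :
    (∃ u : (homKG h k).domain, (u : HomEnergySpace h k) = p ∧ homKG h k u = q) ↔
      ∃ a b : (sqrtOp (hZero h k)).domain,
        (a : H) = (homCoord h k p).fst ∧ (b : H) = (homCoord h k p).snd ∧
        (homCoord h k q).fst = K a + sqrtOp (hZero h k) b ∧
        (homCoord h k q).snd = sqrtOp (hZero h k) a + k b := by
  have hmem : ∀ p q, (p, q) ∈ homKGGraph h k ↔ ∃ a b : (sqrtOp (hZero h k)).domain,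
        (a : H) = (homCoord h k p).fst ∧ (b : H) = (homCoord h k p).snd ∧
        (homCoord h k q).fst = K a + sqrtOp (hZero h k) b ∧
        (homCoord h k q).snd = sqrtOp (hZero h k) a + k b := fun p q => by
    refine exists₂_congr fun a b => and_congr Iff.rfl (and_congr Iff.rfl (and_congr ?_ Iff.rfl))
    rw [mem_kHomGraph_iff hh hk hpos hK, sub_eq_iff_eq_add]
  have hg : (homKG h k).graph = homKGGraph h k := by
    refine Submodule.toLinearPMap_graph_eq _ ?_
    rintro ⟨p, q⟩ hpq hp
    obtain rfl : p = 0 := hp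
    obtain ⟨a, b, ha, hb, h1, h2⟩ := (hmem _ _).1 hpq
    rw [map_zero] at ha hb
    obtain rfl : a = 0 := Subtype.ext ha
    obtain rfl : b = 0 := Subtype.ext hb
    simp only [LinearPMap.map_zero, Submodule.coe_zero, map_zero, add_zero] at h1 h2
    have h3 : homCoord h k q = 0 := (WithLp.equiv 2 (H × H)).injective (Prod.ext h1 h2)
    have h4 := norm_homCoord q
    rw [h3, norm_zero] at h4
    exact norm_eq_zero.1 h4.symm
  rw [← hmem, ← hg, LinearPMap.mem_graph_iff]

end Coordinates

/-! ### The resolvent of the homogeneous Klein-Gordon operator -/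

section Resolvent

variable {U : Set ℂ} {z₀ : ℂ}

lemma TemperedAt.comp_const {E : Type*} [NormedAddCommGroup E] [NormedSpace ℂ E]
    {F : ℂ → H →L[ℂ] H} (h : TemperedAt U F z₀) (X : H →L[ℂ] E) (Y : E →L[ℂ] H) :
    TemperedAt U (fun z => X ∘L F z ∘L Y) z₀ := by
  obtain ⟨C, m, hC, h⟩ := h
  refine ⟨‖X‖ * C * ‖Y‖, m, by positivity, ?_⟩
  filter_upwards [h] with z hz hzU
  calc ‖X ∘L F z ∘L Y‖ ≤ ‖X‖ * (‖F z‖ * ‖Y‖) :=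
        (ContinuousLinearMap.opNorm_comp_le _ _).trans
          (by gcongr; exact ContinuousLinearMap.opNorm_comp_le _ _)
    _ ≤ ‖X‖ * ((C * gauge z₀ z ^ m) * ‖Y‖) := by
        have := hz hzU
        gcongr
    _ = _ := by ring

set_option maxHeartbeats 1000000 in
/-- The resolvent of the homogeneous Klein-Gordon operator near every point. -/
theorem exists_homKG_resolvent (hh : IsSelfAdjoint h) (hk : IsSelfAdjoint k)
    (hpos : OpPos (hZero h k)) (hA2 : CondA2 h k) {P : ℂ → H →L[ℂ] H}
    (hP : ∀ z₀ : ℂ, (∀ᶠ z in 𝓝[≠] z₀, z.im ≠ 0 → IsInverseOf h (pencil k z) (P z)) ∧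
      TemperedAt nonreal P z₀) (z₀ : ℂ) :
    (∀ᶠ z in 𝓝[≠] z₀, z.im ≠ 0 → z ∈ resolventPoints (homKG h k)) ∧
      TemperedAt nonreal (res (homKG h k)) z₀ := by
  have hA := isSelfAdjoint_hZero hh hk
  obtain ⟨K, hK, hKz, hKt⟩ := exists_kHat hh hk hpos hA2
  obtain ⟨J, hJ1, hJ2⟩ := exists_homCoord_inverse hh hk hpos
  obtain ⟨G, N, hp⟩ := exists_isSqrtPair hA hpos.1
  set S := sqrtOp (hZero h k)
  -- As the pencil is `h₀ - (k - z)²`, one has `(h₀ + 1) P z = 1 + V z P z`; therefore `SP z` is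
  -- `h₀^{1/2} P z` written with bounded operators.
  let V : ℂ → H →L[ℂ] H := fun z =>
    (k - z • (1 : H →L[ℂ] H)) * (k - z • (1 : H →L[ℂ] H)) + 1
  let SP : ℂ → H →L[ℂ] H := fun z => N + N * V z * P z
  let ι₁ : H →L[ℂ] HomEnergySpace h k := J ∘L
    ((WithLp.prodContinuousLinearEquiv 2 ℂ H H).symm : H × H →L[ℂ] WithLp 2 (H × H)) ∘L
      ContinuousLinearMap.inl ℂ H H
  let ι₂ : H →L[ℂ] HomEnergySpace h k := J ∘L
    ((WithLp.prodContinuousLinearEquiv 2 ℂ H H).symm : H × H →L[ℂ] WithLp 2 (H × H)) ∘L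
      ContinuousLinearMap.inr ℂ H H
  let π₁ : HomEnergySpace h k →L[ℂ] H := WithLp.fstL 2 ℂ H H ∘L homCoord h k
  let π₂ : HomEnergySpace h k →L[ℂ] H := WithLp.sndL 2 ℂ H H ∘L homCoord h k
  -- The system is `(K - z) a + S b = q₁`, `S a + (k - z) b = q₂`. Direct elimination would need
  -- `S⁻¹ q₁`, which need not lie in `H`. Instead put `f = (K - z)⁻¹ q₁` and `b = (k - z) v` with `S
  -- v = f - a`, which settles the first equation. With `v = N f + p` and `a = G f - S p` the second
  -- becomes: pencil applied to `p` equals `V N f - q₂`.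
  let R : ℂ → HomEnergySpace h k →L[ℂ] HomEnergySpace h k := fun z =>
    ((ι₁ ∘L ((G - SP z * V z * N) * kRes K z) ∘L π₁ + ι₁ ∘L SP z ∘L π₂) +
      ι₂ ∘L ((k - z • (1 : H →L[ℂ] H)) * (N + P z * V z * N) * kRes K z) ∘L π₁) +
      ι₂ ∘L (-((k - z • (1 : H →L[ℂ] H)) * P z)) ∘L π₂
  have hRt : TemperedAt nonreal R z₀ := by
    have hPt := (hP z₀).2
    have hKt := hKt z₀
    have c1 : ∀ B : H →L[ℂ] H, TemperedAt nonreal (fun _ => B) z₀ := fun B =>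
      ContinuousAt.temperedAt continuousAt_const
    have c2 : TemperedAt nonreal (fun z => k - z • (1 : H →L[ℂ] H)) z₀ :=
      ContinuousAt.temperedAt (by fun_prop)
    have c3 : TemperedAt nonreal V z₀ := (c2.mul c2).add (c1 1)
    have c4 : TemperedAt nonreal SP z₀ := (c1 N).add (((c1 N).mul c3).mul hPt)
    exact ((((((c1 G).sub ((c4.mul c3).mul (c1 N))).mul hKt).comp_const ι₁ π₁).add
      (c4.comp_const ι₁ π₂)).add (((c2.mul ((c1 N).add ((hPt.mul c3).mul (c1 N)))).mul
        hKt).comp_const ι₂ π₁)).add ((c2.mul hPt).neg.comp_const ι₂ π₂)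
  have hres : ∀ᶠ z in 𝓝[≠] z₀, z.im ≠ 0 → IsResolventAt (homKG h k) z (R z) := by
    filter_upwards [(hP z₀).1] with z hPz hz
    obtain ⟨hPr, hPl⟩ := hPz hz
    obtain ⟨hKu, hKv⟩ := hKz z hz
    have hku := isUnit_sub_smul hk hz
    set T := k - z • (1 : H →L[ℂ] H) with hT
    have hpk : ∀ u : h.domain, h u + pencil k z u = (hZero h k) u - T (T u) := fun u => by
      have h1 : (hZero h k) u = (k * k) u + h u := addBounded_apply (A := h) (k * k) u
      rw [h1, hT, pencil]
      simp only [sub_apply, smul_apply, one_apply_eq_self, mul_apply_eq_comp, map_sub, map_smul]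
      module
    have hTS : ∀ v : S.domain, ∃ b : S.domain, (b : H) = T v ∧
        S b = K (S v) - z • S v := fun v => by
      obtain ⟨y, hy, hyS⟩ := hK v
      refine ⟨y - z • v, ?_, ?_⟩
      · rw [Submodule.coe_sub, Submodule.coe_smul, hy, hT, sub_apply, smul_apply,
          one_apply_eq_self]
      · rw [LinearPMap.map_sub, LinearPMap.map_smul, hyS]
    have hR : ∀ q, homCoord h k (R z q) = WithLp.toLp 2
        (G (kRes K z (π₁ q)) - SP z (V z (N (kRes K z (π₁ q))) - π₂ q),
          T (N (kRes K z (π₁ q)) + P z (V z (N (kRes K z (π₁ q))) - π₂ q))) := fun q => by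
      have h1 : R z q = J (WithLp.toLp 2
        (G (kRes K z (π₁ q)) - SP z (V z (N (kRes K z (π₁ q))) - π₂ q),
          T (N (kRes K z (π₁ q)) + P z (V z (N (kRes K z (π₁ q))) - π₂ q)))) := by
        have h2 : ∀ x y : H, J (WithLp.toLp 2 (x, y)) = ι₁ x + ι₂ y := fun x y => by
          have h3 : WithLp.toLp 2 (x, y) = WithLp.toLp 2 (x, 0) + WithLp.toLp 2 (0, y) := by
            rw [← WithLp.toLp_add, Prod.mk_add_mk, add_zero, zero_add]
          rw [h3, map_add]
          rfl
        have h3 : R z = ((ι₁ ∘L ((G - SP z * V z * N) * kRes K z) ∘L π₁ + ι₁ ∘L SP z ∘L π₂) +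
          ι₂ ∘L (T * (N + P z * V z * N) * kRes K z) ∘L π₁) + ι₂ ∘L (-(T * P z)) ∘L π₂ := rfl
        rw [h2, h3]
        simp only [add_apply, ContinuousLinearMap.comp_apply, mul_apply_eq_comp, sub_apply,
          neg_apply, map_sub, map_add, map_neg]
        abel
      rw [h1, hJ2]
    have hright : ∀ q, ∃ u : (homKG h k).domain, (u : HomEnergySpace h k) = R z q ∧
        homKG h k u - z • (u : HomEnergySpace h k) = q := fun q => by
      have hRq := hR q
      set f := kRes K z (π₁ q) with hf
      set y := V z (N f) - π₂ q with hy
      clear_value y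
      obtain ⟨u, hu, huy⟩ := hPr y
      rw [hpk] at huy
      obtain ⟨s₁, hs₁, hs₁S⟩ := hp.exists_sqrt f
      obtain ⟨s₂, hs₂, hs₂S⟩ := hp.exists_sqrt' f
      obtain ⟨b', c', hb', hc', hcS⟩ := exists_sqrtOp hA hpos.1 u
      have hVu : V z u = T (T u) + u := rfl
      have hSP : S b' = SP z y := by
        obtain ⟨s, hs, hsS⟩ := hp.exists_sqrt ((hZero h k) u + (1 : H →L[ℂ] H) u)
        have h1 := hp.inverse.2 u
        obtain rfl : s = b' := Subtype.ext (hs.trans (h1.trans hb'.symm))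
        have h2 : (hZero h k) u + (1 : H →L[ℂ] H) u = y + V z (P z y) := by
          rw [← hu, hVu, ← huy, one_apply_eq_self]
          abel
        rw [hsS, h2, map_add]
        rfl
      obtain ⟨b, hb, hbS⟩ := hTS (s₂ + b')
      have hsum : ((s₂ + b' : S.domain) : H) = N f + P z y := by
        rw [Submodule.coe_add, hs₂, hb', hu]
      rw [hsum] at hb
      have hSsum : S (s₂ + b') = f - (G f - SP z y) := by
        rw [LinearPMap.map_add, hs₂S, hSP]
        abel
      have ha : ((s₁ - c' : S.domain) : H) = G f - SP z y := by
        rw [Submodule.coe_sub, hs₁, hc', hSP]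
      have hKf : K f - z • f = π₁ q := by
        have h1 := DFunLike.congr_fun (Ring.mul_inverse_cancel _ hKu) (π₁ q)
        rw [mul_apply_eq_comp, sub_apply, smul_apply, one_apply_eq_self, one_apply_eq_self] at h1
        exact h1
      have hmem : ∃ u : (homKG h k).domain, (u : HomEnergySpace h k) = R z q ∧
          homKG h k u = q + z • R z q := by
        rw [homKG_iff hh hk hpos hK]
        refine ⟨s₁ - c', b, by rw [ha, hRq]; rfl, by rw [hb, hRq]; rfl, ?_, ?_⟩
        · rw [map_add, map_smul, hRq, hbS, hSsum, ha]
          change π₁ q + z • (G f - SP z y) = _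
          generalize G f - SP z y = g
          rw [← hKf, map_sub]
          module
        · rw [map_add, map_smul, hRq, LinearPMap.map_sub, hs₁S, hcS, hb]
          change π₂ q + z • T (N f + P z y) = _
          have h1 : (hZero h k) u = y + T (T (P z y)) := by
            rw [← hu, ← huy, sub_add_cancel]
          have h2 : ∀ x, k x = T x + z • x := fun x => by
            rw [hT, sub_apply, smul_apply, one_apply_eq_self, sub_add_cancel]
          have h3 : V z (N f) = T (T (N f)) + N f := rfl
          rw [h1, hy, h3, h2, map_add, map_add]
          module
      obtain ⟨u', hu', hu'q⟩ := hmem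
      exact ⟨u', hu', by rw [hu'q, hu', add_sub_cancel_right]⟩
    refine ⟨hright, fun p => ?_⟩
    obtain ⟨p', hp', hpq⟩ := hright (homKG h k p - z • (p : HomEnergySpace h k))
    rw [← hp']
    have hd : homKG h k (p' - p) = z • ((p' - p : (homKG h k).domain) : HomEnergySpace h k) := by
      rw [LinearPMap.map_sub, Submodule.coe_sub, smul_sub]
      rw [sub_eq_iff_eq_add] at hpq
      rw [hpq]
      abel
    obtain ⟨a, b, ha, hb, h1, h2⟩ := (homKG_iff hh hk hpos hK _ _).1 ⟨p' - p, rfl, rfl⟩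
    rw [hd, map_smul, WithLp.smul_fst, ← ha] at h1
    rw [hd, map_smul, WithLp.smul_snd, ← hb] at h2
    -- For a null vector `(a, b)`, the element `v = (k - z)⁻¹ b` satisfies `S v = -a`, hence `h₀ v =
    -- -S a = (k - z)² v`: the pencil annihilates `v`.
    obtain ⟨v, hv, hvS⟩ := hKv b
    have hva : S v = -(a : H) := by
      have h3 : S b = -((K - z • (1 : H →L[ℂ] H)) a) := by
        rw [sub_apply, smul_apply, one_apply_eq_self, h1]
        abel
      rw [hvS, h3, map_neg]
      exact congrArg Neg.neg (DFunLike.congr_fun (Ring.inverse_mul_cancel _ hKu) (a : H))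
    have hTv : T v = b := by
      rw [hv]
      exact DFunLike.congr_fun (Ring.mul_inverse_cancel _ hku) (b : H)
    obtain ⟨u, hu, huS⟩ := exists_of_sqrtOp_mem hA hpos.1 (s := v) (t := -a) hva.symm
    have hu0 : (u : H) = 0 := by
      have h3 := hPl u
      rw [hpk u, huS, hu, hTv, LinearPMap.map_neg] at h3
      have h4 : -S a - T b = 0 := by
        rw [hT, sub_apply, smul_apply, one_apply_eq_self, h2]
        abel
      rw [h4, map_zero] at h3
      exact hu.trans h3.symm
    have hv0 : v = 0 := Subtype.ext (hu.symm.trans hu0)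
    have hb0 : (b : H) = 0 := by rw [← hTv, hv0, Submodule.coe_zero, map_zero]
    have ha0 : (a : H) = 0 := by
      rw [hv0, LinearPMap.map_zero] at hva
      exact neg_eq_zero.1 hva.symm
    have h3 : homCoord h k (p' - p : (homKG h k).domain) = 0 :=
      (WithLp.equiv 2 (H × H)).injective (Prod.ext (ha.symm.trans ha0) (hb.symm.trans hb0))
    have h4 := norm_homCoord ((p' - p : (homKG h k).domain) : HomEnergySpace h k)
    rw [h3, norm_zero] at h4
    exact sub_eq_zero.1 (norm_eq_zero.1 h4.symm)
  refine ⟨?_, hRt.mono_norm ?_⟩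
  · filter_upwards [hres] with z hz hzn using ⟨_, hz hzn⟩
  · filter_upwards [hres] with z hz hzn
    rw [(hz hzn).res_eq]

end Resolvent

/-! ### From local bounds to a tempered resolvent -/

section Tempered

variable {E : Type*} [NormedAddCommGroup E] [NormedSpace ℂ E] {A : E →ₗ.[ℂ] E} {z₀ : ℂ}

/-- Nonreal points are resolvent points or eigenvalues, and the resolvent has at most polynomial
growth at the real axis. -/
structure IsTempered (A : E →ₗ.[ℂ] E) : Prop where
  mem_or_mem : ∀ z : ℂ, z.im ≠ 0 → z ∈ resolventPoints A ∨ z ∈ complexEigenvalues A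
  bound : ∀ r : ℝ, ∃ δ : ℝ, 0 < δ ∧ ∃ (C : ℝ) (m : ℕ), 0 ≤ C ∧ ∀ z : ℂ, |z.re| ≤ r → z.im ≠ 0 →
    |z.im| < δ → z ∈ resolventPoints A ∧ ‖res A z‖ ≤ C * |z.im|⁻¹ ^ m

lemma notMem_complexEigenvalues {z : ℂ} (hz : z ∈ resolventPoints A) :
    z ∉ complexEigenvalues A := by
  rintro ⟨_, u, hu, huz⟩
  obtain ⟨T, hT⟩ := hz
  have h := hT.2 u
  rw [huz, sub_self, map_zero] at h
  exact hu h.symm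

/-- An operator with a resolvent is closed. -/
lemma exists_of_tendsto {z₁ : ℂ} (h₁ : z₁ ∈ resolventPoints A) {ι : Type*} {l : Filter ι}
    [l.NeBot] {u : ι → A.domain} {x y : E} (hx : Filter.Tendsto (fun i => (u i : E)) l (𝓝 x))
    (hy : Filter.Tendsto (fun i => A (u i)) l (𝓝 y)) : ∃ a : A.domain, (a : E) = x ∧ A a = y := by
  obtain ⟨T, hT⟩ := h₁
  have h1 : Filter.Tendsto (fun i => T (A (u i) - z₁ • (u i : E))) l (𝓝 (T (y - z₁ • x))) :=
    (T.continuous.tendsto _).comp (hy.sub (hx.const_smul z₁))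
  simp only [hT.2] at h1
  have h2 := tendsto_nhds_unique h1 hx
  obtain ⟨a, ha, haA⟩ := hT.1 (y - z₁ • x)
  rw [h2] at ha
  rw [ha] at haA
  exact ⟨a, ha, sub_left_injective haA⟩

/-- Induction on the order of the pole. A bounded resolvent has a limit, which is a resolvent at
`z₀` because `A` is closed. Otherwise let `T` be the limit of `(z - z₀)^{m+1} R(z)`: if `T = 0` the
order drops; if `T v ≠ 0`, then `T v` is an eigenvector, since `(A - z)(z - z₀)^{m+1} R(z) v = (z -
z₀)^{m+1} v` tends to `0`. -/
lemma mem_resolventPoints_or_eigenvalue [CompleteSpace E]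
    (h : ∀ᶠ z in 𝓝[≠] z₀, z ∈ resolventPoints A) (m : ℕ) {C : ℝ}
    (hb : ∀ᶠ z in 𝓝[≠] z₀, ‖res A z‖ ≤ C * ‖z - z₀‖⁻¹ ^ m) :
    z₀ ∈ resolventPoints A ∨ ∃ u : A.domain, (u : E) ≠ 0 ∧ A u = z₀ • (u : E) := by
  induction m generalizing C with
  | zero =>
    left
    simp only [pow_zero, mul_one] at hb
    have hd : ∀ᶠ z in 𝓝[≠] z₀, DifferentiableAt ℂ (res A) z :=
      h.mono fun z hz => (hasDerivAt_res hz).differentiableAt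
    have hlim := Complex.tendsto_limUnder_of_differentiable_on_punctured_nhds_of_bounded_under hd
      ⟨C + ‖res A z₀‖, Filter.eventually_map.2 (hb.mono fun z hz =>
        (norm_sub_le _ _).trans (by linarith))⟩
    set T := Filter.limUnder (𝓝[≠] z₀) (res A)
    have hid : Filter.Tendsto (fun z : ℂ => z) (𝓝[≠] z₀) (𝓝 z₀) := nhdsWithin_le_nhds
    have happ : ∀ v, Filter.Tendsto (fun z => res A z v) (𝓝[≠] z₀) (𝓝 (T v)) := fun v =>
      ((ContinuousLinearMap.apply ℂ E v).continuous.tendsto _).comp hlim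
    obtain ⟨z₁, hz₁⟩ := h.exists
    refine ⟨T, fun v => ?_, fun u => ?_⟩
    · have hex : ∀ z, ∃ u : A.domain, z ∈ resolventPoints A →
          (u : E) = res A z v ∧ A u - z • (u : E) = v := fun z => by
        by_cases hz : z ∈ resolventPoints A
        · obtain ⟨u, hu⟩ := (isResolventAt_res hz).1 v
          exact ⟨u, fun _ => hu⟩
        · exact ⟨0, fun h => absurd h hz⟩
      choose u hu using hex
      have h1 : Filter.Tendsto (fun z => (u z : E)) (𝓝[≠] z₀) (𝓝 (T v)) :=
        (happ v).congr' (h.mono fun z hz => (hu z hz).1.symm)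
      have h2 : Filter.Tendsto (fun z => A (u z)) (𝓝[≠] z₀) (𝓝 (v + z₀ • T v)) := by
        refine (tendsto_const_nhds.add (hid.smul h1)).congr' (h.mono fun z hz => ?_)
        have := (hu z hz).2
        rw [sub_eq_iff_eq_add] at this
        exact this.symm
      obtain ⟨a, ha, haA⟩ := exists_of_tendsto hz₁ h1 h2
      exact ⟨a, ha, by rw [haA, ha, add_sub_cancel_right]⟩
    · have h1 : Filter.Tendsto (fun z => res A z (A u - z • (u : E))) (𝓝[≠] z₀)
          (𝓝 (T (A u - z₀ • (u : E)))) :=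
        Filter.Tendsto.comp ((isBoundedBilinearMap_apply (𝕜 := ℂ) (E := E) (F := E)).continuous.tendsto
          (T, A u - z₀ • (u : E))) (Filter.Tendsto.prodMk_nhds hlim
            (tendsto_const_nhds.sub (hid.smul_const _)))
      have h2 : Filter.Tendsto (fun z => res A z (A u - z • (u : E))) (𝓝[≠] z₀) (𝓝 (u : E)) :=
        tendsto_const_nhds.congr' (h.mono fun z hz => ((isResolventAt_res hz).2 u).symm)
      exact tendsto_nhds_unique h1 h2
  | succ m ih =>
    let g : ℂ → E →L[ℂ] E := fun z => (z - z₀) ^ (m + 1) • res A z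
    have hgb : ∀ᶠ z in 𝓝[≠] z₀, ‖g z‖ ≤ C := by
      filter_upwards [hb, self_mem_nhdsWithin] with z hz hne
      have hpos : 0 < ‖z - z₀‖ := norm_pos_iff.2 (sub_ne_zero.2 hne)
      calc ‖g z‖ = ‖z - z₀‖ ^ (m + 1) * ‖res A z‖ := by rw [norm_smul, norm_pow]
        _ ≤ ‖z - z₀‖ ^ (m + 1) * (C * ‖z - z₀‖⁻¹ ^ (m + 1)) := by gcongr
        _ = C := by rw [inv_pow]; field_simp
    have hgd : ∀ᶠ z in 𝓝[≠] z₀, DifferentiableAt ℂ g z :=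
      h.mono fun z hz => by
        have h1 : DifferentiableAt ℂ (fun y : ℂ => (y - z₀) ^ (m + 1)) z := by fun_prop
        exact h1.fun_smul (hasDerivAt_res hz).differentiableAt
    have hlim := Complex.tendsto_limUnder_of_differentiable_on_punctured_nhds_of_bounded_under hgd
      ⟨C + ‖g z₀‖, Filter.eventually_map.2 (hgb.mono fun z hz =>
        (norm_sub_le _ _).trans (by linarith))⟩
    set T := Filter.limUnder (𝓝[≠] z₀) g with hT
    have hid : Filter.Tendsto (fun z : ℂ => z) (𝓝[≠] z₀) (𝓝 z₀) := nhdsWithin_le_nhds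
    obtain ⟨z₁, hz₁⟩ := h.exists
    by_cases hT0 : T = 0
    · have hset : {z | z ≠ z₀ → DifferentiableAt ℂ g z ∧ ‖g z‖ ≤ C} ∈ 𝓝 z₀ :=
        eventually_nhdsWithin_iff.1 (hgd.and hgb)
      have hdiff := Complex.differentiableOn_update_limUnder_of_bddAbove (f := g) hset
        (fun z hz => (hz.1 hz.2).1.differentiableWithinAt) ⟨C, by
          rintro _ ⟨z, hz, rfl⟩
          exact (hz.1 hz.2).2⟩
      have hd0 := (hdiff.differentiableAt hset).hasFDerivAt.isBigO_sub
      obtain ⟨C', hC'⟩ := hd0.bound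
      refine ih (C := C') ?_
      filter_upwards [nhdsWithin_le_nhds hC', self_mem_nhdsWithin] with z hz hne
      have hpos : 0 < ‖z - z₀‖ := norm_pos_iff.2 (sub_ne_zero.2 hne)
      rw [Function.update_of_ne hne, Function.update_self, ← hT, hT0, sub_zero, norm_smul, norm_pow]
        at hz
      rw [inv_pow, ← div_eq_mul_inv, le_div_iff₀ (by positivity)]
      refine le_of_mul_le_mul_right ?_ hpos
      calc ‖res A z‖ * ‖z - z₀‖ ^ m * ‖z - z₀‖ = ‖z - z₀‖ ^ (m + 1) * ‖res A z‖ := by ring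
        _ ≤ _ := hz
    · right
      obtain ⟨v, hv⟩ : ∃ v, T v ≠ 0 := by
        by_contra! h0
        exact hT0 (ContinuousLinearMap.ext h0)
      have hex : ∀ z, ∃ u : A.domain, z ∈ resolventPoints A →
          (u : E) = res A z v ∧ A u - z • (u : E) = v := fun z => by
        by_cases hz : z ∈ resolventPoints A
        · obtain ⟨u, hu⟩ := (isResolventAt_res hz).1 v
          exact ⟨u, fun _ => hu⟩
        · exact ⟨0, fun h => absurd h hz⟩
      choose u hu using hex
      have h1 : Filter.Tendsto (fun z => (((z - z₀) ^ (m + 1) • u z : A.domain) : E)) (𝓝[≠] z₀)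
          (𝓝 (T v)) := by
        refine Filter.Tendsto.congr' (h.mono fun z hz => ?_)
          (((ContinuousLinearMap.apply ℂ E v).continuous.tendsto _).comp hlim)
        change _ = (((z - z₀) ^ (m + 1) • u z : A.domain) : E)
        rw [Submodule.coe_smul, (hu z hz).1]
        rfl
      have h2 : Filter.Tendsto (fun z => A ((z - z₀) ^ (m + 1) • u z)) (𝓝[≠] z₀)
          (𝓝 (z₀ • T v)) := by
        have h3 : Filter.Tendsto (fun z : ℂ => (z - z₀) ^ (m + 1) • v) (𝓝[≠] z₀) (𝓝 0) := by
          have : ContinuousAt (fun z : ℂ => (z - z₀) ^ (m + 1) • v) z₀ := by fun_prop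
          simpa using this.tendsto.mono_left nhdsWithin_le_nhds
        have h4 := h3.add (hid.smul h1)
        rw [zero_add] at h4
        refine h4.congr' (h.mono fun z hz => ?_)
        have h5 := (hu z hz).2
        rw [sub_eq_iff_eq_add] at h5
        change _ = A ((z - z₀) ^ (m + 1) • u z)
        rw [LinearPMap.map_smul, h5, Submodule.coe_smul, smul_add, smul_comm z]
      obtain ⟨a, ha, haA⟩ := exists_of_tendsto hz₁ h1 h2
      exact ⟨a, by rwa [ha], by rw [haA, ha]⟩

/-- Near a non-real `z₀` the gauge is at most a multiple of `|z - z₀|⁻¹`, so `z₀` is at worst a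
pole. Near a real `t`, `|z - t| ≥ |Im z|` turns the gauge into a multiple of `|Im z|⁻¹`, and
compactness of `[-r, r]` makes the constants uniform. -/
lemma isTempered_of_temperedAt [CompleteSpace E]
    (h : ∀ z₀ : ℂ, (∀ᶠ z in 𝓝[≠] z₀, z.im ≠ 0 → z ∈ resolventPoints A) ∧
      TemperedAt nonreal (res A) z₀) : IsTempered A := by
  constructor
  · intro z₀ hz₀
    obtain ⟨h1, C, m, hC, h2⟩ := h z₀
    have him : 0 < |z₀.im| := abs_pos.2 hz₀
    have hnear : ∀ᶠ z in 𝓝[≠] z₀, |z₀.im| / 2 < |z.im| ∧ ‖z - z₀‖ < 1 := by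
      refine mem_nhdsWithin_of_mem_nhds (Filter.inter_mem
        ((isOpen_lt (continuous_const (y := |z₀.im| / 2)) (by fun_prop : Continuous fun z : ℂ =>
          |z.im|)).mem_nhds (half_lt_self him))
        ((isOpen_lt (by fun_prop : Continuous fun z : ℂ => ‖z - z₀‖)
          (continuous_const (y := (1 : ℝ)))).mem_nhds (by simp)))
    have hne : ∀ᶠ z in 𝓝[≠] z₀, z.im ≠ 0 := hnear.mono fun z hz h0 => by
      rw [h0, abs_zero] at hz
      linarith [hz.1]
    have hb : ∀ᶠ z in 𝓝[≠] z₀,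
        ‖res A z‖ ≤ C * (2 + 2 * |z₀.im|⁻¹) ^ m * ‖z - z₀‖⁻¹ ^ m := by
      filter_upwards [h2, hnear, hne, self_mem_nhdsWithin] with z hz hn hzim hzne
      have hpos : 0 < ‖z - z₀‖ := norm_pos_iff.2 (sub_ne_zero.2 hzne)
      refine (hz hzim).trans ?_
      rw [mul_assoc, ← mul_pow]
      have h5 : 0 ≤ gauge z₀ z := zero_le_one.trans (one_le_gauge _ _)
      gcongr
      have h3 : 1 ≤ ‖z - z₀‖⁻¹ := (one_le_inv₀ hpos).2 hn.2.le
      have h4 : |z.im|⁻¹ ≤ 2 * |z₀.im|⁻¹ := by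
        rw [← div_eq_mul_inv, ← inv_div]
        exact inv_anti₀ (by positivity) hn.1.le
      unfold gauge
      have h6 : 0 ≤ |z₀.im|⁻¹ := by positivity
      nlinarith
    rcases mem_resolventPoints_or_eigenvalue (h1.mp (hne.mono fun z hz h => h hz)) m hb with h3 | h3
    · exact Or.inl h3
    · exact Or.inr ⟨hz₀, h3⟩
  · intro r
    have hK : IsCompact ((fun t : ℝ => (t : ℂ)) '' Set.Icc (-r) r) :=
      isCompact_Icc.image Complex.continuous_ofReal
    have hloc : ∀ t : ℝ, ∃ ρ : ℝ, 0 < ρ ∧ ∃ (C : ℝ) (m : ℕ), 0 ≤ C ∧ ∀ z : ℂ, ‖z - t‖ < ρ →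
        z.im ≠ 0 → z ∈ resolventPoints A ∧ ‖res A z‖ ≤ C * gauge t z ^ m := fun t => by
      obtain ⟨h1, C, m, hC, h2⟩ := h t
      obtain ⟨ρ, hρ, hball⟩ := Metric.eventually_nhds_iff.1
        (eventually_nhdsWithin_iff.1 (h1.and h2))
      refine ⟨ρ, hρ, C, m, hC, fun z hz him => ?_⟩
      have hne : z ≠ t := fun h0 => him (by rw [h0, Complex.ofReal_im])
      obtain ⟨h3, h4⟩ := hball (by rwa [dist_eq_norm]) hne
      exact ⟨h3 him, h4 him⟩
    choose ρ hρ C m hC hloc using hloc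
    obtain ⟨s, hs⟩ := isCompact_Icc.elim_finite_subcover (s := Set.Icc (-r) r)
      (fun t => Metric.ball t (ρ t / 2)) (fun t => Metric.isOpen_ball)
      (fun t _ => Set.mem_iUnion.2 ⟨t, Metric.mem_ball_self (half_pos (hρ t))⟩)
    obtain ⟨δ, hδ, hδs⟩ : ∃ δ : ℝ, 0 < δ ∧ ∀ t ∈ s, δ ≤ ρ t / 2 := by
      rcases s.eq_empty_or_nonempty with rfl | hne
      · exact ⟨1, one_pos, by simp⟩
      · obtain ⟨t₀, ht₀, hmin⟩ := s.exists_min_image (fun t => ρ t / 2) hne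
        exact ⟨ρ t₀ / 2, half_pos (hρ t₀), hmin⟩
    refine ⟨min δ 1, lt_min hδ one_pos, ∑ t ∈ s, C t * 3 ^ m t, s.sup m,
      Finset.sum_nonneg fun t _ => mul_nonneg (hC t) (by positivity), fun z hzr him hzδ => ?_⟩
    obtain ⟨t, hts, htz⟩ : ∃ t ∈ s, z.re ∈ Metric.ball t (ρ t / 2) := by
      have := hs (abs_le.1 hzr)
      simpa using this
    have hpos : 0 < |z.im| := abs_pos.2 him
    have hdist : ‖z - t‖ < ρ t := by
      have h1 := Complex.norm_le_abs_re_add_abs_im (z - t)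
      have h2 : |z.re - t| < ρ t / 2 := by simpa [Real.dist_eq] using htz
      have h3 := hδs t hts
      have h4 := hzδ.trans_le (min_le_left _ _)
      simp only [Complex.sub_re, Complex.ofReal_re, Complex.sub_im, Complex.ofReal_im,
        sub_zero] at h1
      linarith
    obtain ⟨h1, h2⟩ := hloc t z hdist him
    refine ⟨h1, h2.trans ?_⟩
    have h3 : gauge t z ≤ 3 * |z.im|⁻¹ := by
      have h4 : ‖z - t‖⁻¹ ≤ |z.im|⁻¹ := by
        refine inv_anti₀ hpos ?_
        have := Complex.abs_im_le_norm (z - t)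
        simpa using this
      have h5 : 1 ≤ |z.im|⁻¹ := (one_le_inv₀ hpos).2 (hzδ.trans_le (min_le_right _ _)).le
      unfold gauge
      linarith
    have h4 : 1 ≤ |z.im|⁻¹ := (one_le_inv₀ hpos).2 (hzδ.trans_le (min_le_right _ _)).le
    have h5 : 0 ≤ gauge t z := zero_le_one.trans (one_le_gauge _ _)
    calc C t * gauge t z ^ m t ≤ C t * (3 * |z.im|⁻¹) ^ m t := by
          have := hC t
          gcongr
      _ = (C t * 3 ^ m t) * |z.im|⁻¹ ^ m t := by ring
      _ ≤ (∑ t ∈ s, C t * 3 ^ m t) * |z.im|⁻¹ ^ s.sup m := by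
          refine mul_le_mul ?_ (pow_le_pow_right₀ h4 (Finset.le_sup hts)) (by positivity)
            (Finset.sum_nonneg fun t _ => mul_nonneg (hC t) (by positivity))
          exact Finset.single_le_sum (f := fun t => C t * 3 ^ m t)
            (fun t _ => mul_nonneg (hC t) (by positivity)) hts

end Tempered

/-! ### Functions that are flat on the real axis -/

section Flat

/-- `D` vanishes to infinite order on the real axis. -/
def IsFlat (D : ℂ → ℂ) : Prop := ∀ N : ℕ, ∃ C : ℝ, ∀ z : ℂ, ‖D z‖ ≤ C * |z.im| ^ N

variable {D D' F G : ℂ → ℂ}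

lemma IsFlat.exists_nonneg (h : IsFlat D) (N : ℕ) :
    ∃ C : ℝ, 0 ≤ C ∧ ∀ z : ℂ, ‖D z‖ ≤ C * |z.im| ^ N := by
  obtain ⟨C, hC⟩ := h N
  exact ⟨max C 0, le_max_right _ _, fun z => (hC z).trans
    (mul_le_mul_of_nonneg_right (le_max_left _ _) (by positivity))⟩

lemma IsFlat.eq_zero (h : IsFlat D) {z : ℂ} (hz : z.im = 0) : D z = 0 := by
  obtain ⟨C, hC⟩ := h 1
  have := hC z
  rw [hz, abs_zero, pow_one, mul_zero] at this
  exact norm_le_zero_iff.1 this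

lemma IsFlat.add (h : IsFlat D) (h' : IsFlat D') : IsFlat fun z => D z + D' z := fun N => by
  obtain ⟨C, hC⟩ := h N
  obtain ⟨C', hC'⟩ := h' N
  exact ⟨C + C', fun z => (norm_add_le _ _).trans (by rw [add_mul]; exact add_le_add (hC z) (hC' z))⟩

lemma IsFlat.mul_bounded (h : IsFlat D) {M : ℝ} (hM : ∀ z, ‖F z‖ ≤ M) :
    IsFlat fun z => F z * D z := fun N => by
  obtain ⟨C, hC0, hC⟩ := h.exists_nonneg N
  refine ⟨M * C, fun z => ?_⟩
  rw [norm_mul, mul_assoc]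
  exact mul_le_mul (hM z) (hC z) (norm_nonneg _) ((norm_nonneg _).trans (hM z))

lemma IsFlat.const_mul (h : IsFlat D) (c : ℂ) : IsFlat fun z => c * D z :=
  h.mul_bounded (F := fun _ => c) (M := ‖c‖) fun _ => le_rfl

lemma contDiff_fderiv_apply (hD : ContDiff ℝ ∞ D) (v : ℂ) :
    ContDiff ℝ ∞ fun z => fderiv ℝ D z v :=
  (hD.fderiv_right (m := ∞) (by simp)).clm_apply contDiff_const

lemma contDiff_dbar (hD : ContDiff ℝ ∞ D) : ContDiff ℝ ∞ (dbar D) :=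
  contDiff_const.mul ((contDiff_fderiv_apply hD 1).add
    (contDiff_const.mul (contDiff_fderiv_apply hD Complex.I)))

lemma tsupport_dbar_subset (D : ℂ → ℂ) : tsupport (dbar D) ⊆ tsupport D := by
  refine closure_minimal (fun z hz => ?_) (isClosed_tsupport D)
  by_contra h
  have h0 : fderiv ℝ D z = 0 := by
    by_contra h1
    exact h (tsupport_fderiv_subset ℝ (subset_tsupport _ h1))
  exact hz (by simp [dbar, h0])

lemma hasCompactSupport_dbar (h : HasCompactSupport D) : HasCompactSupport (dbar D) :=
  h.mono' ((subset_tsupport _).trans (tsupport_dbar_subset D))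

/-- A tangential derivative of a flat function is flat. -/
lemma IsFlat.fderiv_one (h : IsFlat D) (hD : ContDiff ℝ ∞ D) (hc : HasCompactSupport D) :
    IsFlat fun z => fderiv ℝ D z 1 := by
  obtain ⟨L, hL⟩ := ContDiff.lipschitzWith_of_hasCompactSupport (hc.fderiv ℝ)
    (hD.fderiv_right (m := ∞) (by simp)) (by simp)
  -- Landau interpolation: a horizontal step `s` stays at constant height and gives `s |∂ₓD| ≤ 2 sup
  -- |D| + L s²`. As `D = O(|Im z|^{2N})`, the step `s = |Im z|^N` balances the two terms.
  have key : ∀ (z : ℂ) (s : ℝ), 0 ≤ s →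
      ‖D (z + s) - D z - (s : ℂ) * fderiv ℝ D z 1‖ ≤ L * s * s := fun z s hs => by
    have h1 := Convex.norm_image_sub_le_of_norm_fderiv_le' (𝕜 := ℝ) (f := D) (C := L * s)
      (s := Metric.closedBall z s) (x := z) (y := z + s) (φ := fderiv ℝ D z)
      (fun y _ => (hD.differentiable (by simp)) y) (fun y hy => by
        rw [← dist_eq_norm]
        exact (hL.dist_le_mul y z).trans (mul_le_mul_of_nonneg_left hy L.2))
      (convex_closedBall z s) (Metric.mem_closedBall_self hs)
      (by simp [abs_of_nonneg hs])
    have h2 : fderiv ℝ D z (z + s - z) = (s : ℂ) * fderiv ℝ D z 1 := by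
      rw [add_sub_cancel_left, show ((s : ℂ)) = s • (1 : ℂ) by simp, map_smul]
      simp
    rw [h2] at h1
    simpa [abs_of_nonneg hs] using h1
  intro N
  obtain ⟨C, hC0, hC⟩ := h.exists_nonneg (2 * N)
  refine ⟨2 * C + L, fun z => ?_⟩
  have hbd : ∀ s : ℝ, 0 ≤ s → s * ‖fderiv ℝ D z 1‖ ≤ 2 * (C * |z.im| ^ (2 * N)) + L * s * s :=
    fun s hs => by
      have h1 := key z s hs
      have h2 := hC z
      have h3 := hC (z + s)
      rw [Complex.add_im, Complex.ofReal_im, add_zero] at h3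
      have h4 : (s : ℂ) * fderiv ℝ D z 1 =
          D (z + s) - D z - (D (z + s) - D z - (s : ℂ) * fderiv ℝ D z 1) := by ring
      have h5 : s * ‖fderiv ℝ D z 1‖ = ‖(s : ℂ) * fderiv ℝ D z 1‖ := by
        rw [norm_mul, Complex.norm_real, Real.norm_of_nonneg hs]
      rw [h5, h4]
      refine (norm_sub_le _ _).trans ?_
      have := norm_sub_le (D (z + s)) (D z)
      linarith
  -- The step must be positive; where `|Im z|^N = 0`, arbitrarily small steps show that the
  -- derivative vanishes.
  rcases eq_or_ne (|z.im| ^ N) 0 with h0 | h0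
  · have h0' : |z.im| ^ (2 * N) = 0 := by rw [two_mul, pow_add, h0, zero_mul]
    rw [h0, mul_zero]
    refine le_of_forall_pos_le_add fun ε hε => ?_
    have hL0 : (0 : ℝ) < L + 1 := by positivity
    have hs : 0 < ε / (L + 1) := by positivity
    have h1 := hbd _ hs.le
    rw [h0', mul_zero, mul_zero, zero_add, mul_comm, mul_assoc, ← mul_assoc] at h1
    have h2 := le_of_mul_le_mul_right h1 hs
    rw [zero_add]
    refine h2.trans ?_
    rw [mul_div_assoc', div_le_iff₀ hL0]
    nlinarith
  · have hs : 0 < |z.im| ^ N := lt_of_le_of_ne (by positivity) h0.symm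
    have h1 := hbd _ hs.le
    refine le_of_mul_le_mul_left (h1.trans (le_of_eq ?_)) hs
    ring

lemma fderiv_fderiv_comm (hD : ContDiff ℝ ∞ D) (v w z : ℂ) :
    fderiv ℝ (fun y => fderiv ℝ D y v) z w = fderiv ℝ (fun y => fderiv ℝ D y w) z v := by
  have hd : DifferentiableAt ℝ (fderiv ℝ D) z :=
    ((hD.fderiv_right (m := ∞) (by simp)).differentiable (by simp)) z
  have h1 : ∀ a b : ℂ, fderiv ℝ (fun y => fderiv ℝ D y a) z b = fderiv ℝ (fderiv ℝ D) z b a :=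
    fun a b => by
      rw [fderiv_clm_apply hd (differentiableAt_const a)]
      simp
  rw [h1, h1]
  exact (hD.contDiffAt.isSymmSndFDerivAt (by
    rw [minSmoothness_of_isRCLikeNormedField]
    exact WithTop.coe_le_coe.2 (le_top (a := (2 : ℕ∞))))) w v

lemma dbar_fderiv_one (hD : ContDiff ℝ ∞ D) (z : ℂ) :
    dbar (fun y => fderiv ℝ D y 1) z = fderiv ℝ (dbar D) z 1 := by
  have hd : ∀ v, DifferentiableAt ℝ (fun y => fderiv ℝ D y v) z := fun v =>
    ((contDiff_fderiv_apply hD v).differentiable (by simp)) z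
  have h1 : fderiv ℝ (dbar D) z = (1 / 2 : ℂ) • (fderiv ℝ (fun y => fderiv ℝ D y 1) z +
      Complex.I • fderiv ℝ (fun y => fderiv ℝ D y Complex.I) z) := by
    have := (((hd 1).hasFDerivAt.add ((hd Complex.I).hasFDerivAt.const_mul Complex.I)).const_mul
      (1 / 2 : ℂ)).fderiv
    exact this
  rw [h1, dbar, fderiv_fderiv_comm hD 1 Complex.I z]
  simp [mul_add]

/-- An almost analytic function that vanishes on the real axis is flat. -/
lemma isFlat_of_dbar (hD : ContDiff ℝ ∞ D) (hc : HasCompactSupport D)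
    (h0 : ∀ t : ℝ, D t = 0) (hbar : IsFlat (dbar D)) : IsFlat D := by
  intro N
  induction N generalizing D with
  | zero =>
    obtain ⟨C, hC⟩ := hc.exists_bound_of_continuous hD.continuous
    exact ⟨C, fun z => by simpa using hC z⟩
  | succ N ih =>
    -- `∂ₓD` satisfies the same hypotheses as `D`, since it commutes with `∂̄`; so it is `O(|Im
    -- z|^N)` by induction. Then so is `∂_y D = i ∂ₓD - 2i ∂̄D`, and integration from the axis gains
    -- one power.
    have h1 : IsFlat (dbar fun y => fderiv ℝ D y 1) := by
      have := hbar.fderiv_one (contDiff_dbar hD) (hasCompactSupport_dbar hc)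
      simpa only [← dbar_fderiv_one hD] using this
    have hdiff : Differentiable ℝ D := hD.differentiable (by simp)
    have h2 : ∀ t : ℝ, fderiv ℝ D t 1 = 0 := fun t => by
      have ha : HasDerivAt (fun s : ℝ => D s) (fderiv ℝ D t 1) t := by
        have h3 : HasDerivAt (fun s : ℝ => (s : ℂ)) 1 t := by
          simpa using (hasDerivAt_id t).ofReal_comp
        exact (hdiff t).hasFDerivAt.comp_hasDerivAt t h3
      have hb : (fun s : ℝ => D s) = fun _ => 0 := funext h0
      rw [hb] at ha
      exact ha.unique (hasDerivAt_const t 0)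
    obtain ⟨C₁, hC₁⟩ := ih (contDiff_fderiv_apply hD 1) (hc.fderiv_apply ℝ 1) h2 h1
    obtain ⟨C₂, hC₂⟩ := hbar N
    refine ⟨C₁ + 2 * C₂, fun z => ?_⟩
    have hpath : ∀ s : ℝ, HasDerivAt (fun s : ℝ => D (z.re + s * Complex.I))
        (fderiv ℝ D (z.re + s * Complex.I) Complex.I) s := fun s => by
      have h3 : HasDerivAt (fun s : ℝ => (z.re : ℂ) + s * Complex.I) Complex.I s := by
        have := ((Complex.ofRealCLM.hasDerivAt (x := s)).mul_const Complex.I).const_add (z.re : ℂ)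
        simpa using this
      exact (hdiff _).hasFDerivAt.comp_hasDerivAt s h3
    have h4 := Convex.norm_image_sub_le_of_norm_hasDerivWithin_le
      (f := fun s : ℝ => D (z.re + s * Complex.I)) (C := (C₁ + 2 * C₂) * |z.im| ^ N)
      (s := Set.uIcc 0 z.im) (x := 0) (y := z.im) (fun s _ => (hpath s).hasDerivWithinAt)
      (fun s hs => by
        set ζ : ℂ := z.re + s * Complex.I with hζ
        have him : ζ.im = s := by simp [hζ]
        have hs' : |s| ≤ |z.im| := by
          have := Set.abs_sub_left_of_mem_uIcc hs
          simpa using this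
        have h5 : fderiv ℝ D ζ Complex.I =
            Complex.I * fderiv ℝ D ζ 1 + (-2 * Complex.I) * dbar D ζ := by
          rw [dbar]
          linear_combination fderiv ℝ D ζ Complex.I * Complex.I_sq
        have h6 := hC₁ ζ
        have h7 := hC₂ ζ
        rw [him] at h6 h7
        have hp : |s| ^ N ≤ |z.im| ^ N := pow_le_pow_left₀ (abs_nonneg _) hs' N
        have hsum : ‖fderiv ℝ D ζ Complex.I‖ ≤ ‖fderiv ℝ D ζ 1‖ + 2 * ‖dbar D ζ‖ := by
          rw [h5]
          refine (norm_add_le _ _).trans (le_of_eq ?_)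
          simp
        have hnn : 0 ≤ (C₁ + 2 * C₂) * |s| ^ N := by
          have := norm_nonneg (fderiv ℝ D ζ 1)
          have := norm_nonneg (dbar D ζ)
          linarith
        -- No sign of the constants is given; it is read off at a point where the power of the
        -- height is positive.
        rcases eq_or_ne (|s| ^ N) 0 with h0 | h0
        · rw [h0, mul_zero] at h6 h7
          by_cases hC : 0 ≤ C₁ + 2 * C₂
          · have : 0 ≤ (C₁ + 2 * C₂) * |z.im| ^ N := by positivity
            linarith
          · have hone : |(1 : ℝ)| ^ N = 1 := by simp
            have h8 := hC₁ Complex.I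
            have h9 := hC₂ Complex.I
            simp only [Complex.I_im, hone, mul_one] at h8 h9
            exact absurd (by linarith [(norm_nonneg _).trans h8, (norm_nonneg _).trans h9]) hC
        · have hpos : 0 < |s| ^ N := lt_of_le_of_ne (by positivity) h0.symm
          have hC : 0 ≤ C₁ + 2 * C₂ := nonneg_of_mul_nonneg_left hnn hpos
          have := mul_le_mul_of_nonneg_left hp hC
          linarith)
      (convex_uIcc _ _) Set.left_mem_uIcc Set.right_mem_uIcc
    simp only [Complex.re_add_im, Complex.ofReal_zero, zero_mul, add_zero, h0, sub_zero,
      Real.norm_eq_abs] at h4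
    rw [pow_succ, ← mul_assoc]
    exact h4

end Flat

/-! ### Stokes' formula for flat densities -/

section Stokes

variable {B : Type*} [NormedAddCommGroup B] [NormedSpace ℂ B] [NormedSpace ℝ B]
  [IsScalarTower ℝ ℂ B] {D : ℂ → ℂ} {R R' : ℂ → B}

/-- Polynomial growth of `R` at the real axis. -/
def TemperedAtReal (R : ℂ → B) : Prop :=
  ∀ t : ℝ, ∃ (C : ℝ) (m : ℕ), 0 ≤ C ∧ ∀ᶠ z in 𝓝 (t : ℂ), z.im ≠ 0 → ‖R z‖ ≤ C * |z.im|⁻¹ ^ m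

lemma IsFlat.norm_smul_le (h : IsFlat D) (hR : TemperedAtReal R) (N : ℕ) (t : ℝ) :
    ∃ C : ℝ, 0 ≤ C ∧ ∀ᶠ z in 𝓝 (t : ℂ), ‖D z • R z‖ ≤ C * |z.im| ^ N := by
  obtain ⟨C, m, hC, hb⟩ := hR t
  obtain ⟨C', hC', hb'⟩ := h.exists_nonneg (N + m)
  refine ⟨C' * C, mul_nonneg hC' hC, hb.mono fun z hz => ?_⟩
  by_cases him : z.im = 0
  · rw [h.eq_zero him, zero_smul, norm_zero]
    positivity
  · have hpos : 0 < |z.im| := abs_pos.2 him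
    rw [norm_smul]
    calc ‖D z‖ * ‖R z‖ ≤ (C' * |z.im| ^ (N + m)) * (C * |z.im|⁻¹ ^ m) :=
          mul_le_mul (hb' z) (hz him) (norm_nonneg _) (by positivity)
      _ = C' * C * |z.im| ^ N := by rw [pow_add, inv_pow]; field_simp

lemma IsFlat.continuous_smul (h : IsFlat D) (hD : Continuous D) (hR : TemperedAtReal R)
    (hc : ∀ z ∈ tsupport D, z.im ≠ 0 → ContinuousAt R z) : Continuous fun z => D z • R z := by
  refine continuous_iff_continuousAt.2 fun z => ?_
  by_cases him : z.im = 0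
  · have hz : ((z.re : ℝ) : ℂ) = z := by
      rw [← Complex.re_add_im z, him]
      simp
    obtain ⟨C, -, hb⟩ := h.norm_smul_le hR 1 z.re
    rw [hz] at hb
    have hcont : Filter.Tendsto (fun z : ℂ => C * |z.im| ^ 1) (𝓝 z) (𝓝 0) := by
      have : Continuous fun z : ℂ => C * |z.im| ^ 1 := by fun_prop
      simpa [him] using this.tendsto z
    rw [ContinuousAt, h.eq_zero him, zero_smul]
    exact squeeze_zero_norm' hb hcont
  · by_cases hz : z ∈ tsupport D
    · exact hD.continuousAt.smul (hc z hz him)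
    · have h0 : (fun z => D z • R z) =ᶠ[𝓝 z] fun _ => 0 := by
        filter_upwards [notMem_tsupport_iff_eventuallyEq.1 hz] with y hy
        rw [hy]
        exact zero_smul _ _
      exact continuousAt_const.congr h0.symm

lemma IsFlat.integrable_smul (h : IsFlat D) (hD : Continuous D) (hs : HasCompactSupport D)
    (hR : TemperedAtReal R) (hc : ∀ z ∈ tsupport D, z.im ≠ 0 → ContinuousAt R z) :
    Integrable (fun z => D z • R z) :=
  (h.continuous_smul hD hR hc).integrable_of_hasCompactSupport hs.smul_right

/-- At real points `D R = O(|Im z|²)`, so `D R` is differentiable there with zero derivative and the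
Leibniz formula persists, all its terms being zero. Hence the axis contributes no boundary term to
Stokes' formula. -/
lemma IsFlat.hasFDerivAt_smul (h : IsFlat D) (hD : ContDiff ℝ ∞ D) (hR : TemperedAtReal R)
    (hd : ∀ z ∈ tsupport D, z.im ≠ 0 → HasDerivAt R (R' z) z)
    (h' : ∀ v, IsFlat fun z => fderiv ℝ D z v) (z : ℂ) :
    DifferentiableAt ℝ (fun z => D z • R z) z ∧ ∀ v,
      fderiv ℝ (fun z => D z • R z) z v = fderiv ℝ D z v • R z + (v * D z) • R' z := by
  by_cases him : z.im = 0
  · have hz : ((z.re : ℝ) : ℂ) = z := by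
      rw [← Complex.re_add_im z, him]
      simp
    have h0 : HasFDerivAt (fun z => D z • R z) (0 : ℂ →L[ℝ] B) z := by
      obtain ⟨C, hC, hb⟩ := h.norm_smul_le hR 2 z.re
      rw [hz] at hb
      rw [hasFDerivAt_iff_isLittleO]
      simp only [h.eq_zero him, zero_smul, sub_zero, zero_apply]
      have h1 : (fun z => D z • R z) =O[𝓝 z] fun y => ‖y - z‖ ^ 2 := by
        refine Asymptotics.IsBigO.of_bound C (hb.mono fun y hy => hy.trans ?_)
        rw [norm_pow, norm_norm]
        have : |y.im| ≤ ‖y - z‖ := by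
          have := Complex.abs_im_le_norm (y - z)
          rwa [Complex.sub_im, him, sub_zero] at this
        gcongr
      refine h1.trans_isLittleO ?_
      have h2 : (fun y : ℂ => ‖y - z‖ ^ 2) =o[𝓝 z] fun y => ‖y - z‖ ^ 1 := by
        have ht : Filter.Tendsto (fun y : ℂ => ‖y - z‖) (𝓝 z) (𝓝 0) := by
          have : Continuous fun y : ℂ => ‖y - z‖ := by fun_prop
          simpa using this.tendsto z
        exact (Asymptotics.isLittleO_pow_pow one_lt_two).comp_tendsto ht
      simp only [pow_one] at h2
      exact h2.of_norm_right
    refine ⟨h0.differentiableAt, fun v => ?_⟩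
    rw [h0.fderiv, (h' v).eq_zero him, h.eq_zero him]
    simp
  · by_cases hz : z ∈ tsupport D
    · have h1 := ((hD.differentiable (by simp)) z).hasFDerivAt.fun_smul
        ((hd z hz him).hasFDerivAt.restrictScalars ℝ)
      refine ⟨h1.differentiableAt, fun v => ?_⟩
      rw [h1.fderiv]
      simp [smul_smul, add_comm, mul_comm]
    · have h0 : (fun z => D z • R z) =ᶠ[𝓝 z] fun _ => 0 := by
        filter_upwards [notMem_tsupport_iff_eventuallyEq.1 hz] with y hy
        rw [hy]
        exact zero_smul _ _
      refine ⟨(differentiableAt_const (0 : B)).congr_of_eventuallyEq h0, fun v => ?_⟩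
      have h1 : fderiv ℝ D z = 0 := by
        by_contra h2
        exact hz (tsupport_fderiv_subset ℝ (subset_tsupport _ h2))
      rw [h0.fderiv_eq, h1, image_eq_zero_of_notMem_tsupport hz]
      simp

/-- `∫ ∂̄D R = 0` if `R` is holomorphic on the support of `D` away from the real axis, where `D` is
flat. -/
lemma IsFlat.integral_dbar_smul (h : IsFlat D) (hD : ContDiff ℝ ∞ D) (hs : HasCompactSupport D)
    (hR : TemperedAtReal R) (hR' : TemperedAtReal R')
    (hd : ∀ z ∈ tsupport D, z.im ≠ 0 → HasDerivAt R (R' z) z)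
    (hc : ∀ z ∈ tsupport D, z.im ≠ 0 → ContinuousAt R' z) (hbar : IsFlat (dbar D)) :
    ∫ z, dbar D z • R z = 0 := by
  have h1 : IsFlat fun z => fderiv ℝ D z 1 := h.fderiv_one hD hs
  have h2 : ∀ v, IsFlat fun z => fderiv ℝ D z v := fun v => by
    have h3 : IsFlat fun z => fderiv ℝ D z Complex.I := by
      have := (h1.const_mul Complex.I).add (hbar.const_mul (-2 * Complex.I))
      convert this using 2 with z
      rw [dbar]
      linear_combination fderiv ℝ D z Complex.I * Complex.I_sq
    have := (h1.const_mul v.re).add (h3.const_mul v.im)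
    convert this using 2 with z
    have hv : v = v.re • (1 : ℂ) + v.im • Complex.I := by simp
    conv_lhs => rw [hv, map_add, map_smul, map_smul]
    simp
  have hsub : ∀ v, tsupport (fun z => fderiv ℝ D z v) ⊆ tsupport D := fun v =>
    tsupport_fderiv_apply_subset ℝ v
  have hi : ∀ v, Integrable fun z => fderiv ℝ D z v • R z := fun v =>
    (h2 v).integrable_smul (contDiff_fderiv_apply hD v).continuous (hs.fderiv_apply ℝ v) hR
      fun z hz him => (hd z (hsub v hz) him).continuousAt
  have hi' : ∀ v : ℂ, Integrable fun z => (v * D z) • R' z := fun v => by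
    have := (h.integrable_smul hD.continuous hs hR' hc).smul v
    refine this.congr (Filter.Eventually.of_forall fun z => ?_)
    exact smul_smul _ _ _
  have hfd := h.hasFDerivAt_smul hD hR hd h2
  have hint : ∀ v, Integrable fun z => fderiv ℝ (fun z => D z • R z) z v := fun v => by
    simp only [fun z => (hfd z).2 v]
    exact (hi v).add (hi' v)
  have hi0 : Integrable fun z => D z • R z :=
    h.integrable_smul hD.continuous hs hR fun z hz him => (hd z hz him).continuousAt
  -- Integration by parts against the constant function `1`.
  have hzero : ∀ v, ∫ z, fderiv ℝ (fun z => D z • R z) z v = 0 := fun v => by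
    have := integral_smul_fderiv_eq_neg_fderiv_smul_of_integrable (μ := (volume : Measure ℂ))
      (f := fun _ : ℂ => (1 : ℝ)) (g := fun z => D z • R z) (v := v) (by simp)
      (by simpa using hint v)
      (by simpa using hi0)
      (fun x _ => differentiableAt_const _) (fun x _ => (hfd x).1)
    simpa using this
  -- Holomorphy of `R` enters here: the terms in `R'` are `D R' + i² D R' = 0`.
  have hsum : (fun z => dbar D z • R z) = fun z => (1 / 2 : ℂ) •
      (fderiv ℝ (fun z => D z • R z) z 1 +
        Complex.I • fderiv ℝ (fun z => D z • R z) z Complex.I) := by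
    funext z
    rw [(hfd z).2, (hfd z).2, dbar]
    simp only [smul_add, smul_smul, add_smul, mul_add]
    have : Complex.I * (Complex.I * D z) = - D z := by
      linear_combination D z * Complex.I_sq
    rw [this]
    simp only [one_mul, neg_smul, mul_neg, mul_smul]
    module
  rw [hsum, integral_smul, integral_add (hint 1)
    (g := fun z => Complex.I • fderiv ℝ (fun z => D z • R z) z Complex.I)
    ((hint Complex.I).smul _), integral_smul, hzero,
    hzero]
  simp

end Stokes

/-! ### The Cauchy-Pompeiu formula -/

section Pompeiu

/-- The point `e^{iθ}` of the unit circle. -/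
def circlePt (θ : ℝ) : ℂ := (Real.cos θ : ℂ) + (Real.sin θ : ℂ) * Complex.I

lemma continuous_circlePt : Continuous circlePt := by
  unfold circlePt
  fun_prop

lemma norm_circlePt (θ : ℝ) : ‖circlePt θ‖ = 1 := by
  rw [circlePt, Complex.norm_add_mul_I, Real.cos_sq_add_sin_sq, Real.sqrt_one]

lemma hasDerivAt_circlePt (θ : ℝ) : HasDerivAt circlePt (circlePt θ * Complex.I) θ := by
  have h : HasDerivAt circlePt _ θ := (Real.hasDerivAt_cos θ).ofReal_comp.fun_add
    ((Real.hasDerivAt_sin θ).ofReal_comp.mul_const Complex.I)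
  refine h.congr_deriv ?_
  rw [circlePt]
  rw [Complex.ofReal_neg]
  linear_combination (-Real.sin θ : ℂ) * Complex.I_sq

variable {G : ℂ → ℂ}

/-- The Wirtinger derivative in polar coordinates. -/
lemma inv_circlePt_mul_dbar (z : ℂ) (θ : ℝ) : (circlePt θ)⁻¹ * dbar G z =
    (1 / 2 : ℂ) * (fderiv ℝ G z (circlePt θ) +
      Complex.I * fderiv ℝ G z (circlePt θ * Complex.I)) := by
  have h0 : circlePt θ ≠ 0 := by
    rw [← norm_ne_zero_iff, norm_circlePt]
    exact one_ne_zero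
  rw [inv_mul_eq_iff_eq_mul₀ h0, dbar]
  have h1 : circlePt θ = Real.cos θ • (1 : ℂ) + Real.sin θ • Complex.I := by
    simp [circlePt]
  have h2 : circlePt θ * Complex.I = Real.cos θ • Complex.I + (-Real.sin θ) • (1 : ℂ) := by
    rw [circlePt]
    simp only [Complex.real_smul, Complex.ofReal_neg]
    linear_combination (Real.sin θ : ℂ) * Complex.I_sq
  rw [h2]
  conv_rhs => rw [h1]
  simp only [map_add, map_smul]
  simp only [Complex.real_smul, Complex.ofReal_neg, mul_one]
  have h3 : (Real.cos θ : ℂ) ^ 2 + (Real.sin θ : ℂ) ^ 2 = 1 := by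
    exact_mod_cast Real.cos_sq_add_sin_sq θ
  generalize fderiv ℝ G z 1 = a
  generalize fderiv ℝ G z Complex.I = b
  generalize (Real.cos θ : ℂ) = c at *
  generalize (Real.sin θ : ℂ) = s at *
  linear_combination (-1 / 2 : ℂ) * (a + Complex.I * b) * h3 +
    (1 / 2 : ℂ) * (s ^ 2 * a - c * s * b) * Complex.I_sq

variable (hG : ContDiff ℝ ∞ G) (hc : HasCompactSupport G)
include hG hc

lemma integrableOn_polar {v : ℝ → ℂ} (hv : Continuous v) :
    IntegrableOn (fun p : ℝ × ℝ => fderiv ℝ G (p.1 * circlePt p.2) (v p.2))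
      (Set.Ioi 0 ×ˢ Set.Ioo (-Real.pi) Real.pi) := by
  obtain ⟨ρ, hρ, h0⟩ := (hc.fderiv ℝ).exists_pos_le_norm
  have hcont : Continuous fun p : ℝ × ℝ => fderiv ℝ G (p.1 * circlePt p.2) (v p.2) := by
    refine ((hG.continuous_fderiv (by simp)).comp ?_).clm_apply (hv.comp continuous_snd)
    exact (Complex.continuous_ofReal.comp continuous_fst).mul
      (continuous_circlePt.comp continuous_snd)
  have hK : IsCompact (Set.Icc (0 : ℝ) ρ ×ˢ Set.Icc (-Real.pi) Real.pi) :=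
    isCompact_Icc.prod isCompact_Icc
  refine IntegrableOn.of_forall_sdiff_eq_zero (hcont.continuousOn.integrableOn_compact hK)
    (measurableSet_Ioi.prod measurableSet_Ioo) fun p hp => ?_
  have hp1 : ρ ≤ p.1 := by
    by_contra h
    exact hp.2 ⟨⟨le_of_lt hp.1.1, (not_le.1 h).le⟩, Set.Ioo_subset_Icc_self hp.1.2⟩
  rw [h0, zero_apply]
  rw [norm_mul, norm_circlePt, mul_one, Complex.norm_real]
  exact hp1.trans (le_abs_self _)

lemma integral_polar_radial :
    ∫ p in Set.Ioi (0 : ℝ) ×ˢ Set.Ioo (-Real.pi) Real.pi,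
      fderiv ℝ G ((p.1 : ℝ) * circlePt p.2) (circlePt p.2) = -(2 * Real.pi) * G 0 := by
  have hi := integrableOn_polar hG hc continuous_circlePt
  have h1 : ∀ θ : ℝ, ∫ r in Set.Ioi (0 : ℝ), fderiv ℝ G (r * circlePt θ) (circlePt θ) = -G 0 :=
    fun θ => by
      obtain ⟨ρ, hρ, h0⟩ := hc.exists_pos_le_norm
      obtain ⟨ρ', hρ', h0'⟩ := (hc.fderiv ℝ).exists_pos_le_norm
      have hnorm : ∀ r : ℝ, r ≤ ‖(r : ℂ) * circlePt θ‖ := fun r => by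
        rw [norm_mul, norm_circlePt, mul_one, Complex.norm_real]
        exact le_abs_self _
      have hd : ∀ r : ℝ, HasDerivAt (fun r : ℝ => G (r * circlePt θ))
          (fderiv ℝ G (r * circlePt θ) (circlePt θ)) r := fun r => by
        have h2 : HasDerivAt (fun r : ℝ => (r : ℂ) * circlePt θ) (circlePt θ) r := by
          simpa using ((hasDerivAt_id r).ofReal_comp).mul_const (circlePt θ)
        exact ((hG.differentiable (by simp)) _).hasFDerivAt.comp_hasDerivAt r h2
      have hcont : Continuous fun r : ℝ => fderiv ℝ G (r * circlePt θ) (circlePt θ) := by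
        refine ((hG.continuous_fderiv (by simp)).comp ?_).clm_apply continuous_const
        fun_prop
      have := integral_Ioi_of_hasDerivAt_of_tendsto' (a := 0) (m := 0) (fun r _ => hd r)
        (IntegrableOn.of_forall_sdiff_eq_zero
          (hcont.continuousOn.integrableOn_compact (isCompact_Icc (a := 0) (b := ρ')))
          measurableSet_Ioi fun r hr => by
            have hr1 : ρ' ≤ r := by
              by_contra h
              exact hr.2 ⟨le_of_lt hr.1, (not_le.1 h).le⟩
            rw [h0' _ (hr1.trans (hnorm r)), zero_apply])
        (tendsto_const_nhds.congr' ((Filter.eventually_ge_atTop ρ).mono fun r hr =>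
          (h0 _ (hr.trans (hnorm r))).symm))
      simpa using this
  rw [Measure.volume_eq_prod, setIntegral_prod _ hi, integral_integral_swap]
  · simp only [h1]
    rw [setIntegral_const]
    simp only [Measure.real, Real.volume_Ioo, sub_neg_eq_add]
    rw [ENNReal.toReal_ofReal (by positivity), Complex.real_smul]
    push_cast
    ring
  · rw [Measure.prod_restrict]
    exact hi

lemma integral_polar_angular :
    ∫ p in Set.Ioi (0 : ℝ) ×ˢ Set.Ioo (-Real.pi) Real.pi,
      fderiv ℝ G ((p.1 : ℝ) * circlePt p.2) (circlePt p.2 * Complex.I) = 0 := by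
  have hi := integrableOn_polar hG hc (v := fun θ => circlePt θ * Complex.I)
    (continuous_circlePt.mul continuous_const)
  rw [Measure.volume_eq_prod, setIntegral_prod _ hi]
  refine setIntegral_eq_zero_of_forall_eq_zero fun r (hr : 0 < r) => ?_
  have hd : ∀ θ : ℝ, HasDerivAt (fun θ : ℝ => G (r * circlePt θ))
      ((r : ℂ) * fderiv ℝ G (r * circlePt θ) (circlePt θ * Complex.I)) θ := fun θ => by
    have h2 := (hasDerivAt_circlePt θ).const_mul (r : ℂ)
    have h3 := ((hG.differentiable (by simp)) (r * circlePt θ)).hasFDerivAt.comp_hasDerivAt θ h2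
    rw [← Complex.real_smul (z := circlePt θ * Complex.I), map_smul, Complex.real_smul] at h3
    exact h3
  have hcont : Continuous fun θ : ℝ =>
      (r : ℂ) * fderiv ℝ G (r * circlePt θ) (circlePt θ * Complex.I) := by
    refine continuous_const.mul (((hG.continuous_fderiv (by simp)).comp ?_).clm_apply
      (continuous_circlePt.mul continuous_const))
    exact continuous_const.mul continuous_circlePt
  have h4 := intervalIntegral.integral_eq_sub_of_hasDerivAt (a := -Real.pi) (b := Real.pi)
    (fun θ _ => hd θ) (hcont.intervalIntegrable _ _)
  have h5 : circlePt (-Real.pi) = circlePt Real.pi := by simp [circlePt]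
  rw [h5, sub_self, intervalIntegral.integral_of_le (by linarith [Real.pi_pos]),
    integral_Ioc_eq_integral_Ioo, integral_const_mul] at h4
  exact (mul_eq_zero.1 h4).resolve_left (by exact_mod_cast hr.ne')

/-- The polar Jacobian cancels `|u|⁻¹`. The tangential derivative integrates to zero over each
circle by periodicity, the radial one to `-2π G(0)`, and the factor `1/2` of `∂̄` gives the
constant. -/
lemma integral_inv_mul_dbar : ∫ u : ℂ, u⁻¹ * dbar G u = -Real.pi * G 0 := by
  rw [← Complex.integral_comp_polarCoord_symm, polarCoord_target]
  have h1 : ∀ p ∈ Set.Ioi (0 : ℝ) ×ˢ Set.Ioo (-Real.pi) Real.pi,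
      p.1 • ((Complex.polarCoord.symm p)⁻¹ * dbar G (Complex.polarCoord.symm p)) =
      (1 / 2 : ℂ) * (fderiv ℝ G (p.1 * circlePt p.2) (circlePt p.2) +
        Complex.I * fderiv ℝ G (p.1 * circlePt p.2) (circlePt p.2 * Complex.I)) := fun p hp => by
    have hp1 : (p.1 : ℂ) ≠ 0 := by exact_mod_cast (ne_of_gt hp.1)
    rw [Complex.polarCoord_symm_apply]
    change p.1 • (((p.1 : ℂ) * circlePt p.2)⁻¹ * dbar G (p.1 * circlePt p.2)) = _
    rw [← inv_circlePt_mul_dbar, Complex.real_smul, mul_inv]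
    field_simp
  rw [setIntegral_congr_fun (measurableSet_Ioi.prod measurableSet_Ioo) h1, integral_const_mul,
    integral_add (integrableOn_polar hG hc continuous_circlePt)
      ((integrableOn_polar hG hc (v := fun θ => circlePt θ * Complex.I)
        (continuous_circlePt.mul continuous_const)).const_mul _), integral_const_mul,
    integral_polar_radial hG hc, integral_polar_angular hG hc]
  ring

/-- The Cauchy-Pompeiu formula for functions with compact support. -/
lemma integral_cauchy_dbar (z : ℂ) : ∫ w : ℂ, (w - z)⁻¹ * dbar G w = -Real.pi * G z := by
  have h1 : ContDiff ℝ ∞ fun u => G (z + u) := hG.comp (contDiff_const.add contDiff_id)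
  have h2 : HasCompactSupport fun u => G (z + u) :=
    hc.comp_homeomorph (Homeomorph.addLeft z)
  have h3 := integral_inv_mul_dbar h1 h2
  rw [← integral_add_left_eq_self _ z]
  simp only [add_sub_cancel_left, add_zero] at h3 ⊢
  rw [← h3]
  refine integral_congr_ae (Filter.Eventually.of_forall fun u => ?_)
  simp only [dbar, fderiv_comp_add_left]

end Pompeiu

/-! ### The Cauchy kernel -/

section CauchyKernel

variable {B : Type*} [NormedAddCommGroup B] [NormedSpace ℂ B]

/-- The Cauchy kernel, cut off at distance `ρ`. -/
def cauchyKernel (ρ : ℝ) (u : ℂ) : ℂ := if ‖u‖ < ρ then u⁻¹ else 0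

lemma integrable_cauchyKernel (ρ : ℝ) : Integrable (cauchyKernel ρ) := by
  have hm : Measurable (cauchyKernel ρ) :=
    Measurable.ite (measurableSet_lt measurable_norm measurable_const) measurable_inv
      measurable_const
  have h1 : Integrable (fun u : ℂ => (fun r : ℝ => if r < ρ then r⁻¹ else 0) ‖u‖) := by
    refine (integrable_fun_norm_addHaar volume (f := fun r : ℝ => if r < ρ then r⁻¹ else 0)).2 ?_
    rw [Complex.finrank_real_complex]
    have h2 : IntegrableOn (fun _ : ℝ => (1 : ℝ)) (Set.Ioo 0 ρ) :=
      integrableOn_const (by simp) (by simp)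
    have h3 : IntegrableOn (fun y : ℝ => y ^ (2 - 1) • (if y < ρ then y⁻¹ else 0)) (Set.Ioo 0 ρ) :=
      h2.congr_fun (fun y hy => by
        simp only [hy.2, if_true, smul_eq_mul, Nat.add_one_sub_one, pow_one]
        exact (mul_inv_cancel₀ hy.1.ne').symm) measurableSet_Ioo
    refine h3.of_forall_sdiff_eq_zero measurableSet_Ioi fun y hy => ?_
    rw [if_neg fun h => hy.2 ⟨hy.1, h⟩, smul_zero]
  refine h1.mono' hm.aestronglyMeasurable (Filter.Eventually.of_forall fun u => ?_)
  by_cases hu : ‖u‖ < ρ <;> simp [cauchyKernel, hu]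

/-- The supports bound `|p.1 - p.2|`, so the kernel may be replaced by its integrable cutoff, and
the integrand is that of a convolution times a bounded function. -/
lemma integrable_cauchy_smul {U : ℂ → B} (hU : Integrable U) (hUc : HasCompactSupport U)
    {D : ℂ → ℂ} (hD : Continuous D) (hDc : HasCompactSupport D) :
    Integrable (fun p : ℂ × ℂ => (D p.1 * (p.1 - p.2)⁻¹) • U p.2) (volume.prod volume) := by
  obtain ⟨ρ₁, -, h₁⟩ := hUc.exists_pos_le_norm
  obtain ⟨ρ₂, -, h₂⟩ := hDc.exists_pos_le_norm
  have h3 := Integrable.convolution_integrand (μ := (volume : Measure ℂ)) (ν := volume)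
    (ContinuousLinearMap.lsmul ℂ ℂ (E := B)).flip hU (integrable_cauchyKernel (ρ₁ + ρ₂))
  obtain ⟨M, hM⟩ := hDc.exists_bound_of_continuous hD
  have h4 := h3.bdd_smul (φ := fun p : ℂ × ℂ => D p.1) M
    (hD.comp continuous_fst).aestronglyMeasurable (Filter.Eventually.of_forall fun p => hM p.1)
  refine h4.congr (Filter.Eventually.of_forall fun p => ?_)
  change D p.1 • (cauchyKernel (ρ₁ + ρ₂) (p.1 - p.2) • U p.2) = _
  rw [smul_smul]
  by_cases hU0 : ρ₁ ≤ ‖p.2‖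
  · simp [h₁ _ hU0]
  by_cases hD0 : ρ₂ ≤ ‖p.1‖
  · simp [h₂ _ hD0]
  have : ‖p.1 - p.2‖ < ρ₁ + ρ₂ := by
    have := norm_sub_le p.1 p.2
    linarith
  rw [cauchyKernel, if_pos this]

end CauchyKernel

/-! ### The Helffer-Sjöstrand integral of a tempered operator -/

section HelfferSjostrandIntegral

variable {E : Type*} [NormedAddCommGroup E] [NormedSpace ℂ E] {A : E →ₗ.[ℂ] E}
  {f g : ℝ → ℂ} {F G : ℂ → ℂ}

lemma hsIntegral_eq (A : E →ₗ.[ℂ] E) (F : ℂ → ℂ) :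
    hsIntegral A F = (Real.pi : ℂ)⁻¹ • ∫ z : ℂ, hsIntegrand A F z := by
  have hpi : (Real.pi : ℂ) ≠ 0 := by exact_mod_cast Real.pi_ne_zero
  rw [hsIntegral]
  congr 1
  field_simp
  linear_combination (-1 : ℂ) * Complex.I_sq

lemma IsTempered.temperedAtReal (hA : IsTempered A) : TemperedAtReal (res A) := fun t => by
  obtain ⟨δ, hδ, C, m, hC, hb⟩ := hA.bound (|t| + 1)
  refine ⟨C, m, hC, ?_⟩
  have h1 : ∀ᶠ z : ℂ in 𝓝 (t : ℂ), ‖z - (t : ℂ)‖ < min δ 1 := by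
    filter_upwards [Metric.ball_mem_nhds (t : ℂ) (lt_min hδ one_pos)] with z hz
    rwa [← dist_eq_norm]
  filter_upwards [h1] with z hz him
  have h2 := Complex.abs_re_le_norm (z - t)
  have h3 := Complex.abs_im_le_norm (z - t)
  simp only [Complex.sub_re, Complex.ofReal_re, Complex.sub_im, Complex.ofReal_im, sub_zero]
    at h2 h3
  refine (hb z ?_ him (h3.trans_lt (hz.trans_le (min_le_left _ _)))).2
  have h4 := abs_sub_abs_le_abs_sub z.re t
  have h5 := hz.trans_le (min_le_right δ 1)
  linarith

lemma IsTempered.temperedAtReal_sq (hA : IsTempered A) :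
    TemperedAtReal fun z => res A z * res A z := fun t => by
  obtain ⟨C, m, hC, hb⟩ := hA.temperedAtReal t
  refine ⟨C * C, m + m, by positivity, hb.mono fun z hz him => (norm_mul_le _ _).trans ?_⟩
  calc ‖res A z‖ * ‖res A z‖ ≤ (C * |z.im|⁻¹ ^ m) * (C * |z.im|⁻¹ ^ m) :=
        mul_le_mul (hz him) (hz him) (norm_nonneg _) (by positivity)
    _ = C * C * |z.im|⁻¹ ^ (m + m) := by ring

lemma IsAdmissible.mem_resolventPoints (hA : IsTempered A) (hF : IsAdmissible A f F) {z : ℂ}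
    (hz : z ∈ tsupport F) (him : z.im ≠ 0) : z ∈ resolventPoints A :=
  (hA.mem_or_mem z him).resolve_right fun h => (Set.ext_iff.1 hF.2 z).1 ⟨hz, h⟩

lemma IsAdmissible.mem_of_dbar (hA : IsTempered A) (hF : IsAdmissible A f F) {z : ℂ}
    (hz : dbar F z ≠ 0) : z ∈ resolventPoints A :=
  hF.mem_resolventPoints hA (tsupport_dbar_subset F (subset_tsupport _ hz)) fun him =>
    hz (IsFlat.eq_zero hF.1.flat him)

lemma dbar_mul (hF : ContDiff ℝ ∞ F) (hG : ContDiff ℝ ∞ G) (z : ℂ) :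
    dbar (fun z => F z * G z) z = F z * dbar G z + G z * dbar F z := by
  have h := ((hF.differentiable (by simp)) z).hasFDerivAt.fun_mul
    ((hG.differentiable (by simp)) z).hasFDerivAt
  rw [dbar, h.fderiv, dbar, dbar]
  simp only [add_apply, smul_apply, smul_eq_mul]
  ring

lemma dbar_sub (hF : ContDiff ℝ ∞ F) (hG : ContDiff ℝ ∞ G) (z : ℂ) :
    dbar (fun z => F z - G z) z = dbar F z - dbar G z := by
  have h := ((hF.differentiable (by simp)) z).hasFDerivAt.fun_sub
    ((hG.differentiable (by simp)) z).hasFDerivAt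
  rw [dbar, h.fderiv, dbar, dbar]
  simp only [sub_apply]
  ring

lemma IsAdmissible.mul (hF : IsAdmissible A f F) (hG : IsAdmissible A g G) :
    IsAdmissible A (fun t => f t * g t) fun z => F z * G z := by
  obtain ⟨MF, hMF⟩ := hF.1.compact.exists_bound_of_continuous hF.1.smooth.continuous
  obtain ⟨MG, hMG⟩ := hG.1.compact.exists_bound_of_continuous hG.1.smooth.continuous
  refine ⟨⟨hF.1.smooth.mul hG.1.smooth, hF.1.compact.mul_right, fun t => ?_, ?_⟩, ?_⟩
  · rw [hF.1.extends_f, hG.1.extends_f]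
  · have h : IsFlat fun z => F z * dbar G z + G z * dbar F z :=
      (IsFlat.mul_bounded hG.1.flat hMF).add (IsFlat.mul_bounded hF.1.flat hMG)
    intro N
    obtain ⟨C, hC⟩ := h N
    exact ⟨C, fun z => by rw [dbar_mul hF.1.smooth hG.1.smooth]; exact hC z⟩
  · refine Set.subset_eq_empty (Set.inter_subset_inter_left _ ?_) hF.2
    exact tsupport_mul_subset_left

variable [CompleteSpace E]

lemma integrable_hsIntegrand (hA : IsTempered A) (hF : IsAdmissible A f F) :
    Integrable (hsIntegrand A F) :=
  IsFlat.integrable_smul hF.1.flat (contDiff_dbar hF.1.smooth).continuous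
    (hasCompactSupport_dbar hF.1.compact) hA.temperedAtReal fun _ hz him =>
      continuousAt_res (hF.mem_resolventPoints hA (tsupport_dbar_subset F hz) him)

/-- The Helffer-Sjöstrand integral does not depend on the almost analytic extension. -/
lemma hsIntegral_eq_of_isAdmissible (hA : IsTempered A) (hF : IsAdmissible A f F)
    (hG : IsAdmissible A f G) : hsIntegral A F = hsIntegral A G := by
  rw [hsIntegral_eq, hsIntegral_eq]
  congr 1
  rw [← sub_eq_zero, ← integral_sub (integrable_hsIntegrand hA hF) (integrable_hsIntegrand hA hG)]
  have hD : ContDiff ℝ ∞ fun z => F z - G z := hF.1.smooth.sub hG.1.smooth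
  have hDc : HasCompactSupport fun z => F z - G z := hF.1.compact.sub hG.1.compact
  have hbar : IsFlat (dbar fun z => F z - G z) := by
    have h := IsFlat.add hF.1.flat (IsFlat.const_mul hG.1.flat (-1))
    convert h using 2 with z
    rw [dbar_sub hF.1.smooth hG.1.smooth]
    ring
  have hflat := isFlat_of_dbar hD hDc
    (fun t => by rw [hF.1.extends_f, hG.1.extends_f, sub_self]) hbar
  have hmem : ∀ z ∈ tsupport (fun z => F z - G z), z.im ≠ 0 → z ∈ resolventPoints A :=
    fun z hz him => by
      rcases tsupport_sub F G hz with h | h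
      · exact hF.mem_resolventPoints hA h him
      · exact hG.mem_resolventPoints hA h him
  rw [← hflat.integral_dbar_smul hD hDc hA.temperedAtReal hA.temperedAtReal_sq
    (fun z hz him => hasDerivAt_res (hmem z hz him))
    (fun z hz him => (continuousAt_res (hmem z hz him)).mul (continuousAt_res (hmem z hz him)))
    hbar]
  refine integral_congr_ae (Filter.Eventually.of_forall fun z => ?_)
  simp only [hsIntegrand, dbar_sub hF.1.smooth hG.1.smooth, sub_smul]

/-- The resolvent identity as a partial fraction: in each summand only one variable is left in a
resolvent, and the other is integrated by Cauchy-Pompeiu. -/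
lemma resolvent_product (hA : IsTempered A) (hF : IsAdmissible A f F) (hG : IsAdmissible A g G)
    {z w : ℂ} (h : w ≠ z) : hsIntegrand A F z * hsIntegrand A G w =
      -((dbar G w * (w - z)⁻¹) • hsIntegrand A F z) -
        (dbar F z * (z - w)⁻¹) • hsIntegrand A G w := by
  unfold hsIntegrand
  rw [smul_mul_smul_comm, smul_smul, smul_smul]
  by_cases hz : dbar F z = 0
  · simp [hz]
  by_cases hw : dbar G w = 0
  · simp [hw]
  have h1 := (isResolventAt_res (hF.mem_of_dbar hA hz)).sub_eq
    (isResolventAt_res (hG.mem_of_dbar hA hw))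
  have hzw : z - w ≠ 0 := sub_ne_zero.2 h.symm
  have h2 : res A z * res A w = (z - w)⁻¹ • (res A z - res A w) := by
    rw [h1, smul_smul, inv_mul_cancel₀ hzw, one_smul]
  have h3 : (w - z)⁻¹ = -(z - w)⁻¹ := by rw [← inv_neg, neg_sub]
  rw [h2, h3]
  module

/-- The Helffer-Sjöstrand integral is multiplicative. -/
lemma hsIntegral_mul (hA : IsTempered A) (hF : IsAdmissible A f F) (hG : IsAdmissible A g G) :
    hsIntegral A (fun z => F z * G z) = hsIntegral A F * hsIntegral A G := by
  set U := hsIntegrand A F with hUdef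
  set V := hsIntegrand A G with hVdef
  have hU : Integrable U := integrable_hsIntegrand hA hF
  have hV : Integrable V := integrable_hsIntegrand hA hG
  have hUc : HasCompactSupport U := (hasCompactSupport_dbar hF.1.compact).smul_right
  have hVc : HasCompactSupport V := (hasCompactSupport_dbar hG.1.compact).smul_right
  have hK₁ := integrable_cauchy_smul hU hUc (contDiff_dbar hG.1.smooth).continuous
    (hasCompactSupport_dbar hG.1.compact)
  have hK₂ := integrable_cauchy_smul hV hVc (contDiff_dbar hF.1.smooth).continuous
    (hasCompactSupport_dbar hF.1.compact)
  have hK₁' := hK₁.swap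
  have hprod : (∫ z, U z) * ∫ w, V w = ∫ z, ∫ w, U z * V w := by
    have h1 : ∀ z, ∫ w, U z * V w = U z * ∫ w, V w := fun z =>
      ContinuousLinearMap.integral_comp_comm (ContinuousLinearMap.mul ℂ (E →L[ℂ] E) (U z)) hV
    simp only [h1]
    exact (ContinuousLinearMap.integral_comp_comm
      ((ContinuousLinearMap.mul ℂ (E →L[ℂ] E)).flip (∫ w, V w)) hU).symm
  have hinner : ∀ z, ∫ w, U z * V w = ∫ w, (-((dbar G w * (w - z)⁻¹) • U z) -
      (dbar F z * (z - w)⁻¹) • V w) := fun z => by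
    refine integral_congr_ae ?_
    have : ∀ᵐ w : ℂ, w ≠ z := by
      rw [ae_iff]
      simp
    exact this.mono fun w hw => resolvent_product hA hF hG hw
  -- Fubini: the inner, scalar integral is the Cauchy-Pompeiu formula and returns `-π G(z)`.
  have h1 : ∫ p : ℂ × ℂ, (dbar G p.1 * (p.1 - p.2)⁻¹) • U p.2 ∂(volume.prod volume) =
      -(Real.pi : ℂ) • ∫ z, G z • U z := by
    rw [integral_prod_symm _ hK₁, ← integral_smul]
    refine integral_congr_ae (Filter.Eventually.of_forall fun z => ?_)
    simp only [integral_smul_const]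
    rw [← smul_assoc, smul_eq_mul, ← integral_cauchy_dbar hG.1.smooth hG.1.compact z]
    simp only [mul_comm]
  have h2 : ∫ p : ℂ × ℂ, (dbar F p.1 * (p.1 - p.2)⁻¹) • V p.2 ∂(volume.prod volume) =
      -(Real.pi : ℂ) • ∫ z, F z • V z := by
    rw [integral_prod_symm _ hK₂, ← integral_smul]
    refine integral_congr_ae (Filter.Eventually.of_forall fun z => ?_)
    simp only [integral_smul_const]
    rw [← smul_assoc, smul_eq_mul, ← integral_cauchy_dbar hF.1.smooth hF.1.compact z]
    simp only [mul_comm]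
  have h3 : ∫ z, ∫ w, (-((dbar G w * (w - z)⁻¹) • U z) - (dbar F z * (z - w)⁻¹) • V w) =
      (Real.pi : ℂ) • ((∫ z, G z • U z) + ∫ z, F z • V z) := by
    have h4 := integral_prod (μ := (volume : Measure ℂ)) (ν := (volume : Measure ℂ))
      (fun p : ℂ × ℂ => -((dbar G p.2 * (p.2 - p.1)⁻¹) • U p.1) -
        (dbar F p.1 * (p.1 - p.2)⁻¹) • V p.2) (hK₁'.neg.sub hK₂)
    rw [← h4, integral_sub (f := fun p : ℂ × ℂ => -((dbar G p.2 * (p.2 - p.1)⁻¹) • U p.1))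
      hK₁'.neg hK₂, integral_neg, h2]
    have h5 := integral_prod_swap (μ := (volume : Measure ℂ)) (ν := (volume : Measure ℂ))
      (fun p : ℂ × ℂ => (dbar G p.1 * (p.1 - p.2)⁻¹) • U p.2)
    simp only [Prod.fst_swap, Prod.snd_swap] at h5
    rw [h5, h1]
    module
  obtain ⟨MF, hMF⟩ := hF.1.compact.exists_bound_of_continuous hF.1.smooth.continuous
  obtain ⟨MG, hMG⟩ := hG.1.compact.exists_bound_of_continuous hG.1.smooth.continuous
  have hGU : Integrable fun z => G z • U z :=
    hU.bdd_smul MG hG.1.smooth.continuous.aestronglyMeasurable (Filter.Eventually.of_forall hMG)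
  have hFV : Integrable fun z => F z • V z :=
    hV.bdd_smul MF hF.1.smooth.continuous.aestronglyMeasurable (Filter.Eventually.of_forall hMF)
  have h6 : ∫ z, hsIntegrand A (fun z => F z * G z) z = (∫ z, G z • U z) + ∫ z, F z • V z := by
    rw [← integral_add hGU hFV]
    refine integral_congr_ae (Filter.Eventually.of_forall fun z => ?_)
    simp only [hUdef, hVdef, hsIntegrand, dbar_mul hF.1.smooth hG.1.smooth, smul_smul, add_smul]
    rw [add_comm]
  have hpi : (Real.pi : ℂ) ≠ 0 := by exact_mod_cast Real.pi_ne_zero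
  rw [hsIntegral_eq, hsIntegral_eq, hsIntegral_eq, smul_mul_smul_comm, hprod]
  simp only [hinner]
  rw [h3, h6, smul_smul, mul_assoc, inv_mul_cancel₀ hpi, mul_one]

end HelfferSjostrandIntegral

/-! ### Almost analytic extensions -/

section Kernel

variable {φ : ℝ → ℂ} {g : ℝ → ℂ}

/-- All the functions `t ^ n φ(t)` are integrable. -/
def HasMoments (φ : ℝ → ℂ) : Prop := ∀ n : ℕ, Integrable fun t : ℝ => (t : ℂ) ^ n * φ t

lemma HasMoments.integrable (h : HasMoments φ) : Integrable φ := by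
  simpa using h 0

lemma HasMoments.integrable_norm (h : HasMoments φ) (n : ℕ) :
    Integrable fun t : ℝ => |t| ^ n * ‖φ t‖ := by
  simpa using (h n).norm

lemma HasMoments.mul_id (h : HasMoments φ) : HasMoments fun t => (t : ℂ) * φ t := fun n => by
  simpa only [pow_succ, mul_assoc] using h (n + 1)

/-- Smooth functions of one variable with compact support. -/
def IsTest (g : ℝ → ℂ) : Prop := ContDiff ℝ ∞ g ∧ HasCompactSupport g

lemma IsTest.deriv (h : IsTest g) : IsTest (deriv g) :=
  ⟨h.1.iterate_deriv 1, h.2.deriv⟩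

/-- `∫ g(x - y t) φ(t) dt`, as a function of `z = x + i y`. -/
def dilate (g φ : ℝ → ℂ) (z : ℂ) : ℂ := ∫ t : ℝ, g (z.re - z.im * t) * φ t

lemma integrable_dilate (hg : IsTest g) (hφ : HasMoments φ) (z : ℂ) :
    Integrable fun t : ℝ => g (z.re - z.im * t) * φ t := by
  obtain ⟨M, hM⟩ := hg.2.exists_bound_of_continuous hg.1.continuous
  exact hφ.integrable.bdd_mul (c := M) (hg.1.continuous.comp (by fun_prop)).aestronglyMeasurable
    (Filter.Eventually.of_forall fun t => hM _)

lemma hasFDerivAt_dilate (hg : IsTest g) (hφ : HasMoments φ) (z : ℂ) :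
    HasFDerivAt (dilate g φ)
      (dilate (deriv g) φ z • (Complex.ofRealCLM ∘L Complex.reCLM) -
        dilate (deriv g) (fun t => t * φ t) z • (Complex.ofRealCLM ∘L Complex.imCLM)) z := by
  set re' : ℂ →L[ℝ] ℂ := Complex.ofRealCLM ∘L Complex.reCLM with hre
  set im' : ℂ →L[ℝ] ℂ := Complex.ofRealCLM ∘L Complex.imCLM with him
  obtain ⟨M, hM⟩ := hg.deriv.2.exists_bound_of_continuous hg.deriv.1.continuous
  have hi1 := integrable_dilate hg.deriv hφ z
  have hi2 := integrable_dilate hg.deriv hφ.mul_id z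
  have hM0 : 0 ≤ M := (norm_nonneg _).trans (hM 0)
  have key := hasFDerivAt_integral_of_dominated_of_fderiv_le (μ := (volume : Measure ℝ)) (𝕜 := ℝ)
    (F := fun (z : ℂ) (t : ℝ) => g (z.re - z.im * t) * φ t) (x₀ := z) (s := Set.univ)
    (F' := fun (z : ℂ) (t : ℝ) => (deriv g (z.re - z.im * t) * φ t) • re' -
      (deriv g (z.re - z.im * t) * (t * φ t)) • im')
    (bound := fun t => M * ‖φ t‖ * ‖re'‖ + M * (|t| ^ 1 * ‖φ t‖) * ‖im'‖) Filter.univ_mem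
    (Filter.Eventually.of_forall fun y => (integrable_dilate hg hφ y).aestronglyMeasurable)
    (integrable_dilate hg hφ z)
    ((hi1.aestronglyMeasurable.smul_const re').sub (hi2.aestronglyMeasurable.smul_const im'))
    (Filter.Eventually.of_forall fun t y _ => by
      refine (norm_sub_le _ _).trans (add_le_add ?_ ?_)
      · rw [norm_smul, norm_mul]
        gcongr
        exact hM _
      · rw [norm_smul, norm_mul, norm_mul, Complex.norm_real, pow_one, Real.norm_eq_abs]
        gcongr
        exact hM _)
    (((hφ.integrable.norm.const_mul M).mul_const _).add
      (((hφ.integrable_norm 1).const_mul M).mul_const _))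
    (Filter.Eventually.of_forall fun t y _ => by
      have h1 : HasFDerivAt (fun y : ℂ => y.re - y.im * t) (Complex.reCLM - t • Complex.imCLM) y := by
        refine (Complex.reCLM.hasFDerivAt.fun_sub (Complex.imCLM.hasFDerivAt.mul_const t))
      have h2 := ((hg.1.differentiable (by simp) (y.re - y.im * t)).hasDerivAt).hasFDerivAt.comp y h1
      have h3 := h2.mul_const (φ t)
      refine h3.congr_fderiv (ContinuousLinearMap.ext fun v => ?_)
      simp [hre, him]
      ring)
  have hint : ∫ t : ℝ, ((deriv g (z.re - z.im * t) * φ t) • re' -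
      (deriv g (z.re - z.im * t) * (t * φ t)) • im') =
      dilate (deriv g) φ z • re' - dilate (deriv g) (fun t => t * φ t) z • im' := by
    rw [integral_sub (hi1.smul_const re') (hi2.smul_const im'), integral_smul_const,
      integral_smul_const]
    rfl
  rw [hint] at key
  exact key

/-- Dilation integrals are stable under differentiation: `g` becomes `g'` and `φ` becomes `φ` or `t
φ`. -/
lemma contDiff_dilate (hg : IsTest g) (hφ : HasMoments φ) : ContDiff ℝ ∞ (dilate g φ) := by
  refine contDiff_infty.2 fun n => ?_
  induction n generalizing g φ with
  | zero =>
    exact contDiff_zero.2 (continuous_iff_continuousAt.2 fun z =>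
      (hasFDerivAt_dilate hg hφ z).continuousAt)
  | succ n ih =>
    push_cast
    refine contDiff_succ_iff_hasFDerivAt.2 ⟨_, ?_, hasFDerivAt_dilate hg hφ⟩
    exact ((ih hg.deriv hφ).smul contDiff_const).sub
      ((ih hg.deriv hφ.mul_id).smul contDiff_const)

lemma dilate_ofReal (x : ℝ) : dilate g φ x = g x * ∫ t, φ t := by
  simp [dilate, integral_const_mul]

/-- `∂̄` replaces `φ` by `(1 - i t) φ`, whose moments `(-i)^n - i (-i)^{n+1}` all vanish when those
of `φ` are `(-i)^n`; combined with `norm_dilate_le` this makes the extension almost analytic. -/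
lemma dbar_dilate (hg : IsTest g) (hφ : HasMoments φ) (z : ℂ) : dbar (dilate g φ) z =
    (1 / 2 : ℂ) * dilate (deriv g) (fun t => φ t - Complex.I * (t * φ t)) z := by
  have h : dilate (deriv g) (fun t => φ t - Complex.I * (t * φ t)) z =
      dilate (deriv g) φ z - Complex.I * dilate (deriv g) (fun t => t * φ t) z := by
    have h1 := integrable_dilate hg.deriv hφ z
    have h2 := integrable_dilate hg.deriv hφ.mul_id z
    rw [dilate, dilate, dilate, ← integral_const_mul, ← integral_sub h1 (h2.const_mul _)]
    congr 1
    funext t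
    ring
  rw [dbar, (hasFDerivAt_dilate hg hφ z).fderiv, h]
  simp [sub_eq_add_neg]

/-- Vanishing of the zeroth moment means vanishing on the axis, and `∂_y` gives an integral of the
same kind with `g'` and `t φ`. Integrating `N` times from the axis produces `|Im z|^N` and uses the
derivative of order `N` only. -/
lemma norm_dilate_le (hg : IsTest g) (hφ : HasMoments φ)
    (h0 : ∀ n : ℕ, ∫ t : ℝ, (t : ℂ) ^ n * φ t = 0) {N : ℕ} {M : ℝ}
    (hM : ∀ t, ‖iteratedDeriv N g t‖ ≤ M) (z : ℂ) :
    ‖dilate g φ z‖ ≤ M * (∫ t : ℝ, |t| ^ N * ‖φ t‖) * |z.im| ^ N := by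
  induction N generalizing g φ z with
  | zero =>
    simp only [iteratedDeriv_zero] at hM
    simp only [pow_zero, one_mul, mul_one]
    rw [dilate, ← integral_const_mul]
    refine norm_integral_le_of_norm_le (hφ.integrable.norm.const_mul M)
      (Filter.Eventually.of_forall fun t => ?_)
    rw [norm_mul]
    exact mul_le_mul_of_nonneg_right (hM _) (norm_nonneg _)
  | succ N ih =>
    have h1 : ∀ n : ℕ, ∫ t : ℝ, (t : ℂ) ^ n * (t * φ t) = 0 := fun n => by
      simpa only [pow_succ, mul_assoc] using h0 (n + 1)
    have hM' : ∀ t, ‖iteratedDeriv N (deriv g) t‖ ≤ M := fun t => by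
      rw [← iteratedDeriv_succ']
      exact hM t
    have h2 := fun z => ih hg.deriv hφ.mul_id h1 hM' z
    have hnorm : ∀ t : ℝ, |t| ^ N * ‖(t : ℂ) * φ t‖ = |t| ^ (N + 1) * ‖φ t‖ := fun t => by
      rw [norm_mul, Complex.norm_real, Real.norm_eq_abs]
      ring
    simp only [hnorm] at h2
    set K := M * ∫ t : ℝ, |t| ^ (N + 1) * ‖φ t‖ with hK
    have hM0 : 0 ≤ M := (norm_nonneg _).trans (hM 0)
    have hK0 : 0 ≤ K := mul_nonneg hM0 (integral_nonneg fun t => by positivity)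
    have hpath : ∀ s : ℝ, HasDerivAt (fun s : ℝ => dilate g φ (z.re + s * Complex.I))
        (-dilate (deriv g) (fun t => t * φ t) (z.re + s * Complex.I)) s := fun s => by
      have h3 : HasDerivAt (fun s : ℝ => (z.re : ℂ) + s * Complex.I) Complex.I s := by
        simpa using (((hasDerivAt_id s).ofReal_comp).mul_const Complex.I).const_add (z.re : ℂ)
      refine ((hasFDerivAt_dilate hg hφ _).comp_hasDerivAt s h3).congr_deriv ?_
      simp
    have h4 := Convex.norm_image_sub_le_of_norm_hasDerivWithin_le
      (f := fun s : ℝ => dilate g φ (z.re + s * Complex.I)) (C := K * |z.im| ^ N)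
      (s := Set.uIcc 0 z.im) (x := 0) (y := z.im) (fun s _ => (hpath s).hasDerivWithinAt)
      (fun s hs => by
        have hs' : |s| ≤ |z.im| := by
          have := Set.abs_sub_left_of_mem_uIcc hs
          simpa using this
        rw [norm_neg]
        refine (h2 _).trans ?_
        have him : ((z.re : ℂ) + s * Complex.I).im = s := by simp
        rw [him]
        gcongr)
      (convex_uIcc _ _) Set.left_mem_uIcc Set.right_mem_uIcc
    have h5 : dilate g φ z.re = 0 := by
      have h6 : ∫ t, φ t = 0 := by simpa using h0 0
      rw [dilate_ofReal, h6, mul_zero]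
    simp only [Complex.re_add_im, Complex.ofReal_zero, zero_mul, add_zero, h5, sub_zero,
      Real.norm_eq_abs] at h4
    rw [pow_succ, ← mul_assoc]
    exact h4

/-- Decay of `dilate g φ` at points whose real part is at distance at least one from the support
of `g`. -/
lemma norm_dilate_le_of_dist (hφ : HasMoments φ) {M : ℝ} (hM : ∀ t, ‖g t‖ ≤ M)
    {z : ℂ} (hz : ∀ s, g s ≠ 0 → 1 ≤ |z.re - s|) (N : ℕ) :
    ‖dilate g φ z‖ ≤ M * (∫ t : ℝ, |t| ^ N * ‖φ t‖) * |z.im| ^ N := by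
  rw [mul_assoc, ← integral_mul_const, ← integral_const_mul, dilate]
  refine norm_integral_le_of_norm_le (((hφ.integrable_norm N).mul_const _).const_mul M)
    (Filter.Eventually.of_forall fun t => ?_)
  have hM0 : 0 ≤ M := (norm_nonneg _).trans (hM 0)
  by_cases h : g (z.re - z.im * t) = 0
  · rw [h, zero_mul, norm_zero]
    positivity
  · have h1 := hz _ h
    rw [sub_sub_cancel, abs_mul] at h1
    rw [norm_mul]
    refine mul_le_mul (hM _) ?_ (norm_nonneg _) hM0
    calc ‖φ t‖ = 1 * ‖φ t‖ := (one_mul _).symm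
      _ ≤ (|z.im| * |t|) ^ N * ‖φ t‖ :=
          mul_le_mul_of_nonneg_right (one_le_pow₀ h1) (norm_nonneg _)
      _ = |t| ^ N * ‖φ t‖ * |z.im| ^ N := by rw [mul_pow]; ring

lemma norm_dilate_le_sup (hφ : HasMoments φ) {M : ℝ} (hM : ∀ t, ‖g t‖ ≤ M) (z : ℂ) :
    ‖dilate g φ z‖ ≤ M * ∫ t : ℝ, ‖φ t‖ := by
  rw [← integral_const_mul, dilate]
  refine norm_integral_le_of_norm_le (hφ.integrable.norm.const_mul M)
    (Filter.Eventually.of_forall fun t => ?_)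
  rw [norm_mul]
  exact mul_le_mul_of_nonneg_right (hM _) (norm_nonneg _)

open FourierTransform in
/-- A rapidly decreasing function whose moments are the powers of `-i`. -/
lemma exists_moments : ∃ φ : ℝ → ℂ, HasMoments φ ∧
    ∀ n : ℕ, ∫ t : ℝ, (t : ℂ) ^ n * φ t = (-Complex.I) ^ n := by
  -- `φ` is the inverse Fourier transform of a test function equal to `e^{-2πs}` near `0`; the
  -- `n`-th derivative there is `(-2π)^n`, and it is also `(-2πi)^n` times the `n`-th moment.
  let b : ContDiffBump (0 : ℝ) := default
  have hc : HasCompactSupport fun s : ℝ => (b s : ℂ) * Complex.exp (-2 * Real.pi * s) :=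
    (b.hasCompactSupport.comp_left (g := fun r : ℝ => (r : ℂ)) Complex.ofReal_zero).mul_right
  have hs : ContDiff ℝ ∞ fun s : ℝ => (b s : ℂ) * Complex.exp (-2 * Real.pi * s) :=
    (Complex.ofRealCLM.contDiff.comp b.contDiff).mul
      (Complex.contDiff_exp.comp (contDiff_const.mul Complex.ofRealCLM.contDiff))
  set ψ : SchwartzMap ℝ ℂ := hc.toSchwartzMap hs with hψ
  set φ : SchwartzMap ℝ ℂ := 𝓕⁻ ψ with hφdef
  have hφ : HasMoments φ := fun n => by
    refine (φ.integrable_pow_mul volume n).mono' (by fun_prop) ?_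
    exact Filter.Eventually.of_forall fun t => by simp
  refine ⟨φ, hφ, fun n => ?_⟩
  have h1 : 𝓕 (φ : ℝ → ℂ) = fun s : ℝ => (b s : ℂ) * Complex.exp (-2 * Real.pi * s) := by
    rw [← SchwartzMap.fourier_coe, hφdef, FourierTransform.fourier_fourierInv_eq]
    rfl
  have h2 := Real.iteratedDeriv_fourier (f := (φ : ℝ → ℂ)) (N := ⊤) (n := n)
    (fun m _ => by
      refine (hφ m).congr (Filter.Eventually.of_forall fun t => ?_)
      simp) le_top
  have h3 := congrFun h2 0
  rw [h1, Real.fourier_eq] at h3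
  have h4 : (fun s : ℝ => (b s : ℂ) * Complex.exp (-2 * Real.pi * s)) =ᶠ[𝓝 0]
      fun s : ℝ => Complex.exp (((-2 * Real.pi : ℝ) : ℂ) * s) := by
    filter_upwards [b.eventuallyEq_one] with s hs
    rw [hs]
    simp
  have h5 : iteratedDeriv n (fun s : ℝ => Complex.exp (((-2 * Real.pi : ℝ) : ℂ) * s)) 0 =
      ((-2 * Real.pi : ℝ) : ℂ) ^ n := by
    generalize ((-2 * Real.pi : ℝ) : ℂ) = c
    have h : ∀ m : ℕ, iteratedDeriv m (fun s : ℝ => Complex.exp (c * s)) =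
        fun s : ℝ => c ^ m * Complex.exp (c * s) := fun m => by
      induction m with
      | zero => simp
      | succ m ih =>
        rw [iteratedDeriv_succ, ih]
        funext s
        have h7 : HasDerivAt (fun s : ℝ => c * (s : ℂ)) c s := by
          simpa using (hasDerivAt_id s).ofReal_comp.const_mul c
        rw [(h7.cexp.const_mul (c ^ m)).deriv]
        ring
    rw [h]
    simp
  rw [h4.iteratedDeriv_eq, h5] at h3
  have h6 : ∀ t : ℝ, (-2 * (Real.pi : ℂ) * Complex.I * t) ^ n • φ t =
      (-2 * Real.pi * Complex.I : ℂ) ^ n * ((t : ℂ) ^ n * φ t) := fun t => by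
    rw [smul_eq_mul, mul_pow _ (t : ℂ)]
    ring
  simp only [inner_zero_right, neg_zero, h6, AddChar.map_zero_eq_one, one_smul] at h3
  rw [integral_const_mul] at h3
  have h7 : (-2 * Real.pi * Complex.I : ℂ) ^ n ≠ 0 := pow_ne_zero _ (by simp [Real.pi_ne_zero])
  refine mul_left_cancel₀ h7 (h3.symm.trans ?_)
  rw [← mul_pow]
  congr 1
  push_cast
  linear_combination (-2 * Real.pi : ℂ) * Complex.I_sq

end Kernel

/-! ### Existence of admissible extensions, with bounds -/

section Extension

/-- A cutoff function in the plane: equal to one on the rectangle `|Re z| < a`, `|Im z| < b` and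
supported in `|Re z| ≤ a'`, `|Im z| ≤ b'`. -/
lemma exists_planeCutoff {a a' b b' : ℝ} (ha : 0 < a) (haa : a < a') (hb : 0 < b) (hbb : b < b') :
    ∃ X : ℂ → ℂ, ContDiff ℝ ∞ X ∧ HasCompactSupport X ∧ (∀ z, ‖X z‖ ≤ 1) ∧
      (∀ z : ℂ, |z.re| < a → |z.im| < b → X z = 1) ∧
      ∀ z ∈ tsupport X, |z.re| ≤ a' ∧ |z.im| ≤ b' := by
  let ψ : ContDiffBump (0 : ℝ) := ⟨a, a', ha, haa⟩
  let χ : ContDiffBump (0 : ℝ) := ⟨b, b', hb, hbb⟩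
  have hsub : tsupport (fun z : ℂ => (ψ z.re : ℂ) * (χ z.im : ℂ)) ⊆
      {z : ℂ | |z.re| ≤ a' ∧ |z.im| ≤ b'} := by
    refine closure_minimal (fun z hz => ?_) ?_
    · have h1 : ψ z.re ≠ 0 := fun h => hz (by simp [h])
      have h2 : χ z.im ≠ 0 := fun h => hz (by simp [h])
      have h3 : z.re ∈ Function.support ψ := h1
      have h4 : z.im ∈ Function.support χ := h2
      rw [ψ.support_eq, mem_ball_zero_iff, Real.norm_eq_abs] at h3
      rw [χ.support_eq, mem_ball_zero_iff, Real.norm_eq_abs] at h4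
      exact ⟨h3.le, h4.le⟩
    · exact (isClosed_le (continuous_abs.comp Complex.continuous_re) continuous_const).inter
        (isClosed_le (continuous_abs.comp Complex.continuous_im) continuous_const)
  refine ⟨fun z => (ψ z.re : ℂ) * (χ z.im : ℂ), ?_, ?_, fun z => ?_, fun z hre him => ?_,
    fun z hz => hsub hz⟩
  · exact (Complex.ofRealCLM.contDiff.comp (ψ.contDiff.comp Complex.reCLM.contDiff)).mul
      (Complex.ofRealCLM.contDiff.comp (χ.contDiff.comp Complex.imCLM.contDiff))
  · refine (isCompact_closedBall (0 : ℂ) (a' + b')).of_isClosed_subset (isClosed_tsupport _)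
      fun z hz => ?_
    rw [mem_closedBall_zero_iff]
    have := hsub hz
    exact (Complex.norm_le_abs_re_add_abs_im z).trans (add_le_add this.1 this.2)
  · rw [norm_mul, Complex.norm_real, Complex.norm_real, Real.norm_of_nonneg ψ.nonneg,
      Real.norm_of_nonneg χ.nonneg]
    exact mul_le_one₀ ψ.le_one χ.nonneg χ.le_one
  · have h1 : ψ z.re = 1 := ψ.one_of_mem_closedBall (by
      rw [mem_closedBall_zero_iff, Real.norm_eq_abs]
      exact hre.le)
    have h2 : χ z.im = 1 := χ.one_of_mem_closedBall (by
      rw [mem_closedBall_zero_iff, Real.norm_eq_abs]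
      exact him.le)
    simp [h1, h2]

variable {f φ : ℝ → ℂ} {X : ℂ → ℂ}

lemma dbar_eq_zero_of_eq_one {a b : ℝ} (hX : ∀ z : ℂ, |z.re| < a → |z.im| < b → X z = 1) {z : ℂ}
    (hre : |z.re| < a) (him : |z.im| < b) : dbar X z = 0 := by
  have h : X =ᶠ[𝓝 z] fun _ => 1 := by
    have h1 : IsOpen {z : ℂ | |z.re| < a ∧ |z.im| < b} :=
      (isOpen_lt (continuous_abs.comp Complex.continuous_re) continuous_const).inter
        (isOpen_lt (continuous_abs.comp Complex.continuous_im) continuous_const)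
    filter_upwards [h1.mem_nhds ⟨hre, him⟩] with y hy
    exact hX y hy.1 hy.2
  simp [dbar, h.fderiv_eq]

/-- The bound for `∂̄(X G)`, where `G` is a dilation integral and `X` a cutoff. -/
lemma exists_dbar_mul_dilate_le (hφ : HasMoments φ)
    (hm : ∀ n : ℕ, ∫ t : ℝ, (t : ℂ) ^ n * φ t = (-Complex.I) ^ n) {r b : ℝ} (hb : 0 < b)
    (hXs : ContDiff ℝ ∞ X) (hXc : HasCompactSupport X) (hX1 : ∀ z, ‖X z‖ ≤ 1)
    (hX : ∀ z : ℂ, |z.re| < r + 1 → |z.im| < b → X z = 1) (N : ℕ) :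
    ∃ C : ℝ, 0 ≤ C ∧ ∀ f : ℝ → ℂ, IsTest f → (∀ t, f t ≠ 0 → |t| ≤ r) → ∀ M : ℝ,
      (∀ t, ‖f t‖ ≤ M) → (∀ t, ‖iteratedDeriv (N + 1) f t‖ ≤ M) →
      ∀ z : ℂ, ‖dbar (fun z => X z * dilate f φ z) z‖ ≤ C * M * |z.im| ^ N := by
  obtain ⟨B, hB⟩ := (hasCompactSupport_dbar hXc).exists_bound_of_continuous
    (contDiff_dbar hXs).continuous
  have hB0 : 0 ≤ B := (norm_nonneg _).trans (hB 0)
  set φ₁ : ℝ → ℂ := fun t => φ t - Complex.I * (t * φ t) with hφ₁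
  have hφ₁m : HasMoments φ₁ := fun n => by
    refine ((hφ n).sub ((hφ.mul_id n).const_mul Complex.I)).congr
      (Filter.Eventually.of_forall fun t => ?_)
    simp only [hφ₁, Pi.sub_apply]
    ring
  have hzero : ∀ n : ℕ, ∫ t : ℝ, (t : ℂ) ^ n * φ₁ t = 0 := fun n => by
    have h1 : ∀ t : ℝ, (t : ℂ) ^ n * φ₁ t =
        (t : ℂ) ^ n * φ t - Complex.I * ((t : ℂ) ^ (n + 1) * φ t) := fun t => by
      simp only [hφ₁]
      ring
    simp only [h1]
    rw [integral_sub (hφ n) ((hφ (n + 1)).const_mul _), integral_const_mul, hm, hm]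
    linear_combination (-Complex.I) ^ n * Complex.I_sq
  set c₁ := ∫ t : ℝ, |t| ^ N * ‖φ₁ t‖ with hc₁
  set c₂ := ∫ t : ℝ, |t| ^ N * ‖φ t‖ with hc₂
  set c₃ := ∫ t : ℝ, ‖φ t‖ with hc₃
  have hc₁0 : 0 ≤ c₁ := integral_nonneg fun t => by positivity
  have hc₂0 : 0 ≤ c₂ := integral_nonneg fun t => by positivity
  have hc₃0 : 0 ≤ c₃ := integral_nonneg fun t => by positivity
  refine ⟨c₁ + B * (c₂ + c₃ * b⁻¹ ^ N), by positivity, fun f hf hfr M hM hM' z => ?_⟩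
  have hM0 : 0 ≤ M := (norm_nonneg _).trans (hM 0)
  rw [dbar_mul hXs (contDiff_dilate hf hφ)]
  have h1 : ‖X z * dbar (dilate f φ) z‖ ≤ M * c₁ * |z.im| ^ N := by
    rw [dbar_dilate hf hφ, norm_mul, norm_mul]
    have h2 := norm_dilate_le hf.deriv hφ₁m hzero (N := N) (M := M) (fun t => by
      rw [← iteratedDeriv_succ']
      exact hM' t) z
    have h3 : ‖(1 / 2 : ℂ)‖ ≤ 1 := by norm_num
    calc ‖X z‖ * (‖(1 / 2 : ℂ)‖ * ‖dilate (deriv f) φ₁ z‖)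
        ≤ 1 * (1 * ‖dilate (deriv f) φ₁ z‖) := by
          gcongr
          exact hX1 z
      _ ≤ _ := by simpa using h2
  -- `∂̄X` vanishes on the inner rectangle. Above and below it `|Im z| ≥ b`, and the power `(|Im z|
  -- / b)^N ≥ 1` can be inserted. On its sides `Re z` is at distance at least one from the support
  -- of `f`, and the moments of `φ` provide the power.
  have h4 : ‖dilate f φ z * dbar X z‖ ≤ (M * c₂ + M * (c₃ * b⁻¹ ^ N)) * |z.im| ^ N * B := by
    rw [norm_mul]
    by_cases hre : |z.re| < r + 1
    · by_cases him : |z.im| < b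
      · rw [dbar_eq_zero_of_eq_one hX hre him, norm_zero, mul_zero]
        positivity
      · refine mul_le_mul ?_ (hB z) (norm_nonneg _) (by positivity)
        have h5 : 1 ≤ b⁻¹ * |z.im| := by
          rw [inv_mul_eq_div, one_le_div hb]
          exact not_lt.1 him
        have h6 : 1 ≤ b⁻¹ ^ N * |z.im| ^ N := by
          rw [← mul_pow]
          exact one_le_pow₀ h5
        calc ‖dilate f φ z‖ ≤ M * c₃ * 1 := by simpa using norm_dilate_le_sup hφ hM z
          _ ≤ M * c₃ * (b⁻¹ ^ N * |z.im| ^ N) := by gcongr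
          _ ≤ M * c₂ * |z.im| ^ N + M * c₃ * (b⁻¹ ^ N * |z.im| ^ N) :=
              le_add_of_nonneg_left (by positivity)
          _ = _ := by ring
    · refine mul_le_mul ?_ (hB z) (norm_nonneg _) (by positivity)
      have h5 := norm_dilate_le_of_dist hφ hM (z := z) (fun s hs => by
        have h6 := hfr s hs
        have h7 := abs_sub_abs_le_abs_sub z.re s
        linarith [not_lt.1 hre]) N
      refine h5.trans ?_
      have : 0 ≤ M * (c₃ * b⁻¹ ^ N) * |z.im| ^ N := by positivity
      rw [add_mul]
      linarith
  refine (norm_add_le _ _).trans ((add_le_add h1 h4).trans (le_of_eq ?_))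
  ring

variable {E : Type*} [NormedAddCommGroup E] [NormedSpace ℂ E] {A : E →ₗ.[ℂ] E}

/-- Admissible almost analytic extensions exist, and the Helffer-Sjöstrand integral is controlled by
finitely many derivatives. -/
lemma exists_isAdmissible_norm_le (hA : IsTempered A) {r : ℝ} (hr : 0 ≤ r) :
    ∃ (C : ℝ) (m : ℕ), 0 ≤ C ∧ ∀ f : ℝ → ℂ, IsTest f → (∀ t, f t ≠ 0 → |t| ≤ r) → ∀ M : ℝ,
      (∀ t, ‖f t‖ ≤ M) → (∀ t, ‖iteratedDeriv m f t‖ ≤ M) →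
      ∃ F, IsAdmissible A f F ∧ ‖hsIntegral A F‖ ≤ C * M := by
  obtain ⟨φ, hφ, hm⟩ := exists_moments
  -- The cutoff of height `δ / 2` keeps the support in the strip without eigenvalues, which gives
  -- admissibility; flatness of order `m` then cancels the growth `|Im z|^{-m}` of the resolvent,
  -- and the integrand is bounded on a compact set.
  obtain ⟨δ, hδ, C₁, m, hC₁, hres⟩ := hA.bound (r + 2)
  obtain ⟨X, hXs, hXc, hX1, hX, hXt⟩ := exists_planeCutoff (a := r + 1) (a' := r + 2) (b := δ / 4)
    (b' := δ / 2) (by linarith) (by linarith) (by linarith) (by linarith)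
  have hδ4 : 0 < δ / 4 := by linarith
  obtain ⟨K, hK0, hK⟩ := exists_dbar_mul_dilate_le hφ hm hδ4 hXs hXc hX1 hX m
  refine ⟨Real.pi⁻¹ * (K * C₁ * volume.real (tsupport X)), m + 1, by positivity,
    fun f hf hfr M hM hM' => ?_⟩
  have hadm : IsAdmissible A f fun z => X z * dilate f φ z := by
    refine ⟨⟨hXs.mul (contDiff_dilate hf hφ), hXc.mul_right, fun t => ?_, fun N => ?_⟩, ?_⟩
    · have h0 : ∫ t, φ t = 1 := by simpa using hm 0
      rw [dilate_ofReal, h0, mul_one]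
      by_cases ht : f t = 0
      · rw [ht, mul_zero]
      · rw [hX t (by simpa using (hfr t ht).trans_lt (lt_add_one r)) (by simpa using hδ4), one_mul]
    · obtain ⟨K', -, hK'⟩ := exists_dbar_mul_dilate_le hφ hm hδ4 hXs hXc hX1 hX N
      obtain ⟨M₀, hM₀⟩ := hf.2.exists_bound_of_continuous hf.1.continuous
      have hder : IsTest (iteratedDeriv (N + 1) f) := by
        generalize N + 1 = n
        induction n with
        | zero => simpa using hf
        | succ n ih =>
          rw [iteratedDeriv_succ]
          exact ih.deriv
      obtain ⟨M₁, hM₁⟩ := hder.2.exists_bound_of_continuous hder.1.continuous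
      exact ⟨K' * max M₀ M₁, hK' f hf hfr (max M₀ M₁) (fun t => (hM₀ t).trans (le_max_left _ _))
        fun t => (hM₁ t).trans (le_max_right _ _)⟩
    · refine Set.eq_empty_of_forall_notMem fun z hz => ?_
      have h1 := hXt z (tsupport_mul_subset_left hz.1)
      exact notMem_complexEigenvalues (hres z h1.1 hz.2.1 (by linarith)).1 hz.2
  have hM0 : 0 ≤ M := (norm_nonneg _).trans (hM 0)
  refine ⟨_, hadm, ?_⟩
  have hd := hK f hf hfr M hM hM'
  rw [hsIntegral_eq, norm_smul, norm_inv, Complex.norm_real, Real.norm_of_nonneg Real.pi_pos.le,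
    mul_assoc]
  refine mul_le_mul_of_nonneg_left ?_ (by positivity)
  have hoff : ∀ z ∉ tsupport X, hsIntegrand A (fun z => X z * dilate f φ z) z = 0 :=
    fun z hz => by
      have : dbar (fun z => X z * dilate f φ z) z = 0 := by
        by_contra h
        exact hz (tsupport_mul_subset_left (tsupport_dbar_subset _ (subset_tsupport _ h)))
      rw [hsIntegrand, this, zero_smul]
  rw [← setIntegral_eq_integral_of_forall_compl_eq_zero hoff]
  refine (norm_setIntegral_le_of_norm_le_const (C := K * M * C₁) hXc.measure_lt_top
    fun z hz => ?_).trans (le_of_eq (by ring))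
  rw [hsIntegrand, norm_smul]
  by_cases him : z.im = 0
  · rw [IsFlat.eq_zero hadm.1.flat him, norm_zero, zero_mul]
    positivity
  · have h1 := hXt z hz
    have hpos : 0 < |z.im| := abs_pos.2 him
    calc _ ≤ (K * M * |z.im| ^ m) * (C₁ * |z.im|⁻¹ ^ m) :=
          mul_le_mul (hd z) (hres z h1.1 him (by linarith)).2 (norm_nonneg _) (by positivity)
      _ = K * M * C₁ := by rw [inv_pow]; field_simp

end Extension

/-! ### The smooth functional calculus of a tempered operator -/

section FunctionalCalculus

variable {E : Type*} [NormedAddCommGroup E] [NormedSpace ℂ E] {A : E →ₗ.[ℂ] E}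
  {f g : ℝ → ℂ} {F G : ℂ → ℂ}

lemma dbar_add (hF : ContDiff ℝ ∞ F) (hG : ContDiff ℝ ∞ G) (z : ℂ) :
    dbar (fun z => F z + G z) z = dbar F z + dbar G z := by
  have h := ((hF.differentiable (by simp)) z).hasFDerivAt.fun_add
    ((hG.differentiable (by simp)) z).hasFDerivAt
  rw [dbar, h.fderiv, dbar, dbar]
  simp only [add_apply]
  ring

lemma dbar_const_mul (hF : ContDiff ℝ ∞ F) (c z : ℂ) :
    dbar (fun z => c * F z) z = c * dbar F z := by
  have h := ((hF.differentiable (by simp)) z).hasFDerivAt.const_mul c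
  rw [dbar, h.fderiv, dbar]
  simp only [smul_apply, smul_eq_mul]
  ring

lemma IsAdmissible.add (hF : IsAdmissible A f F) (hG : IsAdmissible A g G) :
    IsAdmissible A (fun t => f t + g t) fun z => F z + G z := by
  refine ⟨⟨hF.1.smooth.add hG.1.smooth, hF.1.compact.add hG.1.compact, fun t => ?_, ?_⟩, ?_⟩
  · rw [hF.1.extends_f, hG.1.extends_f]
  · have h := IsFlat.add hF.1.flat hG.1.flat
    simp only [← dbar_add hF.1.smooth hG.1.smooth] at h
    exact h
  · refine Set.eq_empty_of_forall_notMem fun z hz => ?_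
    rcases tsupport_add F G hz.1 with h | h
    · exact (Set.ext_iff.1 hF.2 z).1 ⟨h, hz.2⟩
    · exact (Set.ext_iff.1 hG.2 z).1 ⟨h, hz.2⟩

lemma IsAdmissible.const_mul (hF : IsAdmissible A f F) (c : ℂ) :
    IsAdmissible A (fun t => c * f t) fun z => c * F z := by
  refine ⟨⟨contDiff_const.mul hF.1.smooth, hF.1.compact.mul_left, fun t => ?_, ?_⟩, ?_⟩
  · rw [hF.1.extends_f]
  · have h := IsFlat.const_mul hF.1.flat c
    simp only [← dbar_const_mul hF.1.smooth] at h
    exact h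
  · exact Set.subset_eq_empty (Set.inter_subset_inter_left _ tsupport_mul_subset_right) hF.2

lemma isTest (f : 𝓓((⊤ : Opens ℝ), ℂ)) : IsTest f := ⟨f.contDiff, f.hasCompactSupport⟩

lemma exists_isAdmissible (hA : IsTempered A) (f : 𝓓((⊤ : Opens ℝ), ℂ)) :
    ∃ F : ℂ → ℂ, IsAdmissible A f F := by
  obtain ⟨r, hr, h0⟩ := f.hasCompactSupport.exists_pos_le_norm
  obtain ⟨C, m, -, h⟩ := exists_isAdmissible_norm_le hA hr.le
  obtain ⟨M₀, hM₀⟩ := f.hasCompactSupport.exists_bound_of_continuous f.continuous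
  have hc : HasCompactSupport (iteratedDeriv m f) := by
    generalize m = n
    induction n with
    | zero => simpa using f.hasCompactSupport
    | succ n ih =>
      rw [iteratedDeriv_succ]
      exact ih.deriv
  obtain ⟨M₁, hM₁⟩ := hc.exists_bound_of_continuous
    (f.contDiff.continuous_iteratedDeriv m (by exact_mod_cast le_top))
  obtain ⟨F, hF, -⟩ := h f (isTest f) (fun t ht => by
    by_contra h1
    exact ht (h0 t (not_le.1 h1).le)) (max M₀ M₁) (fun t => (hM₀ t).trans (le_max_left _ _))
    fun t => (hM₁ t).trans (le_max_right _ _)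
  exact ⟨F, hF⟩

variable [CompleteSpace E]

lemma hsIntegral_add (hA : IsTempered A) (hF : IsAdmissible A f F) (hG : IsAdmissible A g G) :
    hsIntegral A (fun z => F z + G z) = hsIntegral A F + hsIntegral A G := by
  rw [hsIntegral_eq, hsIntegral_eq, hsIntegral_eq, ← smul_add,
    ← integral_add (integrable_hsIntegrand hA hF) (integrable_hsIntegrand hA hG)]
  congr 2
  funext z
  simp only [hsIntegrand, dbar_add hF.1.smooth hG.1.smooth, add_smul]

lemma hsIntegral_const_mul (hF : IsAdmissible A f F) (c : ℂ) :
    hsIntegral A (fun z => c * F z) = c • hsIntegral A F := by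
  have h1 : ∀ z, hsIntegrand A (fun z => c * F z) z = c • hsIntegrand A F z := fun z => by
    simp only [hsIntegrand, dbar_const_mul hF.1.smooth, mul_smul]
  rw [hsIntegral_eq, hsIntegral_eq]
  simp only [h1]
  rw [integral_smul, smul_comm]

/-- The functional calculus `f ↦ f(A)` on test functions, as a continuous linear map. -/
lemma exists_functionalCalculus (hA : IsTempered A) :
    ∃ Λ : 𝓓((⊤ : Opens ℝ), ℂ) →L[ℂ] (E →L[ℂ] E),
      (∀ (f : 𝓓((⊤ : Opens ℝ), ℂ)) (F : ℂ → ℂ), IsAdmissible A f F → Λ f = hsIntegral A F) ∧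
      ∀ f g fg : 𝓓((⊤ : Opens ℝ), ℂ), (∀ t, fg t = f t * g t) → Λ fg = Λ f * Λ g := by
  -- Any choice of extensions will do: sums, multiples and products of admissible extensions are
  -- admissible for the corresponding functions, and independence of the extension transfers the
  -- identities.
  choose ext hext using exists_isAdmissible hA
  have hind : ∀ (f : 𝓓((⊤ : Opens ℝ), ℂ)) (F : ℂ → ℂ), IsAdmissible A f F →
      hsIntegral A (ext f) = hsIntegral A F := fun f F hF =>
    hsIntegral_eq_of_isAdmissible hA (hext f) hF
  have hadd : ∀ f g : 𝓓((⊤ : Opens ℝ), ℂ),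
      hsIntegral A (ext (f + g)) = hsIntegral A (ext f) + hsIntegral A (ext g) := fun f g => by
    rw [← hsIntegral_add hA (hext f) (hext g)]
    exact hind (f + g) _ ((hext f).add (hext g))
  have hsmul : ∀ (c : ℂ) (f : 𝓓((⊤ : Opens ℝ), ℂ)),
      hsIntegral A (ext (c • f)) = c • hsIntegral A (ext f) := fun c f => by
    rw [← hsIntegral_const_mul (hext f) c]
    exact hind (c • f) _ ((hext f).const_mul c)
  -- Continuity for the LF topology is continuity on functions supported in each fixed compact set,
  -- where the seminorms of orders `0` and `m` are enough.
  have hcont : ∀ (K : Compacts ℝ) (hK : (K : Set ℝ) ⊆ (⊤ : Opens ℝ)),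
      Continuous ((fun f => hsIntegral A (ext f)) ∘
        TestFunction.ofSupportedIn (F := ℂ) (n := ⊤) hK) := fun K hK => by
    obtain ⟨r, hr⟩ := K.isCompact.isBounded.exists_norm_le
    obtain ⟨C, m, hC, hb⟩ := exists_isAdmissible_norm_le hA (le_max_right r 0)
    refine (ContDiffMapSupportedIn.mkCLMtoNormedSpace (𝕜 := ℂ)
      (fun f => hsIntegral A (ext (TestFunction.ofSupportedIn hK f)))
      (fun f g => hadd (TestFunction.ofSupportedIn hK f) (TestFunction.ofSupportedIn hK g))
      (fun c f => hsmul c (TestFunction.ofSupportedIn hK f))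
      ⟨{0, m}, C, hC, fun f => ?_⟩).continuous
    have hsemi : ∀ j ∈ ({0, m} : Finset ℕ), ∀ t, ‖iteratedDeriv j f t‖ ≤
        (({0, m} : Finset ℕ).sup fun i => ContDiffMapSupportedIn.seminorm ℂ ℝ ℂ ⊤ K i) f :=
      fun j hj t => by
        rw [← norm_iteratedFDeriv_eq_norm_iteratedDeriv]
        exact (ContDiffMapSupportedIn.norm_iteratedFDeriv_apply_le_seminorm_top ℂ).trans
          (Seminorm.le_def.1 (Finset.le_sup
            (f := fun i => ContDiffMapSupportedIn.seminorm ℂ ℝ ℂ ⊤ K i) hj) f)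
    obtain ⟨F, hF, hFb⟩ := hb f (isTest (TestFunction.ofSupportedIn hK f)) (fun t ht => by
      refine (hr t ?_).trans (le_max_left _ _)
      by_contra h
      exact ht (f.zero_on_compl h)) _ (fun t => by simpa using hsemi 0 (by simp) t)
      (hsemi m (by simp))
    rw [hind (TestFunction.ofSupportedIn hK f) F hF]
    exact hFb
  refine ⟨TestFunction.mkCLM ℂ (fun f => hsIntegral A (ext f)) hadd hsmul hcont,
    fun f F hF => hind f F hF, fun f g fg h => ?_⟩
  change hsIntegral A (ext fg) = hsIntegral A (ext f) * hsIntegral A (ext g)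
  rw [← hsIntegral_mul hA (hext f) (hext g)]
  refine hind fg _ ?_
  have h1 := (hext f).mul (hext g)
  rwa [← funext h] at h1

end FunctionalCalculus

end KleinGordon

end

theorem mainTheorem10 {H : Type*} [NormedAddCommGroup H] [InnerProductSpace ℂ H] [CompleteSpace H]
    (h : H →ₗ.[ℂ] H) (k : H →L[ℂ] H) (x w : H →ₗ.[ℂ] H) (W χm χp χt : ℝ → ℝ) (ε R ℓ : ℝ)
    (hh : IsSelfAdjoint h) (hk : IsSelfAdjoint k)
    (hA1 : OpPos (hZero h k)) (hA2 : CondA2 h k)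
    (hx : IsSelfAdjoint x) (hxs : opSpectrum x = Set.range ((↑) : ℝ → ℂ))
    (hxac : acSpectrum x = Set.range ((↑) : ℝ → ℂ))
    (hw : IsSelfAdjoint w) (hwpos : OpPos w) (hwinv : (0 : ℂ) ∉ opSpectrum w)
    (hχ : IsCutoffTriple χm χp χt) (hε : 0 < ε) (hR : 0 < R)
    (hTE : TwoEnds h k x w W ℓ
      (bfc (fun t => χp (ε⁻¹ * t)) x) (bfc (fun t => χm (ε⁻¹ * t)) x)
      (bfc (fun t => χp (ε⁻¹ * t - 3)) x) (bfc (fun t => χm (ε⁻¹ * t + 3)) x)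
      (bfc (fun t => χt (R⁻¹ * t)) x)) :
    (∀ f : 𝓓((⊤ : Opens ℝ), ℂ), ∃ F : ℂ → ℂ, IsAdmissible (homKG h k) f F) ∧
    (∀ (f : 𝓓((⊤ : Opens ℝ), ℂ)) (F : ℂ → ℂ), IsAdmissible (homKG h k) f F →
      Integrable (hsIntegrand (homKG h k) F) volume) ∧
    (∀ (f : 𝓓((⊤ : Opens ℝ), ℂ)) (F G : ℂ → ℂ), IsAdmissible (homKG h k) f F →
      IsAdmissible (homKG h k) f G → hsIntegral (homKG h k) F = hsIntegral (homKG h k) G) ∧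
    ∃ Λ : 𝓓((⊤ : Opens ℝ), ℂ) →L[ℂ] (HomEnergySpace h k →L[ℂ] HomEnergySpace h k),
      (∀ (f : 𝓓((⊤ : Opens ℝ), ℂ)) (F : ℂ → ℂ), IsAdmissible (homKG h k) f F →
        Λ f = hsIntegral (homKG h k) F) ∧
      ∀ f g fg : 𝓓((⊤ : Opens ℝ), ℂ), (∀ t, fg t = f t * g t) → Λ fg = Λ f * Λ g := by
  have hA : IsTempered (homKG h k) := isTempered_of_temperedAt fun z₀ =>
    let ⟨_, hP⟩ := exists_pencil_inverse_of_twoEnds hh hk hx hw hwpos hwinv hχ hTE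
    exists_homKG_resolvent hh hk hA1 hA2 hP z₀
  exact ⟨exists_isAdmissible hA, fun _ _ hF => integrable_hsIntegrand hA hF,
    fun _ _ _ hF hG => hsIntegral_eq_of_isAdmissible hA hF hG, exists_functionalCalculus hA⟩
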